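/- Let $p>3$ be a prime, $k$ a perfect field of characteristic $p$ with algebraic closure $\bar k$, $W=W(k)$, $\overline W=W(\bar k)$, $K^{u}=\overline W[1/p]$, $A=W[[t_1,\dots,t_h]]$, $A_0=A/pA=k[[t_1,\dots,t_h]]$, $\overline A=\overline W[[t_1,\dots,t_h]]$. A lift of Frobenius is a ring endomorphism $\phi$ of $A$ that restricts to the Witt vector Frobenius $\sigma$ on $W$ and reduces to $a\mapsto a^p$ modulo $p$. Let $H$ be an $F$-crystal over $A_0$: a finite free $A$-module with an integrable, $p$-adically topologically nilpotent connection $\nabla=\sum_i dt_i\otimes D_i$ and, for every lift of Frobenius $\phi$, a horizontal $A$-linear map $F(\phi):\phi^*H\to H$ that is an isomorphism after inverting $p$, such that $F(\psi)\circ\chi(\phi,\psi)=F(\phi)$ for all lifts $\phi,\psi$, where $\chi(\phi,\psi):\phi^*H\simeq\psi^*H$ is the Taylor isomorphism defined by $\nabla$. Put $H_0=H/pH$. The conjugate filtration $\mathrm{Fil}_iH_0$ (resp. the Hodge filtration $\mathrm{Fil}^iH_0$) consists of the $x\in H_0$ that have a lift $y\in H$ with $p^iy\in\mathrm{Im}\,F(\phi)$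 (resp. $F(\phi)\phi^*y\in p^iH$). Assume: * $H$ is a Hodge $F$-crystal: there is given a decreasing filtration $H=\mathrm{Fil}^0H\supset\mathrm{Fil}^1H\supset\cdots$ by free submodules with $\mathrm{Fil}^iH\otimes_AA_0=\mathrm{Fil}^iH_0$ and $D_j\mathrm{Fil}^{i}H\subset\mathrm{Fil}^{i-1}H$; * $H$ is ordinary: the graded module of the conjugate filtration is free over $A_0$ and $H_0=\mathrm{Fil}_iH_0\oplus\mathrm{Fil}^{i+1}H_0$ for all $i$; * $\mathrm{Fil}_3H_0=H_0$, $\mathrm{Fil}^4H_0=0$, and $H$ is divisible: $F(\phi)\phi^*\mathrm{Fil}^iH\subset p^iH$ for $0\le i\le3$ for some lift of Frobenius $\phi$; * the Hodge numbers $\operatorname{rank}_{A_0}\mathrm{Fil}_iH_0/\mathrm{Fil}_{i-1}H_0$, $i=0,1,2,3$, are $1,h,h,1$; * there is given a perfect alternating $A$-bilinear form $\langle\,,\rangle$ on $H$ with $\langle\nabla x,y\rangle+\langle x,\nabla y\rangle=d\langle x,y\rangle$, $\langle F(\phi)\phi^*x,F(\phi)\phi^*y\rangle=p^3\phi(\langle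 x,y\rangle)$ for all $\phi$, $(\mathrm{Fil}^3H)^\perp=\mathrm{Fil}^1H$ and $(\mathrm{Fil}^2H)^\perp=\mathrm{Fil}^2H$; * the map $\bigoplus_iA\,\partial/\partial t_i\to\mathrm{Hom}(\mathrm{Fil}^3H,\mathrm{Fil}^2H/\mathrm{Fil}^3H)$ induced by $\nabla$ is an isomorphism. Then there is a filtration $U_0\subset U_1\subset\cdots$ of $H$ by sub-$F$-crystals with $U_i\otimes_AA_0=\mathrm{Fil}_iH_0$ and $U_i/U_{i-1}$ ($U_{-1}=0$) the $i$-th Tate twist of a unit $F$-crystal. Put $H^i=U_i\cap\mathrm{Fil}^iH$, $\overline H=\overline A\otimes_AH$, $\overline H^i=(\overline A\otimes_A U_i)\cap(\overline A\otimes_A\mathrm{Fil}^iH)$. There are an $\overline A$-basis $e_0,\dots,e_{2h+1}$ of $\overline H$ with $e_0\in\overline H^0$, $e_1,\dots,e_h\in\overline H^1$, $e_{h+1},\dots,e_{2h}\in\overline H^2$, $e_{2h+1}\in\overline H^3$, with Gram matrix $$\begin{pmatrix}0&0&0&-1\\0&0&I_h&0\\0&-I_h&0&0\\1&0&0&0\end{pmatrix},$$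 and a matrix over $K^u[[t_1,\dots,t_h]]$ of the form $$\mathcal T=\begin{pmatrix}1&\tau_{23}^\star&0&0\\0&I_h&0&0\\0&0&I_h&\tau_{23}\\0&0&0&1\end{pmatrix}\begin{pmatrix}1&0&-\tau_{13}^\star&Z\\0&I_h&\tau_{12}&\tau_{13}\\0&0&I_h&0\\0&0&0&1\end{pmatrix}$$ (${}^\star$ is transpose) such that with respect to $e_0,\dots,e_{2h+1}$ the connection has matrix $\mathcal T^{-1}d\mathcal T$ and, for every lift of Frobenius $\phi$ of $A$ (extended to $\overline A$), $F(\phi)\phi^*$ has matrix $\mathcal T^{-1}P\,\phi(\mathcal T)$, where $P=\mathrm{diag}(1,pI_h,p^2I_h,p^3)$. Here, for $g=\sum_m a_mt^m\in K^u[[t]]$, $\phi(g)=\sum_m\sigma(a_m)\phi(t^m)$, each coefficient being the sum of a $p$-adically convergent series; part of this assertion and of the last one below is that these series converge for the entries of $\mathcal T$ and of $\mathcal T\mathcal S$. Moreover, for every such filtration $U_\bullet$, every such pair $(e_\bullet,\mathcal T)$, with $\tau_{23}=(\tau_1,\dots,\tau_h)^\star$, and every generator $\omega_0$ of the rank one $A$-module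 $\mathrm{Fil}^3H=H^3$: there is $f\in\overline A^\times$ with $\omega_0=f\,e_{2h+1}$; the matrix $(\partial\tau_i/\partial t_j)$ is invertible over $K^u[[t]]$, with inverse denoted $(\partial t_i/\partial\tau_j)$; and the elements $$\check\omega_0=f^{-1}e_0,\quad\check\omega_j=f^{-1}\sum_m\frac{\partial t_j}{\partial\tau_m}e_m,\quad\check\omega_{h+j}=f\,D_j(f^{-1}\omega_0)=f\sum_m\frac{\partial\tau_m}{\partial t_j}e_{h+m}\ (1\le j\le h),\quad\check\omega_{2h+1}=\omega_0$$ lie in $H^0$, $H^1$, $H^2$, $H^3$ respectively and form an $A$-basis of $H$. Thus $(\check\omega_0,\dots,\check\omega_{2h+1})=(e_0,\dots,e_{2h+1})\mathcal S$ with $$\mathcal S=\mathrm{diag}\Big(f^{-1},\ f^{-1}\Big(\frac{\partial t_j}{\partial\tau_i}\Big)_{i,j},\ f\Big(\frac{\partial\tau_i}{\partial t_j}\Big)_{i,j},\ f\Big).$$ The matrix $\mathcal T\mathcal S$ is invertible; with respect to the basis $\check\omega_0,\dots,\check\omega_{2h+1}$ of $H$ the matrix of $\nabla$ is $$(\mathcal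 T\mathcal S)^{-1}\cdot d(\mathcal T\mathcal S),$$ and for every lift of Frobenius $\phi:A\to A$ the matrix of $F(\phi)\phi^*$ is $$(\mathcal T\mathcal S)^{-1}\cdot P\cdot\phi(\mathcal T\mathcal S).$$ -/

import Mathlib

open scoped TensorProduct

noncomputable section

namespace CY3Crystal

section Rings

/-- `A = W(k)[[t_1, …, t_n]]`, with `W(k)` the ring of `p`-typical Witt vectors of `k`. -/
abbrev PS (p : ℕ) [Fact p.Prime] (k : Type*) [CommRing k] (n : ℕ) : Type _ :=
  MvPowerSeries (Fin n) (WittVector p k)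

/-- The partial derivative `∂ / ∂ t_i` on power series with coefficients in `R`. -/
def pd {R : Type*} [CommRing R] {n : ℕ} (i : Fin n) (f : MvPowerSeries (Fin n) R) :
    MvPowerSeries (Fin n) R :=
  MvPowerSeries.pderiv R i f

/-- A lift of Frobenius on `A = W(k)[[t]]`: a ring endomorphism which restricts to the Witt vector
Frobenius on `W(k)` and reduces to `a ↦ a ^ p` modulo `p`. -/
structure FrobLift (p : ℕ) [Fact p.Prime] (k : Type*) [CommRing k] (n : ℕ) where
  toRingHom : PS p k n →+* PS p k n
  map_const : ∀ w : WittVector p k,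
    toRingHom (MvPowerSeries.C w) = MvPowerSeries.C (WittVector.frobenius w)
  map_mod : ∀ a, ∃ b, toRingHom a = a ^ p + (p : PS p k n) * b

/-- Unordered convergence of a family in the `p`-adic topology of an abelian group. -/
def PadicHasSum (p : ℕ) {ι M : Type*} [AddCommGroup M] (f : ι → M) (x : M) : Prop :=
  ∀ N : ℕ, ∃ s₀ : Finset ι, ∀ s : Finset ι, s₀ ⊆ s → ∃ y : M, ∑ i ∈ s, f i - x = p ^ N • y

end Rings

section Crystals

variable (p : ℕ) [Fact p.Prime] (k : Type*) [Field k] (n : ℕ)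
  (H : Type*) [AddCommGroup H] [Module (PS p k n) H]

/-- The data and axioms of an integrable, `p`-adically topologically nilpotent connection on `H`.
As `Ω¹_{A/W}` is free on `dt_1, …, dt_n`, a connection `∇ : H → Ω¹ ⊗ H` is given by its components
`D_i`, that is `∇ x = ∑ i, dt_i ⊗ D_i x`. (A crystal is such an `H` which is moreover finite and
free over `A`.) -/
structure Crystal where
  D : Fin n → AddMonoid.End H
  leibniz : ∀ (i : Fin n) (a : PS p k n) (x : H), D i (a • x) = pd i a • x + a • D i x
  integrable : ∀ (i j : Fin n) (x : H), D i (D j x) = D j (D i x)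
  nilpotent : ∀ (i : Fin n) (N : ℕ), ∃ M : ℕ, ∀ m : ℕ, M ≤ m →
    ∀ x : H, ∃ y : H, (D i ^ m) x = p ^ N • y

variable {p k n H} in
/-- `D_1 ^ m_1 ∘ … ∘ D_n ^ m_n`. -/
def Crystal.Dpow (X : Crystal p k n H) (m : Fin n → ℕ) : AddMonoid.End H :=
  (List.ofFn fun i => X.D i ^ m i).prod

/-- The structure of an `F`-crystal on `H`. An `A`-linear map `F(φ) : φ^* H → H` is the same as the
`φ`-semilinear map `F(φ) φ^* : H → H`; the field `F` records the latter. -/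
structure FCrystal extends Crystal p k n H where
  F : ∀ φ : FrobLift p k n, H →ₛₗ[φ.toRingHom] H
  /-- `∇ ∘ F(φ) φ^* = (φ ⊗ F(φ) φ^*) ∘ ∇`, read off at `dt_i`. -/
  horizontal : ∀ (φ : FrobLift p k n) (i : Fin n) (x : H),
    D i (F φ x) = ∑ j, pd i (φ.toRingHom (MvPowerSeries.X j)) • F φ (D j x)
  /-- `F(ψ) ∘ χ(φ, ψ) = F(φ)`, with `χ(φ, ψ)` given by its Taylor series. The coefficient
  `c m = ∏ j, (p ^ m_j / m_j !) * ((φ t_j - ψ t_j) / p) ^ m_j` lies in `A` and is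
  characterised by the first equation, as `A` has no torsion. -/
  taylor : ∀ φ ψ : FrobLift p k n, ∃ c : (Fin n → ℕ) → PS p k n,
    (∀ m, ((∏ j, (m j).factorial : ℕ) : PS p k n) * c m =
      ∏ j, (φ.toRingHom (MvPowerSeries.X j) - ψ.toRingHom (MvPowerSeries.X j)) ^ m j) ∧
    ∀ x : H, PadicHasSum p (fun m => c m • F ψ (toCrystal.Dpow m x)) (F φ x)
  /-- `F(φ) ⊗ ℚ_p` is an isomorphism. It is a map between modules of the same finite rank, so this
  says that the cokernel of `F(φ)` is killed by a power of `p`. -/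
  isogeny : ∀ φ : FrobLift p k n, ∃ N : ℕ, ∀ x : H,
    p ^ N • x ∈ Submodule.span (PS p k n) (Set.range (F φ))

end Crystals

section Filtrations

/-- The ideal `pA`. -/
def pIdeal (p : ℕ) [Fact p.Prime] (k : Type*) [Field k] (n : ℕ) : Ideal (PS p k n) :=
  Ideal.span {(p : PS p k n)}

/-- `A₀ = A / pA`; for a perfect field `k` this is `k[[t_1, …, t_n]]`. -/
abbrev PS₀ (p : ℕ) [Fact p.Prime] (k : Type*) [Field k] (n : ℕ) : Type _ :=
  PS p k n ⧸ pIdeal p k n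

/-- `H₀ = H / pH = H ⊗_A A₀`. -/
abbrev Red (p : ℕ) [Fact p.Prime] (k : Type*) [Field k] (n : ℕ)
    (H : Type*) [AddCommGroup H] [Module (PS p k n) H] : Type _ :=
  H ⧸ (pIdeal p k n • ⊤ : Submodule (PS p k n) H)

variable {p : ℕ} [Fact p.Prime] {k : Type*} [Field k] {n : ℕ}
  {H : Type*} [AddCommGroup H] [Module (PS p k n) H]

/-- The reduction map `H → H₀`, semilinear along `A → A₀`. -/
def red : H →ₛₗ[Ideal.Quotient.mk (pIdeal p k n)] Red p k n H where
  toFun x := Submodule.Quotient.mk x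
  map_add' _ _ := rfl
  map_smul' _ _ := rfl

instance : RingHomSurjective (Ideal.Quotient.mk (pIdeal p k n)) :=
  ⟨Ideal.Quotient.mk_surjective⟩

/-- The submodule `p ^ i H`. -/
def pPow (i : ℕ) : Submodule (PS p k n) H :=
  (⊤ : Submodule (PS p k n) H).map (LinearMap.lsmul (PS p k n) H ((p : PS p k n) ^ i))

/-- The conjugate filtration: `Fil_i H₀` consists of the reductions of the `y : H` with
`p ^ i y ∈ Im F(φ)`. -/
def conjFil (X : FCrystal p k n H) (φ : FrobLift p k n) (i : ℕ) :
    Submodule (PS₀ p k n) (Red p k n H) :=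
  ((Submodule.span (PS p k n) (Set.range (X.F φ))).comap
    (LinearMap.lsmul (PS p k n) H ((p : PS p k n) ^ i))).map red

/-- The Hodge filtration: `Fil^i H₀` consists of the reductions of the `y : H` with
`F(φ) φ^* y ∈ p ^ i H`. -/
def hodgeFil (X : FCrystal p k n H) (φ : FrobLift p k n) (i : ℕ) :
    Submodule (PS₀ p k n) (Red p k n H) :=
  ((pPow i).comap (X.F φ)).map red

/-- The `i`-th step minus one of an increasing filtration that starts with `0` in degree `-1`. -/
def prev {R M : Type*} [Ring R] [AddCommGroup M] [Module R M] (U : ℕ → Submodule R M) :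
    ℕ → Submodule R M
  | 0 => ⊥
  | i + 1 => U i

/-- The `i`-th graded piece of an increasing filtration that starts with `0` in degree `-1`. -/
abbrev Gr {R M : Type*} [Ring R] [AddCommGroup M] [Module R M] (U : ℕ → Submodule R M)
    (i : ℕ) : Type _ :=
  U i ⧸ (prev U i).submoduleOf (U i)

/-- `H` is ordinary: `gr_• H₀` is free and the conjugate and Hodge filtrations are opposite. -/
structure IsOrdinary (X : FCrystal p k n H) (φ : FrobLift p k n) : Prop where
  free : ∀ i, Module.Free (PS₀ p k n) (Gr (conjFil X φ) i)
  opposite : ∀ i, IsCompl (conjFil X φ i) (hodgeFil X φ (i + 1))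

/-- `H` is of level `≤ N`. -/
def LevelLE (X : FCrystal p k n H) (φ : FrobLift p k n) (N : ℕ) : Prop :=
  conjFil X φ N = ⊤ ∧ hodgeFil X φ (N + 1) = ⊥

/-- `Fil` is a Hodge filtration on `H` (making `H` a Hodge `F`-crystal). The equality
`Fil^i H ⊗ A₀ = Fil^i H₀` is the conjunction of `lifts` and `saturated`; the second one says that
`Fil^i H ⊗ A₀ → H₀` is injective. -/
structure IsHodgeFiltration (X : FCrystal p k n H) (φ : FrobLift p k n)
    (Fil : ℕ → Submodule (PS p k n) H) : Prop where
  zero : Fil 0 = ⊤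
  antitone : Antitone Fil
  free : ∀ i, Module.Free (PS p k n) (Fil i)
  lifts : ∀ i, (Fil i).map red = hodgeFil X φ i
  saturated : ∀ (i : ℕ) (y : H), (p : PS p k n) • y ∈ Fil i → y ∈ Fil i
  transversal : ∀ (i : ℕ) (j : Fin n), ∀ x ∈ Fil (i + 1), X.D j x ∈ Fil i

/-- Divisibility of a Hodge `F`-crystal of level `≤ N`. -/
def IsDivisible (X : FCrystal p k n H) (Fil : ℕ → Submodule (PS p k n) H) (N : ℕ) : Prop :=
  ∃ φ : FrobLift p k n, ∀ i ≤ N, ∀ x ∈ Fil i, X.F φ x ∈ (pPow i : Submodule (PS p k n) H)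

/-- The map `T_{A/W} → Hom(Fil³, Fil² / Fil³)` induced by the connection, where `a : Fin n → A`
stands for the derivation `∑ i, a_i ∂ / ∂ t_i`. As `Fil² = H² ⊕ Fil³` and `H³ = Fil³`, the target is
`Hom(H³, H²)`. -/
def kodairaSpencer {X : FCrystal p k n H} {φ : FrobLift p k n}
    {Fil : ℕ → Submodule (PS p k n) H} (hF : IsHodgeFiltration X φ Fil) :
    (Fin n → PS p k n) →ₗ[PS p k n]
      (Fil 3 →ₗ[PS p k n] (Fil 2 ⧸ (Fil 3).submoduleOf (Fil 2))) where
  toFun a :=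
    { toFun := fun x => Submodule.Quotient.mk
        ⟨∑ i, a i • X.D i x, Submodule.sum_mem _ fun i _ =>
          Submodule.smul_mem _ _ (hF.transversal 2 i x x.2)⟩
      map_add' := fun x y => by
        rw [← Submodule.Quotient.mk_add]
        congr 1
        ext
        simp [Finset.sum_add_distrib]
      map_smul' := fun b x => by
        rw [RingHom.id_apply, ← Submodule.Quotient.mk_smul, Submodule.Quotient.eq]
        change (∑ i, a i • X.D i (b • (x : H))) - b • ∑ i, a i • X.D i x ∈ Fil 3
        rw [Finset.smul_sum, ← Finset.sum_sub_distrib]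
        refine Submodule.sum_mem _ fun i _ => ?_
        rw [X.leibniz, smul_add, smul_comm b (a i), add_sub_cancel_right]
        exact Submodule.smul_mem _ _ (Submodule.smul_mem _ _ x.2) }
  map_add' a b := by
    ext x
    refine (Submodule.Quotient.eq _).2 ?_
    change (∑ i, (a i + b i) • X.D i x) - (∑ i, a i • X.D i x + ∑ i, b i • X.D i x) ∈ Fil 3
    simp [add_smul, Finset.sum_add_distrib]
  map_smul' c a := by
    ext x
    refine (Submodule.Quotient.eq _).2 ?_
    change (∑ i, (c * a i) • X.D i x) - c • ∑ i, a i • X.D i x ∈ Fil 3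
    simp [Finset.smul_sum, mul_smul]

/-- The structure of an ordinary CY3 crystal with Hodge numbers `1, n, n, 1` over
`k[[t_1, …, t_n]]` whose Kodaira-Spencer map is an isomorphism. The lift of Frobenius `φ` serves
to compute the filtrations on `H₀` (which do not depend on it). -/
structure IsOrdinaryCY3 (X : FCrystal p k n H) (φ : FrobLift p k n)
    (Fil : ℕ → Submodule (PS p k n) H) (B : LinearMap.BilinForm (PS p k n) H) : Prop where
  hodge : IsHodgeFiltration X φ Fil
  ordinary : IsOrdinary X φ
  level : LevelLE X φ 3
  divisible : IsDivisible X Fil 3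
  rank_zero : Module.finrank (PS₀ p k n) (Gr (conjFil X φ) 0) = 1
  rank_one : Module.finrank (PS₀ p k n) (Gr (conjFil X φ) 1) = n
  rank_two : Module.finrank (PS₀ p k n) (Gr (conjFil X φ) 2) = n
  rank_three : Module.finrank (PS₀ p k n) (Gr (conjFil X φ) 3) = 1
  alternating : ∀ x, B x x = 0
  /-- `H → Hom(H, A)` is an isomorphism. -/
  nondegenerate : Function.Bijective B
  form_conn : ∀ (i : Fin n) (x y : H), B (X.D i x) y + B x (X.D i y) = pd i (B x y)
  form_frob : ∀ (ψ : FrobLift p k n) (x y : H),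
    B (X.F ψ x) (X.F ψ y) = (p : PS p k n) ^ 3 * ψ.toRingHom (B x y)
  riemann_three : ∀ y, y ∈ Fil 1 ↔ ∀ x ∈ Fil 3, B x y = 0
  riemann_two : ∀ y, y ∈ Fil 2 ↔ ∀ x ∈ Fil 2, B x y = 0
  kodairaSpencer_bijective : Function.Bijective (kodairaSpencer hodge)

/-- `U_0 ⊆ U_1 ⊆ …` is the filtration by sub-`F`-crystals with `U_i ⊗ A₀ = Fil_i H₀` and
`U_i / U_{i-1} ≃ V_i(-i)`, where `V_i` is a unit `F`-crystal: on the free module `U_i / U_{i-1}`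
the map `F(ψ) ψ^*` is `p ^ i` times a map whose linearization is onto (hence bijective). -/
structure IsConjFiltration (X : FCrystal p k n H) (φ : FrobLift p k n)
    (U : ℕ → Submodule (PS p k n) H) : Prop where
  mono : Monotone U
  free : ∀ i, Module.Free (PS p k n) (U i)
  free_gr : ∀ i, Module.Free (PS p k n) (Gr U i)
  lifts : ∀ i, (U i).map red = conjFil X φ i
  saturated : ∀ (i : ℕ) (y : H), (p : PS p k n) • y ∈ U i → y ∈ U i
  conn_mem : ∀ (i : ℕ) (j : Fin n), ∀ x ∈ U i, X.D j x ∈ U i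
  frob_mem : ∀ (i : ℕ) (ψ : FrobLift p k n), ∀ x ∈ U i, X.F ψ x ∈ U i
  frob_divisible : ∀ (i : ℕ) (ψ : FrobLift p k n), ∀ x ∈ U i,
    ∃ y ∈ U i, X.F ψ x - (p : PS p k n) ^ i • y ∈ prev U i
  frob_onto : ∀ (i : ℕ) (ψ : FrobLift p k n), ∀ y ∈ U i,
    ∃ z ∈ Submodule.span (PS p k n) (X.F ψ '' (U i : Set H)),
      (p : PS p k n) ^ i • y - z ∈ prev U i

end Filtrations

section BaseChange

/-- The map `W(k) → W(k̄)`. -/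
instance wittAlgebra (p : ℕ) [Fact p.Prime] (k : Type*) [Field k] :
    Algebra (WittVector p k) (WittVector p (AlgebraicClosure k)) :=
  (WittVector.map (algebraMap k (AlgebraicClosure k))).toAlgebra

/-- `Ā = W(k̄)[[t_1, …, t_n]]`, an `A`-algebra coefficientwise. -/
abbrev PSbar (p : ℕ) [Fact p.Prime] (k : Type*) [Field k] (n : ℕ) : Type _ :=
  PS p (AlgebraicClosure k) n

/-- `K^u = W(k̄)[1/p]`. -/
abbrev Ku (p : ℕ) [Fact p.Prime] (k : Type*) [Field k] : Type _ :=
  FractionRing (WittVector p (AlgebraicClosure k))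

/-- `K^u[[t_1, …, t_n]]`, an `Ā`-algebra coefficientwise. -/
abbrev KPS (p : ℕ) [Fact p.Prime] (k : Type*) [Field k] (n : ℕ) : Type _ :=
  MvPowerSeries (Fin n) (Ku p k)

variable {p : ℕ} [Fact p.Prime] {k : Type*} [Field k] {n : ℕ}
  {H : Type*} [AddCommGroup H] [Module (PS p k n) H]

lemma pd_algebraMap (i : Fin n) (a : PS p k n) :
    pd i (algebraMap (PS p k n) (PSbar p k n) a) =
      algebraMap (PS p k n) (PSbar p k n) (pd i a) := by
  ext m
  simp [pd, MvPowerSeries.coeff_pderiv, MvPowerSeries.algebraMap_apply'']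

/-- `D_i` on `H̄ = Ā ⊗ H`: `a ⊗ x ↦ ∂_i a ⊗ x + a ⊗ D_i x`. -/
def Dbar (X : FCrystal p k n H) (i : Fin n) :
    (PSbar p k n ⊗[PS p k n] H) →+ (PSbar p k n ⊗[PS p k n] H) :=
  TensorProduct.liftAddHom
    (AddMonoidHom.mk' (fun a => AddMonoidHom.mk' (fun x => pd i a ⊗ₜ x + a ⊗ₜ X.D i x)
        (fun x y => by
          simp only [map_add, TensorProduct.tmul_add]
          abel))
      (fun a b => by
        ext x
        simp only [pd, map_add, TensorProduct.add_tmul, AddMonoidHom.mk'_apply,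
          AddMonoidHom.add_apply]
        abel))
    (fun r a x => by
      have h : pd i (r • a) = pd i r • a + r • pd i a := by
        rw [Algebra.smul_def, Algebra.smul_def, Algebra.smul_def, ← pd_algebraMap]
        simp only [pd, Derivation.leibniz, smul_eq_mul]
        ring
      simp only [AddMonoidHom.mk'_apply]
      rw [h, X.leibniz, TensorProduct.tmul_add, TensorProduct.add_tmul, TensorProduct.smul_tmul,
        TensorProduct.smul_tmul, TensorProduct.smul_tmul]
      abel)

/-- The lift of Frobenius `φb` on `Ā` extends the lift of Frobenius `φ` on `A`. -/
def Extends (φb : FrobLift p (AlgebraicClosure k) n) (φ : FrobLift p k n) : Prop :=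
  ∀ a, φb.toRingHom (algebraMap (PS p k n) (PSbar p k n) a) =
    algebraMap (PS p k n) (PSbar p k n) (φ.toRingHom a)

/-- `F(φ) φ^*` on `H̄ = Ā ⊗ H`: `a ⊗ x ↦ φb a ⊗ F(φ) φ^* x`, with `φb` the extension of `φ`. -/
def Fbar (X : FCrystal p k n H) {φb : FrobLift p (AlgebraicClosure k) n} {φ : FrobLift p k n}
    (hφ : Extends φb φ) : (PSbar p k n ⊗[PS p k n] H) →+ (PSbar p k n ⊗[PS p k n] H) :=
  TensorProduct.liftAddHom
    (AddMonoidHom.mk' (fun a => AddMonoidHom.mk' (fun x => φb.toRingHom a ⊗ₜ X.F φ x)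
        (fun x y => by simp only [map_add, TensorProduct.tmul_add]))
      (fun a b => by
        ext x
        simp only [map_add, TensorProduct.add_tmul, AddMonoidHom.mk'_apply,
          AddMonoidHom.add_apply]))
    (fun r a x => by
      simp only [AddMonoidHom.mk'_apply]
      rw [LinearMap.map_smulₛₗ, Algebra.smul_def, map_mul, hφ, ← Algebra.smul_def,
        TensorProduct.smul_tmul])

/-- Unordered `p`-adic convergence of a family in `K^u`: neighbourhoods of `0` are
`p ^ N W(k̄)`. -/
def KuHasSum {ι : Type*} (f : ι → Ku p k) (x : Ku p k) : Prop :=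
  ∀ N : ℕ, ∃ s₀ : Finset ι, ∀ s : Finset ι, s₀ ⊆ s →
    ∃ w : WittVector p (AlgebraicClosure k),
      ∑ i ∈ s, f i - x =
        (p : Ku p k) ^ N * algebraMap (WittVector p (AlgebraicClosure k)) (Ku p k) w

/-- `g = φ(f)` for `f = ∑ a_m t^m` in `K^u[[t]]`: coefficient by coefficient, the series
`∑ σ(a_m) φ(t^m)` converges `p`-adically to `g`. -/
def IsFrobImage [CharP k p] (φ : FrobLift p k n) (f g : KPS p k n) : Prop :=
  ∀ d : Fin n →₀ ℕ, KuHasSum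
    (fun m : Fin n →₀ ℕ =>
      WittVector.FractionRing.frobeniusRingHom p (AlgebraicClosure k) (MvPowerSeries.coeff m f) *
        algebraMap (WittVector p (AlgebraicClosure k)) (Ku p k) (MvPowerSeries.coeff d
          (algebraMap (PS p k n) (PSbar p k n) (φ.toRingHom (MvPowerSeries.monomial m 1)))))
    (MvPowerSeries.coeff d g)

end BaseChange

section Matrices

/-- The index set `0; 1, …, n; n+1, …, 2n; 2n+1`, in four blocks. -/
abbrev Idx (n : ℕ) : Type := (Unit ⊕ Fin n) ⊕ (Fin n ⊕ Unit)

/-- The number of the block. -/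
def wt {n : ℕ} : Idx n → ℕ
  | Sum.inl (Sum.inl _) => 0
  | Sum.inl (Sum.inr _) => 1
  | Sum.inr (Sum.inl _) => 2
  | Sum.inr (Sum.inr _) => 3

/-- The index `2n+1`. -/
abbrev lastIdx (n : ℕ) : Idx n := Sum.inr (Sum.inr ())

variable {R : Type*} [CommRing R] {n : ℕ}

/-- The matrix with block rows `(0,0,0,-1)`, `(0,0,I,0)`, `(0,-I,0,0)`, `(1,0,0,0)`. -/
def gramMatrix (R : Type*) [CommRing R] (n : ℕ) : Matrix (Idx n) (Idx n) R :=
  Matrix.fromBlocks 0 (Matrix.fromBlocks 0 (-1) 1 0) (Matrix.fromBlocks 0 (-1) 1 0) 0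

/-- `P = diag(1, pI, p²I, p³)`. -/
def Pmatrix (R : Type*) [CommRing R] (n p : ℕ) : Matrix (Idx n) (Idx n) R :=
  Matrix.diagonal fun i => (p : R) ^ wt i

/-- The product of the matrices with block rows
`(1,τ₂₃ᵀ,0,0)`, `(0,I,0,0)`, `(0,0,I,τ₂₃)`, `(0,0,0,1)` and
`(1,0,-τ₁₃ᵀ,Z)`, `(0,I,τ₁₂,τ₁₃)`, `(0,0,I,0)`, `(0,0,0,1)`. -/
def Tmatrix (Z : R) (τ₂₃ τ₁₃ : Fin n → R) (τ₁₂ : Matrix (Fin n) (Fin n) R) :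
    Matrix (Idx n) (Idx n) R :=
  Matrix.fromBlocks
      (Matrix.fromBlocks 1 (Matrix.replicateRow Unit τ₂₃) 0 1) 0
      0 (Matrix.fromBlocks 1 (Matrix.replicateCol Unit τ₂₃) 0 1) *
    Matrix.fromBlocks
      1 (Matrix.fromBlocks (Matrix.replicateRow Unit (-τ₁₃)) (Matrix.of fun _ _ => Z)
          τ₁₂ (Matrix.replicateCol Unit τ₁₃))
      0 1

/-- The Jacobian matrix `(∂ τ_i / ∂ t_j)`. -/
def jacobian (τ : Fin n → MvPowerSeries (Fin n) R) :
    Matrix (Fin n) (Fin n) (MvPowerSeries (Fin n) R) :=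
  Matrix.of fun i j => pd j (τ i)

/-- The block diagonal matrix with blocks `f⁻¹`, `f⁻¹ (J⁻¹)ᵀ`, `f J`, `f`. For `J = (∂ τ_i / ∂ t_j)`
the second block is `f⁻¹ (∂ t_j / ∂ τ_i)`. -/
def Smatrix (f : Rˣ) (J : Matrix (Fin n) (Fin n) R) : Matrix (Idx n) (Idx n) R :=
  Matrix.fromBlocks
    (Matrix.fromBlocks (Matrix.of fun _ _ => ((f⁻¹ : Rˣ) : R)) 0
      0 (((f⁻¹ : Rˣ) : R) • (J⁻¹).transpose)) 0
    0 (Matrix.fromBlocks ((f : R) • J) 0 0 (Matrix.of fun _ _ => (f : R)))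

/-- The matrix of an additive map: column `j` holds the coordinates of the image of `b_j`. -/
def matrixOf {ι M : Type*} [AddCommGroup M] [Module R M] (b : Module.Basis ι R M) (g : M → M) :
    Matrix ι ι R :=
  Matrix.of fun i j => b.repr (g (b j)) i

end Matrices

section Frames

variable {p : ℕ} [Fact p.Prime] {k : Type*} [Field k] [CharP k p] {n : ℕ}
  {H : Type*} [AddCommGroup H] [Module (PS p k n) H]

/-- A basis `e_0, …, e_{2n+1}` of `H̄ = Ā ⊗ H` adapted to `H̄ = H̄⁰ ⊕ H̄¹ ⊕ H̄² ⊕ H̄³`,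
`H̄^i = Ū_i ∩ Fil^i H̄`, with the standard Gram matrix, and a matrix `T` over `K^u[[t]]` of the
standard shape such that, with respect to `e`, the connection has matrix `T⁻¹ dT` and
`F(φ) φ^*` has matrix `T⁻¹ P φ(T)`. -/
structure Frame (X : FCrystal p k n H) (Fil U : ℕ → Submodule (PS p k n) H)
    (B : LinearMap.BilinForm (PS p k n) H) where
  e : Module.Basis (Idx n) (PSbar p k n) (PSbar p k n ⊗[PS p k n] H)
  Z : KPS p k n
  τ₂₃ : Fin n → KPS p k n
  τ₁₃ : Fin n → KPS p k n
  τ₁₂ : Matrix (Fin n) (Fin n) (KPS p k n)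
  mem : ∀ j, e j ∈ (U (wt j)).baseChange (PSbar p k n) ⊓ (Fil (wt j)).baseChange (PSbar p k n)
  gram : ∀ i j, B.baseChange (PSbar p k n) (e i) (e j) = gramMatrix (PSbar p k n) n i j
  conn : ∀ l : Fin n,
    (matrixOf e (Dbar X l)).map (algebraMap (PSbar p k n) (KPS p k n)) =
      (Tmatrix Z τ₂₃ τ₁₃ τ₁₂)⁻¹ * (Tmatrix Z τ₂₃ τ₁₃ τ₁₂).map (pd l)
  frob : ∀ φ : FrobLift p k n, ∃ (φb : FrobLift p (AlgebraicClosure k) n) (hφ : Extends φb φ)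
    (φT : Matrix (Idx n) (Idx n) (KPS p k n)),
    (∀ i j, IsFrobImage φ (Tmatrix Z τ₂₃ τ₁₃ τ₁₂ i j) (φT i j)) ∧
    (matrixOf e (Fbar X hφ)).map (algebraMap (PSbar p k n) (KPS p k n)) =
      (Tmatrix Z τ₂₃ τ₁₃ τ₁₂)⁻¹ * Pmatrix (KPS p k n) n p * φT

/-- The matrix `T` of a frame. -/
def Frame.T {X : FCrystal p k n H} {Fil U : ℕ → Submodule (PS p k n) H}
    {B : LinearMap.BilinForm (PS p k n) H} (E : Frame X Fil U B) :
    Matrix (Idx n) (Idx n) (KPS p k n) :=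
  Tmatrix E.Z E.τ₂₃ E.τ₁₃ E.τ₁₂

/-- The matrix `S` that belongs to a frame and a unit `f` of `Ā`, with entries in `K^u[[t]]`. -/
def Frame.S {X : FCrystal p k n H} {Fil U : ℕ → Submodule (PS p k n) H}
    {B : LinearMap.BilinForm (PS p k n) H} (E : Frame X Fil U B) (f : (PSbar p k n)ˣ) :
    Matrix (Idx n) (Idx n) (KPS p k n) :=
  Smatrix (Units.map (algebraMap (PSbar p k n) (KPS p k n)).toMonoidHom f) (jacobian E.τ₂₃)

end Frames

end CY3Crystal

end

open scoped TensorProduct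

noncomputable section

namespace CY3Crystal

set_option linter.unusedSectionVars false

/-! Slope filtration. Opposite conjugate and Hodge filtrations split `H` modulo `p`, for every `i`,
into a part on which `F(φ)` has slopes at most `i` and a part on which it is divisible by `p^(i+1)`.
Lifts of the first part are corrected to an `F(φ)`-stable summand `U_i`, the graph of the fixed
point of a `p`-adic contraction (`exists_slope_graph`). Since `F(φ)` is more divisible on `H / U_i`
than on `U_i`, any inclusion into `U_i` known modulo `p^N` improves to `p^(N+1)` under Frobenius.
This shows that the `U_i` are nested and horizontal; by the Taylor formula they do not depend on `φ`
(`IsSlopeSub.le`, `IsSlopeSub.conn_mem`, `IsSlopeSub.change`). The same gain of one `p` makes `U_i`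
and `U_j` orthogonal for `i + j ≤ 2`. With the Kodaira-Spencer isomorphism this yields a symplectic
basis of `H` adapted to the pieces `U_i ∩ Fil^i` (`exists_adapted_basis`).

Horizontal frame. Over `W(k̄)[[t]]` Lang's theorem (`exists_mul_map_stdLift_eq`) trivializes the
unit root parts. In the resulting basis `e` the Frobenius of the standard lift is block upper
triangular with diagonal blocks `p^w`. Horizontality kills the diagonal blocks of the connection,
because the derivatives of `φ(t_j)` are divisible by `p`. Griffiths transversality kills everything
beyond the first superdiagonal, so the connection matrix `N` raises the weight by exactly one
(`matrixOf_Dbar_hasDeg`). Integrability then says that `N` is closed and commutes with itself, so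
`dT = T N` is solved by three iterated integrals. A constant unipotent factor normalizes the
Frobenius at the origin, and a unipotent symplectic matrix has the shape required of `T`
(`exists_period_matrix`).

Arbitrary lifts of Frobenius. Integration creates denominators of logarithmic size only, while
`φ(t^m)` lies in `(p, t)^|m|`. Hence every `φ` acts by convergent series on a ring `Overconv` that
contains the entries of `T` (`frobSer`). In the coordinates given by `T`, the defect of the formula
for `F(φ)` satisfies a homogeneous linear differential system, so it vanishes once it vanishes at
the origin. There the Taylor formula relates `F(φ)` to the standard lift, and its terms are those of
`φ(T)` evaluated at the image of the origin (`horizontalCoords_Fbar`).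

Normal form. For any frame, the transition matrix between `e` and an adapted symplectic basis of `H`
is block diagonal and symplectic, hence determined by its last entry `f` and by its block of weight
2. The latter is `f` times the Jacobian of `τ₂₃`, since `ω_{h+j}` is a covariant derivative and the
last column of the connection is `dτ₂₃` (`Frame.toMatrix_map_eq_S`). The formulas for the connection
and the Frobenius follow by change of basis. -/

/-- The power series with the given coefficients. -/
def mkPS {σ R : Type*} (f : (σ →₀ ℕ) → R) : MvPowerSeries σ R := f

@[simp]
lemma coeff_mkPS {σ R : Type*} [CommRing R] (f : (σ →₀ ℕ) → R) (d : σ →₀ ℕ) :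
    MvPowerSeries.coeff d (mkPS f) = f d := rfl

/-! ### The `p`-adic topology on Witt vectors and on power series over them. -/

section PAdic

/-- `R` is `p`-adically separated. -/
def PSep (p : ℕ) (R : Type*) [CommRing R] : Prop :=
  ∀ x : R, (∀ N : ℕ, (p : R) ^ N ∣ x) → x = 0

/-- Every series `∑ p ^ m g_m` converges `p`-adically in `R`. -/
def PSum (p : ℕ) (R : Type*) [CommRing R] : Prop :=
  ∀ g : ℕ → R, ∃ S : R, ∀ M : ℕ, (p : R) ^ M ∣ S - ∑ m ∈ Finset.range M, (p : R) ^ m * g m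

/-- Banach's fixed point theorem for the `p`-adic topology. Successive iterates of `0` differ by
`p^m g_m`; `PSum` supplies a limit of the telescoping series and `PSep` shows that it is fixed. It
solves the slope equation and the Frobenius equations over `W(k̄)`. -/
lemma exists_fixed_point_of_contraction {p : ℕ} {R : Type*} [CommRing R] (hsep : PSep p R)
    (hsum : PSum p R) {κ : Type*} (f : (κ → R) → κ → R)
    (hf : ∀ (N : ℕ) (x y : κ → R), (∀ i, (p : R) ^ N ∣ x i - y i) →
      ∀ i, (p : R) ^ (N + 1) ∣ f x i - f y i) :
    ∃ x, f x = x := by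
  have h1 : ∀ m i, (p : R) ^ m ∣ f^[m + 1] 0 i - f^[m] 0 i := by
    intro m
    induction m with
    | zero => intro i; simp
    | succ m ih =>
      rw [Function.iterate_succ_apply' f (m + 1), Function.iterate_succ_apply' f m]
      rw [Function.iterate_succ_apply' f m] at ih
      exact hf m _ _ ih
  choose g hg using h1
  choose S hS using fun i => hsum fun m => g m i
  have h2 : ∀ M i, ∑ m ∈ Finset.range M, (p : R) ^ m * g m i = f^[M] 0 i := by
    intro M i
    simp only [← hg]
    rw [Finset.sum_range_sub (fun m => f^[m] 0 i)]
    simp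
  refine ⟨S, funext fun i => sub_eq_zero.1 (hsep _ fun M => ?_)⟩
  have h3 : ∀ M i, (p : R) ^ M ∣ S i - f^[M] 0 i := fun M i => by
    rw [← h2]; exact hS i M
  have h4 := hf M S _ (h3 M) i
  rw [← Function.iterate_succ_apply' f M] at h4
  have h5 := dvd_sub h4 (h3 (M + 1) i)
  rw [show f S i - f^[M + 1] 0 i - (S i - f^[M + 1] 0 i) = f S i - S i by ring] at h5
  exact (pow_dvd_pow _ (Nat.le_succ M)).trans h5

lemma coeff_natCast_pow_mul {R : Type*} [CommRing R] {σ : Type*} (p N : ℕ) (d : σ →₀ ℕ)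
    (f : MvPowerSeries σ R) :
    MvPowerSeries.coeff d ((p : MvPowerSeries σ R) ^ N * f) =
      (p : R) ^ N * MvPowerSeries.coeff d f := by
  rw [← map_natCast (MvPowerSeries.C (σ := σ) (R := R)) p, ← map_pow, MvPowerSeries.coeff_C_mul]

lemma natCast_pow_dvd_iff {R : Type*} [CommRing R] {σ : Type*} (p N : ℕ)
    (f : MvPowerSeries σ R) :
    (p : MvPowerSeries σ R) ^ N ∣ f ↔ ∀ d, (p : R) ^ N ∣ MvPowerSeries.coeff d f := by
  constructor
  · rintro ⟨g, rfl⟩ d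
    rw [coeff_natCast_pow_mul]
    exact dvd_mul_right _ _
  · intro h
    choose g hg using h
    refine ⟨mkPS g, ?_⟩
    ext d
    rw [coeff_natCast_pow_mul, hg, coeff_mkPS]

lemma PSep.mvPowerSeries {R : Type*} [CommRing R] {σ : Type*} {p : ℕ} (h : PSep p R) :
    PSep p (MvPowerSeries σ R) := by
  intro f hf
  ext d
  exact h _ fun N => (natCast_pow_dvd_iff p N f).1 (hf N) d

lemma PSum.mvPowerSeries {R : Type*} [CommRing R] {σ : Type*} {p : ℕ} (h : PSum p R) :
    PSum p (MvPowerSeries σ R) := by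
  intro g
  choose S hS using fun d => h fun m => MvPowerSeries.coeff d (g m)
  refine ⟨mkPS S, fun M => (natCast_pow_dvd_iff p M _).2 fun d => ?_⟩
  rw [map_sub, map_sum, coeff_mkPS]
  simp only [coeff_natCast_pow_mul]
  exact hS d M

variable {p : ℕ} [hp : Fact p.Prime] {k : Type*} [Field k] [CharP k p] [PerfectRing k p]

lemma psep_wittVector : PSep p (WittVector p k) := by
  intro x hx
  refine IsHausdorff.haus (I := Ideal.span {(p : WittVector p k)}) inferInstance x fun N => ?_
  rw [SModEq.zero, smul_eq_mul, Ideal.mul_top, Ideal.span_singleton_pow, Ideal.mem_span_singleton]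
  exact hx N

lemma psum_wittVector : PSum p (WittVector p k) := by
  intro g
  obtain ⟨L, hL⟩ := IsPrecomplete.prec (I := Ideal.span {(p : WittVector p k)}) inferInstance
    (f := fun M => ∑ m ∈ Finset.range M, (p : WittVector p k) ^ m * g m) (by
      intro m n hmn
      rw [SModEq.sub_mem, smul_eq_mul, Ideal.mul_top, Ideal.span_singleton_pow,
        Ideal.mem_span_singleton, ← Finset.sum_range_add_sum_Ico _ hmn, sub_add_cancel_left,
        dvd_neg]
      refine Finset.dvd_sum fun i hi => ?_
      exact ((pow_dvd_pow _ (Finset.mem_Ico.1 hi).1)).trans (dvd_mul_right _ _))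
  refine ⟨L, fun M => ?_⟩
  have := hL M
  rw [SModEq.sub_mem, smul_eq_mul, Ideal.mul_top, Ideal.span_singleton_pow,
        Ideal.mem_span_singleton, ← dvd_neg, neg_sub] at this
  exact this

lemma psep_PS {n : ℕ} : PSep p (PS p k n) := psep_wittVector.mvPowerSeries
lemma psum_PS {n : ℕ} : PSum p (PS p k n) := psum_wittVector.mvPowerSeries

lemma natCast_p_ne_zero_witt : (p : WittVector p k) ≠ 0 := (WittVector.irreducible p).ne_zero

/-- Write a nonzero integer as `p^a q` with `q` prime to `p`: the power of `p` is nonzero in the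
domain `W(k)`, and `q` has nonzero residue in `k`. -/
instance charZero_witt : CharZero (WittVector p k) := by
  refine charZero_of_inj_zero fun m hm => ?_
  by_contra h0
  obtain ⟨a, q, hq, rfl⟩ := Nat.exists_eq_pow_mul_and_not_dvd h0 p hp.out.ne_one
  rw [Nat.cast_mul, Nat.cast_pow] at hm
  rcases mul_eq_zero.1 hm with h | h
  · exact natCast_p_ne_zero_witt (eq_zero_of_pow_eq_zero h)
  · have := congrArg (WittVector.constantCoeff) h
    rw [map_natCast, map_zero] at this
    exact hq ((CharP.cast_eq_zero_iff k p q).1 this)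

instance charZero_mvPowerSeries {R : Type*} [CommRing R] [CharZero R] {σ : Type*} :
    CharZero (MvPowerSeries σ R) :=
  charZero_of_inj_zero fun m hm => by
    have := congrArg (MvPowerSeries.constantCoeff (σ := σ) (R := R)) hm
    rw [map_natCast, map_zero] at this
    exact_mod_cast this

instance isDomain_PS {n : ℕ} : IsDomain (PS p k n) := NoZeroDivisors.to_isDomain _

lemma natCast_p_ne_zero_PS {n : ℕ} : (p : PS p k n) ≠ 0 :=
  Nat.cast_ne_zero.2 hp.out.ne_zero

lemma not_isUnit_natCast_p {n : ℕ} : ¬ IsUnit (p : PS p k n) := by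
  rw [MvPowerSeries.isUnit_iff_constantCoeff, map_natCast]
  exact (WittVector.irreducible p).not_isUnit

lemma pIdeal_le_jacobson {n : ℕ} : pIdeal p k n ≤ Ideal.jacobson ⊥ := by
  rw [IsLocalRing.jacobson_eq_maximalIdeal _ bot_ne_top, pIdeal, Ideal.span_singleton_le_iff_mem]
  exact (IsLocalRing.mem_maximalIdeal _).2 not_isUnit_natCast_p

end PAdic

/-! ### The filtration of power series by powers of `(p, t)`. -/

section FrobeniusLifts

variable {R : Type*} [CommRing R] {n : ℕ}

/-- The coefficient of `g` in degree `d` is divisible by `p ^ (L - d)`. -/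
def MixedOrd (p L : ℕ) (g : MvPowerSeries (Fin n) R) : Prop :=
  ∀ d : Fin n →₀ ℕ, (p : R) ^ (L - d.degree) ∣ MvPowerSeries.coeff d g

lemma MixedOrd.mul {p L L' : ℕ} {g g' : MvPowerSeries (Fin n) R} (h : MixedOrd p L g)
    (h' : MixedOrd p L' g') : MixedOrd p (L + L') (g * g') := by
  intro d
  rw [MvPowerSeries.coeff_mul]
  refine Finset.dvd_sum fun x hx => ?_
  rw [Finset.HasAntidiagonal.mem_antidiagonal] at hx
  have hd : d.degree = x.1.degree + x.2.degree := by rw [← hx, map_add]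
  refine Dvd.dvd.trans (pow_dvd_pow _ ?_) (pow_add (p : R) _ _ ▸ mul_dvd_mul (h x.1) (h' x.2))
  omega

lemma MixedOrd.zero {p : ℕ} (g : MvPowerSeries (Fin n) R) : MixedOrd p 0 g := by
  intro d; simp

lemma MixedOrd.sum {p L : ℕ} {ι : Type*} (s : Finset ι) (g : ι → MvPowerSeries (Fin n) R)
    (h : ∀ i ∈ s, MixedOrd p L (g i)) : MixedOrd p L (∑ i ∈ s, g i) := by
  intro d
  rw [map_sum]
  exact Finset.dvd_sum fun i hi => h i hi d

/-- A power series of order `≥ M + 1` is a combination of the variables with coefficients of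
order `≥ M`. -/
lemma exists_sum_X_mul (M : ℕ) (a : MvPowerSeries (Fin n) R)
    (ha : ∀ d : Fin n →₀ ℕ, d.degree < M + 1 → MvPowerSeries.coeff d a = 0) :
    ∃ b : Fin n → MvPowerSeries (Fin n) R, a = ∑ j, MvPowerSeries.X j * b j ∧
      ∀ j (d : Fin n →₀ ℕ), d.degree < M → MvPowerSeries.coeff d (b j) = 0 := by
  classical
  have key : ∀ d : Fin n →₀ ℕ, d ≠ 0 → ∃ j, d j ≠ 0 := fun d hd => by
    by_contra h
    push Not at h
    exact hd (Finsupp.ext h)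
  -- `J` assigns to each nonzero exponent one variable dividing the monomial; `b j` collects the
  -- monomials assigned to `j`, so that each is counted once.
  let J : (Fin n →₀ ℕ) → Option (Fin n) := fun d =>
    if h : d ≠ 0 then some (key d h).choose else none
  refine ⟨fun j => mkPS fun e => if J (e + Finsupp.single j 1) = some j then
    MvPowerSeries.coeff (e + Finsupp.single j 1) a else 0, ?_, ?_⟩
  · ext d
    rw [map_sum]
    by_cases hd : d = 0
    · subst hd
      rw [ha 0 (by simp)]
      symm
      refine Finset.sum_eq_zero fun j _ => ?_
      rw [MvPowerSeries.X, MvPowerSeries.coeff_monomial_mul, if_neg]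
      intro h
      have := h j
      simp at this
    · set j₀ := (key d hd).choose with hj₀
      have hJ : J d = some j₀ := dif_pos hd
      rw [Finset.sum_eq_single j₀]
      · have hle : Finsupp.single j₀ 1 ≤ d := by
          rw [Finsupp.single_le_iff]
          exact Nat.one_le_iff_ne_zero.2 (key d hd).choose_spec
        rw [MvPowerSeries.X, MvPowerSeries.coeff_monomial_mul, if_pos hle, one_mul,
          coeff_mkPS, tsub_add_cancel_of_le hle, if_pos hJ]
      · intro j _ hj
        rw [MvPowerSeries.X, MvPowerSeries.coeff_monomial_mul]
        split_ifs with hle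
        · rw [one_mul, coeff_mkPS, tsub_add_cancel_of_le hle, if_neg]
          rw [hJ]
          simpa using fun h => hj h.symm
        · rfl
      · simp
  · intro j d hd
    rw [coeff_mkPS]
    split_ifs
    · exact ha _ (by rw [map_add, Finsupp.degree_single]; omega)
    · rfl

end FrobeniusLifts

/-! ### Continuity of lifts of Frobenius, and the standard lift. -/

section FrobLiftFacts

variable {p : ℕ} [hp : Fact p.Prime] {k : Type*} [Field k] [CharP k p] {n : ℕ}

namespace FrobLift

variable (φ : FrobLift p k n)

/-- Modulo `p` the image of `t_j` is `t_j^p`, so it lies in `(p, t)`. Its constant term is divisible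
by `p` but need not vanish: a lift of Frobenius can move the origin. -/
lemma mixedOrd_X (j : Fin n) : MixedOrd p 1 (φ.toRingHom (MvPowerSeries.X j)) := by
  obtain ⟨b, hb⟩ := φ.map_mod (MvPowerSeries.X j)
  intro d
  by_cases hd : d = 0
  · subst hd
    rw [hb]
    have h := coeff_natCast_pow_mul p 1 0 b
    rw [pow_one] at h
    rw [map_add, h]
    simp only [map_zero, tsub_zero, pow_one, MvPowerSeries.coeff_zero_eq_constantCoeff, map_pow,
      MvPowerSeries.constantCoeff_X]
    rw [zero_pow hp.out.ne_zero, zero_add]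
    exact dvd_mul_right _ _
  · have : 1 ≤ d.degree := by
      rw [Nat.one_le_iff_ne_zero]
      rwa [Ne, Finsupp.degree_eq_zero_iff]
    rw [show 1 - d.degree = 0 by omega, pow_zero]
    exact one_dvd _

/-- Split off one variable at a time; each contributes a factor `φ(t_j)` in `(p, t)`. For a monomial
this says that the coefficient of `t^d` in `φ(t^m)` is divisible by `p^(|m| - |d|)`, the source of
convergence for all series below. -/
lemma mixedOrd_of_order (M : ℕ) (a : PS p k n)
    (ha : ∀ d : Fin n →₀ ℕ, d.degree < M → MvPowerSeries.coeff d a = 0) :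
    MixedOrd p M (φ.toRingHom a) := by
  induction M generalizing a with
  | zero => exact MixedOrd.zero _
  | succ M ih =>
    obtain ⟨b, hb, hb'⟩ := exists_sum_X_mul M a ha
    rw [hb, map_sum]
    refine MixedOrd.sum _ _ fun j _ => ?_
    rw [map_mul, add_comm]
    exact (φ.mixedOrd_X j).mul (ih (b j) (hb' j))

lemma mixedOrd_monomial (m : Fin n →₀ ℕ) :
    MixedOrd p m.degree (φ.toRingHom (MvPowerSeries.monomial m 1)) := by
  classical
  refine φ.mixedOrd_of_order _ _ fun d hd => ?_
  rw [MvPowerSeries.coeff_monomial, if_neg]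
  rintro rfl
  exact lt_irrefl _ hd

lemma dvd_pd_X (i j : Fin n) : (p : PS p k n) ∣ pd i (φ.toRingHom (MvPowerSeries.X j)) := by
  obtain ⟨b, hb⟩ := φ.map_mod (MvPowerSeries.X j)
  rw [hb, pd, map_add, MvPowerSeries.pderiv_pow, Derivation.leibniz]
  have : MvPowerSeries.pderiv (WittVector p k) i (p : PS p k n) = 0 :=
    Derivation.map_natCast _ p
  rw [this, smul_zero, add_zero, smul_eq_mul]
  refine dvd_add ?_ (dvd_mul_right _ _)
  rw [mul_assoc]
  exact dvd_mul_right _ _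

end FrobLift

/-- The lift of Frobenius `∑ a_m t^m ↦ ∑ σ(a_m) t^{pm}`. -/
def stdLift (p : ℕ) [hp : Fact p.Prime] (k : Type*) [Field k] [CharP k p] [PerfectRing k p] (n : ℕ) :
    FrobLift p k n where
  toRingHom := (MvPowerSeries.map (WittVector.frobenius (p := p) (R := k))).comp
    (MvPowerSeries.expand p hp.out.ne_zero (R := WittVector p k) (σ := Fin n)).toRingHom
  map_const w := by
    simp [MvPowerSeries.expand_C]
  map_mod a := by
    -- Divisibility by `p` is tested on residues of coefficients, where the Witt vector Frobenius
    -- becomes the `p`-th power and the identity is the usual one in characteristic `p`.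
    have hdvd : (p : PS p k n) ^ 1 ∣ ((MvPowerSeries.map (WittVector.frobenius (p := p) (R := k))).comp
      (MvPowerSeries.expand p hp.out.ne_zero).toRingHom) a - a ^ p := by
      have h0 : MvPowerSeries.map (WittVector.constantCoeff (p := p) (R := k))
          (((MvPowerSeries.map (WittVector.frobenius (p := p) (R := k))).comp
            (MvPowerSeries.expand p hp.out.ne_zero).toRingHom) a - a ^ p) = 0 := by
        rw [map_sub, map_pow, ← MvPowerSeries.map_frobenius_expand p hp.out.ne_zero,
          ← MvPowerSeries.map_expand, sub_eq_zero]
        ext d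
        simp only [RingHom.comp_apply, MvPowerSeries.coeff_map]
        rw [WittVector.frobenius_eq_map_frobenius]
        rfl
      rw [natCast_pow_dvd_iff]
      intro d
      rw [pow_one, ← Ideal.mem_span_singleton, WittVector.mem_span_p_iff_coeff_zero_eq_zero]
      have := congrArg (MvPowerSeries.coeff d) h0
      rwa [MvPowerSeries.coeff_map, map_zero] at this
    obtain ⟨b, hb⟩ := hdvd
    exact ⟨b, by rw [pow_one] at hb; rw [← hb]; ring⟩

lemma stdLift_apply [PerfectRing k p] (a : PS p k n) : (stdLift p k n).toRingHom a =
    MvPowerSeries.map (WittVector.frobenius (p := p) (R := k))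
      (MvPowerSeries.expand p hp.out.ne_zero a) := rfl

end FrobLiftFacts

/-! ### The `p`-adic topology of `K^u`. -/

section KuTopology

variable {p : ℕ} [hp : Fact p.Prime] {k : Type*} [Field k]

/-- The inclusion of `W(k̄)` in `K^u`. -/
abbrev toKu (p : ℕ) [Fact p.Prime] (k : Type*) [Field k] :
    WittVector p (AlgebraicClosure k) →+* Ku p k :=
  algebraMap (WittVector p (AlgebraicClosure k)) (Ku p k)

/-- `x` lies in `p ^ N W(k̄)`. -/
def IsSmall (N : ℕ) (x : Ku p k) : Prop := ∃ w, x = (p : Ku p k) ^ N * toKu p k w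

lemma IsSmall.zero (N : ℕ) : IsSmall N (0 : Ku p k) := ⟨0, by simp⟩

lemma IsSmall.add {N : ℕ} {x y : Ku p k} (hx : IsSmall N x) (hy : IsSmall N y) :
    IsSmall N (x + y) := by
  obtain ⟨a, rfl⟩ := hx
  obtain ⟨b, rfl⟩ := hy
  exact ⟨a + b, by rw [map_add, mul_add]⟩

lemma IsSmall.neg {N : ℕ} {x : Ku p k} (hx : IsSmall N x) : IsSmall N (-x) := by
  obtain ⟨a, rfl⟩ := hx
  exact ⟨-a, by rw [map_neg, mul_neg]⟩

lemma IsSmall.sub {N : ℕ} {x y : Ku p k} (hx : IsSmall N x) (hy : IsSmall N y) :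
    IsSmall N (x - y) := by
  rw [sub_eq_add_neg]; exact hx.add hy.neg

lemma IsSmall.sum {N : ℕ} {ι : Type*} (s : Finset ι) (f : ι → Ku p k)
    (h : ∀ i ∈ s, IsSmall N (f i)) : IsSmall N (∑ i ∈ s, f i) :=
  Finset.sum_induction f (IsSmall N) (fun _ _ => IsSmall.add) (IsSmall.zero N) h

lemma IsSmall.mul {N M : ℕ} {x y : Ku p k} (hx : IsSmall N x) (hy : IsSmall M y) :
    IsSmall (N + M) (x * y) := by
  obtain ⟨a, rfl⟩ := hx
  obtain ⟨b, rfl⟩ := hy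
  exact ⟨a * b, by rw [map_mul]; ring⟩

lemma IsSmall.mono {N M : ℕ} (hNM : M ≤ N) {x : Ku p k} (hx : IsSmall N x) : IsSmall M x := by
  obtain ⟨a, rfl⟩ := hx
  obtain ⟨c, rfl⟩ := Nat.exists_eq_add_of_le hNM
  exact ⟨(p : WittVector p (AlgebraicClosure k)) ^ c * a, by
    rw [map_mul, map_pow, map_natCast]; ring⟩

lemma isSmall_toKu (w : WittVector p (AlgebraicClosure k)) : IsSmall 0 (toKu p k w) :=
  ⟨w, by simp⟩

lemma isSmall_p_pow (N : ℕ) : IsSmall N ((p : Ku p k) ^ N) := ⟨1, by simp⟩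

lemma isSmall_of_dvd {N : ℕ} {w : WittVector p (AlgebraicClosure k)}
    (h : (p : WittVector p (AlgebraicClosure k)) ^ N ∣ w) : IsSmall N (toKu p k w) := by
  obtain ⟨c, rfl⟩ := h
  exact ⟨c, by rw [map_mul, map_pow, map_natCast]⟩

variable [CharP k p]

lemma toKu_injective : Function.Injective (toKu p k) := IsFractionRing.injective _ _

lemma dvd_of_isSmall {N : ℕ} {w : WittVector p (AlgebraicClosure k)}
    (h : IsSmall N (toKu p k w)) : (p : WittVector p (AlgebraicClosure k)) ^ N ∣ w := by
  obtain ⟨c, hc⟩ := h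
  refine ⟨c, toKu_injective ?_⟩
  rw [hc, map_mul, map_pow, map_natCast]

instance charZero_Ku : CharZero (Ku p k) :=
  charZero_of_injective_algebraMap (toKu_injective (p := p) (k := k))

lemma p_ne_zero_Ku : (p : Ku p k) ≠ 0 := Nat.cast_ne_zero.2 hp.out.ne_zero

lemma IsSmall.of_p_pow_mul {N L : ℕ} {x : Ku p k} (h : IsSmall (N + L) ((p : Ku p k) ^ L * x)) :
    IsSmall N x := by
  obtain ⟨w, hw⟩ := h
  refine ⟨w, mul_left_cancel₀ (pow_ne_zero L p_ne_zero_Ku) ?_⟩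
  rw [hw]; ring

lemma exists_isSmall (x : Ku p k) : ∃ N : ℕ, IsSmall 0 ((p : Ku p k) ^ N * x) := by
  obtain ⟨a, b, hb, rfl⟩ := IsFractionRing.div_surjective (A := WittVector p (AlgebraicClosure k)) x
  have hb0 : b ≠ 0 := nonZeroDivisors.ne_zero hb
  obtain ⟨N, u, rfl⟩ := WittVector.exists_eq_pow_p_mul' b hb0
  refine ⟨N, ((u⁻¹ : (WittVector p (AlgebraicClosure k))ˣ) : WittVector p _) * a, ?_⟩
  have hp0 : (p : Ku p k) ≠ 0 := p_ne_zero_Ku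
  have hu : toKu p k ((u⁻¹ : (WittVector p (AlgebraicClosure k))ˣ) : WittVector p _) *
      toKu p k u = 1 := by
    rw [← map_mul, Units.inv_mul, map_one]
  have hu0 : toKu p k u ≠ 0 := right_ne_zero_of_mul_eq_one hu
  rw [map_mul, map_mul, map_pow, map_natCast, pow_zero, one_mul, eq_div_of_mul_eq hu0 hu]
  field_simp

lemma eq_zero_of_isSmall {x : Ku p k} (h : ∀ N, IsSmall N x) : x = 0 := by
  obtain ⟨w, hw⟩ := h 0
  rw [pow_zero, one_mul] at hw
  subst hw
  rw [psep_wittVector w fun N => dvd_of_isSmall (h N), map_zero]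

/-- The Frobenius of `K^u`. -/
abbrev sigmaKu (p : ℕ) [Fact p.Prime] (k : Type*) [Field k] [CharP k p] : Ku p k →+* Ku p k :=
  WittVector.FractionRing.frobeniusRingHom p (AlgebraicClosure k)

lemma sigmaKu_toKu (w : WittVector p (AlgebraicClosure k)) :
    sigmaKu p k (toKu p k w) = toKu p k (WittVector.frobenius w) := by
  change IsFractionRing.ringEquivOfRingEquiv _ _ = _
  rw [IsFractionRing.ringEquivOfRingEquiv_algebraMap]
  rfl

lemma IsSmall.sigma {N : ℕ} {x : Ku p k} (h : IsSmall N x) : IsSmall N (sigmaKu p k x) := by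
  obtain ⟨w, rfl⟩ := h
  exact ⟨WittVector.frobenius w, by rw [map_mul, map_pow, map_natCast, sigmaKu_toKu]⟩

/-- Convergence of a sequence in `K^u`. -/
def KLim (x : ℕ → Ku p k) (y : Ku p k) : Prop :=
  ∀ N : ℕ, ∃ M₀ : ℕ, ∀ M, M₀ ≤ M → IsSmall N (x M - y)

lemma KLim.unique {x : ℕ → Ku p k} {y z : Ku p k} (hy : KLim x y) (hz : KLim x z) : y = z := by
  refine sub_eq_zero.1 (eq_zero_of_isSmall fun N => ?_)
  obtain ⟨M, hM⟩ := hy N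
  obtain ⟨M', hM'⟩ := hz N
  have := (hM' (max M M') (le_max_right _ _)).sub (hM (max M M') (le_max_left _ _))
  rwa [sub_sub_sub_cancel_left] at this

lemma KLim.const (y : Ku p k) : KLim (fun _ => y) y := fun N => ⟨0, fun M _ => by
  rw [sub_self]; exact IsSmall.zero N⟩

lemma KLim.add {x x' : ℕ → Ku p k} {y y' : Ku p k} (h : KLim x y) (h' : KLim x' y') :
    KLim (fun M => x M + x' M) (y + y') := fun N => by
  obtain ⟨M, hM⟩ := h N
  obtain ⟨M', hM'⟩ := h' N
  refine ⟨max M M', fun L hL => ?_⟩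
  rw [add_sub_add_comm]
  exact (hM L (le_trans (le_max_left _ _) hL)).add (hM' L (le_trans (le_max_right _ _) hL))

lemma KLim.sum {ι : Type*} (s : Finset ι) (x : ι → ℕ → Ku p k) (y : ι → Ku p k)
    (h : ∀ i ∈ s, KLim (x i) (y i)) : KLim (fun M => ∑ i ∈ s, x i M) (∑ i ∈ s, y i) := by
  classical
  induction s using Finset.induction_on with
  | empty => simpa using KLim.const (0 : Ku p k)
  | insert a s ha ih =>
    simp only [Finset.sum_insert ha]
    exact (h a (Finset.mem_insert_self _ _)).add (ih fun i hi => h i (Finset.mem_insert_of_mem hi))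

lemma KLim.mul {x x' : ℕ → Ku p k} {y y' : Ku p k} (h : KLim x y) (h' : KLim x' y') :
    KLim (fun M => x M * x' M) (y * y') := fun N => by
  -- The limits have fixed denominators `p^a` and `p^b`; the cross terms are controlled by asking
  -- for that much more precision of the other factor.
  obtain ⟨a, ha⟩ := exists_isSmall y
  obtain ⟨b, hb⟩ := exists_isSmall y'
  obtain ⟨M, hM⟩ := h (N + b)
  obtain ⟨M', hM'⟩ := h' (N + a)
  refine ⟨max M M', fun L hL => ?_⟩
  have h1 := hM L (le_trans (le_max_left _ _) hL)
  have h2 := hM' L (le_trans (le_max_right _ _) hL)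
  have e : x L * x' L - y * y' = (x L - y) * (x' L - y') + (x L - y) * y' + y * (x' L - y') := by
    ring
  rw [e]
  refine ((IsSmall.mono (by omega) (h1.mul h2)).add ?_).add ?_
  · refine IsSmall.of_p_pow_mul (L := b) ?_
    rw [mul_left_comm]
    exact h1.mul hb
  · refine IsSmall.of_p_pow_mul (L := a) ?_
    rw [← mul_assoc]
    exact IsSmall.mono (by omega) (ha.mul h2)

lemma KLim.congr {x x' : ℕ → Ku p k} {y : Ku p k} (h : KLim x y)
    (h' : KLim (fun M => x' M - x M) 0) : KLim x' y := by
  have := h.add h'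
  simpa using this

lemma KLim.isSmall {x : ℕ → Ku p k} {y : Ku p k} (h : KLim x y) {N : ℕ}
    (hx : ∀ M, IsSmall N (x M)) : IsSmall N y := by
  obtain ⟨M, hM⟩ := h N
  simpa using (hx M).sub (hM M le_rfl)

/-- After scaling by `p^C` the increments are `p^M` times integral elements, so the completeness of
`W(k̄)` sums them. The constant `C` allows for bounded denominators. -/
lemma exists_kLim (x : ℕ → Ku p k) (C : ℕ) (h0 : x 0 = 0)
    (h : ∀ M, IsSmall M ((p : Ku p k) ^ C * (x (M + 1) - x M))) : ∃ y, KLim x y := by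
  choose w hw using h
  obtain ⟨S, hS⟩ := psum_wittVector (k := AlgebraicClosure k) w
  have hpC : (p : Ku p k) ^ C ≠ 0 := pow_ne_zero _ p_ne_zero_Ku
  refine ⟨((p : Ku p k) ^ C)⁻¹ * toKu p k S, fun N => ⟨N + C, fun M hM => ?_⟩⟩
  refine IsSmall.of_p_pow_mul (L := C) ?_
  rw [mul_sub, mul_inv_cancel_left₀ hpC]
  have h1 : (p : Ku p k) ^ C * x M =
      toKu p k (∑ m ∈ Finset.range M, (p : WittVector p (AlgebraicClosure k)) ^ m * w m) := by
    rw [map_sum]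
    simp only [map_mul, map_pow, map_natCast]
    simp only [← hw]
    rw [← Finset.mul_sum, Finset.sum_range_sub, h0, sub_zero]
  rw [h1, ← map_sub, ← neg_sub, map_neg]
  exact (isSmall_of_dvd ((pow_dvd_pow _ hM).trans (hS M))).neg

end KuTopology

/-! ### Power series over `K^u` of subexponential growth, closed under products, derivatives and
integrals. -/

section Overconvergent

variable {p : ℕ} [hp : Fact p.Prime] {k : Type*} [Field k] [CharP k p] {n : ℕ}

/-- Power series over `K^u` whose coefficients grow slower than any exponential. -/
def IsOverconv (f : KPS p k n) : Prop :=
  ∀ q : ℕ, 0 < q → ∃ N : ℕ, ∀ m : Fin n →₀ ℕ,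
    IsSmall 0 ((p : Ku p k) ^ (N + m.degree / q) * MvPowerSeries.coeff m f)

lemma IsSmall.pow_mul_mono {a b : ℕ} (hab : a ≤ b) {x : Ku p k}
    (h : IsSmall 0 ((p : Ku p k) ^ a * x)) : IsSmall 0 ((p : Ku p k) ^ b * x) := by
  obtain ⟨c, rfl⟩ := Nat.exists_eq_add_of_le hab
  rw [add_comm a c, pow_add, mul_assoc]
  exact ((isSmall_p_pow c).mul h).mono (Nat.zero_le _)

lemma isOverconv_of_coeff (f : KPS p k n) (h : ∀ m, IsSmall 0 (MvPowerSeries.coeff m f)) :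
    IsOverconv f := fun q _ => ⟨0, fun m =>
  IsSmall.pow_mul_mono (Nat.zero_le _) (by simpa using h m)⟩

lemma coeff_toKPS (a : PSbar p k n) (m : Fin n →₀ ℕ) :
    MvPowerSeries.coeff m (algebraMap (PSbar p k n) (KPS p k n) a) =
      toKu p k (MvPowerSeries.coeff m a) := by
  rw [MvPowerSeries.algebraMap_apply'', MvPowerSeries.coeff_map]

lemma coeff_toPSbar (a : PS p k n) (m : Fin n →₀ ℕ) :
    MvPowerSeries.coeff m (algebraMap (PS p k n) (PSbar p k n) a) =
      algebraMap (WittVector p k) (WittVector p (AlgebraicClosure k)) (MvPowerSeries.coeff m a) := by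
  rw [MvPowerSeries.algebraMap_apply'', MvPowerSeries.coeff_map]

lemma toKPS_injective : Function.Injective (algebraMap (PSbar p k n) (KPS p k n)) := by
  intro a b h
  ext m : 1
  refine toKu_injective ?_
  rw [← coeff_toKPS, ← coeff_toKPS, h]

lemma isOverconv_algebraMap (a : PSbar p k n) :
    IsOverconv (algebraMap (PSbar p k n) (KPS p k n) a) :=
  isOverconv_of_coeff _ fun m => by rw [coeff_toKPS]; exact isSmall_toKu _

lemma isOverconv_C (x : Ku p k) : IsOverconv (MvPowerSeries.C x : KPS p k n) := by
  classical
  intro q _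
  obtain ⟨N, hN⟩ := exists_isSmall x
  refine ⟨N, fun m => IsSmall.pow_mul_mono (Nat.le_add_right _ _) ?_⟩
  rw [MvPowerSeries.coeff_C]
  split_ifs
  · exact hN
  · rw [mul_zero]; exact IsSmall.zero _

lemma IsOverconv.add {f g : KPS p k n} (hf : IsOverconv f) (hg : IsOverconv g) :
    IsOverconv (f + g) := fun q hq => by
  obtain ⟨N, hN⟩ := hf q hq
  obtain ⟨N', hN'⟩ := hg q hq
  refine ⟨N + N', fun m => ?_⟩
  rw [map_add, mul_add]
  exact (IsSmall.pow_mul_mono (by omega) (hN m)).add (IsSmall.pow_mul_mono (by omega) (hN' m))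

lemma isSmall_mul_pair {q N N' : ℕ} {a b m : Fin n →₀ ℕ} (h : a + b = m) {x y : Ku p k}
    (hx : IsSmall 0 ((p : Ku p k) ^ (N + a.degree / q) * x))
    (hy : IsSmall 0 ((p : Ku p k) ^ (N' + b.degree / q) * y)) :
    IsSmall 0 ((p : Ku p k) ^ (N + N' + m.degree / q) * (x * y)) := by
  have hd : m.degree = a.degree + b.degree := by rw [← h, map_add]
  refine IsSmall.pow_mul_mono (a := (N + a.degree / q) + (N' + b.degree / q)) ?_ ?_
  · have : a.degree / q + b.degree / q ≤ (a.degree + b.degree) / q :=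
      Nat.div_add_div_le_add_div
    rw [hd]; omega
  · rw [pow_add, mul_mul_mul_comm]
    exact hx.mul hy

lemma IsOverconv.mul {f g : KPS p k n} (hf : IsOverconv f) (hg : IsOverconv g) :
    IsOverconv (f * g) := fun q hq => by
  obtain ⟨N, hN⟩ := hf q hq
  obtain ⟨N', hN'⟩ := hg q hq
  refine ⟨N + N', fun m => ?_⟩
  rw [MvPowerSeries.coeff_mul, Finset.mul_sum]
  refine IsSmall.sum _ _ fun x hx => ?_
  exact isSmall_mul_pair (Finset.HasAntidiagonal.mem_antidiagonal.1 hx) (hN _) (hN' _)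

/-- The ring of power series over `K^u` whose coefficients grow slower than any exponential. -/
def Overconv (p : ℕ) [Fact p.Prime] (k : Type*) [Field k] [CharP k p] (n : ℕ) :
    Subring (KPS p k n) where
  carrier := {f | IsOverconv f}
  mul_mem' := IsOverconv.mul
  add_mem' := IsOverconv.add
  one_mem' := by simpa using isOverconv_C (p := p) (k := k) (n := n) 1
  zero_mem' := by simpa using isOverconv_C (p := p) (k := k) (n := n) 0
  neg_mem' {f} hf := fun q hq => by
    obtain ⟨N, hN⟩ := hf q hq
    exact ⟨N, fun m => by rw [map_neg, mul_neg]; exact (hN m).neg⟩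

lemma IsOverconv.pd {f : KPS p k n} (hf : IsOverconv f) (l : Fin n) : IsOverconv (pd l f) :=
  fun q hq => by
  obtain ⟨N, hN⟩ := hf q hq
  refine ⟨N + 1, fun m => ?_⟩
  rw [CY3Crystal.pd, MvPowerSeries.coeff_pderiv, ← mul_assoc]
  have h1 := hN (m + Finsupp.single l 1)
  rw [map_add, Finsupp.degree_single] at h1
  have h2 : (m.degree + 1) / q ≤ m.degree / q + 1 := by
    refine (Nat.div_le_div_right (Nat.add_le_add_left hq _)).trans ?_
    rw [Nat.add_div_right _ hq]
  refine IsSmall.mul (N := 0) (M := 0) (IsSmall.pow_mul_mono (by omega) h1) ?_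
  have := isSmall_toKu (p := p) (k := k) ((m l + 1 : ℕ) : WittVector p (AlgebraicClosure k))
  rw [map_natCast] at this
  exact_mod_cast this

lemma isUnit_natCast_witt {u : ℕ} (hu : ¬ p ∣ u) :
    IsUnit (u : WittVector p (AlgebraicClosure k)) := by
  refine WittVector.isUnit_of_coeff_zero_ne_zero _ fun h => hu ?_
  have h' : WittVector.constantCoeff (u : WittVector p (AlgebraicClosure k)) = 0 := h
  rw [map_natCast] at h'
  exact (CharP.cast_eq_zero_iff (AlgebraicClosure k) p u).1 h'

/-- The valuation of `a` is at most logarithmic in `a`: if `v = q + c`, then `c q ≤ 2^c 2^q ≤ p^v ≤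
a`. -/
lemma exponent_le_of_pow_dvd {a v q : ℕ} (ha : 0 < a) (hq : 0 < q) (h : p ^ v ∣ a) :
    v ≤ q + a / q := by
  rcases le_total v q with hvq | hvq
  · exact hvq.trans (Nat.le_add_right _ _)
  · obtain ⟨c, rfl⟩ := Nat.exists_eq_add_of_le hvq
    refine Nat.add_le_add_left ((Nat.le_div_iff_mul_le hq).2 ?_) _
    calc c * q ≤ 2 ^ c * 2 ^ q := Nat.mul_le_mul Nat.lt_two_pow_self.le Nat.lt_two_pow_self.le
      _ = 2 ^ (q + c) := by rw [← pow_add, add_comm]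
      _ ≤ p ^ (q + c) := Nat.pow_le_pow_left hp.out.two_le _
      _ ≤ a := Nat.le_of_dvd ha h

lemma isSmall_of_natCast_mul {a q E : ℕ} (ha : 0 < a) (hq : 0 < q) {x : Ku p k}
    (h : IsSmall 0 ((p : Ku p k) ^ E * (x * (a : Ku p k)))) :
    IsSmall 0 ((p : Ku p k) ^ (E + (q + a / q)) * x) := by
  obtain ⟨v, u, hu, rfl⟩ := Nat.exists_eq_pow_mul_and_not_dvd ha.ne' p hp.out.ne_one
  have hv := exponent_le_of_pow_dvd ha hq (Dvd.intro _ rfl : p ^ v ∣ p ^ v * u)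
  obtain ⟨w, hw⟩ := isUnit_natCast_witt (k := k) hu
  refine IsSmall.pow_mul_mono (a := E + v) (by omega) ?_
  have h2 : toKu p k ((w⁻¹ : (WittVector p (AlgebraicClosure k))ˣ) : WittVector p _) *
      (u : Ku p k) = 1 := by
    rw [← map_natCast (toKu p k) u, ← hw, ← map_mul, Units.inv_mul, map_one]
  have h3 := (isSmall_toKu (p := p) (k := k)
    ((w⁻¹ : (WittVector p (AlgebraicClosure k))ˣ) : WittVector p _)).mul h
  convert h3 using 1
  push_cast
  linear_combination (-(p : Ku p k) ^ E * x * (p : Ku p k) ^ v) * h2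

/-- Integration divides a coefficient by an exponent `m l`, which costs only logarithmically many
factors `p`. This is why iterated integrals of integral forms, such as the entries of a period
matrix, stay in a ring on which every lift of Frobenius acts. -/
lemma isOverconv_of_pd {f : KPS p k n} (h : ∀ l, IsOverconv (pd l f)) : IsOverconv f := by
  intro q hq
  -- Growth rate `1/(2q)` for the derivative and `1/(2q)` for the divisor `m l` add up to the
  -- required rate `1/q`.
  choose N hN using fun l => h l (2 * q) (by omega)
  obtain ⟨N₀, hN₀⟩ := exists_isSmall (MvPowerSeries.coeff 0 f)
  refine ⟨N₀ + ∑ l, N l + 2 * q, fun m => ?_⟩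
  by_cases hm : m = 0
  · subst hm
    exact IsSmall.pow_mul_mono (Nat.le_add_right_of_le (by omega)) hN₀
  · obtain ⟨l, hl⟩ : ∃ l, m l ≠ 0 := by
      by_contra hcon
      push Not at hcon
      exact hm (Finsupp.ext hcon)
    have hle : Finsupp.single l 1 ≤ m := Finsupp.single_le_iff.2 (Nat.one_le_iff_ne_zero.2 hl)
    have h1 := hN l (m - Finsupp.single l 1)
    have h2 : (((m - Finsupp.single l 1 : Fin n →₀ ℕ) l : ℕ) : Ku p k) + 1 = (m l : Ku p k) := by
      rw [Finsupp.tsub_apply, Finsupp.single_eq_same]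
      exact_mod_cast congrArg (Nat.cast (R := Ku p k)) (Nat.sub_add_cancel (Nat.one_le_iff_ne_zero.2 hl))
    rw [CY3Crystal.pd, MvPowerSeries.coeff_pderiv, tsub_add_cancel_of_le hle, h2] at h1
    have h3 := isSmall_of_natCast_mul (Nat.pos_of_ne_zero hl) (show 0 < 2 * q by omega) h1
    refine IsSmall.pow_mul_mono ?_ h3
    have h4 : (m - Finsupp.single l 1).degree + 1 = m.degree := by
      conv_rhs => rw [← tsub_add_cancel_of_le hle, map_add, Finsupp.degree_single]
    have h5 : m l ≤ m.degree := Finsupp.le_degree l m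
    have h6 : (m - Finsupp.single l 1).degree / (2 * q) + m l / (2 * q) ≤
        ((m - Finsupp.single l 1).degree + m l) / (2 * q) := Nat.div_add_div_le_add_div
    have h7 : ((m - Finsupp.single l 1).degree + m l) / (2 * q) ≤ m.degree / q := by
      rw [← Nat.mul_div_mul_left m.degree q (show 0 < 2 by norm_num)]
      exact Nat.div_le_div_right (by omega)
    have h8 : N l ≤ ∑ l, N l := Finset.single_le_sum (fun _ _ => Nat.zero_le _) (Finset.mem_univ l)
    omega

end Overconvergent

/-! ### The action of a lift of Frobenius on overconvergent series, and its extension to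
`W(k̄)[[t]]`. -/

section FrobeniusOnSeries

variable {p : ℕ} [hp : Fact p.Prime] {k : Type*} [Field k] [CharP k p] {n : ℕ}

/-- The inclusion `A → K^u[[t]]`. -/
abbrev toKPS (p : ℕ) [Fact p.Prime] (k : Type*) [Field k] (n : ℕ) : PS p k n →+* KPS p k n :=
  (algebraMap (PSbar p k n) (KPS p k n)).comp (algebraMap (PS p k n) (PSbar p k n))

/-- `φ` on polynomials with coefficients in `K^u`. -/
def frobPoly (φ : FrobLift p k n) : MvPolynomial (Fin n) (Ku p k) →+* KPS p k n :=
  MvPolynomial.eval₂Hom ((MvPowerSeries.C).comp (sigmaKu p k))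
    fun j => toKPS p k n (φ.toRingHom (MvPowerSeries.X j))

lemma frobPoly_monomial (φ : FrobLift p k n) (m : Fin n →₀ ℕ) (x : Ku p k) :
    frobPoly φ (MvPolynomial.monomial m x) = MvPowerSeries.C (sigmaKu p k x) *
      toKPS p k n (φ.toRingHom (MvPowerSeries.monomial m 1)) := by
  rw [frobPoly, MvPolynomial.eval₂Hom_monomial, RingHom.comp_apply,
    MvPowerSeries.monomial_one_eq, Finsupp.prod, Finsupp.prod, map_prod, map_prod]
  simp only [map_pow]

lemma coeff_frobPoly_monomial (φ : FrobLift p k n) (m d : Fin n →₀ ℕ) (x : Ku p k) :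
    MvPowerSeries.coeff d (frobPoly φ (MvPolynomial.monomial m x)) = sigmaKu p k x *
      toKu p k (MvPowerSeries.coeff d (algebraMap (PS p k n) (PSbar p k n)
        (φ.toRingHom (MvPowerSeries.monomial m 1)))) := by
  rw [frobPoly_monomial, MvPowerSeries.coeff_C_mul, RingHom.comp_apply, coeff_toKPS]

/-- The coefficient of `t^d` in `φ(t^m)` supplies `|m| - |d|` factors `p`, of which the denominator
of `x` spends at most `N + |m|/2`. As `|m| ≥ 2M`, at least `M` remain after the correction by `p^(N
+ |d|)`. Rate `q = 2` is therefore all that is used of overconvergence. -/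
lemma isSmall_coeff_frobPoly_monomial (φ : FrobLift p k n) (m d : Fin n →₀ ℕ) (x : Ku p k)
    {N M : ℕ} (hM : 2 * M ≤ m.degree) (hx : IsSmall 0 ((p : Ku p k) ^ (N + m.degree / 2) * x)) :
    IsSmall M ((p : Ku p k) ^ (N + d.degree) *
      MvPowerSeries.coeff d (frobPoly φ (MvPolynomial.monomial m x))) := by
  rw [coeff_frobPoly_monomial, coeff_toPSbar]
  obtain ⟨c, hc⟩ := φ.mixedOrd_monomial m d
  rw [hc, map_mul, map_mul, map_pow, map_pow, map_natCast, map_natCast]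
  obtain ⟨e, he⟩ := Nat.exists_eq_add_of_le
    (show m.degree / 2 + M ≤ d.degree + (m.degree - d.degree) by omega)
  have e1 : (p : Ku p k) ^ (N + d.degree) * (sigmaKu p k x * ((p : Ku p k) ^ (m.degree - d.degree) *
      toKu p k (algebraMap _ _ c))) = (p : Ku p k) ^ M * ((p : Ku p k) ^ e *
      (sigmaKu p k ((p : Ku p k) ^ (N + m.degree / 2) * x) * toKu p k (algebraMap _ _ c))) := by
    rw [map_mul, map_pow, map_natCast]
    have : (p : Ku p k) ^ (N + d.degree) * (p : Ku p k) ^ (m.degree - d.degree) =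
        (p : Ku p k) ^ M * ((p : Ku p k) ^ e * (p : Ku p k) ^ (N + m.degree / 2)) := by
      rw [← pow_add, ← pow_add, ← pow_add]
      congr 1
      omega
    linear_combination (sigmaKu p k x * toKu p k (algebraMap _ _ c)) * this
  rw [e1]
  exact ((isSmall_p_pow M).mul ((isSmall_p_pow e).mul (hx.sigma.mul (isSmall_toKu _)))).mono
    (by omega)

/-- `Q` has only monomials of degree `≥ 2 M`, with overconvergent bound `N` on its coefficients. -/
def PolySmall (N M : ℕ) (Q : MvPolynomial (Fin n) (Ku p k)) : Prop :=
  ∀ m : Fin n →₀ ℕ, (m.degree < 2 * M → Q.coeff m = 0) ∧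
    IsSmall 0 ((p : Ku p k) ^ (N + m.degree / 2) * Q.coeff m)

lemma PolySmall.isSmall_coeff (φ : FrobLift p k n) {N M : ℕ} {Q : MvPolynomial (Fin n) (Ku p k)}
    (hQ : PolySmall N M Q) (d : Fin n →₀ ℕ) :
    IsSmall M ((p : Ku p k) ^ (N + d.degree) * MvPowerSeries.coeff d (frobPoly φ Q)) := by
  conv => rw [Q.as_sum]
  rw [map_sum, map_sum, Finset.mul_sum]
  refine IsSmall.sum _ _ fun m hm => ?_
  refine isSmall_coeff_frobPoly_monomial φ m d _ ?_ (hQ m).2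
  by_contra h
  exact MvPolynomial.mem_support_iff.1 hm ((hQ m).1 (not_le.1 h))

/-- `g` is the limit of the images under `φ` of the truncations of `f`. -/
def FrobLim (φ : FrobLift p k n) (f g : KPS p k n) : Prop :=
  ∀ d, KLim (fun M => MvPowerSeries.coeff d (frobPoly φ (f.truncTotal (2 * M))))
    (MvPowerSeries.coeff d g)

lemma FrobLim.unique {φ : FrobLift p k n} {f g g' : KPS p k n} (h : FrobLim φ f g)
    (h' : FrobLim φ f g') : g = g' := MvPowerSeries.ext fun d => (h d).unique (h' d)

lemma coeff_truncTotal_isSmall {f : KPS p k n} {N : ℕ}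
    (hN : ∀ m : Fin n →₀ ℕ,
      IsSmall 0 ((p : Ku p k) ^ (N + m.degree / 2) * MvPowerSeries.coeff m f)) (M : ℕ)
    (m : Fin n →₀ ℕ) : IsSmall 0 ((p : Ku p k) ^ (N + m.degree / 2) *
      (f.truncTotal M).coeff m) := by
  rw [MvPowerSeries.coeff_truncTotal_eq_ite]
  split_ifs
  · exact hN m
  · rw [mul_zero]; exact IsSmall.zero _

lemma exists_frobLim (φ : FrobLift p k n) {f : KPS p k n} (hf : IsOverconv f) :
    ∃ g, FrobLim φ f g := by
  obtain ⟨N, hN⟩ := hf 2 two_pos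
  have : ∀ d : Fin n →₀ ℕ, ∃ y, KLim
      (fun M => MvPowerSeries.coeff d (frobPoly φ (f.truncTotal (2 * M)))) y := by
    intro d
    refine exists_kLim _ (N + d.degree) ?_ fun M => ?_
    · have : f.truncTotal (2 * 0) = 0 := by
        ext m
        rw [MvPowerSeries.coeff_truncTotal_eq_zero _ (by omega), MvPolynomial.coeff_zero]
      rw [this, map_zero, map_zero]
    · rw [← map_sub, ← map_sub]
      refine PolySmall.isSmall_coeff φ (fun m => ⟨fun h => ?_, ?_⟩) d
      · rw [MvPolynomial.coeff_sub, MvPowerSeries.coeff_truncTotal _ h,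
          MvPowerSeries.coeff_truncTotal _ (by omega), sub_self]
      · rw [MvPolynomial.coeff_sub, mul_sub]
        exact (coeff_truncTotal_isSmall hN _ _).sub (coeff_truncTotal_isSmall hN _ _)
  choose y hy using this
  exact ⟨mkPS y, fun d => by rw [coeff_mkPS]; exact hy d⟩

/-- Truncations may be replaced by any polynomials that agree with them up to degree about `2M` and
obey the same growth bound uniformly in `M`. Products and derivatives of truncations are of this
kind. -/
lemma FrobLim.of_approx {φ : FrobLift p k n} {f g : KPS p k n} (h : FrobLim φ f g) (N c : ℕ)
    (Q : ℕ → MvPolynomial (Fin n) (Ku p k))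
    (hQ : ∀ M, PolySmall N (M - c) (Q M - f.truncTotal (2 * M))) (d : Fin n →₀ ℕ) :
    KLim (fun M => MvPowerSeries.coeff d (frobPoly φ (Q M))) (MvPowerSeries.coeff d g) := by
  refine (h d).congr fun L => ⟨L + (N + d.degree) + c, fun M hM => ?_⟩
  beta_reduce
  rw [← map_sub, ← map_sub, sub_zero]
  exact IsSmall.of_p_pow_mul (L := N + d.degree)
    (((hQ M).isSmall_coeff φ d).mono (by omega))

lemma FrobLim.add {φ : FrobLift p k n} {f g f' g' : KPS p k n} (h : FrobLim φ f g)
    (h' : FrobLim φ f' g') : FrobLim φ (f + f') (g + g') := fun d => by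
  simp only [map_add]
  exact (h d).add (h' d)

/-- A product of truncations agrees below degree `2M` with the truncation of the product, and its
coefficients obey a bound independent of `M`. Multiplicativity thus passes from polynomials to
limits. -/
lemma FrobLim.mul {φ : FrobLift p k n} {f g f' g' : KPS p k n} (hf : IsOverconv f)
    (hf' : IsOverconv f') {G : KPS p k n} (hG : FrobLim φ (f * f') G) (h : FrobLim φ f g)
    (h' : FrobLim φ f' g') : G = g * g' := by
  obtain ⟨N, hN⟩ := hf 2 two_pos
  obtain ⟨N', hN'⟩ := hf' 2 two_pos
  obtain ⟨N'', hN''⟩ := (hf.mul hf') 2 two_pos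
  ext d
  have h1 := hG.of_approx (N + N' + N'') 0
    (fun M => f.truncTotal (2 * M) * f'.truncTotal (2 * M)) (fun M m => by
      refine ⟨fun hm => ?_, ?_⟩
      · rw [Nat.sub_zero] at hm
        rw [MvPolynomial.coeff_sub, MvPowerSeries.coeff_truncTotal _ hm,
          MvPowerSeries.coeff_truncTotal_mul_truncTotal_eq_coeff_mul _ _ hm, sub_self]
      · rw [MvPolynomial.coeff_sub, mul_sub]
        refine IsSmall.sub ?_ (IsSmall.pow_mul_mono (by omega)
          (coeff_truncTotal_isSmall hN'' _ _))
        rw [MvPolynomial.coeff_mul, Finset.mul_sum]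
        refine IsSmall.sum _ _ fun x hx => ?_
        refine IsSmall.pow_mul_mono (by omega : N + N' + m.degree / 2 ≤ _)
          (isSmall_mul_pair (Finset.HasAntidiagonal.mem_antidiagonal.1 hx)
          (coeff_truncTotal_isSmall hN _ _) (coeff_truncTotal_isSmall hN' _ _))) d
  refine h1.unique ?_
  simp only [map_mul, MvPowerSeries.coeff_mul]
  exact KLim.sum _ _ _ fun x _ => (h x.1).mul (h' x.2)

lemma pd_frobPoly (φ : FrobLift p k n) (l : Fin n) (Q : MvPolynomial (Fin n) (Ku p k)) :
    pd l (frobPoly φ Q) = ∑ j, pd l (toKPS p k n (φ.toRingHom (MvPowerSeries.X j))) *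
      frobPoly φ (MvPolynomial.pderiv j Q) := by
  classical
  induction Q using MvPolynomial.induction_on with
  | C a =>
    simp [frobPoly, pd]
  | add P Q hP hQ =>
    simp only [pd] at *
    simp only [map_add, hP, hQ, mul_add, Finset.sum_add_distrib]
  | mul_X P i hP =>
    have hX : frobPoly φ (MvPolynomial.X i) = toKPS p k n (φ.toRingHom (MvPowerSeries.X i)) :=
      MvPolynomial.eval₂Hom_X' _ _ _
    simp only [pd] at *
    rw [map_mul, Derivation.leibniz, hP, hX]
    simp only [Derivation.leibniz, map_add, smul_eq_mul, map_mul, mul_add, Finset.sum_add_distrib,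
      MvPolynomial.pderiv_X, Pi.single_apply, apply_ite (frobPoly φ), map_zero, mul_ite,
      mul_one, mul_zero, Finset.sum_ite_eq, Finset.mem_univ, if_true, hX]
    rw [Finset.mul_sum]
    congr 1
    · simp [mul_comm]
    · refine Finset.sum_congr rfl fun j _ => ?_
      ring

/-- The chain rule holds for polynomials and survives the limit, since the derivative of a
truncation approximates the truncation of the derivative. -/
lemma FrobLim.pd {φ : FrobLift p k n} {f g : KPS p k n} (hf : IsOverconv f) (h : FrobLim φ f g)
    {g' : Fin n → KPS p k n} (h' : ∀ j, FrobLim φ (pd j f) (g' j)) (l : Fin n) :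
    pd l g = ∑ j, pd l (toKPS p k n (φ.toRingHom (MvPowerSeries.X j))) * g' j := by
  classical
  ext d
  have h1 : KLim (fun M => MvPowerSeries.coeff d
      (CY3Crystal.pd l (frobPoly φ (f.truncTotal (2 * M)))))
      (MvPowerSeries.coeff d (CY3Crystal.pd l g)) := by
    simp only [CY3Crystal.pd, MvPowerSeries.coeff_pderiv]
    exact (h _).mul (KLim.const _)
  refine h1.unique ?_
  simp only [pd_frobPoly, map_sum, MvPowerSeries.coeff_mul]
  refine KLim.sum _ _ _ fun j _ => KLim.sum _ _ _ fun x _ => (KLim.const _).mul ?_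
  obtain ⟨N, hN⟩ := (hf.pd j) 2 two_pos
  -- Differentiation lowers the degree of exactness from `2M` to `2M - 1`, whence the shift `1`.
  refine (h' j).of_approx N 1 (fun M => MvPolynomial.pderiv j (f.truncTotal (2 * M)))
    (fun M m => ?_) x.2
  have e1 : (MvPolynomial.pderiv j (f.truncTotal (2 * M))).coeff m =
      if m.degree + 1 < 2 * M then MvPowerSeries.coeff m (CY3Crystal.pd j f) else 0 := by
    rw [MvPolynomial.coeff_pderiv, MvPowerSeries.coeff_truncTotal_eq_ite, map_add,
      Finsupp.degree_single, CY3Crystal.pd, MvPowerSeries.coeff_pderiv]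
    split_ifs
    · rfl
    · rw [zero_mul]
  rw [MvPolynomial.coeff_sub, e1, MvPowerSeries.coeff_truncTotal_eq_ite]
  refine ⟨fun hm => ?_, ?_⟩
  · rw [if_pos (by omega), if_pos (by omega), sub_self]
  · have := hN m
    split_ifs <;> simp only [sub_self, mul_zero, sub_zero, zero_sub, mul_neg, IsSmall.zero]
    · exact this
    · exact this.neg

lemma frobLim_C (φ : FrobLift p k n) (x : Ku p k) :
    FrobLim φ (MvPowerSeries.C x) (MvPowerSeries.C (sigmaKu p k x)) := by
  classical
  intro d N
  refine ⟨1, fun M hM => ?_⟩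
  have : (MvPowerSeries.C x : KPS p k n).truncTotal (2 * M) = MvPolynomial.C x := by
    ext m
    rw [MvPowerSeries.coeff_truncTotal_eq_ite, MvPolynomial.coeff_C, MvPowerSeries.coeff_C]
    by_cases hm : m = 0
    · subst hm
      rw [if_pos (by rw [map_zero]; omega)]
    · rw [if_neg hm, if_neg (Ne.symm hm), ite_self]
  beta_reduce
  rw [this, frobPoly, MvPolynomial.eval₂Hom_C, RingHom.comp_apply, sub_self]
  exact IsSmall.zero _

/-- The action of `φ` on overconvergent power series. -/
def frobSer (φ : FrobLift p k n) : Overconv p k n →+* KPS p k n where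
  toFun f := (exists_frobLim φ f.2).choose
  map_one' := by
    refine (exists_frobLim φ (1 : Overconv p k n).2).choose_spec.unique ?_
    simpa using frobLim_C φ (1 : Ku p k)
  map_zero' := by
    refine (exists_frobLim φ (0 : Overconv p k n).2).choose_spec.unique ?_
    simpa using frobLim_C φ (0 : Ku p k)
  map_mul' f g := FrobLim.mul f.2 g.2 (exists_frobLim φ (f * g).2).choose_spec
    (exists_frobLim φ f.2).choose_spec (exists_frobLim φ g.2).choose_spec
  map_add' f g := (exists_frobLim φ (f + g).2).choose_spec.unique
    ((exists_frobLim φ f.2).choose_spec.add (exists_frobLim φ g.2).choose_spec)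

lemma frobLim_frobSer (φ : FrobLift p k n) (f : Overconv p k n) : FrobLim φ f (frobSer φ f) :=
  (exists_frobLim φ f.2).choose_spec

lemma frobSer_C (φ : FrobLift p k n) (x : Ku p k) :
    frobSer φ ⟨MvPowerSeries.C x, isOverconv_C x⟩ = MvPowerSeries.C (sigmaKu p k x) :=
  (frobLim_frobSer φ _).unique (frobLim_C φ x)

lemma pd_frobSer (φ : FrobLift p k n) (f : Overconv p k n) (l : Fin n) :
    pd l (frobSer φ f) = ∑ j, pd l (toKPS p k n (φ.toRingHom (MvPowerSeries.X j))) *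
      frobSer φ ⟨pd j f, f.2.pd j⟩ :=
  (frobLim_frobSer φ f).pd f.2 (fun j => frobLim_frobSer φ ⟨pd j f, f.2.pd j⟩) l

lemma frobPoly_truncTotal (φ : FrobLift p k n) (f : KPS p k n) (M : ℕ) (d : Fin n →₀ ℕ) :
    MvPowerSeries.coeff d (frobPoly φ (f.truncTotal M)) =
      ∑ m ∈ (Finsupp.finite_of_degree_lt (σ := Fin n) M).toFinset,
        sigmaKu p k (MvPowerSeries.coeff m f) *
          toKu p k (MvPowerSeries.coeff d (algebraMap (PS p k n) (PSbar p k n)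
            (φ.toRingHom (MvPowerSeries.monomial m 1)))) := by
  rw [MvPowerSeries.truncTotal, MvPowerSeries.truncFinset_apply, map_sum, map_sum]
  exact Finset.sum_congr rfl fun m _ => coeff_frobPoly_monomial φ m d _

/-- Every single term with `|m| ≥ 2 M₀` already lies in `p^L W(k̄)`, so any finite set containing
the smaller exponents has the same sum up to `p^L`. -/
lemma isFrobImage_frobSer (φ : FrobLift p k n) (f : Overconv p k n) :
    IsFrobImage φ f (frobSer φ f) := by
  classical
  intro d L
  obtain ⟨N, hN⟩ := f.2 2 two_pos
  obtain ⟨M, hM⟩ := frobLim_frobSer φ f d L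
  set M₀ := max M (L + (N + d.degree)) with hM₀
  refine ⟨(Finsupp.finite_of_degree_lt (σ := Fin n) (2 * M₀)).toFinset, fun s hs => ?_⟩
  have h1 := hM M₀ (le_max_left _ _)
  beta_reduce at h1
  rw [frobPoly_truncTotal] at h1
  change IsSmall L _
  rw [← Finset.sum_sdiff hs, add_sub_assoc]
  refine IsSmall.add (IsSmall.sum _ _ fun m hm => ?_) h1
  have h2 : 2 * M₀ ≤ m.degree := by
    simpa using (Finset.mem_sdiff.1 hm).2
  have h3 := isSmall_coeff_frobPoly_monomial φ m d _ h2 (hN m)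
  rw [coeff_frobPoly_monomial] at h3
  exact IsSmall.of_p_pow_mul (h3.mono (le_max_right _ _))

lemma KuHasSum.unique {ι : Type*} {f : ι → Ku p k} {x y : Ku p k} (hx : KuHasSum f x)
    (hy : KuHasSum f y) : x = y := by
  classical
  refine sub_eq_zero.1 (eq_zero_of_isSmall fun N => ?_)
  obtain ⟨s, hs⟩ := hx N
  obtain ⟨s', hs'⟩ := hy N
  have h1 : IsSmall N _ := hs (s ∪ s') Finset.subset_union_left
  have h2 : IsSmall N _ := hs' (s ∪ s') Finset.subset_union_right
  have := h2.sub h1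
  rwa [sub_sub_sub_cancel_left] at this

/-- For an integral series the tail from degree `2M` on is sent by `θ` into `(p, t)^(2M)`, so the
limit of the truncations is `θ a`. The map `j` serves for both `W(k) → W(k̄)` and the identity of
`W(k̄)`. -/
lemma frobLim_of_comm (φ : FrobLift p k n) {k' : Type*} [Field k'] [CharP k' p]
    (θ : FrobLift p k' n) (j : WittVector p k' →+* WittVector p (AlgebraicClosure k))
    (hj : ∀ w, j (WittVector.frobenius w) = WittVector.frobenius (j w))
    (hθ : ∀ i, MvPowerSeries.map j (θ.toRingHom (MvPowerSeries.X i)) =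
      algebraMap (PS p k n) (PSbar p k n) (φ.toRingHom (MvPowerSeries.X i))) (a : PS p k' n) :
    FrobLim φ (MvPowerSeries.map ((toKu p k).comp j) a)
      (MvPowerSeries.map ((toKu p k).comp j) (θ.toRingHom a)) := by
  intro d L
  refine ⟨L + d.degree, fun M hM => ?_⟩
  have h1 : (MvPowerSeries.map ((toKu p k).comp j) a).truncTotal (2 * M) =
      MvPolynomial.map ((toKu p k).comp j) (a.truncTotal (2 * M)) := by
    rw [MvPowerSeries.truncTotal, MvPowerSeries.truncFinset_map]
    rfl
  have h2 : (frobPoly φ).comp (MvPolynomial.map ((toKu p k).comp j)) =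
      ((MvPowerSeries.map ((toKu p k).comp j)).comp θ.toRingHom).comp
        (MvPolynomial.coeToMvPowerSeries.ringHom) := by
    refine MvPolynomial.ringHom_ext (fun w => ?_) fun i => ?_
    · simp only [RingHom.comp_apply, MvPolynomial.map_C, frobPoly, MvPolynomial.eval₂Hom_C,
        MvPolynomial.coeToMvPowerSeries.ringHom_apply, MvPolynomial.coe_C, θ.map_const,
        MvPowerSeries.map_C, sigmaKu_toKu, hj]
    · simp only [RingHom.comp_apply, MvPolynomial.map_X, frobPoly, MvPolynomial.eval₂Hom_X',
        MvPolynomial.coeToMvPowerSeries.ringHom_apply, MvPolynomial.coe_X, ← hθ]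
      ext e
      rw [coeff_toKPS]
      simp
  have h3 := DFunLike.congr_fun h2 (a.truncTotal (2 * M))
  simp only [RingHom.comp_apply, MvPolynomial.coeToMvPowerSeries.ringHom_apply] at h3
  beta_reduce
  rw [h1, h3, ← map_sub, ← map_sub, ← map_sub, MvPowerSeries.coeff_map, RingHom.comp_apply]
  have h4 := θ.mixedOrd_of_order (2 * M) (((a.truncTotal (2 * M) : MvPolynomial _ _) : PS p k' n) - a)
    (fun e he => by
      rw [map_sub, MvPolynomial.coeff_coe, MvPowerSeries.coeff_truncTotal _ he, sub_self]) d
  refine isSmall_of_dvd ((pow_dvd_pow _ (show L ≤ 2 * M - d.degree by omega)).trans ?_)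
  have h5 := map_dvd j h4
  rwa [map_pow, map_natCast] at h5

lemma frobLim_of_extends {φb : FrobLift p (AlgebraicClosure k) n} {φ : FrobLift p k n}
    (hφ : Extends φb φ) (a : PSbar p k n) : FrobLim φ (algebraMap (PSbar p k n) (KPS p k n) a)
      (algebraMap (PSbar p k n) (KPS p k n) (φb.toRingHom a)) := by
  refine frobLim_of_comm φ φb (RingHom.id _) (fun _ => rfl) (fun i => ?_) a
  rw [← hφ]
  simp [MvPowerSeries.algebraMap_apply'']

lemma algebraMap_frobenius (w : WittVector p k) :
    algebraMap (WittVector p k) (WittVector p (AlgebraicClosure k)) (WittVector.frobenius w) =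
      WittVector.frobenius (algebraMap _ _ w) := by
  ext i
  change (WittVector.map _ _).coeff i = (WittVector.frobenius (WittVector.map _ w)).coeff i
  rw [WittVector.coeff_frobenius_charP, WittVector.map_coeff, WittVector.map_coeff,
    WittVector.coeff_frobenius_charP, map_pow]

lemma toKPS_eq_map (a : PS p k n) : toKPS p k n a = MvPowerSeries.map
    ((toKu p k).comp (algebraMap (WittVector p k) (WittVector p (AlgebraicClosure k)))) a := by
  ext d
  rw [RingHom.comp_apply, coeff_toKPS, coeff_toPSbar, MvPowerSeries.coeff_map, RingHom.comp_apply]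

lemma frobLim_toKPS (φ : FrobLift p k n) (a : PS p k n) :
    FrobLim φ (toKPS p k n a) (toKPS p k n (φ.toRingHom a)) := by
  rw [toKPS_eq_map, toKPS_eq_map]
  refine frobLim_of_comm φ φ _ algebraMap_frobenius (fun i => ?_) a
  rw [MvPowerSeries.algebraMap_apply'']

/-- The inclusion of `Ā` in the overconvergent power series. -/
def toOverconv (p : ℕ) [Fact p.Prime] (k : Type*) [Field k] [CharP k p] (n : ℕ) :
    PSbar p k n →+* Overconv p k n :=
  (algebraMap (PSbar p k n) (KPS p k n)).codRestrict (Overconv p k n) isOverconv_algebraMap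

@[simp]
lemma coe_toOverconv (a : PSbar p k n) :
    (toOverconv p k n a : KPS p k n) = algebraMap (PSbar p k n) (KPS p k n) a := rfl

lemma frobSer_of_extends {φb : FrobLift p (AlgebraicClosure k) n} {φ : FrobLift p k n}
    (hφ : Extends φb φ) (a : PSbar p k n) : frobSer φ (toOverconv p k n a) =
      algebraMap (PSbar p k n) (KPS p k n) (φb.toRingHom a) :=
  (frobLim_frobSer φ _).unique (frobLim_of_extends hφ a)

lemma frobSer_toKPS (φ : FrobLift p k n) (a : PS p k n) :
    frobSer φ (toOverconv p k n (algebraMap _ _ a)) = toKPS p k n (φ.toRingHom a) :=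
  (frobLim_frobSer φ _).unique (frobLim_toKPS φ a)

lemma extends_stdLift [PerfectRing k p] :
    Extends (stdLift p (AlgebraicClosure k) n) (stdLift p k n) := by
  intro a
  rw [stdLift_apply, stdLift_apply]
  rw [MvPowerSeries.algebraMap_apply'', MvPowerSeries.algebraMap_apply'',
    ← MvPowerSeries.map_expand]
  ext d : 1
  simp only [MvPowerSeries.coeff_map, algebraMap_frobenius]

/-- The extension is the restriction of `frobSer φ` to integral series: its coefficients are limits
of integral elements, hence integral. It lifts the `p`-th power map because `φ` and the standard
lift agree modulo `p` on monomials, and the standard lift is known to extend. -/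
lemma exists_extends [PerfectRing k p] (φ : FrobLift p k n) :
    ∃ φb : FrobLift p (AlgebraicClosure k) n, Extends φb φ := by
  have hint : ∀ a : PSbar p k n, ∃ b : PSbar p k n,
      algebraMap (PSbar p k n) (KPS p k n) b = frobSer φ (toOverconv p k n a) := by
    intro a
    have : ∀ d, ∃ w, toKu p k w = MvPowerSeries.coeff d (frobSer φ (toOverconv p k n a)) := by
      intro d
      have h1 := (frobLim_frobSer φ (toOverconv p k n a) d).isSmall (N := 0) (fun M => by
        rw [frobPoly_truncTotal]
        refine IsSmall.sum _ _ fun m _ => ?_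
        rw [coe_toOverconv, coeff_toKPS, sigmaKu_toKu, ← map_mul]
        exact isSmall_toKu _)
      obtain ⟨w, hw⟩ := h1
      exact ⟨w, by rw [hw, pow_zero, one_mul]⟩
    choose w hw using this
    refine ⟨mkPS w, ?_⟩
    ext d
    rw [coeff_toKPS, coeff_mkPS, hw]
  choose b hb using hint
  let F : PSbar p k n →+* PSbar p k n :=
    { toFun := b
      map_one' := toKPS_injective (by rw [hb, map_one, map_one, map_one])
      map_zero' := toKPS_injective (by rw [hb, map_zero, map_zero, map_zero])
      map_mul' := fun x y => toKPS_injective (by rw [hb, map_mul, map_mul, map_mul, hb, hb])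
      map_add' := fun x y => toKPS_injective (by rw [hb, map_add, map_add, map_add, hb, hb]) }
  have hF : ∀ a, algebraMap (PSbar p k n) (KPS p k n) (F a) = frobSer φ (toOverconv p k n a) := hb
  have hcong : ∀ a : PSbar p k n, (p : PSbar p k n) ^ 1 ∣
      F a - (stdLift p (AlgebraicClosure k) n).toRingHom a := by
    intro a
    rw [natCast_pow_dvd_iff]
    intro d
    refine dvd_of_isSmall (k := k) ?_
    rw [map_sub, map_sub, ← coeff_toKPS, ← coeff_toKPS, hF, ← frobSer_of_extends extends_stdLift]
    have h1 := (frobLim_frobSer φ (toOverconv p k n a) d).add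
      ((KLim.const (-1)).mul (frobLim_frobSer (stdLift p k n) (toOverconv p k n a) d))
    have h2 := h1.isSmall (N := 1) (fun M => by
      simp only [neg_one_mul]
      rw [← sub_eq_add_neg, frobPoly_truncTotal, frobPoly_truncTotal, ← Finset.sum_sub_distrib]
      refine IsSmall.sum _ _ fun m _ => ?_
      rw [← mul_sub, ← map_sub, ← map_sub, ← map_sub, coe_toOverconv, coeff_toKPS, sigmaKu_toKu]
      refine IsSmall.mul (N := 0) (isSmall_toKu _) (isSmall_of_dvd (N := 1) ?_)
      rw [coeff_toPSbar, pow_one]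
      have h3 : (p : PS p k n) ^ 1 ∣ φ.toRingHom (MvPowerSeries.monomial m 1) -
          (stdLift p k n).toRingHom (MvPowerSeries.monomial m 1) := by
        obtain ⟨b, hb⟩ := φ.map_mod (MvPowerSeries.monomial m 1)
        obtain ⟨c, hc⟩ := (stdLift p k n).map_mod (MvPowerSeries.monomial m 1)
        rw [hb, hc]
        exact ⟨b - c, by ring⟩
      have h4 := map_dvd (algebraMap (WittVector p k) (WittVector p (AlgebraicClosure k)))
        ((natCast_pow_dvd_iff p 1 _).1 h3 d)
      rwa [map_pow, map_natCast, pow_one] at h4)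
    rwa [neg_one_mul, ← sub_eq_add_neg] at h2
  refine ⟨⟨F, fun w => ?_, fun a => ?_⟩, fun a => ?_⟩
  · refine toKPS_injective ?_
    have h1 : toOverconv p k n (MvPowerSeries.C w) = ⟨MvPowerSeries.C (toKu p k w), isOverconv_C _⟩ :=
      Subtype.ext (by
        rw [coe_toOverconv, MvPowerSeries.algebraMap_apply'', MvPowerSeries.map_C])
    rw [hF, h1, frobSer_C, sigmaKu_toKu, MvPowerSeries.algebraMap_apply'', MvPowerSeries.map_C]
  · obtain ⟨c, hc⟩ := hcong a
    obtain ⟨c', hc'⟩ := (stdLift p (AlgebraicClosure k) n).map_mod a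
    refine ⟨c + c', ?_⟩
    rw [sub_eq_iff_eq_add.1 hc, hc']
    ring
  · refine toKPS_injective ?_
    change algebraMap _ _ (F _) = _
    rw [hF, frobSer_toKPS]
    rfl

end FrobeniusOnSeries

/-! ### Nakayama's lemma modulo `p`, lifting of bases, direct summands. -/

section Reduction

variable {p : ℕ} [hp : Fact p.Prime] {k : Type*} [Field k] [CharP k p] [PerfectRing k p] {n : ℕ}
  {H : Type*} [AddCommGroup H] [Module (PS p k n) H]

lemma natCast_pow_smul (N : ℕ) (x : H) : ((p : PS p k n) ^ N) • x = (p ^ N) • x := by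
  rw [← Nat.cast_pow, Nat.cast_smul_eq_nsmul]

lemma mem_pPow {N : ℕ} {x : H} : x ∈ (pPow N : Submodule (PS p k n) H) ↔
    ∃ y : H, x = (p : PS p k n) ^ N • y := by
  simp [pPow, eq_comm]

lemma mem_pIdeal_smul {V : Submodule (PS p k n) H} {x : H} :
    x ∈ pIdeal p k n • V ↔ ∃ y ∈ V, x = (p : PS p k n) • y := by
  rw [pIdeal, Submodule.ideal_span_singleton_smul]
  simp [Submodule.mem_smul_pointwise_iff_exists, eq_comm]

lemma red_eq_zero {x : H} : (red x : Red p k n H) = 0 ↔ ∃ y : H, x = (p : PS p k n) • y := by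
  change (Submodule.Quotient.mk x : Red p k n H) = 0 ↔ _
  rw [Submodule.Quotient.mk_eq_zero, mem_pIdeal_smul]
  simp

lemma red_eq_red {x y : H} : (red x : Red p k n H) = red y ↔
    ∃ z : H, x = y + (p : PS p k n) • z := by
  rw [← sub_eq_zero, ← map_sub, red_eq_zero]
  simp only [sub_eq_iff_eq_add']

/-- Nakayama's lemma modulo `p`. -/
lemma le_of_forall_mod_p {N N' : Submodule (PS p k n) H} (hN : N'.FG)
    (h : ∀ x ∈ N', ∃ y ∈ N, ∃ z ∈ N', x = y + (p : PS p k n) • z) : N' ≤ N := by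
  refine Submodule.le_of_le_smul_of_le_jacobson_bot hN (pIdeal_le_jacobson (p := p) (k := k)) ?_
  intro x hx
  obtain ⟨y, hy, z, hz, rfl⟩ := h x hx
  exact Submodule.add_mem_sup hy (mem_pIdeal_smul.2 ⟨z, hz, rfl⟩)

variable [Module.Free (PS p k n) H] [Module.Finite (PS p k n) H]

lemma smul_p_injective {N : ℕ} {x y : H} (h : (p : PS p k n) ^ N • x = (p : PS p k n) ^ N • y) :
    x = y := by
  have : Module.IsTorsionFree (PS p k n) H := inferInstance
  exact smul_right_injective H (pow_ne_zero N natCast_p_ne_zero_PS) h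

lemma eq_zero_of_forall_p_pow {x : H} (h : ∀ N : ℕ, ∃ y : H, x = (p : PS p k n) ^ N • y) :
    x = 0 := by
  let b := Module.Free.chooseBasis (PS p k n) H
  refine b.repr.map_eq_zero_iff.1 (Finsupp.ext fun i => psep_PS _ fun N => ?_)
  obtain ⟨y, rfl⟩ := h N
  rw [map_smul, Finsupp.smul_apply, smul_eq_mul]
  exact dvd_mul_right _ _

/-- Nakayama gives the spanning part. The coefficients of a linear relation vanish modulo `p`;
dividing by `p` gives another relation, so they are divisible by every power of `p`. -/
lemma exists_basis_of_red {ι : Type*} [Fintype ι] (v : ι → H)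
    (b : Module.Basis ι (PS₀ p k n) (Red p k n H)) (hb : ∀ i, b i = red (v i)) :
    ∃ b' : Module.Basis ι (PS p k n) H, ∀ i, b' i = v i := by
  have hspan : ⊤ ≤ Submodule.span (PS p k n) (Set.range v) := by
    refine le_of_forall_mod_p Module.Finite.fg_top fun x _ => ?_
    choose a ha using fun i => Ideal.Quotient.mk_surjective (b.repr (red x) i)
    have : (red x : Red p k n H) = red (∑ i, a i • v i) := by
      rw [map_sum, ← b.sum_repr (red x)]
      refine Finset.sum_congr rfl fun i _ => ?_
      rw [map_smulₛₗ, ha, hb]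
    obtain ⟨z, hz⟩ := red_eq_red.1 this
    exact ⟨_, Submodule.sum_mem _ fun i _ => Submodule.smul_mem _ _
      (Submodule.subset_span ⟨i, rfl⟩), z, trivial, hz⟩
  have hli : LinearIndependent (PS p k n) v := by
    rw [Fintype.linearIndependent_iff]
    intro g hg i
    refine psep_PS _ fun N => ?_
    induction N generalizing g i with
    | zero => simp
    | succ N ih =>
      have h1 : ∀ i, (p : PS p k n) ∣ g i := by
        intro i
        have h2 : ∑ i, Ideal.Quotient.mk (pIdeal p k n) (g i) • b i = 0 := by
          have := congrArg (red : H → Red p k n H) hg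
          rw [map_sum, map_zero] at this
          rw [← this]
          exact Finset.sum_congr rfl fun i _ => by rw [map_smulₛₗ, hb]
        have h3 := (Fintype.linearIndependent_iff.1 b.linearIndependent) _ h2 i
        rwa [Ideal.Quotient.eq_zero_iff_mem, pIdeal, Ideal.mem_span_singleton] at h3
      choose g' hg' using h1
      have h4 : ∑ i, g' i • v i = 0 := by
        refine smul_p_injective (p := p) (k := k) (n := n) (N := 1) ?_
        rw [smul_zero, pow_one, Finset.smul_sum, ← hg]
        exact Finset.sum_congr rfl fun i _ => by rw [smul_smul, hg']
      rw [hg', pow_succ']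
      exact mul_dvd_mul_left _ (ih g' h4 i)
  exact ⟨Module.Basis.mk hli hspan, fun i => Module.Basis.mk_apply _ _ i⟩

instance nontrivial_PS₀ : Nontrivial (PS₀ p k n) :=
  Ideal.Quotient.nontrivial_iff.2 fun h => not_isUnit_natCast_p (p := p) (k := k) (n := n)
    (Ideal.span_singleton_eq_top.1 h)

instance isLocalRing_PS₀ : IsLocalRing (PS₀ p k n) :=
  IsLocalRing.of_surjective' (Ideal.Quotient.mk (pIdeal p k n)) Ideal.Quotient.mk_surjective

instance free_red : Module.Free (PS₀ p k n) (Red p k n H) :=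
  Module.Free.of_equiv ((TensorProduct.quotTensorEquivQuotSMul H
    (pIdeal p k n)).extendScalarsOfSurjective Ideal.Quotient.mk_surjective)

instance finite_red : Module.Finite (PS₀ p k n) (Red p k n H) :=
  Module.Finite.equiv ((TensorProduct.quotTensorEquivQuotSMul H
    (pIdeal p k n)).extendScalarsOfSurjective Ideal.Quotient.mk_surjective)

lemma finite_of_isCompl {R M : Type*} [CommRing R] [AddCommGroup M] [Module R M]
    [Module.Finite R M] {C D : Submodule R M} (h : IsCompl C D) : Module.Finite R C :=
  Module.Finite.of_surjective _ (Submodule.projectionOnto_surjective h)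

lemma free_of_isCompl {R M : Type*} [CommRing R] [IsLocalRing R] [AddCommGroup M] [Module R M]
    [Module.Finite R M] [Module.Free R M] {C D : Submodule R M} (h : IsCompl C D) :
    Module.Free R C := by
  have := finite_of_isCompl h
  have : Module.Projective R C := Module.Projective.of_split C.subtype
    (Submodule.projectionOnto C D h) (Submodule.projectionOnto_comp_subtype h)
  exact Module.free_of_flat_of_isLocalRing

lemma saturated_of_isCompl {U W : Submodule (PS p k n) H} (h : IsCompl U W) {N : ℕ} {y : H}
    (hy : (p : PS p k n) ^ N • y ∈ U) : y ∈ U := by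
  have h1 := (Submodule.projection_apply_eq_zero_iff h.symm).2 hy
  rw [map_smul] at h1
  exact (Submodule.projection_apply_eq_zero_iff h.symm).1
    (smul_p_injective (p := p) (k := k) (n := n) (N := N) (by rw [h1, smul_zero]))

/-- Direct summands are `p`-adically closed: the projection of `x` to the complement is divisible by
all powers of `p`. -/
lemma mem_of_forall_sub_mem {U W : Submodule (PS p k n) H} (h : IsCompl U W) {x : H}
    (hx : ∀ N : ℕ, ∃ y : H, x - (p : PS p k n) ^ N • y ∈ U) : x ∈ U := by
  refine (Submodule.projection_apply_eq_zero_iff h.symm).1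
    (eq_zero_of_forall_p_pow (p := p) (k := k) (n := n) fun N => ?_)
  obtain ⟨y, hy⟩ := hx N
  have h1 := (Submodule.projection_apply_eq_zero_iff h.symm).2 hy
  rw [map_sub, map_smul, sub_eq_zero] at h1
  exact ⟨_, h1⟩

end Reduction

/-! ### The fixed point equation for a slope submodule. -/

section SlopeEquation

variable {p : ℕ} [hp : Fact p.Prime] {k : Type*} [Field k] [CharP k p] [PerfectRing k p] {n : ℕ}

/-- Over a domain the determinant of `a` is nonzero, so `a` can be cancelled from `a (s a - c) = 0`
by means of its adjugate. -/
lemma matrix_mul_comm_of_eq_smul_one {R : Type*} [CommRing R] [IsDomain R] {ι : Type*} [Fintype ι]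
    [DecidableEq ι] {a s : Matrix ι ι R} {c : R} (hc : c ≠ 0) (h : a * s = c • 1) :
    s * a = c • 1 := by
  have hdet : a.det ≠ 0 := by
    intro h0
    have := congrArg Matrix.det h
    rw [Matrix.det_mul, h0, zero_mul, Matrix.det_smul, Matrix.det_one, mul_one] at this
    exact pow_ne_zero _ hc this.symm
  have h1 : a * (s * a - c • 1) = 0 := by
    rw [mul_sub, ← mul_assoc, h]
    simp
  have h2 : a.det • (s * a - c • 1) = 0 := by
    rw [← one_mul (s * a - c • 1), ← Matrix.smul_mul, ← Matrix.adjugate_mul, mul_assoc, h1, mul_zero]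
  ext i j
  have h3 := congrFun (congrFun h2 i) j
  rw [Matrix.smul_apply, smul_eq_mul, Matrix.zero_apply] at h3
  exact sub_eq_zero.1 ((mul_eq_zero.1 h3).resolve_left hdet)

lemma isUnit_one_sub_p_smul {ι : Type*} [Fintype ι] [DecidableEq ι]
    (e : Matrix ι ι (PS p k n)) : IsUnit (1 - (p : PS p k n) • e) := by
  rw [Matrix.isUnit_iff_isUnit_det]
  have h1 : Ideal.Quotient.mk (pIdeal p k n) (1 - (p : PS p k n) • e).det = 1 := by
    rw [RingHom.map_det, map_sub, map_one]
    have : (Ideal.Quotient.mk (pIdeal p k n)).mapMatrix ((p : PS p k n) • e) = 0 := by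
      ext i j
      change Ideal.Quotient.mk (pIdeal p k n) ((p : PS p k n) * e i j) = 0
      rw [Ideal.Quotient.eq_zero_iff_mem, pIdeal, Ideal.mem_span_singleton]
      exact dvd_mul_right _ _
    rw [this, sub_zero, Matrix.det_one]
  by_contra hu
  have h2 : (1 - (p : PS p k n) • e).det - 1 ∈ IsLocalRing.maximalIdeal (PS p k n) := by
    have : (1 - (p : PS p k n) • e).det - 1 ∈ pIdeal p k n := by
      rw [← Ideal.Quotient.eq_zero_iff_mem, map_sub, h1, map_one, sub_self]
    rw [← IsLocalRing.jacobson_eq_maximalIdeal (⊥ : Ideal (PS p k n)) bot_ne_top]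
    exact pIdeal_le_jacobson this
  have h3 := sub_mem ((IsLocalRing.mem_maximalIdeal _).2 hu) h2
  rw [sub_sub_cancel] at h3
  exact (IsLocalRing.mem_maximalIdeal _).1 h3 isUnit_one

lemma dvd_mul_entry {R : Type*} [CommRing R] {ι κ μ : Type*} [Fintype κ] {c : R}
    (M : Matrix ι κ R) (X : Matrix κ μ R) (h : ∀ i j, c ∣ X i j) (i : ι) (j : μ) :
    c ∣ (M * X) i j := by
  rw [Matrix.mul_apply]
  exact Finset.dvd_sum fun x _ => (h x j).mul_left _

lemma dvd_entry_mul {R : Type*} [CommRing R] {ι κ μ : Type*} [Fintype κ] {c : R}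
    (X : Matrix ι κ R) (M : Matrix κ μ R) (h : ∀ i j, c ∣ X i j) (i : ι) (j : μ) :
    c ∣ (X * M) i j := by
  rw [Matrix.mul_apply]
  exact Finset.dvd_sum fun x _ => (h i x).mul_right _

/-- The graph equation of the slope decomposition of a semilinear map with matrix
`(a, p^{i+1} b; c, p^{i+1} d)` where `a` has slopes `≤ i`. -/
lemma exists_slope_graph {R : Type*} [CommRing R] [IsDomain R] (hsep : PSep p R) (hsum : PSum p R)
    (hp0 : (p : R) ≠ 0) {ι₁ ι₂ : Type*} [Fintype ι₁] [DecidableEq ι₁] [Fintype ι₂]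
    (hunit : ∀ e : Matrix ι₁ ι₁ R, IsUnit (1 - (p : R) • e))
    (φ : R →+* R) (i : ℕ) (a s : Matrix ι₁ ι₁ R)
    (b : Matrix ι₁ ι₂ R) (c c' : Matrix ι₂ ι₁ R) (d : Matrix ι₂ ι₂ R)
    (ha : a * s = ((p : R) ^ i) • 1) (hc : c * s = ((p : R) ^ (i + 1)) • c') :
    ∃ (X : Matrix ι₂ ι₁ R) (Y : Matrix ι₁ ι₁ R),
      (∀ x y, (p : R) ∣ X x y) ∧
      c + ((p : R) ^ (i + 1)) • (d * X.map φ) =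
        X * (a + ((p : R) ^ (i + 1)) • (b * X.map φ)) ∧
      (a + ((p : R) ^ (i + 1)) • (b * X.map φ)) * Y = ((p : R) ^ i) • 1 := by
  have hφP : ∀ N, φ ((p : R) ^ N) = (p : R) ^ N := fun N => by rw [map_pow, map_natCast]
  set P : R := (p : R) with hP
  -- Multiplying the graph equation on the right by `s` and dividing by `p^i` turns it into `X = p
  -- (c' + d φ(X) s - X b φ(X) s)`, whose right side contracts by a factor `p`.
  obtain ⟨x, hx⟩ := exists_fixed_point_of_contraction (p := p) hsep hsum
    (κ := ι₂ × ι₁) (fun x => let X : Matrix ι₂ ι₁ (R) := Matrix.of fun i j => x (i, j)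
      fun ij => (P • (c' + d * X.map φ * s - X * (b * X.map φ * s))) ij.1 ij.2) (by
    intro N x y hxy ij
    dsimp only
    set X : Matrix ι₂ ι₁ (R) := Matrix.of fun i j => x (i, j)
    set Y : Matrix ι₂ ι₁ (R) := Matrix.of fun i j => y (i, j)
    have h1 : ∀ i j, P ^ N ∣ (X - Y) i j := fun i j => hxy (i, j)
    have h2 : ∀ i j, P ^ N ∣ (X.map φ - Y.map φ) i j := fun i j => by
      have := map_dvd φ (h1 i j)
      rw [hφP, Matrix.sub_apply, map_sub] at this
      exact this
    have e : P • (c' + d * X.map φ * s - X * (b * X.map φ * s)) -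
        P • (c' + d * Y.map φ * s - Y * (b * Y.map φ * s)) =
        P • (d * ((X.map φ - Y.map φ) * s) - (X - Y) * (b * X.map φ * s) -
          Y * (b * ((X.map φ - Y.map φ) * s))) := by
      rw [← smul_sub]
      congr 1
      simp only [Matrix.mul_sub, Matrix.sub_mul, Matrix.mul_assoc]
      abel
    rw [← Matrix.sub_apply, e, Matrix.smul_apply, smul_eq_mul, pow_succ']
    refine mul_dvd_mul_left _ ?_
    rw [Matrix.sub_apply, Matrix.sub_apply]
    refine dvd_sub (dvd_sub ?_ ?_) ?_
    · exact dvd_mul_entry _ _ (dvd_entry_mul _ _ h2) _ _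
    · exact dvd_entry_mul _ _ h1 _ _
    · exact dvd_mul_entry _ _ (dvd_mul_entry _ _ (dvd_entry_mul _ _ h2)) _ _)
  set X : Matrix ι₂ ι₁ (R) := Matrix.of fun i j => x (i, j) with hX
  have hfix : P • (c' + d * X.map φ * s - X * (b * X.map φ * s)) = X := by
    refine Matrix.ext fun i j => ?_
    exact congrFun hx (i, j)
  have hP0 : P ^ i ≠ 0 := pow_ne_zero _ hp0
  have hsa := matrix_mul_comm_of_eq_smul_one hP0 ha
  -- Since `s a = p^i`, right multiplication by `s` is injective, which allows the return from the
  -- contracted equation to the original one.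
  have hcancel : ∀ Z Z' : Matrix ι₂ ι₁ (R), Z * s = Z' * s → Z = Z' := by
    intro Z Z' h
    have h1 : (P ^ i) • Z = (P ^ i) • Z' := by
      have : Z * s * a = Z' * s * a := by rw [h]
      rw [Matrix.mul_assoc, Matrix.mul_assoc, hsa] at this
      simpa using this
    refine Matrix.ext fun x y => ?_
    have := congrFun (congrFun h1 x) y
    exact mul_left_cancel₀ hP0 this
  obtain ⟨u, hu⟩ := hunit (-(b * X.map φ * s))
  have hu' : (u : Matrix ι₁ ι₁ (R)) = 1 + P • (b * X.map φ * s) := by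
    rw [hu, smul_neg, sub_neg_eq_add]
  refine ⟨X, s * ((u⁻¹ : (Matrix ι₁ ι₁ (R))ˣ) : Matrix ι₁ ι₁ (R)), ?_, ?_, ?_⟩
  · intro x y
    rw [← hfix]
    exact dvd_mul_right _ _
  · refine hcancel _ _ ?_
    rw [Matrix.mul_assoc, Matrix.add_mul, Matrix.add_mul, hc, ha, Matrix.smul_mul, Matrix.smul_mul,
      pow_succ, mul_smul, mul_smul, mul_smul, ← smul_add, ← smul_add, ← smul_add, Matrix.mul_smul]
    congr 1
    rw [Matrix.mul_add, Matrix.mul_one, Matrix.mul_smul]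
    nth_rewrite 2 [← hfix]
    rw [← smul_add, sub_add_cancel]
  · rw [← Matrix.mul_assoc, Matrix.add_mul, ha, Matrix.smul_mul, pow_succ, mul_smul, ← smul_add, Matrix.smul_mul,
      ← hu', Units.mul_inv]

end SlopeEquation

/-! ### Construction of the slope submodules. -/

section SlopeSub

variable {p : ℕ} [hp : Fact p.Prime] {k : Type*} [Field k] [CharP k p] [PerfectRing k p] {n : ℕ}
  {H : Type*} [AddCommGroup H] [Module (PS p k n) H]

/-- `U` is a direct summand of `H` on which `F(φ)` has slopes `≤ i`, and such that `F(φ)` is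
divisible by `p ^ (i + 1)` on `H / U`. -/
structure IsSlopeSub (X : FCrystal p k n H) (φ : FrobLift p k n) (i : ℕ)
    (U : Submodule (PS p k n) H) : Prop where
  exists_isCompl : ∃ W, IsCompl U W
  frob_mem : ∀ x ∈ U, X.F φ x ∈ U
  p_pow_mem : ∀ x ∈ U, (p : PS p k n) ^ i • x ∈ Submodule.span (PS p k n) (X.F φ '' (U : Set H))
  frob_quot : ∀ x, ∃ y, X.F φ x - (p : PS p k n) ^ (i + 1) • y ∈ U

lemma isCompl_span_of_basis {R M ι₁ ι₂ : Type*} [CommRing R] [Nontrivial R] [AddCommGroup M]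
    [Module R M] (b : Module.Basis (ι₁ ⊕ ι₂) R M) :
    IsCompl (Submodule.span R (Set.range (b ∘ Sum.inl)))
      (Submodule.span R (Set.range (b ∘ Sum.inr))) := by
  refine ⟨(linearIndependent_sum.1 b.linearIndependent).2.2, ?_⟩
  rw [codisjoint_iff, ← Submodule.span_union, ← Set.Sum.elim_range, Sum.elim_comp_inl_inr,
    b.span_eq]

/-- A semilinear map that is `p^i` times an isomorphism on a part of a basis, up to `p^(i+1)`, and
divisible by `p^(i+1)` on the rest, stabilizes a submodule spanned by a perturbation of the first
part. -/
lemma exists_slope_vectors {R M : Type*} [CommRing R] [IsDomain R] [AddCommGroup M] [Module R M]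
    (hsep : PSep p R) (hsum : PSum p R) (hp0 : (p : R) ≠ 0)
    {ι₁ ι₂ : Type*} [Fintype ι₁] [DecidableEq ι₁] [Fintype ι₂]
    (hunit : ∀ e : Matrix ι₁ ι₁ R, IsUnit (1 - (p : R) • e))
    {φ : R →+* R} (F : M →ₛₗ[φ] M) (i : ℕ) (bH : Module.Basis (ι₁ ⊕ ι₂) R M) (m : ι₂ → M)
    (hm : ∀ j, F (bH (Sum.inr j)) = (p : R) ^ (i + 1) • m j) (S : ι₁ → ι₁ ⊕ ι₂ → R)
    (hS : ∀ j, ∑ x, S j x • F (bH x) = (p : R) ^ i • bH (Sum.inl j)) :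
    ∃ (z : ι₂ → ι₁ → R) (v : ι₁ → M) (V Y : Matrix ι₁ ι₁ R),
      (∀ j, v j = bH (Sum.inl j) + (p : R) • ∑ y, z y j • bH (Sum.inr y)) ∧
      (∀ j, F (v j) = ∑ x, V x j • v x) ∧ V * Y = ((p : R) ^ i) • 1 := by
  classical
  obtain ⟨a, ha⟩ : ∃ a : Matrix ι₁ ι₁ R, ∀ x j, a x j = bH.repr (F (bH (Sum.inl j))) (Sum.inl x) :=
    ⟨Matrix.of _, fun _ _ => rfl⟩
  obtain ⟨c, hc⟩ : ∃ a : Matrix ι₂ ι₁ R, ∀ x j, a x j = bH.repr (F (bH (Sum.inl j))) (Sum.inr x) :=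
    ⟨Matrix.of _, fun _ _ => rfl⟩
  obtain ⟨b, hb⟩ : ∃ a : Matrix ι₁ ι₂ R, ∀ x j, a x j = bH.repr (m j) (Sum.inl x) :=
    ⟨Matrix.of _, fun _ _ => rfl⟩
  obtain ⟨d, hd⟩ : ∃ a : Matrix ι₂ ι₂ R, ∀ x j, a x j = bH.repr (m j) (Sum.inr x) :=
    ⟨Matrix.of _, fun _ _ => rfl⟩
  obtain ⟨s, hs⟩ : ∃ a : Matrix ι₁ ι₁ R, ∀ x j, a x j = S j (Sum.inl x) :=
    ⟨Matrix.of _, fun _ _ => rfl⟩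
  obtain ⟨r, hr⟩ : ∃ a : Matrix ι₂ ι₁ R, ∀ x j, a x j = S j (Sum.inr x) :=
    ⟨Matrix.of _, fun _ _ => rfl⟩
  have hrepr : ∀ j z, (∑ x, S j (Sum.inl x) * bH.repr (F (bH (Sum.inl x))) z) +
      (p : R) ^ (i + 1) * (∑ y, bH.repr (m y) z * S j (Sum.inr y)) =
      (p : R) ^ i * bH.repr (bH (Sum.inl j)) z := by
    intro j z
    have := congrArg (fun v => bH.repr v z) (hS j)
    simp only [Fintype.sum_sum_type, hm] at this
    rw [map_add, map_sum, map_sum, map_smul] at this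
    simp only [map_smul, Finsupp.add_apply, Finsupp.finsetSum_apply, Finsupp.smul_apply,
      smul_eq_mul] at this
    rw [← this, Finset.mul_sum]
    congr 1
    exact Finset.sum_congr rfl fun y _ => by ring
  have hI : a * s + ((p : R) ^ (i + 1)) • (b * r) = ((p : R) ^ i) • 1 := by
    refine Matrix.ext fun x j => ?_
    have h1 := hrepr j (Sum.inl x)
    rw [bH.repr_self, Finsupp.single_apply] at h1
    rw [Matrix.add_apply, Matrix.smul_apply, Matrix.smul_apply, Matrix.mul_apply, Matrix.mul_apply,
      Matrix.one_apply, smul_eq_mul, smul_eq_mul]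
    simp only [Sum.inl.injEq, eq_comm (a := j)] at h1
    simp only [ha, hs, hb, hr]
    rw [← h1]
    congr 1
    exact Finset.sum_congr rfl fun y _ => mul_comm _ _
  have hII : c * s + ((p : R) ^ (i + 1)) • (d * r) = 0 := by
    refine Matrix.ext fun x j => ?_
    have h1 := hrepr j (Sum.inr x)
    rw [bH.repr_self, Finsupp.single_apply, if_neg (by simp), mul_zero] at h1
    rw [Matrix.add_apply, Matrix.smul_apply, Matrix.mul_apply, Matrix.mul_apply,
      smul_eq_mul, Matrix.zero_apply]
    simp only [hc, hs, hd, hr]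
    rw [← h1]
    congr 1
    exact Finset.sum_congr rfl fun y _ => mul_comm _ _
  -- The first block row reads `a s = p^i (1 - p b r)`. Correcting `s` by the inverse of this unit
  -- gives an exact inverse of `a` up to `p^i`; the second block row shows that `c` times it is
  -- divisible by `p^(i+1)`.
  obtain ⟨u, hu⟩ := hunit (b * r)
  have has : a * s = ((p : R) ^ i) • (u : Matrix _ _ R) := by
    rw [eq_sub_of_add_eq hI, hu, smul_sub, pow_succ, mul_smul]
  obtain ⟨Z, Y, hZp, hZ, hY⟩ := exists_slope_graph hsep hsum hp0 hunit φ i a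
    (s * (u⁻¹ : (Matrix _ _ R)ˣ).val) b c (-(d * r * (u⁻¹ : (Matrix _ _ R)ˣ).val)) d
    (by rw [← Matrix.mul_assoc, has, Matrix.smul_mul, Units.mul_inv])
    (by rw [← Matrix.mul_assoc, eq_neg_of_add_eq_zero_left hII, Matrix.neg_mul, Matrix.smul_mul,
          smul_neg])
  choose z hz using hZp
  generalize hV : a + ((p : R) ^ (i + 1)) • (b * Z.map φ) = V at hZ hY
  refine ⟨z, fun j => bH (Sum.inl j) + ∑ y, Z y j • bH (Sum.inr y), V, Y, fun j => ?_,
    fun j => ?_, hY⟩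
  · simp only [hz, Finset.smul_sum, smul_smul]
  · have h1 : F (bH (Sum.inl j) + ∑ y, Z y j • bH (Sum.inr y)) =
        F (bH (Sum.inl j)) + ∑ y, (φ (Z y j) * (p : R) ^ (i + 1)) • m y := by
      simp only [map_add, map_sum, LinearMap.map_smulₛₗ, hm, smul_smul]
    refine bH.ext_elem fun z => ?_
    rw [h1]
    simp only [map_add, map_sum, map_smul, Finsupp.add_apply, Finsupp.finsetSum_apply,
      Finsupp.smul_apply, smul_eq_mul, bH.repr_self, Finsupp.single_apply]
    rcases z with x | y
    · simp only [Sum.inl.injEq, reduceCtorEq, if_false, mul_zero, Finset.sum_const_zero, add_zero,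
        mul_ite, mul_one, Finset.sum_ite_eq', Finset.mem_univ, if_true]
      rw [← hV, Matrix.add_apply, Matrix.smul_apply, Matrix.mul_apply, smul_eq_mul, Finset.mul_sum,
        ha]
      congr 1
      exact Finset.sum_congr rfl fun y _ => by
        simp only [hb, Matrix.map_apply]; ring
    · simp only [Sum.inr.injEq, reduceCtorEq, if_false, zero_add,
        mul_ite, mul_one, mul_zero, Finset.sum_ite_eq', Finset.mem_univ, if_true]
      have h2 := congrFun (congrFun hZ y) j
      rw [Matrix.add_apply, Matrix.smul_apply, Matrix.mul_apply, Matrix.mul_apply, smul_eq_mul,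
        Finset.mul_sum] at h2
      rw [← hc]
      refine Eq.trans ?_ (h2.trans ?_)
      · congr 1
        exact Finset.sum_congr rfl fun y _ => by
          simp only [hd, Matrix.map_apply]; ring
      · exact Finset.sum_congr rfl fun y _ => mul_comm _ _

variable [Module.Free (PS p k n) H] [Module.Finite (PS p k n) H]

-- Lift a basis of `Fil_i H₀` by vectors whose `p^i`-multiples lie in the image of Frobenius, and a
-- basis of `Fil^{i+1} H₀` by vectors whose Frobenius is divisible by `p^(i+1)`. Oppositeness makes
-- these a basis of `H`, of the form that `exists_slope_vectors` needs. The perturbation there is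
-- divisible by `p`, so the reduction is unchanged.
set_option maxHeartbeats 1000000 in
lemma exists_isSlopeSub (X : FCrystal p k n H) (φ : FrobLift p k n) (i : ℕ)
    (h : IsCompl (conjFil X φ i) (hodgeFil X φ (i + 1))) :
    ∃ U, IsSlopeSub X φ i U ∧ U.map red = conjFil X φ i := by
  classical
  have hfC : Module.Finite (PS₀ p k n) (conjFil X φ i) := finite_of_isCompl h
  have hfD : Module.Finite (PS₀ p k n) (hodgeFil X φ (i + 1)) := finite_of_isCompl h.symm
  have hC : Module.Free (PS₀ p k n) (conjFil X φ i) := free_of_isCompl h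
  have hD : Module.Free (PS₀ p k n) (hodgeFil X φ (i + 1)) := free_of_isCompl h.symm
  let bC := Module.finBasis (PS₀ p k n) (conjFil X φ i)
  let bD := Module.finBasis (PS₀ p k n) (hodgeFil X φ (i + 1))
  have hl : ∀ j, ∃ l : H, (p : PS p k n) ^ i • l ∈
      Submodule.span (PS p k n) (Set.range (X.F φ)) ∧ red l = (bC j : Red p k n H) := fun j => by
    obtain ⟨l, hl, hl'⟩ := Submodule.mem_map.1 (bC j).2
    exact ⟨l, hl, hl'⟩
  have hn : ∀ j, ∃ l m : H, X.F φ l = (p : PS p k n) ^ (i + 1) • m ∧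
      red l = (bD j : Red p k n H) := fun j => by
    obtain ⟨l, hl, hl'⟩ := Submodule.mem_map.1 (bD j).2
    obtain ⟨m, hm⟩ := mem_pPow.1 hl
    exact ⟨l, m, hm, hl'⟩
  choose l hl hlred using hl
  choose nn m hm hnred using hn
  let b₀ : Module.Basis _ (PS₀ p k n) (Red p k n H) :=
    (bC.prod bD).map (Submodule.prodEquivOfIsCompl _ _ h)
  have hb₀l : ∀ j, b₀ (Sum.inl j) = (bC j : Red p k n H) := fun j => by simp [b₀]
  have hb₀r : ∀ j, b₀ (Sum.inr j) = (bD j : Red p k n H) := fun j => by simp [b₀]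
  obtain ⟨bH, hbH⟩ := exists_basis_of_red (Sum.elim l nn) b₀ (by
    rintro (j | j)
    · rw [hb₀l, Sum.elim_inl, hlred]
    · rw [hb₀r, Sum.elim_inr, hnred])
  have hbl : ∀ j, bH (Sum.inl j) = l j := fun j => hbH _
  have hbn : ∀ j, bH (Sum.inr j) = nn j := fun j => hbH _
  have hspan : Submodule.span (PS p k n) (Set.range (X.F φ)) ≤
      Submodule.span (PS p k n) (Set.range fun j => X.F φ (bH j)) := by
    rw [Submodule.span_le]
    rintro _ ⟨x, rfl⟩
    rw [← bH.sum_repr x, map_sum]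
    refine Submodule.sum_mem _ fun j _ => ?_
    rw [map_smulₛₗ]
    exact Submodule.smul_mem _ _ (Submodule.subset_span ⟨j, rfl⟩)
  have hs : ∀ j, ∃ s : _ → PS p k n, ∑ x, s x • X.F φ (bH x) = (p : PS p k n) ^ i • l j := fun j =>
    (Submodule.mem_span_range_iff_exists_fun _).1 (hspan (hl j))
  choose S hS using hs
  obtain ⟨z, v, V, Y, hv, hFv, hY⟩ := exists_slope_vectors psep_PS psum_PS natCast_p_ne_zero_PS
    isUnit_one_sub_p_smul (X.F φ) i bH m (fun j => by rw [hbn, hm]) S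
    (fun j => by rw [hS, hbl])
  have hvred : ∀ j, (red (v j) : Red p k n H) = red (l j) := fun j =>
    red_eq_red.2 ⟨∑ y, z y j • bH (Sum.inr y), by rw [hv, hbl]⟩
  obtain ⟨bU, hbU⟩ := exists_basis_of_red (Sum.elim v nn) b₀ (by
    rintro (j | j)
    · rw [hb₀l, Sum.elim_inl, hvred, hlred]
    · rw [hb₀r, Sum.elim_inr, hnred])
  have hbUl : ∀ j, bU (Sum.inl j) = v j := fun j => hbU _
  have hbUr : ∀ j, bU (Sum.inr j) = nn j := fun j => hbU _
  have hcompl := isCompl_span_of_basis bU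
  have e1 : bU ∘ Sum.inl = v := funext hbUl
  rw [e1] at hcompl
  have hFmem : ∀ x ∈ Submodule.span (PS p k n) (Set.range v),
      X.F φ x ∈ Submodule.span (PS p k n) (Set.range v) := by
    have : Submodule.span (PS p k n) (Set.range v) ≤
        (Submodule.span (PS p k n) (Set.range v)).comap (X.F φ) := by
      rw [Submodule.span_le]
      rintro _ ⟨j, rfl⟩
      rw [SetLike.mem_coe, Submodule.mem_comap, hFv]
      exact Submodule.sum_mem _ fun x _ => Submodule.smul_mem _ _ (Submodule.subset_span ⟨x, rfl⟩)
    exact this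
  refine ⟨Submodule.span (PS p k n) (Set.range v), ⟨⟨_, hcompl⟩, hFmem, ?_, ?_⟩, ?_⟩
  · have : Submodule.span (PS p k n) (Set.range v) ≤ (Submodule.span (PS p k n) (X.F φ ''
        (Submodule.span (PS p k n) (Set.range v) : Set H))).comap
        (LinearMap.lsmul (PS p k n) H ((p : PS p k n) ^ i)) := by
      rw [Submodule.span_le]
      rintro _ ⟨j, rfl⟩
      rw [SetLike.mem_coe, Submodule.mem_comap, LinearMap.lsmul_apply]
      have h1 : (p : PS p k n) ^ i • v j = ∑ x, Y x j • X.F φ (v x) := by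
        simp only [hFv, Finset.smul_sum, smul_smul]
        rw [Finset.sum_comm]
        simp only [← Finset.sum_smul]
        have h2 : ∀ x, ∑ y, Y y j * V x y = (p : PS p k n) ^ i * if x = j then 1 else 0 := by
          intro x
          have h3 := congrFun (congrFun hY x) j
          rw [Matrix.mul_apply, Matrix.smul_apply, Matrix.one_apply, smul_eq_mul] at h3
          rw [← h3]
          exact Finset.sum_congr rfl fun y _ => mul_comm _ _
        simp only [h2, mul_ite, mul_one, mul_zero, ite_smul, zero_smul, Finset.sum_ite_eq',
          Finset.mem_univ, if_true]
      rw [h1]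
      exact Submodule.sum_mem _ fun x _ => Submodule.smul_mem _ _ (Submodule.subset_span
        ⟨v x, Submodule.subset_span ⟨x, rfl⟩, rfl⟩)
    exact this
  · have : ⊤ ≤ (Submodule.span (PS p k n) (Set.range v) ⊔ pPow (i + 1)).comap (X.F φ) := by
      refine bU.span_eq.ge.trans (Submodule.span_le.2 ?_)
      rintro _ ⟨j | j, rfl⟩
      · rw [hbUl]
        exact Submodule.mem_sup_left (hFmem _ (Submodule.subset_span ⟨j, rfl⟩))
      · rw [hbUr]
        exact Submodule.mem_sup_right (mem_pPow.2 ⟨m j, hm j⟩)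
    intro x
    obtain ⟨y, hy, z, hz, hyz⟩ := Submodule.mem_sup.1 (this (Submodule.mem_top (x := x)))
    obtain ⟨w, rfl⟩ := mem_pPow.1 hz
    exact ⟨w, by rw [← hyz, add_sub_cancel_right]; exact hy⟩
  · rw [Submodule.map_span, ← Set.range_comp]
    have e2 : (red : H →ₛₗ[_] Red p k n H) ∘ v = (conjFil X φ i).subtype ∘ bC :=
      funext fun j => (hvred j).trans (hlred j)
    rw [e2, Set.range_comp, ← Submodule.map_span, bC.span_eq, Submodule.map_top,
      Submodule.range_subtype]

end SlopeSub

/-! ### Uniqueness, horizontality and independence of the lift for slope submodules. -/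

section SlopeFiltration

variable {p : ℕ} [hp : Fact p.Prime] {k : Type*} [Field k] [CharP k p] [PerfectRing k p] {n : ℕ}
  {H : Type*} [AddCommGroup H] [Module (PS p k n) H]

lemma mem_sup_pPow {V : Submodule (PS p k n) H} {N : ℕ} {x : H} :
    x ∈ V ⊔ pPow N ↔ ∃ y : H, x - (p : PS p k n) ^ N • y ∈ V := by
  constructor
  · intro h
    obtain ⟨u, hu, z, hz, rfl⟩ := Submodule.mem_sup.1 h
    obtain ⟨w, rfl⟩ := mem_pPow.1 hz
    exact ⟨w, by rwa [add_sub_cancel_right]⟩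
  · rintro ⟨y, hy⟩
    rw [← sub_add_cancel x ((p : PS p k n) ^ N • y)]
    exact Submodule.add_mem_sup hy (mem_pPow.2 ⟨y, rfl⟩)

lemma pPow_mono {M N : ℕ} (h : M ≤ N) :
    (pPow N : Submodule (PS p k n) H) ≤ pPow M := by
  intro x hx
  obtain ⟨y, rfl⟩ := mem_pPow.1 hx
  exact mem_pPow.2 ⟨(p : PS p k n) ^ (N - M) • y, by rw [smul_smul, ← pow_add, Nat.add_sub_cancel' h]⟩

lemma sup_pPow_mono (V : Submodule (PS p k n) H) {M N : ℕ} (h : M ≤ N) :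
    V ⊔ pPow N ≤ V ⊔ pPow M :=
  sup_le_sup le_rfl (pPow_mono h)

lemma Crystal.Dpow_mem (X : Crystal p k n H) {S : Set H} (h : ∀ l, ∀ x ∈ S, X.D l x ∈ S)
    (m : Fin n → ℕ) {x : H} (hx : x ∈ S) : X.Dpow m x ∈ S := by
  have h1 : ∀ L : List (AddMonoid.End H), (∀ f ∈ L, ∀ x ∈ S, f x ∈ S) → ∀ x ∈ S, L.prod x ∈ S := by
    intro L
    induction L with
    | nil => intro _ x hx; simpa using hx
    | cons f L ih =>
      intro hL x hx
      rw [List.prod_cons]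
      exact hL f (by simp) _ (ih (fun g hg => hL g (by simp [hg])) x hx)
  refine h1 _ (fun f hf x hx => ?_) x hx
  obtain ⟨i, rfl⟩ := (List.mem_ofFn' _ _).1 hf
  change (X.D i ^ m i) x ∈ S
  generalize m i = N
  induction N generalizing x with
  | zero => exact hx
  | succ N ih =>
    rw [pow_succ']
    exact h i _ (ih x hx)

lemma FCrystal.D_p_smul (X : FCrystal p k n H) (l : Fin n) (N : ℕ) (x : H) :
    X.D l ((p : PS p k n) ^ N • x) = (p : PS p k n) ^ N • X.D l x := by
  rw [natCast_pow_smul, natCast_pow_smul, map_nsmul]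

lemma FCrystal.F_p_smul (X : FCrystal p k n H) (φ : FrobLift p k n) (N : ℕ) (x : H) :
    X.F φ ((p : PS p k n) ^ N • x) = (p : PS p k n) ^ N • X.F φ x := by
  rw [natCast_pow_smul, natCast_pow_smul, map_nsmul]

/-- Modulo `p^N` the Taylor formula writes `F(ψ) x` as a finite combination of the `F(φ) D^m x`, and
`D^m x` stays in the stable set `S`. -/
lemma FCrystal.F_mem_of_taylor (X : FCrystal p k n H) (φ ψ : FrobLift p k n)
    (V : Submodule (PS p k n) H) {S : Set H} (hS : ∀ l, ∀ x ∈ S, X.D l x ∈ S)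
    (hV : ∀ x ∈ S, X.F φ x ∈ V) (N : ℕ) {x : H} (hx : x ∈ S) : X.F ψ x ∈ V ⊔ pPow N := by
  obtain ⟨c, -, hc⟩ := X.taylor ψ φ
  obtain ⟨s, hs⟩ := hc x N
  obtain ⟨y, hy⟩ := hs s subset_rfl
  refine mem_sup_pPow.2 ⟨-y, ?_⟩
  rw [smul_neg, natCast_pow_smul, ← hy, sub_neg_eq_add, add_sub_cancel]
  exact Submodule.sum_mem _ fun m _ => Submodule.smul_mem _ _
    (hV _ (X.toCrystal.Dpow_mem hS m hx))

variable [Module.Free (PS p k n) H] [Module.Finite (PS p k n) H]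
  {X : FCrystal p k n H} {φ : FrobLift p k n} {i : ℕ} {U : Submodule (PS p k n) H}

namespace IsSlopeSub

lemma saturated (hU : IsSlopeSub X φ i U) {N : ℕ} {y : H} (hy : (p : PS p k n) ^ N • y ∈ U) :
    y ∈ U :=
  let ⟨_, hW⟩ := hU.exists_isCompl
  saturated_of_isCompl hW hy

lemma mem_of_forall (hU : IsSlopeSub X φ i U) {x : H} (hx : ∀ N : ℕ, x ∈ U ⊔ pPow N) : x ∈ U :=
  let ⟨_, hW⟩ := hU.exists_isCompl
  mem_of_forall_sub_mem hW fun N => mem_sup_pPow.1 (hx N)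

lemma mem_sup_of_smul (hU : IsSlopeSub X φ i U) {M N : ℕ} {y : H}
    (hy : (p : PS p k n) ^ M • y ∈ U ⊔ pPow (M + N)) : y ∈ U ⊔ pPow N := by
  obtain ⟨w, hw⟩ := mem_sup_pPow.1 hy
  rw [pow_add, mul_smul, ← smul_sub] at hw
  exact mem_sup_pPow.2 ⟨w, hU.saturated hw⟩

lemma frob_mem_sup (hU : IsSlopeSub X φ i U) {N : ℕ} {x : H} (hx : x ∈ U ⊔ pPow N) :
    X.F φ x ∈ U ⊔ pPow (N + i + 1) := by
  obtain ⟨y, hy⟩ := mem_sup_pPow.1 hx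
  obtain ⟨z, hz⟩ := hU.frob_quot y
  refine mem_sup_pPow.2 ⟨z, ?_⟩
  have h1 := hU.frob_mem _ hy
  rw [map_sub, X.F_p_smul] at h1
  have h2 := Submodule.add_mem _ h1 (Submodule.smul_mem _ ((p : PS p k n) ^ N) hz)
  rw [smul_sub, smul_smul, ← pow_add, ← add_assoc] at h2
  rwa [sub_add_sub_cancel] at h2

/-- If `U ⊆ U' + p^N H`, then `F(φ) U ⊆ U' + p^(N+j+1) H`. As `p^i U` is spanned by `F(φ) U` and `i
≤ j`, dividing by `p^i` leaves `U ⊆ U' + p^(N+1) H`. -/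
lemma le (hU : IsSlopeSub X φ i U) {j : ℕ} {U' : Submodule (PS p k n) H}
    (hU' : IsSlopeSub X φ j U') (hij : i ≤ j) : U ≤ U' := by
  have h1 : ∀ N : ℕ, U ≤ U' ⊔ pPow N := by
    intro N
    induction N with
    | zero =>
      intro x _
      exact mem_sup_pPow.2 ⟨x, by simp⟩
    | succ N ih =>
      intro x hx
      refine hU'.mem_sup_of_smul (M := i) ?_
      have h2 : Submodule.span (PS p k n) (X.F φ '' (U : Set H)) ≤ U' ⊔ pPow (i + (N + 1)) := by
        rw [Submodule.span_le]
        rintro _ ⟨y, hy, rfl⟩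
        exact sup_pPow_mono _ (by omega) (hU'.frob_mem_sup (ih hy))
      exact h2 (hU.p_pow_mem x hx)
  exact fun x hx => hU'.mem_of_forall fun N => h1 N hx

/-- The same bootstrapping: `p^i x` is a combination of vectors `F(φ) y`, and horizontality writes
`D_l F(φ) y` through the `F(φ) D_j y`. Thus membership of all `D_j y` in `U + p^N H` gives that of
`D_l x` in `U + p^(N+1) H`. -/
lemma conn_mem (hU : IsSlopeSub X φ i U) (l : Fin n) {x : H} (hx : x ∈ U) : X.D l x ∈ U := by
  have h1 : ∀ N : ℕ, ∀ l, ∀ x ∈ U, X.D l x ∈ U ⊔ pPow N := by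
    intro N
    induction N with
    | zero =>
      intro l x _
      exact mem_sup_pPow.2 ⟨X.D l x, by simp⟩
    | succ N ih =>
      intro l x hx
      refine hU.mem_sup_of_smul (M := i) ?_
      rw [← X.D_p_smul]
      have h2 := hU.p_pow_mem x hx
      refine (Submodule.span_induction (p := fun z _ => z ∈ U ∧ X.D l z ∈ U ⊔ pPow (i + (N + 1)))
        ?_ ?_ ?_ ?_ h2).2
      · rintro _ ⟨y, hy, rfl⟩
        refine ⟨hU.frob_mem _ hy, ?_⟩
        rw [X.horizontal]
        refine Submodule.sum_mem _ fun j _ => Submodule.smul_mem _ _ ?_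
        exact sup_pPow_mono _ (by omega) (hU.frob_mem_sup (ih j y hy))
      · simp
      · rintro y z _ _ ⟨h3, h4⟩ ⟨h5, h6⟩
        exact ⟨add_mem h3 h5, by rw [map_add]; exact add_mem h4 h6⟩
      · rintro a y _ ⟨h3, h4⟩
        exact ⟨Submodule.smul_mem _ _ h3, by
          rw [X.leibniz]
          exact add_mem (Submodule.mem_sup_left (Submodule.smul_mem _ _ h3))
            (Submodule.smul_mem _ _ h4)⟩
  exact hU.mem_of_forall fun N => h1 N l x hx

/-- The slope submodule does not depend on the lift of Frobenius. -/
lemma change (hU : IsSlopeSub X φ i U) (ψ : FrobLift p k n) : IsSlopeSub X ψ i U := by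
  have hmem : ∀ x ∈ U, X.F ψ x ∈ U := fun x hx => hU.mem_of_forall fun N =>
    X.F_mem_of_taylor φ ψ U (S := U) (fun l x hx => hU.conn_mem l hx) hU.frob_mem N hx
  refine ⟨hU.exists_isCompl, hmem, fun x hx => ?_, fun x => ?_⟩
  · obtain ⟨W, hW⟩ := hU.exists_isCompl
    have hfg : U.FG := (Module.Finite.iff_fg).1 (finite_of_isCompl hW)
    -- The Taylor formula places `p^i y` in the span of `F(ψ) U` up to `p^(i+1) H`. Saturation of
    -- `U` moves the error into `p · p^i U`, where Nakayama's lemma removes it.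
    have h1 : U.map (LinearMap.lsmul (PS p k n) H ((p : PS p k n) ^ i)) ≤
        Submodule.span (PS p k n) (X.F ψ '' (U : Set H)) := by
      refine le_of_forall_mod_p (hfg.map _) ?_
      rintro _ ⟨y, hy, rfl⟩
      rw [LinearMap.lsmul_apply]
      have h2 : Submodule.span (PS p k n) (X.F φ '' (U : Set H)) ≤
          Submodule.span (PS p k n) (X.F ψ '' (U : Set H)) ⊔ pPow (i + 1) := by
        rw [Submodule.span_le]
        rintro _ ⟨z, hz, rfl⟩
        exact X.F_mem_of_taylor ψ φ (Submodule.span (PS p k n) (X.F ψ '' (U : Set H))) (S := U)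
          (fun l x hx => hU.conn_mem l hx)
          (fun x hx => Submodule.subset_span ⟨x, hx, rfl⟩) (i + 1) hz
      obtain ⟨w, hw⟩ := mem_sup_pPow.1 (h2 (hU.p_pow_mem y hy))
      have h3 : Submodule.span (PS p k n) (X.F ψ '' (U : Set H)) ≤ U := by
        rw [Submodule.span_le]
        rintro _ ⟨z, hz, rfl⟩
        exact hmem z hz
      have hwU : w ∈ U := by
        refine hU.saturated (N := i + 1) ?_
        have h4 := Submodule.sub_mem _ (Submodule.smul_mem _ ((p : PS p k n) ^ i) hy) (h3 hw)
        rwa [sub_sub_cancel] at h4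
      refine ⟨_, hw, (p : PS p k n) ^ i • w, ⟨w, hwU, rfl⟩, ?_⟩
      rw [smul_smul, ← pow_succ', sub_add_cancel]
    exact h1 ⟨x, hx, rfl⟩
  · have h1 := X.F_mem_of_taylor φ ψ (U ⊔ pPow (i + 1)) (S := Set.univ) (fun _ _ _ => trivial)
      (fun x _ => mem_sup_pPow.2 (hU.frob_quot x)) (i + 1) (Set.mem_univ x)
    rw [sup_assoc, sup_idem] at h1
    exact mem_sup_pPow.1 h1

end IsSlopeSub

/-- The projection of the ambient module onto `V`, restricted to `U`, splits `U → U / V`, so the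
quotient is projective over a local ring. -/
lemma free_gr_of_isCompl {R M : Type*} [CommRing R] [IsLocalRing R] [AddCommGroup M] [Module R M]
    [Module.Finite R M] [Module.Free R M] {U V : Submodule R M} (hVU : V ≤ U)
    (hU : ∃ W, IsCompl U W) (hV : ∃ W, IsCompl V W) :
    Module.Free R (U ⧸ V.submoduleOf U) := by
  obtain ⟨W, hW⟩ := hU
  obtain ⟨W', hW'⟩ := hV
  have := free_of_isCompl hW
  have := finite_of_isCompl hW
  let P : U →ₗ[R] U := LinearMap.id - (Submodule.inclusion hVU).comp
    ((Submodule.projectionOnto V W' hW').comp U.subtype)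
  have hP : V.submoduleOf U ≤ LinearMap.ker P := by
    intro x hx
    rw [LinearMap.mem_ker]
    have h1 : Submodule.projectionOnto V W' hW' (x : M) = ⟨x, hx⟩ :=
      Submodule.projectionOnto_apply_left hW' ⟨(x : M), hx⟩
    ext
    simp [P, h1]
  have : Module.Projective R (U ⧸ V.submoduleOf U) := by
    refine Module.Projective.of_split ((V.submoduleOf U).liftQ P hP) (V.submoduleOf U).mkQ ?_
    ext x
    simp only [LinearMap.coe_comp, Function.comp_apply, Submodule.mkQ_apply, Submodule.liftQ_apply,
      LinearMap.id_apply]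
    rw [Submodule.Quotient.eq]
    change (P x : M) - x ∈ V
    simp [P]
  exact Module.free_of_flat_of_isLocalRing

/-- The slope filtration of an ordinary `F`-crystal. -/
theorem exists_isConjFiltration (X : FCrystal p k n H) (φ : FrobLift p k n)
    (h : ∀ i, IsCompl (conjFil X φ i) (hodgeFil X φ (i + 1))) :
    ∃ U, IsConjFiltration X φ U := by
  choose U hU hred using fun i => exists_isSlopeSub X φ i (h i)
  have hmono : Monotone U := fun i j hij => (hU i).le (hU j) hij
  have hprev : ∀ i, prev U i ≤ U i
    | 0 => bot_le
    | i + 1 => hmono i.le_succ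
  have hUψ : ∀ i ψ, IsSlopeSub X ψ i (U i) := fun i ψ => (hU i).change ψ
  refine ⟨U, hmono, fun i => ?_, fun i => ?_, hred, fun i y hy => ?_,
    fun i j x hx => (hU i).conn_mem j hx, fun i ψ => (hUψ i ψ).frob_mem, ?_, ?_⟩
  · obtain ⟨W, hW⟩ := (hU i).exists_isCompl
    exact free_of_isCompl hW
  · refine free_gr_of_isCompl (hprev i) (hU i).exists_isCompl ?_
    cases i with
    | zero => exact ⟨⊤, isCompl_bot_top⟩
    | succ i => exact (hU i).exists_isCompl
  · exact (hU i).saturated (N := 1) (by rwa [pow_one])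
  · rintro (_ | i) ψ x hx
    · exact ⟨X.F ψ x, (hUψ 0 ψ).frob_mem x hx, by simp⟩
    · obtain ⟨y, hy⟩ := (hUψ i ψ).frob_quot x
      refine ⟨y, (hU (i + 1)).saturated (N := i + 1) ?_, hy⟩
      have h1 := Submodule.sub_mem _ ((hUψ (i + 1) ψ).frob_mem x hx) (hmono i.le_succ hy)
      rwa [sub_sub_cancel] at h1
  · intro i ψ y hy
    exact ⟨_, (hUψ i ψ).p_pow_mem y hy, by simp⟩

end SlopeFiltration

/-! ### The standard Gram matrix. -/

section Gram

variable {R M : Type*} [CommRing R] [AddCommGroup M] [Module R M] {n : ℕ}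

lemma gramMatrix_mul_self : gramMatrix R n * gramMatrix R n = -1 := by
  rw [gramMatrix, Matrix.fromBlocks_multiply]
  simp only [Matrix.mul_zero, Matrix.zero_mul, add_zero, zero_add, Matrix.fromBlocks_multiply,
    Matrix.mul_one, neg_zero, Matrix.mul_neg]
  rw [← Matrix.fromBlocks_one, ← Matrix.fromBlocks_one, ← Matrix.fromBlocks_one]
  simp only [Matrix.fromBlocks_neg, neg_zero]

lemma linearIndependent_of_gram {ι : Type*} [Fintype ι] [DecidableEq ι]
    (B : LinearMap.BilinForm R M) (v : ι → M) (G G' : Matrix ι ι R)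
    (h : ∀ i j, B (v i) (v j) = G i j) (hG : G * G' = 1) : LinearIndependent R v := by
  rw [Fintype.linearIndependent_iff]
  intro a ha
  have h1 : Matrix.vecMul a G = 0 := by
    funext j
    have := congrArg (fun x => B x (v j)) ha
    simp only [map_sum, LinearMap.sum_apply, map_smul, LinearMap.smul_apply, h, map_zero,
      LinearMap.zero_apply, smul_eq_mul] at this
    exact this
  have h2 : a = 0 := by
    rw [← Matrix.vecMul_one a, ← hG, ← Matrix.vecMul_vecMul, h1, Matrix.zero_vecMul]
  exact fun i => congrFun h2 i

end Gram

/-! ### A symplectic basis of `H` adapted to the slope and Hodge filtrations. -/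

section AdaptedBasis

variable {p : ℕ} [hp : Fact p.Prime] {k : Type*} [Field k] [CharP k p] [PerfectRing k p] {n : ℕ}
  {H : Type*} [AddCommGroup H] [Module (PS p k n) H]
  [Module.Free (PS p k n) H] [Module.Finite (PS p k n) H]
  {X : FCrystal p k n H} {φ : FrobLift p k n} {Fil U : ℕ → Submodule (PS p k n) H}
  {B : LinearMap.BilinForm (PS p k n) H}

/-- Each element of `V` is `p` times an element that by saturation is again in `V`; iterating, it is
divisible by all powers of `p`. -/
lemma mem_of_forall_red {V : Submodule (PS p k n) H} (hs : ∀ y, (p : PS p k n) • y ∈ V → y ∈ V)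
    (h0 : ∀ x ∈ V, (red x : Red p k n H) = 0) : V = ⊥ := by
  refine (Submodule.eq_bot_iff _).2 fun x hx => ?_
  refine eq_zero_of_forall_p_pow (p := p) (k := k) (n := n) fun N => ?_
  induction N generalizing x with
  | zero => exact ⟨x, by simp⟩
  | succ N ih =>
    obtain ⟨y, rfl⟩ := red_eq_zero.1 (h0 x hx)
    obtain ⟨z, hz⟩ := ih y (hs y hx)
    exact ⟨z, by rw [hz, smul_smul, pow_succ']⟩

lemma isCompl_of_lifts {V V' : Submodule (PS p k n) H}
    {C D : Submodule (PS₀ p k n) (Red p k n H)} (hCD : IsCompl C D)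
    (hV : V.map red = C) (hV' : V'.map red = D)
    (hs : ∀ y, (p : PS p k n) • y ∈ V → y ∈ V) (hs' : ∀ y, (p : PS p k n) • y ∈ V' → y ∈ V') :
    IsCompl V V' := by
  refine ⟨?_, ?_⟩
  · rw [disjoint_iff]
    refine mem_of_forall_red (fun y hy => ⟨hs y hy.1, hs' y hy.2⟩) fun x hx => ?_
    exact Submodule.disjoint_def.1 hCD.disjoint _ (hV ▸ ⟨x, hx.1, rfl⟩) (hV' ▸ ⟨x, hx.2, rfl⟩)
  · rw [codisjoint_iff, eq_top_iff]
    refine le_of_forall_mod_p Module.Finite.fg_top fun x _ => ?_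
    have h1 : (red x : Red p k n H) ∈ C ⊔ D := hCD.sup_eq_top ▸ Submodule.mem_top
    obtain ⟨c, hc, d, hd, hcd⟩ := Submodule.mem_sup.1 h1
    rw [← hV] at hc
    rw [← hV'] at hd
    obtain ⟨c, hc, rfl⟩ := hc
    obtain ⟨d, hd, rfl⟩ := hd
    rw [← map_add] at hcd
    obtain ⟨z, hz⟩ := red_eq_red.1 hcd.symm
    exact ⟨c + d, Submodule.add_mem_sup hc hd, z, trivial, hz⟩

lemma isCompl_conj_hodge (hX : IsOrdinaryCY3 X φ Fil B) (hU : IsConjFiltration X φ U) (i : ℕ) :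
    IsCompl (U i) (Fil (i + 1)) :=
  isCompl_of_lifts (hX.ordinary.opposite i) (hU.lifts i) (hX.hodge.lifts _) (hU.saturated i)
    (hX.hodge.saturated _)

lemma U_three (hX : IsOrdinaryCY3 X φ Fil B) (hU : IsConjFiltration X φ U) : U 3 = ⊤ := by
  have h1 : Fil 4 = ⊥ := by
    refine mem_of_forall_red (hX.hodge.saturated 4) fun x hx => ?_
    have : (red x : Red p k n H) ∈ hodgeFil X φ 4 := hX.hodge.lifts 4 ▸ ⟨x, hx, rfl⟩
    rwa [hX.level.2] at this
  have h2 := isCompl_conj_hodge hX hU 3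
  rw [h1] at h2
  exact eq_top_of_isCompl_bot h2

/-- Modulo lower steps of the filtration, `p^i x` and `p^j y` are combinations of Frobenius images,
and the errors are orthogonal by induction on `i + j`. The similitude factor `p^3` against `p^(i+j)`
with `i + j < 3` improves divisibility of all values `B x y` from `p^N` to `p^(N+1)`. -/
lemma form_conj_eq_zero (hX : IsOrdinaryCY3 X φ Fil B) (hU : IsConjFiltration X φ U) :
    ∀ (s : ℕ), s ≤ 2 → ∀ i j, i + j = s → ∀ x ∈ U i, ∀ y ∈ U j, B x y = 0 := by
  intro s
  induction s using Nat.strong_induction_on with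
  | _ s ih =>
  intro hs i j hij x hx y hy
  refine psep_PS _ fun N => ?_
  induction N generalizing x y with
  | zero => simp
  | succ N ihN =>
    obtain ⟨z, hz, hxz⟩ := hU.frob_onto i φ x hx
    obtain ⟨w, hw, hyw⟩ := hU.frob_onto j φ y hy
    have hzU : z ∈ U i := by
      refine Submodule.span_le.2 ?_ hz
      rintro _ ⟨u, hu, rfl⟩
      exact hU.frob_mem i φ u hu
    have e1 : B ((p : PS p k n) ^ i • x - z) ((p : PS p k n) ^ j • y) = 0 := by
      cases i with
      | zero => rw [(Submodule.mem_bot _).1 hxz, map_zero, LinearMap.zero_apply]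
      | succ i => exact ih (i + j) (by omega) (by omega) i j rfl _ hxz _ (Submodule.smul_mem _ _ hy)
    have e2 : B z ((p : PS p k n) ^ j • y - w) = 0 := by
      cases j with
      | zero => rw [(Submodule.mem_bot _).1 hyw, map_zero]
      | succ j => exact ih (i + j) (by omega) (by omega) i j rfl _ hzU _ hyw
    have e3 : (p : PS p k n) ^ (3 + N) ∣ B z w := by
      rw [← Ideal.mem_span_singleton]
      refine Submodule.span_induction (p := fun z _ => B z w ∈ Ideal.span {(p : PS p k n) ^ (3 + N)})
        ?_ ?_ ?_ ?_ hz
      · rintro _ ⟨u, hu, rfl⟩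
        refine Submodule.span_induction
          (p := fun w _ => B (X.F φ u) w ∈ Ideal.span {(p : PS p k n) ^ (3 + N)}) ?_ ?_ ?_ ?_ hw
        · rintro _ ⟨v, hv, rfl⟩
          rw [hX.form_frob, Ideal.mem_span_singleton, pow_add]
          obtain ⟨c, hc⟩ := ihN u hu v hv
          rw [hc, map_mul, map_pow, map_natCast]
          exact mul_dvd_mul_left _ (dvd_mul_right _ _)
        · rw [map_zero]; exact Ideal.zero_mem _
        · intro a b _ _ ha hb
          rw [map_add]; exact Ideal.add_mem _ ha hb
        · intro c a _ ha
          rw [map_smul]; exact Ideal.mul_mem_left _ _ ha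
      · rw [map_zero, LinearMap.zero_apply]; exact Ideal.zero_mem _
      · intro a b _ _ ha hb
        rw [map_add, LinearMap.add_apply]; exact Ideal.add_mem _ ha hb
      · intro c a _ ha
        rw [map_smul, LinearMap.smul_apply]; exact Ideal.mul_mem_left _ _ ha
    have e4 : (p : PS p k n) ^ (i + j) * B x y = B z w := by
      rw [map_sub, LinearMap.sub_apply, sub_eq_zero] at e1
      rw [map_sub, sub_eq_zero] at e2
      rw [← e2, ← e1, map_smul, map_smul, LinearMap.smul_apply, smul_eq_mul, smul_eq_mul, pow_add]
      ring
    have e5 : (p : PS p k n) ^ (i + j) * (p : PS p k n) ^ (N + 1) ∣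
        (p : PS p k n) ^ (i + j) * B x y := by
      rw [← pow_add, e4]
      exact (pow_dvd_pow _ (by omega)).trans e3
    exact (mul_dvd_mul_iff_left (pow_ne_zero _ natCast_p_ne_zero_PS)).1 e5

lemma form_U (hX : IsOrdinaryCY3 X φ Fil B) (hU : IsConjFiltration X φ U) {i j : ℕ}
    (hij : i + j ≤ 2) {x y : H} (hx : x ∈ U i) (hy : y ∈ U j) : B x y = 0 :=
  form_conj_eq_zero hX hU (i + j) hij i j rfl x hx y hy

lemma form_Fil_two (hX : IsOrdinaryCY3 X φ Fil B) {x y : H} (hx : x ∈ Fil 2) (hy : y ∈ Fil 2) :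
    B x y = 0 :=
  (hX.riemann_two y).1 hy x hx

/-- The top graded piece `H₀ / Fil_2 H₀` has rank one, and the complement `Fil^3 H₀` maps onto it
isomorphically. A generator is moved into `Fil^3 H₀`, lifted, and shown to generate by Nakayama's
lemma. -/
lemma exists_generator (hX : IsOrdinaryCY3 X φ Fil B) (hU : IsConjFiltration X φ U) :
    ∃ ω₀ : H, Fil 3 = Submodule.span (PS p k n) {ω₀} := by
  have := hX.ordinary.free 3
  obtain ⟨b⟩ := (finrank_eq_one_iff Unit).1 hX.rank_three
  obtain ⟨y, hy⟩ := Submodule.Quotient.mk_surjective _ (b ())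
  have h1 : (y : Red p k n H) ∈ conjFil X φ 2 ⊔ hodgeFil X φ 3 :=
    (hX.ordinary.opposite 2).sup_eq_top ▸ Submodule.mem_top
  obtain ⟨c, hc, d, hd, hcd⟩ := Submodule.mem_sup.1 h1
  rw [← hX.hodge.lifts 3] at hd
  obtain ⟨ω, hω, rfl⟩ := hd
  refine ⟨ω, le_antisymm ?_ ((Submodule.span_singleton_le_iff_mem _ _).2 hω)⟩
  refine le_of_forall_mod_p (Module.Finite.iff_fg.1
    (finite_of_isCompl (isCompl_conj_hodge hX hU 2).symm)) fun x hx => ?_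
  let x' : conjFil X φ 3 := ⟨red x, by rw [hX.level.1]; trivial⟩
  have h2 : b.repr (Submodule.Quotient.mk x') () • b () = Submodule.Quotient.mk x' := by
    conv_rhs => rw [← b.sum_repr (Submodule.Quotient.mk x')]
    simp
  obtain ⟨a, ha⟩ := Ideal.Quotient.mk_surjective (b.repr (Submodule.Quotient.mk x') ())
  rw [← hy, ← ha, ← Submodule.Quotient.mk_smul, Submodule.Quotient.eq] at h2
  have h3 : Ideal.Quotient.mk (pIdeal p k n) a • (y : Red p k n H) - red x ∈ conjFil X φ 2 := h2
  have h4 : (red (a • ω - x) : Red p k n H) ∈ conjFil X φ 2 := by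
    have h5 := Submodule.sub_mem _ h3 (Submodule.smul_mem _ (Ideal.Quotient.mk (pIdeal p k n) a) hc)
    rw [← hcd, smul_add, sub_right_comm, add_sub_cancel_left] at h5
    rwa [map_sub, map_smulₛₗ]
  have h5 : a • ω - x ∈ Fil 3 := Submodule.sub_mem _ (Submodule.smul_mem _ _ hω) hx
  have h6 : (red (a • ω - x) : Red p k n H) ∈ hodgeFil X φ 3 := hX.hodge.lifts 3 ▸ ⟨_, h5, rfl⟩
  obtain ⟨z, hz⟩ := red_eq_zero.1 (Submodule.disjoint_def.1
    (hX.ordinary.opposite 2).disjoint _ h4 h6)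
  refine ⟨a • ω, Submodule.smul_mem _ _ (Submodule.mem_span_singleton_self _), -z, ?_, ?_⟩
  · exact Submodule.neg_mem _ (hX.hodge.saturated 3 z (hz ▸ h5))
  · rw [smul_neg, ← hz]; abel

lemma generator_ne_zero (hX : IsOrdinaryCY3 X φ Fil B) {ω₀ : H}
    (h : Fil 3 = Submodule.span (PS p k n) {ω₀}) : ω₀ ≠ 0 := by
  rintro rfl
  have h1 : hodgeFil X φ 3 = ⊥ := by
    rw [← hX.hodge.lifts 3, h]
    simp
  have h2 := hX.ordinary.opposite 2
  rw [h1] at h2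
  have h3 := eq_top_of_isCompl_bot h2
  have h4 := hX.rank_three
  have : Subsingleton (Gr (conjFil X φ) 3) := by
    rw [Submodule.Quotient.subsingleton_iff, eq_top_iff]
    rintro x -
    change (x : Red p k n H) ∈ conjFil X φ 2
    rw [h3]
    trivial
  rw [Module.finrank_zero_of_subsingleton] at h4
  exact zero_ne_one h4

/-- `U 1` and `Fil 2` are complementary isotropic submodules. Kodaira-Spencer provides a basis of
`Fil 2` made of `ω₀` and weight 2 parts of its derivatives, and the remaining vectors are the dual
basis in `U 1`. -/
lemma exists_adapted_basis (hX : IsOrdinaryCY3 X φ Fil B) (hU : IsConjFiltration X φ U) {ω₀ : H}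
    (h : Fil 3 = Submodule.span (PS p k n) {ω₀}) :
    ∃ ω : Module.Basis (Idx n) (PS p k n) H, ω (lastIdx n) = ω₀ ∧
      (∀ j, ω j ∈ U (wt j) ⊓ Fil (wt j)) ∧
      (∀ i j, B (ω i) (ω j) = gramMatrix (PS p k n) n i j) ∧
      ∀ j, ω (Sum.inr (Sum.inl j)) - X.D j ω₀ ∈ Fil 3 := by
  classical
  have hω₀ := generator_ne_zero hX h
  have hω₀3 : ω₀ ∈ Fil 3 := h ▸ Submodule.mem_span_singleton_self ω₀
  have hle : Fil 3 ≤ Fil 2 := hX.hodge.antitone (by norm_num)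
  have hskew : ∀ x y, B x y = - B y x := fun x y =>
    (LinearMap.IsAlt.neg (B := B) hX.alternating y x).symm
  have hc0 := isCompl_conj_hodge hX hU 0
  have hc1 := isCompl_conj_hodge hX hU 1
  have hc2 := isCompl_conj_hodge hX hU 2
  have hdec : ∀ x : H, ∀ i, ∃ u ∈ U i, ∃ f ∈ Fil (i + 1), x = u + f := fun x i => by
    have h1 : x ∈ U i ⊔ Fil (i + 1) :=
      (isCompl_conj_hodge hX hU i).sup_eq_top ▸ Submodule.mem_top
    obtain ⟨u, hu, f, hf, huf⟩ := Submodule.mem_sup.1 h1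
    exact ⟨u, hu, f, hf, huf.symm⟩
  -- The component of `D_j ω₀` in `U 2` differs from it by an element of `Fil 3`, so it stays in
  -- `Fil 2` and keeps its Kodaira-Spencer class.
  choose ω₂ hω₂ g hg hω₂g using fun j => hdec (X.D j ω₀) 2
  have hω₂D : ∀ j, ω₂ j - X.D j ω₀ ∈ Fil 3 := fun j => by
    rw [hω₂g, sub_add_cancel_left]
    exact Submodule.neg_mem _ (hg j)
  have hω₂F : ∀ j, ω₂ j ∈ Fil 2 := fun j => by
    have h1 := Submodule.add_mem _ (hle (hω₂D j)) (hX.hodge.transversal 2 j ω₀ hω₀3)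
    rwa [sub_add_cancel] at h1
  have hsum : ∀ a : Fin n → PS p k n, ∑ j, a j • ω₂ j - ∑ j, a j • X.D j ω₀ ∈ Fil 3 := fun a => by
    rw [← Finset.sum_sub_distrib]
    refine Submodule.sum_mem _ fun j _ => ?_
    rw [← smul_sub]
    exact Submodule.smul_mem _ _ (hω₂D j)
  have hKS0 : ∀ a : Fin n → PS p k n, ∑ j, a j • X.D j ω₀ ∈ Fil 3 → a = 0 := by
    intro a ha
    refine (map_eq_zero_iff _ hX.kodairaSpencer_bijective.1).1 ?_
    refine LinearMap.ext fun x => ?_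
    obtain ⟨c, hc⟩ := Submodule.mem_span_singleton.1 (h.le x.2)
    have h1 : x = c • (⟨ω₀, hω₀3⟩ : Fil 3) := Subtype.ext hc.symm
    rw [h1, map_smul, LinearMap.zero_apply]
    have h2 : kodairaSpencer hX.hodge a ⟨ω₀, hω₀3⟩ = 0 := (Submodule.Quotient.mk_eq_zero _).2 ha
    rw [h2, smul_zero]
  have hKS1 : ∀ y ∈ Fil 2, ∃ a : Fin n → PS p k n, y - ∑ j, a j • X.D j ω₀ ∈ Fil 3 := by
    intro y hy
    have hgen : ∀ x : Fil 3, ∃ c, c • ω₀ = (x : H) := fun x =>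
      Submodule.mem_span_singleton.1 (h.le x.2)
    choose c hc using hgen
    have hinj := smul_left_injective (PS p k n) hω₀
    let f : Fil 3 →ₗ[PS p k n] (Fil 2 ⧸ (Fil 3).submoduleOf (Fil 2)) :=
      { toFun := fun x => c x • Submodule.Quotient.mk ⟨y, hy⟩
        map_add' := fun x z => by
          have : c (x + z) = c x + c z := hinj (by
            change c (x + z) • ω₀ = (c x + c z) • ω₀
            rw [hc, add_smul, hc, hc]; rfl)
          rw [this, add_smul]
        map_smul' := fun r x => by
          have : c (r • x) = r * c x := hinj (by
            change c (r • x) • ω₀ = (r * c x) • ω₀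
            rw [hc, mul_smul, hc]; rfl)
          rw [this, mul_smul, RingHom.id_apply] }
    obtain ⟨a, ha⟩ := hX.kodairaSpencer_bijective.2 f
    have h1 := LinearMap.congr_fun ha ⟨ω₀, hω₀3⟩
    have h2 : f ⟨ω₀, hω₀3⟩ = Submodule.Quotient.mk ⟨y, hy⟩ := by
      have : c ⟨ω₀, hω₀3⟩ = 1 := hinj (by
        change c ⟨ω₀, hω₀3⟩ • ω₀ = (1 : PS p k n) • ω₀
        rw [hc, one_smul])
      change c ⟨ω₀, hω₀3⟩ •
        (Submodule.Quotient.mk ⟨y, hy⟩ : Fil 2 ⧸ (Fil 3).submoduleOf (Fil 2)) = _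
      rw [this, one_smul]
    rw [h2] at h1
    have h3 := (Submodule.Quotient.eq _).1 h1.symm
    exact ⟨a, h3⟩
  have hli : LinearIndependent (PS p k n) (Sum.elim ω₂ fun _ : Unit => ω₀) := by
    rw [Fintype.linearIndependent_iff]
    intro a ha
    simp only [Fintype.sum_sum_type, Sum.elim_inl, Sum.elim_inr, Finset.univ_unique,
      Finset.sum_singleton] at ha
    have h1 : (fun j => a (Sum.inl j)) = 0 := by
      refine hKS0 _ ?_
      have h2 := hsum fun j => a (Sum.inl j)
      rw [eq_neg_of_add_eq_zero_left ha] at h2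
      have h3 := Submodule.neg_mem _ (Submodule.add_mem _ h2
        (Submodule.smul_mem _ (a (Sum.inr default)) hω₀3))
      rwa [sub_eq_add_neg, add_right_comm, neg_add_cancel, zero_add, neg_neg] at h3
    rintro (j | ⟨⟩)
    · exact congrFun h1 j
    · have h2 : ∑ j, a (Sum.inl j) • ω₂ j = 0 :=
        Finset.sum_eq_zero fun j _ => by rw [congrFun h1 j, Pi.zero_apply, zero_smul]
      rw [h2, zero_add] at ha
      exact (smul_eq_zero.1 ha).resolve_right hω₀
  have hspan : Fil 2 = Submodule.span (PS p k n) (Set.range (Sum.elim ω₂ fun _ : Unit => ω₀)) := by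
    refine le_antisymm (fun y hy => ?_) (Submodule.span_le.2 ?_)
    · obtain ⟨a, ha⟩ := hKS1 y hy
      have h1 := Submodule.sub_mem _ ha (hsum a)
      rw [sub_sub_sub_cancel_right, h] at h1
      obtain ⟨c, hc⟩ := Submodule.mem_span_singleton.1 h1
      rw [← sub_add_cancel y (∑ j, a j • ω₂ j), ← hc]
      refine Submodule.add_mem _ (Submodule.smul_mem _ _ (Submodule.subset_span ⟨Sum.inr (), rfl⟩))
        (Submodule.sum_mem _ fun j _ => Submodule.smul_mem _ _
          (Submodule.subset_span ⟨Sum.inl j, rfl⟩))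
    · rintro _ ⟨j | j, rfl⟩
      · exact hω₂F j
      · exact hle hω₀3
  let b : Module.Basis (Fin n ⊕ Unit) (PS p k n) (Fil 2) :=
    (Module.Basis.span hli).map (LinearEquiv.ofEq _ _ hspan.symm)
  have hb : ∀ j, (b j : H) = Sum.elim ω₂ (fun _ : Unit => ω₀) j := fun j => by
    simp [b, Module.Basis.span_apply]
  -- A coordinate function on `Fil 2`, extended by zero on `U 1`, is represented by some `y`. The
  -- part of `y` in `Fil 2` pairs to zero with `Fil 2`, so the part in `U 1` does the job.
  have hdual : ∀ i, ∃ u ∈ U 1, ∀ j, B u (Sum.elim ω₂ (fun _ : Unit => ω₀) j) =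
      if i = j then 1 else 0 := by
    intro i
    obtain ⟨y, hy⟩ := hX.nondegenerate.2 ((b.coord i).comp
      (Submodule.projectionOnto (Fil 2) (U 1) hc1.symm))
    obtain ⟨u, hu, f, hf, huf⟩ := hdec y 1
    refine ⟨u, hu, fun j => ?_⟩
    have h1 := LinearMap.congr_fun hy (b j : H)
    rw [huf, map_add, LinearMap.add_apply, form_Fil_two hX hf (b j).2, add_zero,
      LinearMap.comp_apply, Submodule.projectionOnto_apply_left, b.coord_apply, b.repr_self,
      Finsupp.single_apply, hb] at h1
    rw [h1]
    simp only [eq_comm]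
  choose u hu hub using hdual
  let v : Idx n → H := Sum.elim (Sum.elim (fun _ => -u (Sum.inr ())) (fun j => u (Sum.inl j)))
    (Sum.elim ω₂ (fun _ => ω₀))
  have hsep : ∀ x : H, (∀ y ∈ U 1, B x y = 0) → (∀ j, B x (ω₂ j) = 0) → B x ω₀ = 0 → x = 0 := by
    intro x h1 h2 h3
    refine (map_eq_zero_iff B hX.nondegenerate.1).1 (LinearMap.ext fun y => ?_)
    obtain ⟨u, hu, f, hf, rfl⟩ := hdec y 1
    rw [map_add, h1 u hu, zero_add, LinearMap.zero_apply]
    change f ∈ LinearMap.ker (B x)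
    revert f
    change Fil 2 ≤ _
    rw [hspan, Submodule.span_le]
    rintro _ ⟨j | j, rfl⟩
    · exact h2 j
    · exact h3
  have hgram : ∀ i j, B (v i) (v j) = gramMatrix (PS p k n) n i j := by
    have e11 : ∀ i j, B (u i) (u j) = 0 := fun i j => form_U hX hU le_rfl (hu i) (hu j)
    have e2 : ∀ i j, B (u i) (ω₂ j) = if i = Sum.inl j then 1 else 0 := fun i j => hub i (Sum.inl j)
    have e3 : ∀ i, B (u i) ω₀ = if i = Sum.inr () then 1 else 0 := fun i => hub i (Sum.inr ())
    have e22 : ∀ i j, B (ω₂ i) (ω₂ j) = 0 := fun i j => form_Fil_two hX (hω₂F i) (hω₂F j)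
    have e23 : ∀ i, B (ω₂ i) ω₀ = 0 := fun i => form_Fil_two hX (hω₂F i) (hle hω₀3)
    have e33 : B ω₀ ω₀ = 0 := hX.alternating _
    have e2' : ∀ i j, B (ω₂ j) (u i) = if i = Sum.inl j then -1 else 0 := fun i j => by
      rw [hskew, e2]; split_ifs <;> simp
    have e3' : ∀ i, B ω₀ (u i) = if i = Sum.inr () then -1 else 0 := fun i => by
      rw [hskew, e3]; split_ifs <;> simp
    have e23' : ∀ i, B ω₀ (ω₂ i) = 0 := fun i => by rw [hskew, e23, neg_zero]
    rintro ((i | i) | (i | i)) ((j | j) | (j | j)) <;>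
      simp [v, gramMatrix, Matrix.one_apply, e11, e2, e3, e22, e23, e33, e2', e3', e23', eq_comm]
    split_ifs <;> simp
  have hv1 : ∀ j, v (Sum.inl j) ∈ U 1 := by
    rintro (j | j)
    · exact Submodule.neg_mem _ (hu _)
    · exact hu _
  have hvspan : ⊤ ≤ Submodule.span (PS p k n) (Set.range v) := by
    intro x _
    obtain ⟨u', hu', f, hf, rfl⟩ := hdec x 1
    refine Submodule.add_mem _ ?_ ?_
    · have h1 : u' - (∑ j, B u' (ω₂ j) • u (Sum.inl j) + B u' ω₀ • u (Sum.inr ())) = 0 := by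
        have hm : ∑ j, B u' (ω₂ j) • u (Sum.inl j) + B u' ω₀ • u (Sum.inr ()) ∈ U 1 :=
          Submodule.add_mem _ (Submodule.sum_mem _ fun j _ => Submodule.smul_mem _ _ (hu _))
            (Submodule.smul_mem _ _ (hu _))
        have e2 : ∀ i j, B (u i) (ω₂ j) = if i = Sum.inl j then 1 else 0 :=
          fun i j => hub i (Sum.inl j)
        have e3 : ∀ i, B (u i) ω₀ = if i = Sum.inr () then 1 else 0 := fun i => hub i (Sum.inr ())
        refine hsep _ (fun y hy => form_U hX hU le_rfl (Submodule.sub_mem _ hu' hm) hy)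
          (fun j => ?_) ?_
        · simp [LinearMap.sum_apply, e2]
        · simp [LinearMap.sum_apply, e3]
      rw [sub_eq_zero.1 h1]
      refine Submodule.add_mem _ (Submodule.sum_mem _ fun j _ => Submodule.smul_mem _ _
        (Submodule.subset_span ⟨Sum.inl (Sum.inr j), rfl⟩)) (Submodule.smul_mem _ _ ?_)
      rw [← Submodule.neg_mem_iff]
      exact Submodule.subset_span ⟨Sum.inl (Sum.inl ()), rfl⟩
    · rw [hspan] at hf
      refine Submodule.span_mono ?_ hf
      rintro _ ⟨j, rfl⟩
      exact ⟨Sum.inr j, rfl⟩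
  have hvli : LinearIndependent (PS p k n) v :=
    linearIndependent_of_gram B v _ (-gramMatrix (PS p k n) n) hgram
      (by rw [mul_neg, gramMatrix_mul_self, neg_neg])
  -- By construction the vector lies in `U 1` only. Its component in `Fil 1` is orthogonal to `U 1`,
  -- to the `ω₂ j` since `U 0` is orthogonal to `U 2`, and to `ω₀` since `Fil 1` is orthogonal to
  -- `Fil 3`; so that component is zero.
  have hv0 : v (Sum.inl (Sum.inl ())) ∈ U 0 := by
    obtain ⟨u', hu', f, hf, huf⟩ := hdec (v (Sum.inl (Sum.inl ()))) 0
    have hfeq : f = v (Sum.inl (Sum.inl ())) - u' := by rw [huf, add_sub_cancel_left]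
    have h1 : f = 0 := by
      refine hsep f (fun y hy => ?_) (fun j => ?_) ?_
      · refine form_U hX hU le_rfl ?_ hy
        rw [hfeq]
        exact Submodule.sub_mem _ (hv1 _) (hU.mono zero_le_one hu')
      · rw [hfeq, map_sub, LinearMap.sub_apply, form_U hX hU (by norm_num) hu' (hω₂ j), sub_zero]
        exact (hgram (Sum.inl (Sum.inl ())) (Sum.inr (Sum.inl j))).trans (by simp [gramMatrix])
      · rw [hskew, (hX.riemann_three f).1 hf ω₀ hω₀3, neg_zero]
    rw [huf, h1, add_zero]
    exact hu'
  refine ⟨Module.Basis.mk hvli hvspan, by simp [v], ?_, fun i j => by simp [hgram], fun j => ?_⟩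
  · intro j
    rw [Module.Basis.mk_apply]
    rcases j with (j | j) | (j | j)
    · exact ⟨hv0, by rw [wt, hX.hodge.zero]; trivial⟩
    · refine ⟨hv1 _, (hX.riemann_three _).2 fun x hx => ?_⟩
      rw [h] at hx
      obtain ⟨c, rfl⟩ := Submodule.mem_span_singleton.1 hx
      rw [map_smul, LinearMap.smul_apply]
      have : B ω₀ (v (Sum.inl (Sum.inr j))) = 0 :=
        (hgram (Sum.inr (Sum.inr ())) (Sum.inl (Sum.inr j))).trans (by simp [gramMatrix])
      rw [this, smul_zero]
    · exact ⟨hω₂ j, hω₂F j⟩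
    · exact ⟨by rw [wt, U_three hX hU]; trivial, hω₀3⟩
  · rw [Module.Basis.mk_apply]
    exact hω₂D j

/-- The part of `x` of weight above `i` lies in `Fil (i + 1)`, and also in `U i` as the difference
of `x` and its part of weight at most `i`; these submodules meet in zero. -/
lemma repr_eq_zero_of_mem_U (hX : IsOrdinaryCY3 X φ Fil B) (hU : IsConjFiltration X φ U)
    (ω : Module.Basis (Idx n) (PS p k n) H) (hω : ∀ j, ω j ∈ U (wt j) ⊓ Fil (wt j)) {i : ℕ} {x : H}
    (hx : x ∈ U i) {j : Idx n} (hj : i < wt j) : ω.repr x j = 0 := by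
  classical
  have h1 : ∑ j, (if i < wt j then ω.repr x j else 0) • ω j ∈ Fil (i + 1) := by
    refine Submodule.sum_mem _ fun j _ => ?_
    split_ifs with hj
    · exact Submodule.smul_mem _ _ (hX.hodge.antitone hj (hω j).2)
    · simp
  have h2 : ∑ j, (if i < wt j then ω.repr x j else 0) • ω j ∈ U i := by
    have h3 : ∑ j, (if i < wt j then ω.repr x j else 0) • ω j =
        x - ∑ j, (if i < wt j then 0 else ω.repr x j) • ω j := by
      rw [eq_sub_iff_add_eq, ← Finset.sum_add_distrib]
      conv_rhs => rw [← ω.sum_repr x]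
      exact Finset.sum_congr rfl fun j _ => by split_ifs <;> simp
    rw [h3]
    refine Submodule.sub_mem _ hx (Submodule.sum_mem _ fun j _ => ?_)
    split_ifs with hj
    · simp
    · exact Submodule.smul_mem _ _ (hU.mono (not_lt.1 hj) (hω j).1)
  have h4 := Submodule.disjoint_def.1 (isCompl_conj_hodge hX hU i).disjoint _ h2 h1
  have h5 := (Fintype.linearIndependent_iff.1 ω.linearIndependent) _ h4 j
  rwa [if_pos hj] at h5

lemma repr_eq_zero_of_mem_Fil (hX : IsOrdinaryCY3 X φ Fil B) (hU : IsConjFiltration X φ U)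
    (ω : Module.Basis (Idx n) (PS p k n) H) (hω : ∀ j, ω j ∈ U (wt j) ⊓ Fil (wt j)) {i : ℕ} {x : H}
    (hx : x ∈ Fil (i + 1)) {j : Idx n} (hj : wt j ≤ i) : ω.repr x j = 0 := by
  classical
  have h1 : ∑ j, (if wt j ≤ i then ω.repr x j else 0) • ω j ∈ U i := by
    refine Submodule.sum_mem _ fun j _ => ?_
    split_ifs with hj
    · exact Submodule.smul_mem _ _ (hU.mono hj (hω j).1)
    · simp
  have h2 : ∑ j, (if wt j ≤ i then ω.repr x j else 0) • ω j ∈ Fil (i + 1) := by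
    have h3 : ∑ j, (if wt j ≤ i then ω.repr x j else 0) • ω j =
        x - ∑ j, (if wt j ≤ i then 0 else ω.repr x j) • ω j := by
      rw [eq_sub_iff_add_eq, ← Finset.sum_add_distrib]
      conv_rhs => rw [← ω.sum_repr x]
      exact Finset.sum_congr rfl fun j _ => by split_ifs <;> simp
    rw [h3]
    refine Submodule.sub_mem _ hx (Submodule.sum_mem _ fun j _ => ?_)
    split_ifs with hj
    · simp
    · exact Submodule.smul_mem _ _ (hX.hodge.antitone (not_le.1 hj) (hω j).2)
  have h4 := Submodule.disjoint_def.1 (isCompl_conj_hodge hX hU i).disjoint _ h1 h2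
  have h5 := (Fintype.linearIndependent_iff.1 ω.linearIndependent) _ h4 j
  rwa [if_pos hj] at h5

end AdaptedBasis

/-! ### Fixed vectors of Frobenius-semilinear maps over an algebraically closed field. -/

section FixedVectors

variable {p : ℕ} [hp : Fact p.Prime] {K : Type*} [Field K] [CharP K p] [IsAlgClosed K]

-- If `F^{r+1} v = ∑ a_i F^i v`, these are the equations for `∑ x_i F^i v` to be fixed by `F`.
-- Eliminating `x_0, …, x_{r-1}` leaves a single equation `Y_r(x) = x` for `x = x_r`.
open Polynomial in
lemma exists_root_frobenius_system (a : ℕ → K) (r : ℕ) (ha : ∃ j ≤ r, a j ≠ 0) :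
    ∃ x : ℕ → K, x r ≠ 0 ∧ x 0 = a 0 * x r ^ p ∧
      ∀ i, x (i + 1) = x i ^ p + a (i + 1) * x r ^ p := by
  have hp2 := hp.out.two_le
  let Y : ℕ → K[X] := fun i => Nat.rec (C (a 0) * X ^ p) (fun i y => y ^ p + C (a (i + 1)) * X ^ p) i
  have hY0 : Y 0 = C (a 0) * X ^ p := rfl
  have hY1 : ∀ i, Y (i + 1) = Y i ^ p + C (a (i + 1)) * X ^ p := fun i => rfl
  have hdvd : ∀ i, X ^ p ∣ Y i := by
    intro i
    induction i with
    | zero => exact dvd_mul_left _ _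
    | succ i ih =>
      rw [hY1]
      exact dvd_add (ih.trans (dvd_pow_self _ hp.out.ne_zero)) (dvd_mul_left _ _)
  have hne : ∀ i, (∃ j ≤ i, a j ≠ 0) → Y i ≠ 0 := by
    intro i
    induction i with
    | zero =>
      rintro ⟨j, hj, hj'⟩
      obtain rfl : j = 0 := by omega
      rw [hY0]
      exact mul_ne_zero (C_ne_zero.2 hj') (pow_ne_zero _ X_ne_zero)
    | succ i ih =>
      rintro ⟨j, hj, hj'⟩ h0
      rw [hY1] at h0
      rcases eq_or_ne (Y i) 0 with hi | hi
      · rw [hi, zero_pow hp.out.ne_zero, zero_add] at h0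
        rcases Nat.lt_or_ge i j with h | h
        · obtain rfl : j = i + 1 := by omega
          exact mul_ne_zero (C_ne_zero.2 hj') (pow_ne_zero _ X_ne_zero) h0
        · exact ih ⟨j, h, hj'⟩ hi
      -- A nonzero `Y_i` divisible by `X^p` has degree at least `p`, so `Y_i^p` has degree at least
      -- `p^2` and cannot cancel against a multiple of `X^p`.
      · have h1 : p ≤ (Y i).natDegree := by
          simpa using natDegree_le_of_dvd (hdvd i) hi
        have h2 : (Y i ^ p).natDegree ≤ p := by
          rw [eq_neg_of_add_eq_zero_left h0, natDegree_neg]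
          exact (natDegree_C_mul_le _ _).trans (natDegree_X_pow_le _)
        rw [natDegree_pow] at h2
        nlinarith
  -- With `Y_r = X^2 R`, a root of `X R - 1` solves `Y_r = X` and is automatically nonzero.
  obtain ⟨R, hR⟩ := (pow_dvd_pow X hp2).trans (hdvd r)
  have hR0 : R ≠ 0 := by
    rintro rfl
    exact hne r ha (by rw [hR, mul_zero])
  obtain ⟨x, hx⟩ := IsAlgClosed.exists_root (X * R - 1) (by
    have h1 : (X * R).natDegree = R.natDegree + 1 := natDegree_X_mul hR0
    have h2 : (X * R - 1).natDegree = R.natDegree + 1 := by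
      rw [← h1]
      exact natDegree_sub_eq_left_of_natDegree_lt (by rw [h1, natDegree_one]; omega)
    intro h3
    rw [natDegree_eq_zero_iff_degree_le_zero.2 h3.le] at h2
    omega)
  rw [IsRoot, eval_sub, eval_mul, eval_X, eval_one, sub_eq_zero] at hx
  have hYr : (Y r).eval x = x := by
    rw [hR, eval_mul, eval_pow, eval_X, pow_two, mul_assoc, hx, mul_one]
  refine ⟨fun i => (Y i).eval x, ?_, ?_, fun i => ?_⟩
  · change (Y r).eval x ≠ 0
    rw [hYr]
    rintro rfl
    rw [zero_mul] at hx
    exact zero_ne_one hx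
  · change (Y 0).eval x = a 0 * (Y r).eval x ^ p
    rw [hYr, hY0]; simp
  · change (Y (i + 1)).eval x = (Y i).eval x ^ p + a (i + 1) * (Y r).eval x ^ p
    rw [hYr, hY1]; simp

lemma exists_artinSchreier (c : K) : ∃ y : K, y ^ p - y = c := by
  open Polynomial in
  obtain ⟨y, hy⟩ := IsAlgClosed.exists_root (X ^ p - X - C c : K[X]) (by
    have h1 : (X ^ p - X - C c : K[X]).natDegree = p := by
      rw [natDegree_sub_C]
      rw [natDegree_sub_eq_left_of_natDegree_lt] <;> simp [hp.out.one_lt]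
    intro h3
    rw [natDegree_eq_zero_iff_degree_le_zero.2 h3.le] at h1
    exact hp.out.ne_zero h1.symm)
  refine ⟨y, ?_⟩
  simpa [Polynomial.IsRoot, sub_eq_zero] using hy

variable {V : Type*} [AddCommGroup V] [Module K V] [Module.Finite K V]

/-- Take the first iterate of a nonzero vector that depends on its predecessors. The system above
then has a solution with `x_r ≠ 0`, and minimality makes the resulting fixed vector nonzero. -/
lemma exists_fixed_ne_zero [Nontrivial V] (F : V →ₛₗ[frobenius K p] V)
    (hF : Function.Injective F) : ∃ v, v ≠ 0 ∧ F v = v := by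
  classical
  obtain ⟨v, hv⟩ := exists_ne (0 : V)
  let f : ℕ → V := fun i => F^[i] v
  have hf1 : ∀ i, f (i + 1) = F (f i) := fun i => Function.iterate_succ_apply' F i v
  have hfne : ∀ i, f i ≠ 0 := by
    intro i
    induction i with
    | zero => exact hv
    | succ i ih => rw [hf1]; exact (map_ne_zero_iff F hF).2 ih
  have hex : ∃ r, ∃ a : ℕ → K, f r = ∑ i ∈ Finset.range r, a i • f i := by
    obtain ⟨r, hr⟩ := (monotone_stabilizes_iff_noetherian (R := K) (M := V)).2 inferInstance
      ⟨fun r => Submodule.span K (Set.range fun i : Fin r => f i), by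
        intro a b hab
        refine Submodule.span_mono ?_
        rintro _ ⟨i, rfl⟩
        exact ⟨⟨i, i.2.trans_le hab⟩, rfl⟩⟩
    have h1 : f r ∈ Submodule.span K (Set.range fun i : Fin r => f i) := by
      have h2 := hr (r + 1) (Nat.le_succ r)
      change Submodule.span K (Set.range fun i : Fin r => f i) =
        Submodule.span K (Set.range fun i : Fin (r + 1) => f i) at h2
      rw [h2]
      exact Submodule.subset_span ⟨Fin.last r, rfl⟩
    obtain ⟨c, hc⟩ := (Submodule.mem_span_range_iff_exists_fun K).1 h1
    refine ⟨r, fun i => if h : i < r then c ⟨i, h⟩ else 0, ?_⟩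
    rw [← hc, Finset.sum_range]
    exact Finset.sum_congr rfl fun i _ => by simp
  obtain ⟨a, ha⟩ := Nat.find_spec hex
  have hmin := fun m (hm : m < Nat.find hex) => Nat.find_min hex hm
  generalize Nat.find hex = r at ha hmin
  cases r with
  | zero => exact absurd ha (by simpa using hfne 0)
  | succ r =>
    obtain ⟨x, hxr, hx0, hx1⟩ := exists_root_frobenius_system (p := p) a r (by
      by_contra! hcon
      refine hfne (r + 1) (ha.trans (Finset.sum_eq_zero fun i hi => ?_))
      rw [hcon i (by simpa [Nat.lt_succ_iff] using hi), zero_smul])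
    refine ⟨∑ i ∈ Finset.range (r + 1), x i • f i, fun h0 => ?_, ?_⟩
    · rw [Finset.sum_range_succ] at h0
      refine hmin r (Nat.lt_succ_self r) ⟨fun i => -((x r)⁻¹ * x i), ?_⟩
      have h2 := congrArg (fun w => (x r)⁻¹ • w) (eq_neg_of_add_eq_zero_right h0)
      simp only [smul_smul, inv_mul_cancel₀ hxr, one_smul] at h2
      rw [h2, smul_neg, Finset.smul_sum, ← Finset.sum_neg_distrib]
      exact Finset.sum_congr rfl fun i _ => by rw [smul_smul, neg_smul]
    · have h1 : F (∑ i ∈ Finset.range (r + 1), x i • f i) =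
          ∑ i ∈ Finset.range (r + 1), x i ^ p • f (i + 1) := by
        rw [map_sum]
        exact Finset.sum_congr rfl fun i _ => by rw [map_smulₛₗ, hf1]; rfl
      rw [h1, Finset.sum_range_succ, ha, Finset.sum_range_succ' (fun i => x i • f i), hx0,
        Finset.sum_range_succ' (fun i => a i • f i)]
      simp only [hx1, smul_add, add_smul, Finset.smul_sum, smul_smul, Finset.sum_add_distrib]
      rw [add_assoc]
      congr 2
      · exact Finset.sum_congr rfl fun i _ => by rw [mul_comm]
      · rw [mul_comm]

/-- Let `W` be the span of the fixed vectors. As `F(W) = W`, the map induced on `V / W` is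
injective, so a nonzero quotient contains a nonzero fixed vector. Its lift is fixed up to an element
of `W`, and `F - 1` is surjective on `W` by Artin-Schreier; the corrected lift is fixed, hence lies
in `W`, a contradiction. -/
lemma span_fixed_eq_top (F : V →ₛₗ[frobenius K p] V) (hF : Function.Injective F) :
    Submodule.span K {v | F v = v} = ⊤ := by
  classical
  set W := Submodule.span K {v | F v = v} with hW
  have hfix : ∀ v, F v = v → v ∈ W := fun v hv => Submodule.subset_span hv
  have h1 : ∀ w ∈ W, ∃ u ∈ W, F u = w := by
    intro w hw
    refine Submodule.span_induction (p := fun w _ => ∃ u ∈ W, F u = w) ?_ ?_ ?_ ?_ hw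
    · exact fun v hv => ⟨v, hfix v hv, hv⟩
    · exact ⟨0, zero_mem _, map_zero _⟩
    · rintro _ _ _ _ ⟨u, hu, rfl⟩ ⟨v, hv, rfl⟩
      exact ⟨u + v, add_mem hu hv, map_add _ _ _⟩
    · rintro c _ _ ⟨u, hu, rfl⟩
      obtain ⟨z, hz⟩ := IsAlgClosed.exists_pow_nat_eq c hp.out.pos
      exact ⟨z • u, Submodule.smul_mem _ _ hu, by rw [map_smulₛₗ, frobenius_def, hz]⟩
  have h2 : ∀ w ∈ W, ∃ u ∈ W, F u - u = w := by
    intro w hw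
    have : ∀ c : K, ∃ u ∈ W, F u - u = c • w := by
      refine Submodule.span_induction (p := fun w _ => ∀ c : K, ∃ u ∈ W, F u - u = c • w)
        ?_ ?_ ?_ ?_ hw
      · intro v hv c
        obtain ⟨y, hy⟩ := exists_artinSchreier (p := p) c
        refine ⟨y • v, Submodule.smul_mem _ _ (hfix v hv), ?_⟩
        rw [map_smulₛₗ, frobenius_def, ← hy, sub_smul]
        congr 2
      · exact fun c => ⟨0, zero_mem _, by simp⟩
      · intro u v _ _ hu hv c
        obtain ⟨u', hu', hu⟩ := hu c
        obtain ⟨v', hv', hv⟩ := hv c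
        exact ⟨u' + v', add_mem hu' hv', by rw [map_add, smul_add, ← hu, ← hv]; abel⟩
      · intro a u _ hu c
        obtain ⟨u', hu', hu⟩ := hu (c * a)
        exact ⟨u', hu', by rw [hu, mul_smul]⟩
    simpa using this 1
  by_contra hne
  have : Nontrivial (V ⧸ W) := Submodule.Quotient.nontrivial_iff.2 hne
  have hle : W ≤ W.comap F := Submodule.span_le.2 fun v hv => by
    rw [SetLike.mem_coe, Submodule.mem_comap, hv]
    exact hfix v hv
  obtain ⟨v, hv0, hv⟩ := exists_fixed_ne_zero (W.mapQ W F hle) (by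
    rw [injective_iff_map_eq_zero]
    intro x hx
    obtain ⟨x, rfl⟩ := Submodule.Quotient.mk_surjective _ x
    rw [Submodule.mapQ_apply, Submodule.Quotient.mk_eq_zero] at hx
    obtain ⟨u, hu, hux⟩ := h1 _ hx
    rw [Submodule.Quotient.mk_eq_zero, ← hF hux]
    exact hu)
  obtain ⟨v, rfl⟩ := Submodule.Quotient.mk_surjective _ v
  rw [Submodule.mapQ_apply, Submodule.Quotient.eq] at hv
  obtain ⟨u, hu, huv⟩ := h2 _ hv
  refine hv0 ((Submodule.Quotient.mk_eq_zero _).2 ?_)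
  have h3 : v - u ∈ W := hfix _ (by
    rw [map_sub, sub_eq_sub_iff_sub_eq_sub, ← huv])
  simpa using add_mem h3 hu

variable {ι : Type*} [Fintype ι] [DecidableEq ι]

lemma exists_mul_map_frobenius_eq (G : Matrix ι ι K) (hG : IsUnit G) :
    ∃ Y : Matrix ι ι K, IsUnit Y ∧ G * Y.map (frobenius K p) = Y := by
  let F : (ι → K) →ₛₗ[frobenius K p] (ι → K) :=
    { toFun := fun v => G.mulVec fun i => frobenius K p (v i)
      map_add' := fun v w => by
        rw [← Matrix.mulVec_add]; congr 1; funext i; simp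
      map_smul' := fun c v => by
        rw [← Matrix.mulVec_smul]; congr 1; funext i; simp }
  have hFapp : ∀ v, F v = G.mulVec fun i => frobenius K p (v i) := fun v => rfl
  have hF : Function.Injective F := by
    rw [injective_iff_map_eq_zero]
    intro v hv
    obtain ⟨u, rfl⟩ := hG
    have h1 := congrArg (fun w => (u⁻¹ : (Matrix ι ι K)ˣ).val.mulVec w) hv
    simp only [hFapp, Matrix.mulVec_mulVec, Units.inv_mul, Matrix.one_mulVec,
      Matrix.mulVec_zero] at h1
    funext i
    exact (map_eq_zero _).1 (congrFun h1 i)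
  let b := Module.Basis.ofSpan (span_fixed_eq_top F hF).ge
  let e := b.indexEquiv (Pi.basisFun K ι)
  let b' := b.reindex e
  have hb' : ∀ j, F (b' j) = b' j := fun j => by
    have h1 := Module.Basis.ofSpan_subset (span_fixed_eq_top F hF).ge ⟨e.symm j, rfl⟩
    rw [Module.Basis.reindex_apply]
    exact h1
  refine ⟨Matrix.of fun i j => b' j i, ?_, Matrix.ext fun i j => ?_⟩
  · have h1 : (Matrix.of fun i j => b' j i) = (Pi.basisFun K ι).toMatrix b' :=
      Matrix.ext fun i j => by simp [Module.Basis.toMatrix_apply]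
    rw [h1]
    exact IsUnit.of_mul_eq_one _ ((Pi.basisFun K ι).toMatrix_mul_toMatrix_flip b')
  · exact congrFun (hb' j) i

/-- In a basis of fixed vectors `G` becomes the identity, and the equation becomes an Artin-Schreier
equation in each entry. -/
lemma exists_mul_map_frobenius_sub_eq (G : Matrix ι ι K) (hG : IsUnit G) (C : Matrix ι ι K) :
    ∃ U : Matrix ι ι K, G * U.map (frobenius K p) - U = C := by
  obtain ⟨Y, ⟨Y, rfl⟩, hY⟩ := exists_mul_map_frobenius_eq (p := p) G hG
  choose v hv using fun i j => exists_artinSchreier (p := p) ((Y⁻¹.val * C) i j)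
  refine ⟨Y.val * Matrix.of v, ?_⟩
  have h1 : (Matrix.of v).map (frobenius K p) = Matrix.of v + Y⁻¹.val * C :=
    Matrix.ext fun i j => by
      rw [Matrix.add_apply, ← hv i j]; simp [frobenius_def]
  rw [Matrix.map_mul, ← mul_assoc, hY, h1, mul_add, add_sub_cancel_left, ← mul_assoc,
    Units.mul_inv, one_mul]

end FixedVectors

/-! ### Lang's theorem over Witt vectors and over power series. -/

section Lang

variable {p : ℕ} [hp : Fact p.Prime] {K : Type*} [Field K] [CharP K p] [IsAlgClosed K]
  {ι : Type*} [Fintype ι] [DecidableEq ι]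

lemma constantCoeff_wittFrobenius (x : WittVector p K) :
    WittVector.constantCoeff (WittVector.frobenius x) =
      frobenius K p (WittVector.constantCoeff x) := by
  change (WittVector.frobenius x).coeff 0 = _
  rw [WittVector.coeff_frobenius_charP]
  rfl

lemma map_constantCoeff_frobenius (Y : Matrix ι ι (WittVector p K)) :
    (Y.map (WittVector.frobenius (p := p))).map WittVector.constantCoeff =
      (Y.map WittVector.constantCoeff).map (frobenius K p) :=
  Matrix.ext fun _ _ => constantCoeff_wittFrobenius _

lemma exists_p_smul_of_map_constantCoeff (M : Matrix ι ι (WittVector p K))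
    (h : M.map WittVector.constantCoeff = 0) : ∃ C, M = (p : WittVector p K) • C := by
  have h1 : ∀ i j, ∃ c, M i j = (p : WittVector p K) * c := fun i j => by
    have h2 : M i j ∈ RingHom.ker (WittVector.constantCoeff : WittVector p K →+* K) :=
      congrFun (congrFun h i) j
    rwa [WittVector.ker_constantCoeff, Ideal.mem_span_singleton] at h2
  choose c hc using h1
  exact ⟨Matrix.of c, Matrix.ext fun i j => hc i j⟩

lemma isUnit_map_constantCoeff {G : Matrix ι ι (WittVector p K)} :
    IsUnit (G.map WittVector.constantCoeff) ↔ IsUnit G := by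
  rw [Matrix.isUnit_iff_isUnit_det, Matrix.isUnit_iff_isUnit_det, ← RingHom.mapMatrix_apply,
    ← RingHom.map_det]
  refine ⟨fun h => WittVector.isUnit_of_coeff_zero_ne_zero _ h.ne_zero, fun h => h.map _⟩

/-- The equation is additive in `U` and compatible with multiplication by `p`, so its solvability
modulo `p` suffices: solve for the residue, divide the error by `p`, and sum the corrections. -/
lemma exists_mul_map_wittFrobenius_sub_eq (G : Matrix ι ι (WittVector p K)) (hG : IsUnit G)
    (C : Matrix ι ι (WittVector p K)) :
    ∃ U, G * U.map (WittVector.frobenius (p := p)) - U = C := by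
  let L : Matrix ι ι (WittVector p K) → Matrix ι ι (WittVector p K) :=
    fun U => G * U.map (WittVector.frobenius (p := p)) - U
  have hstep : ∀ C, ∃ U C', C = L U + (p : WittVector p K) • C' := by
    intro C
    obtain ⟨u, hu⟩ := exists_mul_map_frobenius_sub_eq (p := p) _ (isUnit_map_constantCoeff.2 hG)
      (C.map WittVector.constantCoeff)
    choose U hU using fun i j => WittVector.constantCoeff_surjective (p := p) (u i j)
    have hU' : (Matrix.of U).map WittVector.constantCoeff = u := Matrix.ext fun i j => hU i j
    obtain ⟨C', hC'⟩ := exists_p_smul_of_map_constantCoeff (C - L (Matrix.of U)) (by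
      rw [Matrix.map_sub _ (map_sub _), Matrix.map_sub _ (map_sub _), Matrix.map_mul,
        map_constantCoeff_frobenius, hU', hu, sub_self])
    exact ⟨_, C', by rw [← hC', add_sub_cancel]⟩
  choose u r hur using hstep
  let c : ℕ → Matrix ι ι (WittVector p K) := fun N => r^[N] C
  have hc : ∀ N, c N = L (u (c N)) + (p : WittVector p K) • c (N + 1) := fun N => by
    conv_lhs => rw [hur (c N)]
    congr 2
    exact (Function.iterate_succ_apply' r N C).symm
  have hLadd : ∀ U V, L (U + V) = L U + L V := fun U V => by
    simp only [L]
    rw [Matrix.map_add _ (map_add _), mul_add]; abel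
  have hLp : ∀ (N : ℕ) U, L ((p : WittVector p K) ^ N • U) = (p : WittVector p K) ^ N • L U := by
    intro N U
    have h1 : ((p : WittVector p K) ^ N • U).map (WittVector.frobenius (p := p)) =
        (p : WittVector p K) ^ N • U.map (WittVector.frobenius (p := p)) :=
      Matrix.ext fun i j => by simp [map_mul]
    simp only [L]
    rw [h1, Matrix.mul_smul, smul_sub]
  have hL0 : L 0 = 0 := by simp [L]
  have hc0 : c 0 = C := rfl
  choose S hS using fun i j => psum_wittVector (p := p) (k := K) fun N => u (c N) i j
  refine ⟨Matrix.of S, ?_⟩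
  change L (Matrix.of S) = C
  clear_value L c
  have hpart : ∀ M, C = L (∑ N ∈ Finset.range M, (p : WittVector p K) ^ N • u (c N)) +
      (p : WittVector p K) ^ M • c M := by
    intro M
    induction M with
    | zero =>
      simp only [Finset.range_zero, Finset.sum_empty, pow_zero, one_smul]
      rw [hL0, zero_add, hc0]
    | succ M ih =>
      rw [Finset.sum_range_succ, hLadd, hLp, pow_succ, mul_smul, add_assoc, ← smul_add, ← hc,
        ← ih]
  refine Matrix.ext fun i j => sub_eq_zero.1 (psep_wittVector _ fun M => ?_)
  have h1 : ∃ T, Matrix.of S = ∑ N ∈ Finset.range M, (p : WittVector p K) ^ N • u (c N) +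
      (p : WittVector p K) ^ M • T := by
    choose T hT using fun i j => hS i j M
    refine ⟨Matrix.of T, Matrix.ext fun i j => ?_⟩
    rw [Matrix.add_apply, Matrix.sum_apply, Matrix.smul_apply, Matrix.of_apply, Matrix.of_apply,
      smul_eq_mul, ← hT, Finset.sum_congr rfl fun N _ => Matrix.smul_apply _ _ _ _]
    simp only [smul_eq_mul]
    ring
  obtain ⟨T, hT⟩ := h1
  have h2 : L (Matrix.of S) - C = (p : WittVector p K) ^ M • (L T - c M) := by
    have h3 : L (Matrix.of S) = L (∑ N ∈ Finset.range M, (p : WittVector p K) ^ N • u (c N)) +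
        (p : WittVector p K) ^ M • L T := by rw [hT, hLadd, hLp]
    rw [h3, smul_sub]
    conv_lhs => rhs; rw [hpart M]
    exact add_sub_add_left_eq_sub _ _ _
  exact ⟨_, congrFun (congrFun h2 i) j⟩

/-- A solution modulo `p` lifts to a matrix with error `p C`; the linear equation just solved gives
a correction `p U` that removes the whole error at once. -/
lemma exists_mul_map_wittFrobenius_eq (G : Matrix ι ι (WittVector p K)) (hG : IsUnit G) :
    ∃ Y, IsUnit Y ∧ G * Y.map (WittVector.frobenius (p := p)) = Y := by
  obtain ⟨y, hy, hGy⟩ := exists_mul_map_frobenius_eq (p := p) _ (isUnit_map_constantCoeff.2 hG)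
  choose Y hY using fun i j => WittVector.constantCoeff_surjective (p := p) (y i j)
  have hY' : (Matrix.of Y).map WittVector.constantCoeff = y := Matrix.ext fun i j => hY i j
  obtain ⟨C, hC⟩ := exists_p_smul_of_map_constantCoeff
    (G * (Matrix.of Y).map (WittVector.frobenius (p := p)) - Matrix.of Y) (by
      rw [Matrix.map_sub _ (map_sub _), Matrix.map_mul, map_constantCoeff_frobenius, hY', hGy,
        sub_self])
  obtain ⟨U, hU⟩ := exists_mul_map_wittFrobenius_sub_eq G hG C
  have h1 : ((p : WittVector p K) • U).map (WittVector.frobenius (p := p)) =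
      (p : WittVector p K) • U.map (WittVector.frobenius (p := p)) :=
    Matrix.ext fun i j => by simp [map_mul]
  refine ⟨Matrix.of Y - (p : WittVector p K) • U, isUnit_map_constantCoeff.1 ?_, ?_⟩
  · have h2 : (Matrix.of Y - (p : WittVector p K) • U).map WittVector.constantCoeff = y :=
      Matrix.ext fun i j => by
        have h3 : WittVector.constantCoeff (p : WittVector p K) = 0 := by
          rw [map_natCast, CharP.cast_eq_zero]
        rw [Matrix.map_apply, Matrix.sub_apply, Matrix.smul_apply, smul_eq_mul, map_sub, map_mul,
          h3, zero_mul, sub_zero, Matrix.of_apply, hY]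
    rw [h2]; exact hy
  · rw [Matrix.map_sub _ (map_sub _), mul_sub, h1, Matrix.mul_smul, eq_add_of_sub_eq hC,
      eq_add_of_sub_eq hU, smul_add]
    abel

variable {n : ℕ}

/-- `f` and `g` agree in degrees `≤ N`. -/
def AgreeUpTo (N : ℕ) (f g : PS p K n) : Prop :=
  ∀ m : Fin n →₀ ℕ, m.degree ≤ N → MvPowerSeries.coeff m f = MvPowerSeries.coeff m g

/-- The standard lift multiplies degrees by `p ≥ 2`, so coefficients of degree at most `N + 1` of
the image depend only on those of degree at most `N`. -/
lemma AgreeUpTo.stdLift [PerfectRing K p] {N : ℕ} {f g : PS p K n} (h : AgreeUpTo N f g) :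
    AgreeUpTo (N + 1) ((stdLift p K n).toRingHom f) ((stdLift p K n).toRingHom g) := by
  intro m hm
  rw [stdLift_apply, stdLift_apply, MvPowerSeries.coeff_map, MvPowerSeries.coeff_map]
  congr 1
  by_cases hd : ∀ i, p ∣ m i
  · obtain ⟨m', rfl⟩ : ∃ m', p • m' = m := ⟨m.mapRange (fun a => a / p) (by simp), by
      ext i; simp [Nat.mul_div_cancel' (hd i)]⟩
    rw [MvPowerSeries.coeff_expand_smul, MvPowerSeries.coeff_expand_smul]
    refine h m' ?_
    have h1 : (p • m').degree = p * m'.degree := by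
      rw [map_nsmul, smul_eq_mul]
    rw [h1] at hm
    have := hp.out.two_le
    by_contra! hcon
    nlinarith
  · push Not at hd
    obtain ⟨i, hi⟩ := hd
    rw [MvPowerSeries.coeff_expand_of_not_dvd _ _ _ hi,
      MvPowerSeries.coeff_expand_of_not_dvd _ _ _ hi]

lemma agreeUpTo_mul_matrix {N : ℕ} (G : Matrix ι ι (PS p K n)) {Y Z : Matrix ι ι (PS p K n)}
    (h : ∀ i j, AgreeUpTo N (Y i j) (Z i j)) (i j : ι) :
    AgreeUpTo N ((G * Y) i j) ((G * Z) i j) := by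
  classical
  intro m hm
  rw [Matrix.mul_apply, Matrix.mul_apply, map_sum, map_sum]
  refine Finset.sum_congr rfl fun x _ => ?_
  rw [MvPowerSeries.coeff_mul, MvPowerSeries.coeff_mul]
  refine Finset.sum_congr rfl fun a ha => ?_
  rw [h x j a.2]
  refine le_trans ?_ hm
  rw [← (Finset.HasAntidiagonal.mem_antidiagonal.1 ha), map_add]
  exact Nat.le_add_left _ _

/-- Lang's theorem: a unit root module over the strictly henselian ring `W[[t]]` has a basis of
fixed vectors. -/
theorem exists_mul_map_stdLift_eq [PerfectRing K p] (G : Matrix ι ι (PS p K n)) (hG : IsUnit G) :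
    ∃ Y, IsUnit Y ∧ G * Y.map (stdLift p K n).toRingHom = Y := by
  have hG0 : IsUnit (G.map (MvPowerSeries.constantCoeff (σ := Fin n) (R := WittVector p K))) :=
    hG.map (RingHom.mapMatrix (MvPowerSeries.constantCoeff (σ := Fin n) (R := WittVector p K)))
  obtain ⟨Y₀, hY₀, hGY⟩ := exists_mul_map_wittFrobenius_eq _ hG0
  let L : Matrix ι ι (PS p K n) → Matrix ι ι (PS p K n) :=
    fun Y => G * Y.map (stdLift p K n).toRingHom
  -- Iteration starts from the solution at the origin; each application of `L` makes one more degree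
  -- stationary, and the limit is read off degree by degree.
  let Y : ℕ → Matrix ι ι (PS p K n) := fun N => L^[N] (Y₀.map MvPowerSeries.C)
  have hYs : ∀ N, Y (N + 1) = L (Y N) := fun N => Function.iterate_succ_apply' L N _
  have hLagree : ∀ (N : ℕ) {Y Z : Matrix ι ι (PS p K n)}, (∀ i j, AgreeUpTo N (Y i j) (Z i j)) →
      ∀ i j, AgreeUpTo (N + 1) (L Y i j) (L Z i j) := fun N Y Z h i j =>
    agreeUpTo_mul_matrix G (fun i j => (h i j).stdLift) i j
  have hY : ∀ N i j, AgreeUpTo N (Y (N + 1) i j) (Y N i j) := by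
    intro N
    induction N with
    | zero =>
      intro i j m hm
      obtain rfl : m = 0 := (Finsupp.degree_eq_zero_iff m).1 (Nat.le_zero.1 hm)
      rw [hYs]
      have h1 := congrFun (congrFun hGY i) j
      change _ = MvPowerSeries.coeff 0 (MvPowerSeries.C (Y₀ i j))
      rw [MvPowerSeries.coeff_zero_C, ← h1]
      simp only [L, Y, Function.iterate_zero, id, Matrix.mul_apply, Matrix.map_apply, map_sum,
        MvPowerSeries.coeff_zero_eq_constantCoeff, map_mul, (stdLift p K n).map_const,
        MvPowerSeries.constantCoeff_C]
    | succ N ih =>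
      intro i j
      have h1 := hLagree N ih i j
      rwa [← hYs, ← hYs] at h1
  have hY' : ∀ N M i j, N ≤ M → AgreeUpTo N (Y M i j) (Y N i j) := by
    intro N M i j hNM
    induction M, hNM using Nat.le_induction with
    | base => exact fun _ _ => rfl
    | succ M hNM ih => exact fun m hm => (hY M i j m (hm.trans hNM)).trans (ih m hm)
  let Z : Matrix ι ι (PS p K n) := Matrix.of fun i j => mkPS fun m =>
    MvPowerSeries.coeff m (Y m.degree i j)
  have hZ : ∀ N i j, AgreeUpTo N (Z i j) (Y N i j) := by
    intro N i j m hm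
    refine (coeff_mkPS _ _).trans ?_
    exact (hY' m.degree N i j hm m le_rfl).symm
  refine ⟨Z, ?_, Matrix.ext fun i j => ?_⟩
  · rw [Matrix.isUnit_iff_isUnit_det, MvPowerSeries.isUnit_iff_constantCoeff, RingHom.map_det,
      ← Matrix.isUnit_iff_isUnit_det]
    convert hY₀ using 1
    refine Matrix.ext fun i j => ?_
    rw [RingHom.mapMatrix_apply, Matrix.map_apply, ← MvPowerSeries.coeff_zero_eq_constantCoeff_apply,
      hZ 0 i j 0 (by simp)]
    exact MvPowerSeries.coeff_zero_C _
  · refine MvPowerSeries.ext fun m => ?_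
    have h1 := hLagree m.degree (hZ m.degree) i j m (Nat.le_succ _)
    have h2 := hZ (m.degree + 1) i j m (Nat.le_succ _)
    rw [h2, hYs]
    exact h1

end Lang

/-! ### Connection, Frobenius and form after extension of scalars to `W(k̄)[[t]]`. -/

section Operators

variable {p : ℕ} [hp : Fact p.Prime] {k : Type*} [Field k] [CharP k p] [PerfectRing k p] {n : ℕ}
  {H : Type*} [AddCommGroup H] [Module (PS p k n) H] {X : FCrystal p k n H}

lemma pd_mul {R : Type*} [CommRing R] (l : Fin n) (f g : MvPowerSeries (Fin n) R) :
    pd l (f * g) = pd l f * g + f * pd l g := by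
  simp only [pd, Derivation.leibniz, smul_eq_mul]
  ring

lemma pd_add {R : Type*} [CommRing R] (l : Fin n) (f g : MvPowerSeries (Fin n) R) :
    pd l (f + g) = pd l f + pd l g := map_add _ _ _

lemma pd_sum {R κ : Type*} [CommRing R] (l : Fin n) (s : Finset κ)
    (f : κ → MvPowerSeries (Fin n) R) : pd l (∑ x ∈ s, f x) = ∑ x ∈ s, pd l (f x) := map_sum _ _ _

lemma pd_zero {R : Type*} [CommRing R] (l : Fin n) :
    pd l (0 : MvPowerSeries (Fin n) R) = 0 := map_zero _

lemma pd_one {R : Type*} [CommRing R] (l : Fin n) :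
    pd l (1 : MvPowerSeries (Fin n) R) = 0 := Derivation.map_one_eq_zero _

lemma Dbar_tmul (l : Fin n) (a : PSbar p k n) (x : H) :
    Dbar X l (a ⊗ₜ x) = pd l a ⊗ₜ x + a ⊗ₜ X.D l x := rfl

lemma Dbar_smul (l : Fin n) (a : PSbar p k n) (x : PSbar p k n ⊗[PS p k n] H) :
    Dbar X l (a • x) = pd l a • x + a • Dbar X l x := by
  induction x using TensorProduct.induction_on with
  | zero => simp
  | tmul b x =>
    rw [TensorProduct.smul_tmul', TensorProduct.smul_tmul', Dbar_tmul, Dbar_tmul, smul_add,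
      TensorProduct.smul_tmul', TensorProduct.smul_tmul', smul_eq_mul, smul_eq_mul, pd_mul,
      TensorProduct.add_tmul, add_assoc]
    rfl
  | add x y hx hy =>
    rw [smul_add, map_add, hx, hy, map_add, smul_add, smul_add]
    abel

variable {φb : FrobLift p (AlgebraicClosure k) n} {φ : FrobLift p k n} (hφ : Extends φb φ)

lemma Fbar_tmul (a : PSbar p k n) (x : H) :
    Fbar X hφ (a ⊗ₜ x) = φb.toRingHom a ⊗ₜ X.F φ x := rfl

lemma Fbar_smul (a : PSbar p k n) (x : PSbar p k n ⊗[PS p k n] H) :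
    Fbar X hφ (a • x) = φb.toRingHom a • Fbar X hφ x := by
  induction x using TensorProduct.induction_on with
  | zero => simp
  | tmul b x =>
    rw [TensorProduct.smul_tmul', Fbar_tmul, Fbar_tmul, TensorProduct.smul_tmul', smul_eq_mul,
      smul_eq_mul, map_mul]
  | add x y hx hy => rw [smul_add, map_add, hx, hy, map_add, smul_add]

lemma Dbar_comm (i j : Fin n) (x : PSbar p k n ⊗[PS p k n] H) :
    Dbar X i (Dbar X j x) = Dbar X j (Dbar X i x) := by
  induction x using TensorProduct.induction_on with
  | zero => simp
  | tmul b x =>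
    have h1 : pd i (pd j b) = pd j (pd i b) := by
      refine MvPowerSeries.ext fun m => ?_
      simp only [pd, MvPowerSeries.coeff_pderiv, Finsupp.add_apply, Finsupp.single_apply]
      rw [add_right_comm]
      by_cases hij : i = j
      · rw [hij]
      · rw [if_neg hij, if_neg (Ne.symm hij)]
        push_cast
        ring
    simp only [Dbar_tmul, map_add, X.integrable i j, h1]
    abel
  | add x y hx hy => rw [map_add, map_add, hx, hy, map_add, map_add]

lemma pd_toKPS (l : Fin n) (a : PSbar p k n) :
    pd l (algebraMap (PSbar p k n) (KPS p k n) a) =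
      algebraMap (PSbar p k n) (KPS p k n) (pd l a) := by
  refine MvPowerSeries.ext fun m => ?_
  simp only [pd, MvPowerSeries.coeff_pderiv, coeff_toKPS, map_mul, map_add, map_natCast, map_one]

include hφ in
-- The chain rule for the extension is inherited from `frobSer φ`, of which it is the restriction to
-- integral series.
lemma pd_frobLift_bar (l : Fin n) (a : PSbar p k n) : pd l (φb.toRingHom a) =
    ∑ j, algebraMap (PS p k n) (PSbar p k n) (pd l (φ.toRingHom (MvPowerSeries.X j))) *
      φb.toRingHom (pd j a) := by
  refine toKPS_injective ?_
  have h1 := pd_frobSer φ (toOverconv p k n a) l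
  rw [frobSer_of_extends hφ, pd_toKPS] at h1
  rw [h1, map_sum]
  refine Finset.sum_congr rfl fun j _ => ?_
  have h2 : (⟨pd j (toOverconv p k n a : KPS p k n), (toOverconv p k n a).2.pd j⟩ :
      Overconv p k n) = toOverconv p k n (pd j a) := Subtype.ext (pd_toKPS j a)
  rw [h2, frobSer_of_extends hφ, map_mul, ← pd_algebraMap, ← pd_toKPS]
  rfl

lemma Dbar_Fbar (l : Fin n) (x : PSbar p k n ⊗[PS p k n] H) :
    Dbar X l (Fbar X hφ x) =
      ∑ j, algebraMap (PS p k n) (PSbar p k n) (pd l (φ.toRingHom (MvPowerSeries.X j))) •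
        Fbar X hφ (Dbar X j x) := by
  induction x using TensorProduct.induction_on with
  | zero => simp
  | tmul b x =>
    rw [Fbar_tmul, Dbar_tmul, X.horizontal, pd_frobLift_bar hφ, TensorProduct.sum_tmul,
      TensorProduct.tmul_sum, ← Finset.sum_add_distrib]
    refine Finset.sum_congr rfl fun j _ => ?_
    rw [Dbar_tmul, map_add, Fbar_tmul, Fbar_tmul, smul_add, TensorProduct.smul_tmul',
      TensorProduct.smul_tmul', smul_eq_mul, TensorProduct.tmul_smul, TensorProduct.smul_tmul',
      Algebra.smul_def, smul_eq_mul]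
  | add x y hx hy =>
    rw [map_add, map_add, hx, hy, ← Finset.sum_add_distrib]
    exact Finset.sum_congr rfl fun j _ => by rw [map_add, map_add, smul_add]

variable {B : LinearMap.BilinForm (PS p k n) H}

lemma baseChange_Dbar (hB : ∀ (i : Fin n) (x y : H), B (X.D i x) y + B x (X.D i y) = pd i (B x y))
    (l : Fin n) (x y : PSbar p k n ⊗[PS p k n] H) :
    B.baseChange (PSbar p k n) (Dbar X l x) y + B.baseChange (PSbar p k n) x (Dbar X l y) =
      pd l (B.baseChange (PSbar p k n) x y) := by
  induction x using TensorProduct.induction_on with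
  | zero => simp [pd_zero]
  | add x x' hx hx' =>
    rw [map_add, map_add, map_add, LinearMap.add_apply, LinearMap.add_apply, LinearMap.add_apply,
      pd_add, ← hx, ← hx']
    abel
  | tmul a x =>
    induction y using TensorProduct.induction_on with
    | zero => simp [pd_zero]
    | add y y' hy hy' =>
      rw [map_add, map_add, map_add, map_add, pd_add, ← hy, ← hy']
      abel
    | tmul b y =>
      simp only [Dbar_tmul, map_add, LinearMap.add_apply, LinearMap.BilinForm.baseChange_tmul,
        Algebra.smul_def]
      rw [pd_mul, pd_algebraMap, ← hB, pd_mul, map_add]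
      ring

lemma baseChange_Fbar (hB : ∀ (x y : H), B (X.F φ x) (X.F φ y) =
      (p : PS p k n) ^ 3 * φ.toRingHom (B x y)) (x y : PSbar p k n ⊗[PS p k n] H) :
    B.baseChange (PSbar p k n) (Fbar X hφ x) (Fbar X hφ y) =
      (p : PSbar p k n) ^ 3 * φb.toRingHom (B.baseChange (PSbar p k n) x y) := by
  induction x using TensorProduct.induction_on with
  | zero => simp
  | add x x' hx hx' =>
    rw [map_add, map_add, map_add, LinearMap.add_apply, LinearMap.add_apply, map_add, mul_add,
      ← hx, ← hx']
  | tmul a x =>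
    induction y using TensorProduct.induction_on with
    | zero => simp
    | add y y' hy hy' => rw [map_add, map_add, map_add, map_add, mul_add, ← hy, ← hy']
    | tmul b y =>
      simp only [Fbar_tmul, LinearMap.BilinForm.baseChange_tmul, Algebra.smul_def]
      rw [hB, map_mul, map_pow, map_natCast, map_mul, map_mul, hφ]
      ring

end Operators

/-! ### Matrix form of the axioms: gauge change, integrability, horizontality, compatibility with
the form. -/

section MatrixIdentities

variable {p : ℕ} [hp : Fact p.Prime] {k : Type*} [Field k] [CharP k p] [PerfectRing k p] {n : ℕ}
  {H : Type*} [AddCommGroup H] [Module (PS p k n) H] {X : FCrystal p k n H}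
  {φb : FrobLift p (AlgebraicClosure k) n} {φ : FrobLift p k n} (hφ : Extends φb φ)
  {ι : Type*} [Fintype ι] [DecidableEq ι]
  (e b : Module.Basis ι (PSbar p k n) (PSbar p k n ⊗[PS p k n] H))

lemma matrixOf_apply {R M κ : Type*} [CommRing R] [AddCommGroup M] [Module R M]
    (b : Module.Basis κ R M) (g : M → M) (i j : κ) : matrixOf b g i j = b.repr (g (b j)) i := rfl

lemma repr_Dbar (l : Fin n) (x : PSbar p k n ⊗[PS p k n] H) (i : ι) :
    e.repr (Dbar X l x) i =
      pd l (e.repr x i) + ∑ j, matrixOf e (Dbar X l) i j * e.repr x j := by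
  conv_lhs => rw [← e.sum_repr x]
  simp only [map_sum, Dbar_smul, Finset.sum_add_distrib, map_add, map_smul, Finsupp.add_apply,
    Finsupp.finsetSum_apply, Finsupp.smul_apply, smul_eq_mul, e.repr_self, Finsupp.single_apply,
    mul_ite, mul_one, mul_zero, Finset.sum_ite_eq', Finset.mem_univ, if_true]
  congr 1
  exact Finset.sum_congr rfl fun j _ => mul_comm _ _

lemma repr_Fbar (x : PSbar p k n ⊗[PS p k n] H) (i : ι) :
    e.repr (Fbar X hφ x) i =
      ∑ j, matrixOf e (Fbar X hφ) i j * φb.toRingHom (e.repr x j) := by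
  conv_lhs => rw [← e.sum_repr x]
  simp only [map_sum, Fbar_smul, map_smul, Finsupp.finsetSum_apply, Finsupp.smul_apply, smul_eq_mul]
  exact Finset.sum_congr rfl fun j _ => mul_comm _ _

lemma repr_change (x : PSbar p k n ⊗[PS p k n] H) (i : ι) :
    b.repr x i = ∑ j, b.toMatrix e i j * e.repr x j := by
  conv_lhs => rw [← e.sum_repr x]
  simp only [map_sum, map_smul, Finsupp.finsetSum_apply, Finsupp.smul_apply, smul_eq_mul]
  exact Finset.sum_congr rfl fun j _ => mul_comm _ _

lemma toMatrix_mul_matrixOf_Dbar (l : Fin n) :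
    b.toMatrix e * matrixOf e (Dbar X l) =
      (b.toMatrix e).map (pd l) + matrixOf b (Dbar X l) * b.toMatrix e := by
  refine Matrix.ext fun i j => ?_
  rw [Matrix.mul_apply, Matrix.add_apply, Matrix.mul_apply]
  exact (repr_change e b (Dbar X l (e j)) i).symm.trans (repr_Dbar b l (e j) i)

lemma toMatrix_mul_matrixOf_Fbar :
    b.toMatrix e * matrixOf e (Fbar X hφ) =
      matrixOf b (Fbar X hφ) * (b.toMatrix e).map φb.toRingHom := by
  refine Matrix.ext fun i j => ?_
  rw [Matrix.mul_apply, Matrix.mul_apply]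
  exact (repr_change e b (Fbar X hφ (e j)) i).symm.trans (repr_Fbar hφ b (e j) i)

lemma matrixOf_Dbar_integrable (i j : Fin n) :
    (matrixOf e (Dbar X j)).map (pd i) + matrixOf e (Dbar X i) * matrixOf e (Dbar X j) =
      (matrixOf e (Dbar X i)).map (pd j) + matrixOf e (Dbar X j) * matrixOf e (Dbar X i) := by
  refine Matrix.ext fun x y => ?_
  rw [Matrix.add_apply, Matrix.mul_apply, Matrix.add_apply, Matrix.mul_apply]
  have h1 := repr_Dbar (X := X) e i (Dbar X j (e y)) x
  rw [Dbar_comm] at h1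
  exact h1.symm.trans (repr_Dbar e j (Dbar X i (e y)) x)

lemma matrixOf_horizontal (l : Fin n) :
    (matrixOf e (Fbar X hφ)).map (pd l) + matrixOf e (Dbar X l) * matrixOf e (Fbar X hφ) =
      ∑ j, algebraMap (PS p k n) (PSbar p k n) (pd l (φ.toRingHom (MvPowerSeries.X j))) •
        (matrixOf e (Fbar X hφ) * (matrixOf e (Dbar X j)).map φb.toRingHom) := by
  refine Matrix.ext fun x y => ?_
  rw [Matrix.add_apply, Matrix.mul_apply, Matrix.sum_apply]
  refine (repr_Dbar e l (Fbar X hφ (e y)) x).symm.trans ?_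
  rw [Dbar_Fbar, map_sum, Finsupp.finsetSum_apply]
  refine Finset.sum_congr rfl fun j _ => ?_
  rw [map_smul, Finsupp.smul_apply, repr_Fbar, Matrix.smul_apply, Matrix.mul_apply]
  rfl

lemma form_eq_sum {R M κ : Type*} [CommRing R] [AddCommGroup M] [Module R M] [Fintype κ]
    (B : LinearMap.BilinForm R M) (b : Module.Basis κ R M) (x y : M) :
    B x y = ∑ i, ∑ j, b.repr x i * B (b i) (b j) * b.repr y j := by
  conv_lhs => rw [← b.sum_repr x, ← b.sum_repr y]
  simp only [map_sum, LinearMap.sum_apply, map_smul, LinearMap.smul_apply, smul_eq_mul]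
  rw [Finset.sum_comm]
  refine Finset.sum_congr rfl fun i _ => ?_
  rw [Finset.mul_sum]
  exact Finset.sum_congr rfl fun j _ => by ring

variable {B : LinearMap.BilinForm (PS p k n) H}
  (e : Module.Basis (Idx n) (PSbar p k n) (PSbar p k n ⊗[PS p k n] H))
  (he : ∀ i j, B.baseChange (PSbar p k n) (e i) (e j) = gramMatrix (PSbar p k n) n i j)

lemma gramMatrix_map {R S : Type*} [CommRing R] [CommRing S] (f : R →+* S) :
    (gramMatrix R n).map f = gramMatrix S n := by
  refine Matrix.ext fun i j => ?_
  rcases i with ((i | i) | (i | i)) <;> rcases j with ((j | j) | (j | j)) <;>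
    simp [gramMatrix, Matrix.one_apply]

lemma pd_gramMatrix {R : Type*} [CommRing R] (l : Fin n) (i j : Idx n) :
    pd l (gramMatrix (MvPowerSeries (Fin n) R) n i j) = 0 := by
  rw [← gramMatrix_map (MvPowerSeries.C (σ := Fin n) (R := R)), Matrix.map_apply]
  exact MvPowerSeries.pderiv_C ..

include he in
lemma form_apply_eq (x y : PSbar p k n ⊗[PS p k n] H) : B.baseChange (PSbar p k n) x y =
    ∑ i, ∑ j, e.repr x i * gramMatrix (PSbar p k n) n i j * e.repr y j := by
  simp only [form_eq_sum _ e x y, he]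

include he in
lemma conn_gram (hB : ∀ (i : Fin n) (x y : H), B (X.D i x) y + B x (X.D i y) = pd i (B x y))
    (l : Fin n) : (matrixOf e (Dbar X l)).transpose * gramMatrix (PSbar p k n) n +
      gramMatrix (PSbar p k n) n * matrixOf e (Dbar X l) = 0 := by
  refine Matrix.ext fun i j => ?_
  have h1 := baseChange_Dbar hB l (e i) (e j)
  rw [he, pd_gramMatrix, form_apply_eq e he, form_apply_eq e he] at h1
  simp only [e.repr_self, Finsupp.single_apply, ite_mul, mul_ite, zero_mul, mul_zero, one_mul,
    mul_one, Finset.sum_ite_eq, Finset.mem_univ, if_true] at h1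
  rw [Finset.sum_comm (f := fun x y => if i = x then _ else _)] at h1
  simp only [Finset.sum_ite_eq, Finset.mem_univ, if_true] at h1
  rw [Matrix.add_apply, Matrix.mul_apply, Matrix.mul_apply, Matrix.zero_apply, ← h1]
  rfl

include he in
lemma frob_gram (hB : ∀ (x y : H), B (X.F φ x) (X.F φ y) =
      (p : PS p k n) ^ 3 * φ.toRingHom (B x y)) :
    (matrixOf e (Fbar X hφ)).transpose * gramMatrix (PSbar p k n) n * matrixOf e (Fbar X hφ) =
      (p : PSbar p k n) ^ 3 • gramMatrix (PSbar p k n) n := by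
  refine Matrix.ext fun i j => ?_
  have h1 := baseChange_Fbar hφ hB (e i) (e j)
  have h2 : φb.toRingHom (gramMatrix (PSbar p k n) n i j) = gramMatrix (PSbar p k n) n i j :=
    congrFun (congrFun (gramMatrix_map φb.toRingHom) i) j
  rw [he, h2, form_apply_eq e he] at h1
  rw [Matrix.smul_apply, smul_eq_mul, ← h1, Matrix.mul_apply]
  simp only [Matrix.mul_apply, Finset.sum_mul]
  rw [Finset.sum_comm]
  rfl

end MatrixIdentities

/-! ### The formal Poincaré lemma. -/

section Poincare

variable {K : Type*} [Field K] [CharZero K] {n : ℕ}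

lemma coeff_pd {R : Type*} [CommRing R] (l : Fin n) (f : MvPowerSeries (Fin n) R)
    (m : Fin n →₀ ℕ) : MvPowerSeries.coeff m (pd l f) =
      MvPowerSeries.coeff (m + Finsupp.single l 1) f * (m l + 1) :=
  MvPowerSeries.coeff_pderiv ..

lemma coeff_X_mul_pd {R : Type*} [CommRing R] (l : Fin n) (f : MvPowerSeries (Fin n) R)
    (m : Fin n →₀ ℕ) : MvPowerSeries.coeff m (MvPowerSeries.X l * pd l f) =
      m l * MvPowerSeries.coeff m f := by
  classical
  rw [MvPowerSeries.X, MvPowerSeries.coeff_monomial_mul]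
  split_ifs with h
  · have h1 : 1 ≤ m l := by simpa using h l
    rw [coeff_pd, tsub_add_cancel_of_le h, one_mul, mul_comm, Finsupp.tsub_apply,
      Finsupp.single_eq_same]
    congr 1
    rw [← Nat.cast_succ, Nat.succ_eq_add_one, Nat.sub_add_cancel h1]
  · have h1 : m l = 0 := by
      by_contra h0
      refine h (Finsupp.single_le_iff.2 (Nat.one_le_iff_ne_zero.2 h0))
    rw [h1, Nat.cast_zero, zero_mul]

/-- The formal Poincaré lemma in degree one. -/
lemma exists_primitive (g : Fin n → MvPowerSeries (Fin n) K)
    (h : ∀ i j, pd i (g j) = pd j (g i)) :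
    ∃ f, MvPowerSeries.constantCoeff f = 0 ∧ ∀ l, pd l f = g l := by
  classical
  let E := ∑ i, MvPowerSeries.X i * g i
  have hE : ∀ l, pd l E = g l + ∑ i, MvPowerSeries.X i * pd i (g l) := by
    intro l
    have h1 : ∀ i, pd l (MvPowerSeries.X i * g i) =
        (if i = l then g l else 0) + MvPowerSeries.X i * pd i (g l) := fun i => by
      rw [pd_mul, h l i]
      congr 1
      have : pd l (MvPowerSeries.X i : MvPowerSeries (Fin n) K) = if i = l then 1 else 0 := by
        rw [pd, MvPowerSeries.pderiv_X, Pi.single_apply]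
      rw [this]
      split_ifs with hil
      · rw [one_mul, hil]
      · rw [zero_mul]
    rw [pd_sum, Finset.sum_congr rfl fun i _ => h1 i, Finset.sum_add_distrib]
    simp
  have hcoef : ∀ l m, MvPowerSeries.coeff m (pd l E) =
      (m.degree + 1 : K) * MvPowerSeries.coeff m (g l) := by
    intro l m
    rw [hE, map_add, map_sum, Finset.sum_congr rfl fun i _ => coeff_X_mul_pd i (g l) m,
      ← Finset.sum_mul, add_mul, one_mul, add_comm]
    congr 2
    rw [Finsupp.degree_eq_sum, Nat.cast_sum]
  -- Contraction with the Euler field multiplies a primitive by the degree, so the primitive is `E`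
  -- with coefficients divided by their degree. In degree zero the division by zero yields `0`,
  -- which is the normalization wanted.
  refine ⟨mkPS fun m => MvPowerSeries.coeff m E / m.degree, ?_, fun l => ?_⟩
  · rw [← MvPowerSeries.coeff_zero_eq_constantCoeff_apply, coeff_mkPS]
    simp
  · refine MvPowerSeries.ext fun m => ?_
    rw [coeff_pd, coeff_mkPS]
    have h1 := hcoef l m
    rw [coeff_pd] at h1
    have h2 : (m + Finsupp.single l 1).degree = m.degree + 1 := by
      rw [map_add, Finsupp.degree_single]
    rw [h2, div_mul_eq_mul_div, h1, Nat.cast_succ, mul_div_cancel_left₀]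
    exact Nat.cast_add_one_ne_zero _

lemma eq_C_of_pd_eq_zero (f : MvPowerSeries (Fin n) K) (h : ∀ l, pd l f = 0) :
    f = MvPowerSeries.C (MvPowerSeries.constantCoeff f) := by
  classical
  refine MvPowerSeries.ext fun m => ?_
  rw [MvPowerSeries.coeff_C]
  split_ifs with hm
  · rw [hm, MvPowerSeries.coeff_zero_eq_constantCoeff_apply]
  · obtain ⟨l, hl⟩ := Finsupp.ne_iff.1 hm
    have h1 : Finsupp.single l 1 ≤ m := Finsupp.single_le_iff.2 (Nat.one_le_iff_ne_zero.2 hl)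
    have h2 := congrArg (MvPowerSeries.coeff (m - Finsupp.single l 1)) (h l)
    rw [coeff_pd, tsub_add_cancel_of_le h1, map_zero] at h2
    exact (mul_eq_zero.1 h2).resolve_right (Nat.cast_add_one_ne_zero _)

end Poincare

/-! ### Connections that raise weights by one, solved by iterated integrals. -/

section Graded

variable {R : Type*} [CommRing R] {n : ℕ}

lemma wt_le_three (i : Idx n) : wt i ≤ 3 := by
  rcases i with ((i | i) | (i | i)) <;> simp [wt]

/-- The matrix `M` raises the weight by `d`. -/
def HasDeg (d : ℕ) (M : Matrix (Idx n) (Idx n) R) : Prop :=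
  ∀ i j, wt j ≠ wt i + d → M i j = 0

lemma HasDeg.mul {d d' : ℕ} {M M' : Matrix (Idx n) (Idx n) R} (h : HasDeg d M)
    (h' : HasDeg d' M') : HasDeg (d + d') (M * M') := by
  intro i j hij
  rw [Matrix.mul_apply]
  refine Finset.sum_eq_zero fun x _ => ?_
  by_cases hx : wt x = wt i + d
  · rw [h' x j (by omega), mul_zero]
  · rw [h i x hx, zero_mul]

lemma HasDeg.eq_zero {M : Matrix (Idx n) (Idx n) R} (h : HasDeg 4 M) : M = 0 :=
  Matrix.ext fun i j => h i j (by have := wt_le_three j; omega)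

lemma map_pd_mul {ι : Type*} [Fintype ι] (l : Fin n)
    (M N : Matrix ι ι (MvPowerSeries (Fin n) R)) :
    (M * N).map (pd l) = M.map (pd l) * N + M * N.map (pd l) := by
  refine Matrix.ext fun i j => ?_
  rw [Matrix.map_apply, Matrix.mul_apply, pd_sum, Matrix.add_apply, Matrix.mul_apply,
    Matrix.mul_apply, ← Finset.sum_add_distrib]
  exact Finset.sum_congr rfl fun x _ => pd_mul _ _ _

lemma map_pd_add {ι : Type*} (l : Fin n) (M N : Matrix ι ι (MvPowerSeries (Fin n) R)) :
    (M + N).map (pd l) = M.map (pd l) + N.map (pd l) :=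
  Matrix.map_add _ (pd_add l) _ _

variable {K : Type*} [Field K] [CharZero K]

/-- One step of iterated integration: `M N` is closed because `N` is closed and its components
commute. Entries of the wrong weight have zero derivative and zero constant term, so they vanish. -/
lemma exists_primitive_matrix (N : Fin n → Matrix (Idx n) (Idx n) (MvPowerSeries (Fin n) K))
    (hdeg : ∀ l, HasDeg 1 (N l)) (hclosed : ∀ i j, (N j).map (pd i) = (N i).map (pd j))
    (hcomm : ∀ i j, N i * N j = N j * N i) {d : ℕ}
    (M M' : Matrix (Idx n) (Idx n) (MvPowerSeries (Fin n) K)) (hM : HasDeg d M)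
    (hM' : ∀ l, M.map (pd l) = M' * N l) :
    ∃ M₁ : Matrix (Idx n) (Idx n) (MvPowerSeries (Fin n) K), HasDeg (d + 1) M₁ ∧
      M₁.map (MvPowerSeries.constantCoeff (R := K)) = 0 ∧ ∀ l, M₁.map (pd l) = M * N l := by
  have h1 : ∀ i j, (M * N j).map (pd i) = (M * N i).map (pd j) := fun i j => by
    rw [map_pd_mul, map_pd_mul, hM', hM', hclosed i j, Matrix.mul_assoc, Matrix.mul_assoc, hcomm]
  choose f hf0 hf using fun x y => exists_primitive (fun l => (M * N l) x y)
    (fun i j => congrFun (congrFun (h1 i j) x) y)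
  refine ⟨Matrix.of f, fun x y hxy => ?_, Matrix.ext fun x y => hf0 x y,
    fun l => Matrix.ext fun x y => hf x y l⟩
  have h2 := eq_C_of_pd_eq_zero (f x y) fun l => by
    rw [hf]; exact (hM.mul (hdeg l)) x y hxy
  rw [Matrix.of_apply, h2, hf0, map_zero]

/-- The fundamental matrix, normalized at the origin, of a connection which raises weights by
one. -/
lemma exists_fundamental_matrix (N : Fin n → Matrix (Idx n) (Idx n) (MvPowerSeries (Fin n) K))
    (hdeg : ∀ l, HasDeg 1 (N l)) (hclosed : ∀ i j, (N j).map (pd i) = (N i).map (pd j))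
    (hcomm : ∀ i j, N i * N j = N j * N i) :
    ∃ M : Matrix (Idx n) (Idx n) (MvPowerSeries (Fin n) K),
      (∀ l, M.map (pd l) = M * N l) ∧ M.map (MvPowerSeries.constantCoeff (R := K)) = 1 ∧
      ∀ i j, wt j ≤ wt i → M i j = (1 : Matrix (Idx n) (Idx n) (MvPowerSeries (Fin n) K)) i j := by
  have h1 : HasDeg 0 (1 : Matrix (Idx n) (Idx n) (MvPowerSeries (Fin n) K)) := fun i j hij =>
    Matrix.one_apply_ne fun h => hij (by rw [h, add_zero])
  have h1' : ∀ l, (1 : Matrix (Idx n) (Idx n) (MvPowerSeries (Fin n) K)).map (pd l) = 0 :=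
    fun l => Matrix.ext fun i j => by
      rw [Matrix.map_apply, Matrix.one_apply]
      split_ifs
      · exact pd_one l
      · exact pd_zero l
  -- The solution is the sum of the iterated integrals. A fourth would raise weights by four, which
  -- is impossible with weights `0, …, 3`, so the series stops.
  obtain ⟨M₁, hd₁, hc₁, hM₁⟩ := exists_primitive_matrix N hdeg hclosed hcomm 1 0 h1
    fun l => by rw [h1', Matrix.zero_mul]
  obtain ⟨M₂, hd₂, hc₂, hM₂⟩ := exists_primitive_matrix N hdeg hclosed hcomm M₁ 1 hd₁ hM₁
  obtain ⟨M₃, hd₃, hc₃, hM₃⟩ := exists_primitive_matrix N hdeg hclosed hcomm M₂ M₁ hd₂ hM₂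
  have h4 : ∀ l, M₃ * N l = 0 := fun l => (hd₃.mul (hdeg l)).eq_zero
  refine ⟨1 + M₁ + M₂ + M₃, fun l => ?_, ?_, fun i j hij => ?_⟩
  · simp only [map_pd_add, h1', hM₁, hM₂, hM₃, Matrix.add_mul, h4]
    abel
  · rw [Matrix.map_add _ (map_add _), Matrix.map_add _ (map_add _), Matrix.map_add _ (map_add _),
      hc₁, hc₂, hc₃, add_zero, add_zero, add_zero]
    exact Matrix.map_one _ (map_zero _) (map_one _)
  · rw [Matrix.add_apply, Matrix.add_apply, Matrix.add_apply, hd₁ i j (by omega),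
      hd₂ i j (by omega), hd₃ i j (by omega), add_zero, add_zero, add_zero]

end Graded

/-! ### The shape of unipotent symplectic matrices. -/

section Shape

variable {R : Type*} [CommRing R] {n : ℕ}

/-- A unipotent symplectic matrix has the shape of a period matrix. -/
lemma exists_eq_Tmatrix (T : Matrix (Idx n) (Idx n) R)
    (hT : ∀ i j, wt j ≤ wt i → T i j = (1 : Matrix (Idx n) (Idx n) R) i j)
    (hG : T.transpose * gramMatrix R n * T = gramMatrix R n) :
    ∃ Z τ₂₃ τ₁₃ τ₁₂, T = Tmatrix Z τ₂₃ τ₁₃ τ₁₂ := by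
  have hpair : ∀ i j, - T (Sum.inl (Sum.inl ())) i * T (Sum.inr (Sum.inr ())) j +
      ∑ x, T (Sum.inl (Sum.inr x)) i * T (Sum.inr (Sum.inl x)) j -
      ∑ x, T (Sum.inr (Sum.inl x)) i * T (Sum.inl (Sum.inr x)) j +
      T (Sum.inr (Sum.inr ())) i * T (Sum.inl (Sum.inl ())) j = gramMatrix R n i j := by
    intro i j
    rw [← hG, Matrix.mul_assoc, Matrix.mul_apply]
    simp [Matrix.mul_apply, gramMatrix, Matrix.one_apply, Fintype.sum_sum_type]
    ring
  have t00 : ∀ (i : Unit) (j : Unit), T (Sum.inl (Sum.inl i)) (Sum.inl (Sum.inl j)) = 1 := fun i j =>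
    (hT _ _ (by simp [wt])).trans (by simp)
  have t10 : ∀ (i : Fin n) (j : Unit), T (Sum.inl (Sum.inr i)) (Sum.inl (Sum.inl j)) = 0 := fun i j =>
    (hT _ _ (by simp [wt])).trans (by simp)
  have t11 : ∀ (i : Fin n) (j : Fin n), T (Sum.inl (Sum.inr i)) (Sum.inl (Sum.inr j)) = if i = j then 1 else 0 := fun i j =>
    (hT _ _ (by simp [wt])).trans (by simp [Matrix.one_apply])
  have t20 : ∀ (i : Fin n) (j : Unit), T (Sum.inr (Sum.inl i)) (Sum.inl (Sum.inl j)) = 0 := fun i j =>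
    (hT _ _ (by simp [wt])).trans (by simp)
  have t21 : ∀ (i : Fin n) (j : Fin n), T (Sum.inr (Sum.inl i)) (Sum.inl (Sum.inr j)) = 0 := fun i j =>
    (hT _ _ (by simp [wt])).trans (by simp)
  have t22 : ∀ (i : Fin n) (j : Fin n), T (Sum.inr (Sum.inl i)) (Sum.inr (Sum.inl j)) = if i = j then 1 else 0 := fun i j =>
    (hT _ _ (by simp [wt])).trans (by simp [Matrix.one_apply])
  have t30 : ∀ (i : Unit) (j : Unit), T (Sum.inr (Sum.inr i)) (Sum.inl (Sum.inl j)) = 0 := fun i j =>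
    (hT _ _ (by simp [wt])).trans (by simp)
  have t31 : ∀ (i : Unit) (j : Fin n), T (Sum.inr (Sum.inr i)) (Sum.inl (Sum.inr j)) = 0 := fun i j =>
    (hT _ _ (by simp [wt])).trans (by simp)
  have t32 : ∀ (i : Unit) (j : Fin n), T (Sum.inr (Sum.inr i)) (Sum.inr (Sum.inl j)) = 0 := fun i j =>
    (hT _ _ (by simp [wt])).trans (by simp)
  have t33 : ∀ (i : Unit) (j : Unit), T (Sum.inr (Sum.inr i)) (Sum.inr (Sum.inr j)) = 1 := fun i j =>
    (hT _ _ (by simp [wt])).trans (by simp)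
  have h13 : ∀ j, T (Sum.inl (Sum.inl ())) (Sum.inl (Sum.inr j)) =
      T (Sum.inr (Sum.inl j)) (Sum.inr (Sum.inr ())) := by
    intro j
    have h1 := hpair (Sum.inl (Sum.inr j)) (Sum.inr (Sum.inr ()))
    simp [gramMatrix, t11, t21, t31, t33] at h1
    linear_combination -h1
  have h23 : ∀ j, T (Sum.inl (Sum.inl ())) (Sum.inr (Sum.inl j)) =
      - T (Sum.inl (Sum.inr j)) (Sum.inr (Sum.inr ())) +
      ∑ x, T (Sum.inr (Sum.inl x)) (Sum.inr (Sum.inr ())) *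
        T (Sum.inl (Sum.inr x)) (Sum.inr (Sum.inl j)) := by
    intro j
    have h1 := hpair (Sum.inr (Sum.inl j)) (Sum.inr (Sum.inr ()))
    simp [gramMatrix, t22, t32, t33] at h1
    rw [Finset.sum_congr rfl fun x _ => mul_comm (T (Sum.inr (Sum.inl x)) (Sum.inr (Sum.inr ()))) _]
    linear_combination -h1
  -- The upper right corner of the product of the two factors is `Z` plus the scalar product of
  -- `τ₂₃` and `τ₁₃`, which has to be subtracted. The other entries of the top row are forced by the
  -- pairings `h13` and `h23`.
  refine ⟨T (Sum.inl (Sum.inl ())) (Sum.inr (Sum.inr ())) -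
      ∑ x, T (Sum.inr (Sum.inl x)) (Sum.inr (Sum.inr ())) *
        T (Sum.inl (Sum.inr x)) (Sum.inr (Sum.inr ())),
    fun j => T (Sum.inr (Sum.inl j)) (Sum.inr (Sum.inr ())),
    fun j => T (Sum.inl (Sum.inr j)) (Sum.inr (Sum.inr ())),
    Matrix.of fun i j => T (Sum.inl (Sum.inr i)) (Sum.inr (Sum.inl j)), ?_⟩
  rw [Tmatrix, Matrix.fromBlocks_multiply]
  simp only [Matrix.zero_mul, Matrix.mul_zero, add_zero, zero_add, Matrix.mul_one,
    Matrix.fromBlocks_multiply, Matrix.one_mul]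
  refine Matrix.ext fun i j => ?_
  rcases i with ((i | i) | (i | i)) <;> rcases j with ((j | j) | (j | j)) <;>
    simp [h13, h23, Matrix.mul_apply, Matrix.one_apply, t00, t10, t11, t20, t21,
      t22, t30, t31, t32, t33]

end Shape

/-! ### Splitting the Frobenius at the origin into Tate twists. -/

section ConstantFrobenius

variable {p : ℕ} [hp : Fact p.Prime] {k : Type*} [Field k] [CharP k p] {n : ℕ}

/-- After clearing the denominator of `y`, the equation reads `x = σ⁻¹(w + p^d x)`, a contraction
because `d ≥ 1`. Here `σ` is invertible as `k̄` is perfect. -/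
lemma exists_sigma_eq {d : ℕ} (hd : 1 ≤ d) (y : Ku p k) :
    ∃ c, sigmaKu p k c = (p : Ku p k) ^ d * c + y := by
  obtain ⟨M, w, hw⟩ := exists_isSmall y
  rw [pow_zero, one_mul] at hw
  let τ := (WittVector.frobeniusEquiv p (AlgebraicClosure k)).symm
  have hτ : ∀ x, WittVector.frobenius (τ x) = x := fun x =>
    (WittVector.frobeniusEquiv p (AlgebraicClosure k)).apply_symm_apply x
  obtain ⟨x, hx⟩ := exists_fixed_point_of_contraction (p := p) psep_wittVector psum_wittVector
    (κ := Unit) (fun x _ => τ (w + (p : WittVector p (AlgebraicClosure k)) ^ d * x ())) (by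
      intro N a b hab i
      rw [← map_sub, add_sub_add_left_eq_sub, ← mul_sub]
      obtain ⟨c, hc⟩ := hab ()
      rw [hc, ← mul_assoc, ← pow_add, map_mul, map_pow, map_natCast]
      exact (pow_dvd_pow _ (by omega)).mul_right _)
  have hx' : WittVector.frobenius (x ()) =
      w + (p : WittVector p (AlgebraicClosure k)) ^ d * x () := by
    conv_lhs => rw [← hx]
    exact hτ _
  have hpM : (p : Ku p k) ^ M ≠ 0 := pow_ne_zero _ p_ne_zero_Ku
  refine ⟨((p : Ku p k) ^ M)⁻¹ * toKu p k (x ()), ?_⟩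
  rw [map_mul, map_inv₀, map_pow, map_natCast, sigmaKu_toKu, hx', map_add, ← hw, map_mul, map_pow,
    map_natCast]
  field_simp
  ring

lemma eq_zero_of_sigma_eq {d : ℕ} (hd : 1 ≤ d) {x : Ku p k}
    (h : sigmaKu p k x = (p : Ku p k) ^ d * x) : x = 0 := by
  obtain ⟨M, w, hw⟩ := exists_isSmall x
  rw [pow_zero, one_mul] at hw
  have h1 : WittVector.frobenius w = (p : WittVector p (AlgebraicClosure k)) ^ d * w := by
    refine toKu_injective ?_
    rw [← sigmaKu_toKu, ← hw, map_mul, map_pow, map_natCast, h, map_mul, map_pow, map_natCast, ← hw]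
    ring
  let τ := (WittVector.frobeniusEquiv p (AlgebraicClosure k)).symm
  have h2 : w = (p : WittVector p (AlgebraicClosure k)) ^ d * τ w := by
    have h3 := congrArg τ h1
    rw [map_mul, map_pow, map_natCast] at h3
    rw [← h3]
    exact ((WittVector.frobeniusEquiv p (AlgebraicClosure k)).symm_apply_apply w).symm
  have h3 : ∀ N (w : WittVector p (AlgebraicClosure k)),
      w = (p : WittVector p (AlgebraicClosure k)) ^ d * τ w →
      (p : WittVector p (AlgebraicClosure k)) ^ N ∣ w := by
    intro N
    induction N with
    | zero => simp
    | succ N ih =>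
      intro w hw
      have h4 := ih (τ w) (by
        conv_lhs => rw [hw]
        rw [map_mul, map_pow, map_natCast])
      rw [hw, pow_succ']
      exact mul_dvd_mul (dvd_pow_self _ (by omega)) h4
  have h4 : w = 0 := psep_wittVector w fun N => h3 N w h2
  rw [h4, map_zero] at hw
  exact (mul_eq_zero.1 hw).resolve_left (pow_ne_zero _ p_ne_zero_Ku)

/-- An upper triangular matrix with `p ^ w` on the diagonal is the Frobenius matrix of a direct
sum of Tate twists. -/
lemma exists_unipotent_frobenius (Φ : Matrix (Idx n) (Idx n) (Ku p k))
    (hΦ : ∀ i j, wt j ≤ wt i → Φ i j = (p : Ku p k) ^ wt i *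
      (1 : Matrix (Idx n) (Idx n) (Ku p k)) i j) :
    ∃ c : Matrix (Idx n) (Idx n) (Ku p k),
      (∀ i j, wt j ≤ wt i → c i j = (1 : Matrix (Idx n) (Idx n) (Ku p k)) i j) ∧
      c * Φ = Pmatrix (Ku p k) n p * c.map (sigmaKu p k) := by
  classical
  have hΦ0 : ∀ y j, wt j < wt y → Φ y j = 0 := fun y j h => by
    rw [hΦ y j h.le, Matrix.one_apply_ne (fun h' => by rw [h'] at h; exact lt_irrefl _ h),
      mul_zero]
  have hΦd : ∀ y j, wt y = wt j → Φ y j = if y = j then (p : Ku p k) ^ wt j else 0 :=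
    fun y j h => by
      rw [hΦ y j h.ge, h, Matrix.one_apply]; split_ifs <;> simp
  have hsplit : ∀ (c : Matrix (Idx n) (Idx n) (Ku p k)) i j, (c * Φ) i j =
      (∑ y with wt y < wt j, c i y * Φ y j) + c i j * (p : Ku p k) ^ wt j := by
    intro c i j
    rw [Matrix.mul_apply, ← Finset.sum_filter_add_sum_filter_not _ (fun y => wt y < wt j)]
    congr 1
    rw [Finset.sum_eq_single j]
    · rw [hΦd j j rfl, if_pos rfl]
    · intro y hy hyj
      rcases Nat.lt_or_ge (wt j) (wt y) with h | h
      · rw [hΦ0 y j h, mul_zero]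
      · have := (Finset.mem_filter.1 hy).2
        rw [hΦd y j (by omega), if_neg hyj, mul_zero]
    · intro h
      simp at h
  -- The columns are determined in order of weight. In a column of weight `L`, an entry in a row of
  -- smaller weight solves `σ(x) = p^(L - wt i) x + y` with `y` known from earlier columns.
  have key : ∀ L : ℕ, ∃ c : Matrix (Idx n) (Idx n) (Ku p k),
      (∀ i j, wt j ≤ wt i → c i j = (1 : Matrix (Idx n) (Idx n) (Ku p k)) i j) ∧
      ∀ i j, wt j < L → (c * Φ) i j = (p : Ku p k) ^ wt i * sigmaKu p k (c i j) := by
    intro L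
    induction L with
    | zero => exact ⟨1, fun _ _ _ => rfl, fun i j h => absurd h (Nat.not_lt_zero _)⟩
    | succ L ih =>
      obtain ⟨c, hc1, hc⟩ := ih
      have hsol : ∀ i j, ∃ x, wt i < L → sigmaKu p k x = (p : Ku p k) ^ (L - wt i) * x +
          ((p : Ku p k) ^ wt i)⁻¹ * ∑ y with wt y < L, c i y * Φ y j := by
        intro i j
        by_cases h : wt i < L
        · obtain ⟨x, hx⟩ := exists_sigma_eq (p := p) (k := k) (d := L - wt i) (by omega)
            (((p : Ku p k) ^ wt i)⁻¹ * ∑ y with wt y < L, c i y * Φ y j)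
          exact ⟨x, fun _ => hx⟩
        · exact ⟨0, fun h' => absurd h' h⟩
      choose x hx using hsol
      let c' : Matrix (Idx n) (Idx n) (Ku p k) :=
        Matrix.of fun i j => if wt j = L ∧ wt i < L then x i j else c i j
      have hc' : ∀ i j, c' i j = if wt j = L ∧ wt i < L then x i j else c i j := fun _ _ => rfl
      have hc'lt : ∀ i j, wt j < L → c' i j = c i j := fun i j h => by
        rw [hc', if_neg (by omega)]
      have hc'1 : ∀ i j, wt j ≤ wt i → c' i j = (1 : Matrix (Idx n) (Idx n) (Ku p k)) i j :=
        fun i j h => by rw [hc', if_neg (by omega), hc1 i j h]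
      refine ⟨c', hc'1, fun i j hj => ?_⟩
      have hsplit' : (c' * Φ) i j = (∑ y with wt y < wt j, c i y * Φ y j) +
          c' i j * (p : Ku p k) ^ wt j := by
        rw [hsplit]
        congr 1
        refine Finset.sum_congr rfl fun y hy => ?_
        rw [hc'lt i y (by have := (Finset.mem_filter.1 hy).2; omega)]
      rcases Nat.lt_or_ge (wt j) L with hjL | hjL
      · rw [hc'lt i j hjL, ← hc i j hjL, hsplit', hc'lt i j hjL, hsplit]
      · have hjL' : wt j = L := by omega
        rw [hsplit']
        rcases Nat.lt_or_ge (wt i) L with hi | hi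
        · have h1 : c' i j = x i j := by rw [hc', if_pos ⟨hjL', hi⟩]
          have hpi : (p : Ku p k) ^ wt i ≠ 0 := pow_ne_zero _ p_ne_zero_Ku
          rw [h1, hx i j hi, hjL', mul_add, mul_inv_cancel_left₀ hpi, ← mul_assoc, ← pow_add,
            Nat.add_sub_cancel' hi.le]
          ring
        · have h1 : ∑ y with wt y < wt j, c i y * Φ y j = 0 := by
            refine Finset.sum_eq_zero fun y hy => ?_
            have hy' := (Finset.mem_filter.1 hy).2
            rw [hc1 i y (by omega), Matrix.one_apply_ne (by rintro rfl; omega), zero_mul]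
          rw [h1, zero_add, hc'1 i j (by omega), Matrix.one_apply]
          split_ifs with hij
          · rw [hij]; simp
          · simp
  obtain ⟨c, hc1, hc⟩ := key 4
  refine ⟨c, hc1, Matrix.ext fun i j => ?_⟩
  rw [hc i j (by have := wt_le_three j; omega), Pmatrix, Matrix.diagonal_mul, Matrix.map_apply]

lemma gramMatrix_apply_eq_zero {R : Type*} [CommRing R] {i j : Idx n} (h : wt i + wt j ≠ 3) :
    gramMatrix R n i j = 0 := by
  rcases i with ((i | i) | (i | i)) <;> rcases j with ((j | j) | (j | j)) <;>
    simp_all [gramMatrix, wt]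

/-- As the Gram matrix has square `-1`, the hypothesis exhibits a right inverse of `M`; writing that
it is also a left inverse gives the conclusion. -/
lemma gram_transpose_of_gram {R : Type*} [CommRing R] {M : Matrix (Idx n) (Idx n) R}
    (h : M * gramMatrix R n * M.transpose = gramMatrix R n) :
    M.transpose * gramMatrix R n * M = gramMatrix R n := by
  have h1 : M * (-(gramMatrix R n * M.transpose * gramMatrix R n)) = 1 := by
    rw [mul_neg, ← mul_assoc, ← mul_assoc, h, gramMatrix_mul_self, neg_neg]
  have h2 := mul_eq_one_comm.1 h1
  have h3 := congrArg (fun Y => gramMatrix R n * Y) h2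
  simp only [mul_one, neg_mul, mul_neg] at h3
  rw [← mul_assoc, ← mul_assoc, ← mul_assoc, gramMatrix_mul_self, neg_mul, one_mul, neg_mul,
    neg_mul, neg_neg] at h3
  exact h3

/-- The matrix `Y = c G cᵀ` satisfies `p^3 Y = P σ(Y) P`. For `wt i + wt j < 3` the entry `Y i j` is
thus a solution of `σ(x) = p^d x` with `d ≥ 1`, hence zero; for larger sums of weights triangularity
of `c` gives the entry of `G`. -/
lemma unipotent_gram (c Φ : Matrix (Idx n) (Idx n) (Ku p k))
    (hc1 : ∀ i j, wt j ≤ wt i → c i j = (1 : Matrix (Idx n) (Idx n) (Ku p k)) i j)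
    (hc : c * Φ = Pmatrix (Ku p k) n p * c.map (sigmaKu p k))
    (hΦ : Φ.transpose * gramMatrix (Ku p k) n * Φ = (p : Ku p k) ^ 3 • gramMatrix (Ku p k) n) :
    c * gramMatrix (Ku p k) n * c.transpose = gramMatrix (Ku p k) n := by
  set G := gramMatrix (Ku p k) n with hG
  have hp3 : (p : Ku p k) ^ 3 ≠ 0 := pow_ne_zero _ p_ne_zero_Ku
  have hΦ' : Φ * G * Φ.transpose = (p : Ku p k) ^ 3 • G := by
    have h1 : (((p : Ku p k) ^ 3)⁻¹ • -(G * Φ.transpose * G)) * Φ = 1 := by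
      rw [Matrix.smul_mul, neg_mul, mul_assoc, mul_assoc, ← mul_assoc Φ.transpose, hΦ,
        Matrix.mul_smul, hG, gramMatrix_mul_self, smul_neg, smul_smul,
        inv_mul_cancel₀ hp3, one_smul, neg_neg]
    have h2 := mul_eq_one_comm.1 h1
    rw [Matrix.mul_smul, mul_neg, inv_smul_eq_iff₀ hp3] at h2
    have h3 := congrArg (fun Y => Y * G) h2
    simp only [neg_mul, Matrix.smul_mul, one_mul] at h3
    rw [mul_assoc, mul_assoc (G * Φ.transpose), hG, gramMatrix_mul_self, mul_neg, mul_one, mul_neg,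
      neg_neg, ← mul_assoc] at h3
    exact h3
  set Y := c * G * c.transpose with hY
  have hσ : (p : Ku p k) ^ 3 • Y =
      Pmatrix (Ku p k) n p * Y.map (sigmaKu p k) * Pmatrix (Ku p k) n p := by
    have h1 : Y.map (sigmaKu p k) = c.map (sigmaKu p k) * G * (c.map (sigmaKu p k)).transpose := by
      rw [hY, Matrix.map_mul, Matrix.map_mul, hG, gramMatrix_map, Matrix.transpose_map]
    have hPt : (Pmatrix (Ku p k) n p).transpose = Pmatrix (Ku p k) n p := by
      rw [Pmatrix, Matrix.diagonal_transpose]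
    calc (p : Ku p k) ^ 3 • Y = c * ((p : Ku p k) ^ 3 • G) * c.transpose := by
          rw [Matrix.mul_smul, Matrix.smul_mul]
      _ = (c * Φ) * G * (c * Φ).transpose := by
          rw [← hΦ', Matrix.transpose_mul]; simp only [mul_assoc]
      _ = _ := by
          rw [hc, Matrix.transpose_mul, hPt, h1]; simp only [mul_assoc]
  have hYij : ∀ i j, (p : Ku p k) ^ 3 * Y i j =
      (p : Ku p k) ^ (wt i + wt j) * sigmaKu p k (Y i j) := fun i j => by
    have h1 := congrFun (congrFun hσ i) j
    rw [Matrix.smul_apply, smul_eq_mul, Pmatrix, Matrix.mul_diagonal, Matrix.diagonal_mul,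
      Matrix.map_apply] at h1
    rw [h1]; ring
  have hsum : ∀ i j, Y i j = ∑ x, ∑ y, c i x * G x y * c j y := fun i j => by
    rw [hY, Matrix.mul_apply, Finset.sum_comm]
    simp only [Matrix.mul_apply, Finset.sum_mul, Matrix.transpose_apply]
  refine Matrix.ext fun i j => ?_
  rcases Nat.lt_or_ge (wt i + wt j) 3 with h | h
  · rw [hG, gramMatrix_apply_eq_zero (by omega)]
    refine eq_zero_of_sigma_eq (d := 3 - (wt i + wt j)) (by omega) ?_
    have h1 := hYij i j
    refine mul_left_cancel₀ (pow_ne_zero (wt i + wt j) p_ne_zero_Ku) ?_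
    rw [← h1, ← mul_assoc, ← pow_add, Nat.add_sub_cancel' h.le]
  · rw [hsum, Finset.sum_eq_single i, Finset.sum_eq_single j]
    · rw [hc1 i i le_rfl, hc1 j j le_rfl, Matrix.one_apply_eq, Matrix.one_apply_eq, one_mul, mul_one]
    · intro y _ hyj
      rcases Nat.lt_or_ge (wt j) (wt y) with h' | h'
      · rw [hG, gramMatrix_apply_eq_zero (by omega)]; simp
      · rw [hc1 j y h', Matrix.one_apply_ne (Ne.symm hyj), mul_zero]
    · simp
    · intro x _ hxi
      refine Finset.sum_eq_zero fun y _ => ?_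
      rcases Nat.lt_or_ge (wt i) (wt x) with h' | h'
      · rcases Nat.lt_or_ge (wt y) (wt j) with h'' | h''
        · rw [hc1 j y h''.le, Matrix.one_apply_ne (by rintro rfl; omega), mul_zero]
        · rw [hG, gramMatrix_apply_eq_zero (by omega)]; simp
      · rw [hc1 i x h', Matrix.one_apply_ne (Ne.symm hxi)]; simp
    · simp

end ConstantFrobenius

/-! ### Matrices that respect weights, and block diagonal symplectic matrices. -/

section Weights

variable {R : Type*} [CommRing R] {n : ℕ}

/-- A support condition on matrices in terms of weights is stable under multiplication by matrices
which respect the weight. -/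
lemma HasDeg.mul_left_eq_zero {Q : ℕ → ℕ → Prop} {Y M : Matrix (Idx n) (Idx n) R}
    (hY : HasDeg 0 Y) (hM : ∀ i j, Q (wt i) (wt j) → M i j = 0) {i j : Idx n}
    (h : Q (wt i) (wt j)) : (Y * M) i j = 0 := by
  rw [Matrix.mul_apply]
  refine Finset.sum_eq_zero fun x _ => ?_
  by_cases hx : wt x = wt i
  · rw [hM x j (by rwa [hx]), mul_zero]
  · rw [hY i x (by simpa using hx), zero_mul]

lemma HasDeg.mul_right_eq_zero {Q : ℕ → ℕ → Prop} {Y M : Matrix (Idx n) (Idx n) R}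
    (hY : HasDeg 0 Y) (hM : ∀ i j, Q (wt i) (wt j) → M i j = 0) {i j : Idx n}
    (h : Q (wt i) (wt j)) : (M * Y) i j = 0 := by
  rw [Matrix.mul_apply]
  refine Finset.sum_eq_zero fun x _ => ?_
  by_cases hx : wt j = wt x
  · rw [hM i x (by rwa [← hx]), zero_mul]
  · rw [hY x j (by simpa using hx), mul_zero]

lemma HasDeg.gram_transpose_gram {d : ℕ} {Y : Matrix (Idx n) (Idx n) R} (hY : HasDeg d Y) :
    HasDeg d (gramMatrix R n * Y.transpose * gramMatrix R n) := by
  intro i j hij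
  simp only [Matrix.mul_apply, Finset.sum_mul]
  refine Finset.sum_eq_zero fun y _ => Finset.sum_eq_zero fun x _ => ?_
  by_cases h1 : wt i + wt x = 3
  · by_cases h2 : wt y + wt j = 3
    · rw [Matrix.transpose_apply, hY y x (by omega)]; simp
    · rw [gramMatrix_apply_eq_zero h2]; simp
  · rw [gramMatrix_apply_eq_zero h1]; simp

/-- The block diagonal symplectic matrix with blocks `Y₀`, `Y₁`, and their contragredients. -/
def sympDiag (Y₀ : Matrix Unit Unit R) (Y₁ : Matrix (Fin n) (Fin n) R) :
    Matrix (Idx n) (Idx n) R :=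
  Matrix.fromBlocks (Matrix.fromBlocks Y₀ 0 0 Y₁) 0 0
    (Matrix.fromBlocks Y₁⁻¹.transpose 0 0 Y₀⁻¹.transpose)

lemma sympDiag_hasDeg (Y₀ : Matrix Unit Unit R) (Y₁ : Matrix (Fin n) (Fin n) R) :
    HasDeg 0 (sympDiag Y₀ Y₁) := by
  intro i j
  rcases i with ((i | i) | (i | i)) <;> rcases j with ((j | j) | (j | j)) <;> simp [sympDiag, wt]

lemma sympDiag_gram {Y₀ : Matrix Unit Unit R} {Y₁ : Matrix (Fin n) (Fin n) R} (h₀ : IsUnit Y₀)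
    (h₁ : IsUnit Y₁) :
    (sympDiag Y₀ Y₁).transpose * gramMatrix R n * sympDiag Y₀ Y₁ = gramMatrix R n := by
  rw [Matrix.isUnit_iff_isUnit_det] at h₀ h₁
  have e₀ := Matrix.nonsing_inv_mul _ h₀
  have e₁ := Matrix.nonsing_inv_mul _ h₁
  have e₀' : Y₀.transpose * Y₀⁻¹.transpose = 1 := by
    rw [← Matrix.transpose_mul, e₀, Matrix.transpose_one]
  have e₁' : Y₁.transpose * Y₁⁻¹.transpose = 1 := by
    rw [← Matrix.transpose_mul, e₁, Matrix.transpose_one]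
  rw [sympDiag]
  generalize Y₀⁻¹ = Z₀ at *
  generalize Y₁⁻¹ = Z₁ at *
  simp only [gramMatrix, Matrix.fromBlocks_transpose, Matrix.fromBlocks_multiply, Matrix.transpose_zero,
    Matrix.transpose_transpose, Matrix.mul_zero, Matrix.zero_mul, add_zero, zero_add,
    Matrix.mul_one, Matrix.mul_neg, Matrix.neg_mul, neg_zero, e₀, e₁, e₀', e₁']

lemma isUnit_of_gram {Y : Matrix (Idx n) (Idx n) R}
    (h : Y.transpose * gramMatrix R n * Y = gramMatrix R n) :
    -(gramMatrix R n * Y.transpose * gramMatrix R n) * Y = 1 := by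
  rw [neg_mul, mul_assoc, mul_assoc, ← mul_assoc Y.transpose, h, gramMatrix_mul_self, neg_neg]

end Weights

/-- The condition is linear, so it passes from Frobenius images to their span; this is how
surjectivity on the graded pieces becomes a matrix statement. -/
lemma exists_coords_of_mem_span {R M ι : Type*} [CommRing R] [AddCommGroup M] [Module R M]
    [Fintype ι] (ω : Module.Basis ι R M) (G : Matrix ι ι R) (c : R) (Q : ι → Prop) (s : Set M)
    (hs : ∀ z ∈ s, ∃ a : ι → R, ∀ i, Q i → ω.repr z i = c * ∑ x, G i x * a x) (z : M)
    (hz : z ∈ Submodule.span R s) :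
    ∃ a : ι → R, ∀ i, Q i → ω.repr z i = c * ∑ x, G i x * a x := by
  induction hz using Submodule.span_induction with
  | mem z hz => exact hs z hz
  | zero => exact ⟨0, fun i _ => by simp⟩
  | add x z _ _ hx hz =>
    obtain ⟨a, ha⟩ := hx
    obtain ⟨b, hb⟩ := hz
    refine ⟨a + b, fun i hi => ?_⟩
    rw [map_add, Finsupp.add_apply, ha i hi, hb i hi, ← mul_add, ← Finset.sum_add_distrib]
    simp only [Pi.add_apply, mul_add]
  | smul r z _ hz =>
    obtain ⟨a, ha⟩ := hz
    refine ⟨r • a, fun i hi => ?_⟩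
    rw [map_smul, Finsupp.smul_apply, ha i hi, smul_eq_mul, mul_left_comm, Finset.mul_sum]
    congr 1
    exact Finset.sum_congr rfl fun x _ => by rw [Pi.smul_apply, smul_eq_mul, mul_left_comm]

/-! ### Connection and Frobenius matrices in an adapted basis. -/

section UnitRoot

variable {p : ℕ} [hp : Fact p.Prime] {k : Type*} [Field k] [CharP k p] [PerfectRing k p] {n : ℕ}
  {H : Type*} [AddCommGroup H] [Module (PS p k n) H]
  [Module.Free (PS p k n) H] [Module.Finite (PS p k n) H]
  {X : FCrystal p k n H} {φ : FrobLift p k n} {Fil U : ℕ → Submodule (PS p k n) H}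
  {B : LinearMap.BilinForm (PS p k n) H}
  (hX : IsOrdinaryCY3 X φ Fil B) (hU : IsConjFiltration X φ U)
  (ω : Module.Basis (Idx n) (PS p k n) H) (hω : ∀ j, ω j ∈ U (wt j) ⊓ Fil (wt j))

include hX hU hω

lemma repr_prev_eq_zero {i : Idx n} {x : H} (hx : x ∈ prev U (wt i)) : ω.repr x i = 0 := by
  rcases h : wt i with _ | s
  · rw [h] at hx
    rw [(Submodule.mem_bot _).1 hx]; simp
  · rw [h] at hx
    exact repr_eq_zero_of_mem_U hX hU ω hω hx (by omega)

/-- Entries below the diagonal blocks vanish because the `U_i` are horizontal, those beyond the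
first superdiagonal by Griffiths transversality. -/
lemma matrixOf_D_eq_zero (l : Fin n) {i j : Idx n} (h : wt j < wt i ∨ wt i + 1 < wt j) :
    matrixOf ω (X.D l) i j = 0 := by
  rw [matrixOf_apply]
  rcases h with h | h
  · exact repr_eq_zero_of_mem_U hX hU ω hω (hU.conn_mem _ l _ (hω j).1) h
  · obtain ⟨s, hs⟩ := Nat.exists_eq_add_of_lt h
    refine repr_eq_zero_of_mem_Fil hX hU ω hω (i := wt i + s) ?_ (by omega)
    refine hX.hodge.transversal _ l _ ?_
    have h1 := (hω j).2
    rwa [hs, show wt i + 1 + s + 1 = wt i + s + 1 + 1 by omega] at h1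

lemma matrixOf_F_eq_zero (ψ : FrobLift p k n) {i j : Idx n} (h : wt j < wt i) :
    matrixOf ω (X.F ψ) i j = 0 := by
  rw [matrixOf_apply]
  exact repr_eq_zero_of_mem_U hX hU ω hω (hU.frob_mem _ ψ _ (hω j).1) h

/-- The diagonal blocks of the Frobenius matrix are `p ^ w` times invertible matrices. -/
lemma exists_unit_root_matrix (ψ : FrobLift p k n) :
    ∃ G G' : Matrix (Idx n) (Idx n) (PS p k n), HasDeg 0 G ∧ HasDeg 0 G' ∧ G * G' = 1 ∧
      ∀ i j, wt i = wt j → matrixOf ω (X.F ψ) i j = (p : PS p k n) ^ wt i * G i j := by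
  classical
  choose y hy hyF using fun j => hU.frob_divisible (wt j) ψ (ω j) (hω j).1
  obtain ⟨G, hG⟩ : ∃ G : Matrix (Idx n) (Idx n) (PS p k n), ∀ i j, G i j =
      if wt i = wt j then ω.repr (y j) i else 0 := ⟨Matrix.of _, fun _ _ => rfl⟩
  have hFG : ∀ i j, wt i = wt j → matrixOf ω (X.F ψ) i j = (p : PS p k n) ^ wt i * G i j := by
    intro i j hij
    have h1 := hyF j
    rw [← hij] at h1
    have h2 := repr_prev_eq_zero hX hU ω hω h1
    rw [map_sub, map_smul, Finsupp.sub_apply, Finsupp.smul_apply, smul_eq_mul, sub_eq_zero] at h2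
    rw [matrixOf_apply, h2, hG, if_pos hij]
  have hspan : ∀ w, ∀ z ∈ Submodule.span (PS p k n) (X.F ψ '' (U w : Set H)),
      ∃ a : Idx n → PS p k n, ∀ i, wt i = w → ω.repr z i = (p : PS p k n) ^ w * ∑ x, G i x * a x := by
    intro w
    refine exists_coords_of_mem_span ω G _ _ _ ?_
    rintro _ ⟨u, hu, rfl⟩
    refine ⟨fun x => ψ.toRingHom (ω.repr u x), fun i hi => ?_⟩
    conv_lhs => rw [← ω.sum_repr u]
    rw [map_sum, map_sum, Finsupp.finsetSum_apply, Finset.mul_sum]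
    refine Finset.sum_congr rfl fun x _ => ?_
    beta_reduce
    rw [LinearMap.map_smulₛₗ, map_smul, Finsupp.smul_apply, smul_eq_mul, ← matrixOf_apply]
    rcases lt_trichotomy (wt x) w with h | h | h
    · rw [matrixOf_F_eq_zero hX hU ω hω ψ (by omega), hG, if_neg (by omega), mul_zero, zero_mul,
        mul_zero]
    · rw [hFG i x (by omega), hi]; ring
    · rw [repr_eq_zero_of_mem_U hX hU ω hω hu h, map_zero, zero_mul, mul_zero, mul_zero]
  choose z hz hzω using fun j => hU.frob_onto (wt j) ψ (ω j) (hω j).1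
  choose a ha using fun j => hspan (wt j) (z j) (hz j)
  refine ⟨G, Matrix.of fun x j => if wt x = wt j then a j x else 0, fun i j hij => ?_,
    fun i j hij => ?_, Matrix.ext fun i j => ?_, hFG⟩
  · rw [hG, if_neg (by omega)]
  · rw [Matrix.of_apply, if_neg (by omega)]
  · rw [Matrix.mul_apply]
    by_cases hij : wt i = wt j
    · have h1 := hzω j
      rw [← hij] at h1
      have h2 := repr_prev_eq_zero hX hU ω hω h1
      rw [map_sub, map_smul, Finsupp.sub_apply, Finsupp.smul_apply, smul_eq_mul, sub_eq_zero,
        ha j i hij, ← hij] at h2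
      have h3 := mul_left_cancel₀ (pow_ne_zero _ natCast_p_ne_zero_PS) h2
      rw [ω.repr_self, Finsupp.single_apply] at h3
      rw [Matrix.one_apply]
      simp only [eq_comm (a := i)]
      rw [h3]
      refine Finset.sum_congr rfl fun x _ => ?_
      rw [Matrix.of_apply]
      split_ifs with hx
      · rfl
      · rw [hG, if_neg (by omega), zero_mul, zero_mul]
    · rw [Matrix.one_apply_ne (by rintro rfl; exact hij rfl)]
      refine Finset.sum_eq_zero fun x _ => ?_
      rw [Matrix.of_apply, hG]
      split_ifs with h1 h2
      · omega
      all_goals simp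

end UnitRoot

/-! ### Triangular similitudes and changes of basis that respect weights. -/

section Matrices

variable {R : Type*} [CommRing R] {n : ℕ}

lemma exists_basis_of_mul_eq_one {M ι : Type*} [AddCommGroup M] [Module R M] [Fintype ι]
    [DecidableEq ι] (b : Module.Basis ι R M) {Y Y' : Matrix ι ι R} (h : Y' * Y = 1) :
    ∃ e : Module.Basis ι R M, (∀ j, e j = ∑ x, Y x j • b x) ∧ b.toMatrix e = Y := by
  have hY : IsUnit Y.det := by
    rw [← Matrix.isUnit_iff_isUnit_det]
    exact IsUnit.of_mul_eq_one _ (mul_eq_one_comm.1 h)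
  have he : ∀ j, b.map (Matrix.toLinearEquiv b Y hY) j = ∑ x, Y x j • b x := fun j => by
    rw [Module.Basis.map_apply]
    exact Matrix.toLin_self ..
  refine ⟨b.map (Matrix.toLinearEquiv b Y hY), he, Matrix.ext fun i j => ?_⟩
  rw [Module.Basis.toMatrix_apply, he, b.repr_sum_self]

lemma gramMatrix_mul_apply_zero (M : Matrix (Idx n) (Idx n) R) (j : Idx n) :
    (gramMatrix R n * M) (Sum.inl (Sum.inl ())) j = - M (Sum.inr (Sum.inr ())) j := by
  simp [gramMatrix, Matrix.mul_apply, Fintype.sum_sum_type]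

lemma gramMatrix_mul_apply_one (M : Matrix (Idx n) (Idx n) R) (a : Fin n) (j : Idx n) :
    (gramMatrix R n * M) (Sum.inl (Sum.inr a)) j = M (Sum.inr (Sum.inl a)) j := by
  simp [gramMatrix, Matrix.mul_apply, Fintype.sum_sum_type, Matrix.one_apply]

/-- For a symplectic similitude which is block upper triangular, the first two diagonal blocks
determine the last two. -/
lemma diag_of_similitude {q : R} (hq : ∀ (m : ℕ) (x : R), q ^ m * x = 0 → x = 0)
    {Φ : Matrix (Idx n) (Idx n) R} (hΦ : ∀ i j, wt j < wt i → Φ i j = 0)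
    (hd : ∀ i j, wt i = wt j → wt i ≤ 1 → Φ i j = q ^ wt i * (1 : Matrix (Idx n) (Idx n) R) i j)
    (hG : Φ.transpose * gramMatrix R n * Φ = q ^ 3 • gramMatrix R n) (i j : Idx n)
    (hij : wt i = wt j) : Φ i j = q ^ wt i * (1 : Matrix (Idx n) (Idx n) R) i j := by
  have key : ∀ i j, wt i + wt j = 3 → wt i ≤ 1 →
      q ^ wt i * (gramMatrix R n * Φ) i j = q ^ 3 * gramMatrix R n i j := by
    intro i j hij hi
    have h1 : (Φ.transpose * gramMatrix R n * Φ) i j = (q ^ 3 • gramMatrix R n) i j := by rw [hG]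
    rw [mul_assoc, Matrix.mul_apply, Finset.sum_eq_single i, Matrix.transpose_apply,
      hd i i rfl hi, Matrix.one_apply_eq, mul_one] at h1
    · exact h1
    · intro x _ hx
      rw [Matrix.transpose_apply]
      rcases lt_trichotomy (wt x) (wt i) with h | h | h
      · have : (gramMatrix R n * Φ) x j = 0 := by
          rw [Matrix.mul_apply]
          refine Finset.sum_eq_zero fun y _ => ?_
          by_cases hy : wt x + wt y = 3
          · rw [hΦ y j (by omega), mul_zero]
          · rw [gramMatrix_apply_eq_zero hy, zero_mul]
        rw [this, mul_zero]
      · rw [hd x i h (by omega), Matrix.one_apply_ne hx, mul_zero, zero_mul]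
      · rw [hΦ x i h, zero_mul]
    · simp
  rcases i with ((i | i) | (i | i)) <;> rcases j with ((j | j) | (j | j)) <;>
    first
    | (exfalso; revert hij; simp [wt]; done)
    | (refine hd _ _ hij ?_; simp [wt]; done)
    | skip
  · have h1 := key (Sum.inl (Sum.inr i)) (Sum.inr (Sum.inl j)) rfl le_rfl
    rw [gramMatrix_mul_apply_one] at h1
    have h2 := hq 1 (Φ (Sum.inr (Sum.inl i)) (Sum.inr (Sum.inl j)) - q ^ 2 *
      gramMatrix R n (Sum.inl (Sum.inr i)) (Sum.inr (Sum.inl j))) (by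
        simp only [wt] at h1
        rw [mul_sub, h1]; ring)
    rw [sub_eq_zero.1 h2]
    simp [wt, gramMatrix, Matrix.one_apply]
  · have h1 := key (Sum.inl (Sum.inl ())) (Sum.inr (Sum.inr j)) rfl (by simp [wt])
    rw [gramMatrix_mul_apply_zero] at h1
    have h2 : Φ (Sum.inr (Sum.inr ())) (Sum.inr (Sum.inr j)) = q ^ 3 := by
      simpa [wt, gramMatrix] using h1
    rw [show i = () from rfl, h2]
    simp [wt]

lemma mul_map_sympDiag {Y₀ : Matrix Unit Unit R} {Y₁ : Matrix (Fin n) (Fin n) R}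
    {G : Matrix (Idx n) (Idx n) R} (σ : R →+* R)
    (h₀ : G.toBlocks₁₁.toBlocks₁₁ * Y₀.map σ = Y₀) (h₁ : G.toBlocks₁₁.toBlocks₂₂ * Y₁.map σ = Y₁)
    {i j : Idx n} (hij : wt i = wt j) (hi : wt i ≤ 1) :
    (G * (sympDiag Y₀ Y₁).map σ) i j = sympDiag Y₀ Y₁ i j := by
  rcases i with ((i | i) | (i | i)) <;> rcases j with ((j | j) | (j | j)) <;>
    first
    | (exfalso; revert hij; simp [wt]; done)
    | (exfalso; revert hi; simp [wt]; done)
    | skip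
  · rw [Matrix.mul_apply]
    simpa [Fintype.sum_sum_type, sympDiag, Matrix.mul_apply, Matrix.toBlocks₁₁] using
      congrFun (congrFun h₀ i) j
  · rw [Matrix.mul_apply]
    simpa [Fintype.sum_sum_type, sympDiag, Matrix.mul_apply, Matrix.toBlocks₁₁,
      Matrix.toBlocks₂₂] using congrFun (congrFun h₁ i) j

lemma isUnit_toBlocks {G G' : Matrix (Idx n) (Idx n) R} (hG : HasDeg 0 G)
    (h : G * G' = 1) :
    IsUnit G.toBlocks₁₁.toBlocks₁₁ ∧ IsUnit G.toBlocks₁₁.toBlocks₂₂ := by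
  refine ⟨IsUnit.of_mul_eq_one G'.toBlocks₁₁.toBlocks₁₁ (Matrix.ext fun i j => ?_),
    IsUnit.of_mul_eq_one G'.toBlocks₁₁.toBlocks₂₂ (Matrix.ext fun i j => ?_)⟩
  · have h1 := congrFun (congrFun h (Sum.inl (Sum.inl i))) (Sum.inl (Sum.inl j))
    rw [Matrix.mul_apply, Fintype.sum_sum_type, Fintype.sum_sum_type, Fintype.sum_sum_type,
      Finset.sum_eq_zero (s := (Finset.univ : Finset (Fin n))) (fun x _ => by
        rw [hG _ _ (by simp [wt]), zero_mul]), Finset.sum_eq_zero (s := (Finset.univ : Finset (Fin n))) (fun x _ => by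
        rw [hG _ _ (by simp [wt]), zero_mul]),  Finset.sum_eq_zero (s := (Finset.univ : Finset Unit))
        (f := fun x => G (Sum.inl (Sum.inl i)) (Sum.inr (Sum.inr x)) * _) (fun x _ => by
        rw [hG _ _ (by simp [wt]), zero_mul]), add_zero, add_zero, add_zero] at h1
    rw [Matrix.mul_apply]
    refine h1.trans ?_
    simp
  · have h1 := congrFun (congrFun h (Sum.inl (Sum.inr i))) (Sum.inl (Sum.inr j))
    rw [Matrix.mul_apply, Fintype.sum_sum_type, Fintype.sum_sum_type, Fintype.sum_sum_type,
      Finset.sum_eq_zero (s := (Finset.univ : Finset Unit)) (fun x _ => by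
        rw [hG _ _ (by simp [wt]), zero_mul]), Finset.sum_eq_zero (s := (Finset.univ : Finset (Fin n)))
        (f := fun x => G (Sum.inl (Sum.inr i)) (Sum.inr (Sum.inl x)) * _) (fun x _ => by
        rw [hG _ _ (by simp [wt]), zero_mul]),  Finset.sum_eq_zero (s := (Finset.univ : Finset Unit))
        (f := fun x => G (Sum.inl (Sum.inr i)) (Sum.inr (Sum.inr x)) * _) (fun x _ => by
        rw [hG _ _ (by simp [wt]), zero_mul]), add_zero, add_zero, zero_add] at h1
    rw [Matrix.mul_apply]
    refine h1.trans ?_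
    simp [Matrix.one_apply]

lemma HasDeg.map {S : Type*} [CommRing S] {d : ℕ} {M : Matrix (Idx n) (Idx n) R} (h : HasDeg d M)
    {f : R → S} (hf : f 0 = 0) : HasDeg d (M.map f) := fun i j hij => by
  rw [Matrix.map_apply, h i j hij, hf]

/-- The Frobenius matrix in a basis of fixed vectors. -/
lemma diag_of_change {q : R} {Φ Φ' G Y Y' Yσ : Matrix (Idx n) (Idx n) R}
    (hY' : HasDeg 0 Y') (hYσ : HasDeg 0 Yσ) (hYY' : Y' * Y = 1)
    (hΦ : ∀ i j, wt i = wt j → Φ i j = q ^ wt i * G i j)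
    (hfix : ∀ i j, wt i = wt j → wt i ≤ 1 → (G * Yσ) i j = Y i j) (h : Φ' = Y' * (Φ * Yσ))
    {i j : Idx n} (hij : wt i = wt j) (hi : wt i ≤ 1) :
    Φ' i j = q ^ wt i * (1 : Matrix (Idx n) (Idx n) R) i j := by
  have h1 : ∀ x, wt x = wt i → (Φ * Yσ) x j = q ^ wt i * Y x j := by
    intro x hx
    rw [← hfix x j (by omega) (by omega), Matrix.mul_apply, Matrix.mul_apply, Finset.mul_sum]
    refine Finset.sum_congr rfl fun y _ => ?_
    by_cases hy : wt x = wt y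
    · rw [hΦ x y hy, hx]; ring
    · rw [hYσ y j (by omega)]; ring
  rw [h, ← hYY', Matrix.mul_apply, Matrix.mul_apply, Finset.mul_sum]
  refine Finset.sum_congr rfl fun x _ => ?_
  by_cases hx : wt x = wt i
  · rw [h1 x hx]; ring
  · rw [hY' i x (by omega)]; ring

/-- An integrable connection matrix of degree one is closed and commutes with itself. -/
lemma closed_of_integrable {N : Fin n → Matrix (Idx n) (Idx n) (MvPowerSeries (Fin n) R)}
    (hN : ∀ l, HasDeg 1 (N l))
    (h : ∀ i j, (N j).map (pd i) + N i * N j = (N i).map (pd j) + N j * N i) (i j : Fin n) :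
    (N j).map (pd i) = (N i).map (pd j) ∧ N i * N j = N j * N i := by
  have h1 := h i j
  have h2 : ∀ a b, HasDeg 2 (N a * N b) := fun a b => (hN a).mul (hN b)
  have h3 : ∀ a b, HasDeg 1 ((N a).map (pd b)) := fun a b => (hN a).map (pd_zero b)
  have h4 : (N j).map (pd i) = (N i).map (pd j) := by
    refine Matrix.ext fun x y => ?_
    by_cases hxy : wt y = wt x + 1
    · have := congrFun (congrFun h1 x) y
      rwa [Matrix.add_apply, Matrix.add_apply, h2 i j x y (by omega), h2 j i x y (by omega),
        add_zero, add_zero] at this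
    · rw [h3 j i x y hxy, h3 i j x y hxy]
  exact ⟨h4, by rwa [h4, add_right_inj] at h1⟩

end Matrices

/-! ### The connection in a basis in which the unit root parts are trivial. -/

section Bases

variable {p : ℕ} [hp : Fact p.Prime] {k : Type*} [Field k] [CharP k p] [PerfectRing k p] {n : ℕ}
  {H : Type*} [AddCommGroup H] [Module (PS p k n) H] {X : FCrystal p k n H}
  {φb : FrobLift p (AlgebraicClosure k) n} {φ : FrobLift p k n} (hφ : Extends φb φ)

lemma matrixOf_Dbar_baseChange {ι : Type*} (ω : Module.Basis ι (PS p k n) H) (l : Fin n) :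
    matrixOf (Algebra.TensorProduct.basis (PSbar p k n) ω) (Dbar X l) =
      (matrixOf ω (X.D l)).map (algebraMap (PS p k n) (PSbar p k n)) := by
  refine Matrix.ext fun i j => ?_
  rw [matrixOf_apply, Algebra.TensorProduct.basis_apply, Dbar_tmul, pd_one, TensorProduct.zero_tmul,
    zero_add, Algebra.TensorProduct.basis_repr_tmul, one_smul, Finsupp.mapRange_apply]
  rfl

lemma matrixOf_Fbar_baseChange {ι : Type*} (ω : Module.Basis ι (PS p k n) H) :
    matrixOf (Algebra.TensorProduct.basis (PSbar p k n) ω) (Fbar X hφ) =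
      (matrixOf ω (X.F φ)).map (algebraMap (PS p k n) (PSbar p k n)) := by
  refine Matrix.ext fun i j => ?_
  rw [matrixOf_apply, Algebra.TensorProduct.basis_apply, Fbar_tmul, map_one,
    Algebra.TensorProduct.basis_repr_tmul, one_smul, Finsupp.mapRange_apply]
  rfl

variable (e : Module.Basis (Idx n) (PSbar p k n) (PSbar p k n ⊗[PS p k n] H))

/-- Only the diagonal blocks are in question. There horizontality reads `N_l = ∑ ∂_l φ(t_m) φ(N_m)`
after cancelling `p^w`. As each `∂_l φ(t_m)` is divisible by `p`, divisibility of all blocks by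
`p^M` implies divisibility by `p^(M+1)`. -/
lemma matrixOf_Dbar_hasDeg
    (hN : ∀ l i j, wt j < wt i ∨ wt i + 1 < wt j → matrixOf e (Dbar X l) i j = 0)
    (hF : ∀ i j, wt j ≤ wt i → matrixOf e (Fbar X hφ) i j =
      (p : PSbar p k n) ^ wt i * (1 : Matrix (Idx n) (Idx n) (PSbar p k n)) i j) (l : Fin n) :
    HasDeg 1 (matrixOf e (Dbar X l)) := by
  have hdiv : ∀ M : ℕ, ∀ l i j, wt i = wt j →
      (p : PSbar p k n) ^ M ∣ matrixOf e (Dbar X l) i j := by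
    intro M
    induction M with
    | zero => intro l i j _; rw [pow_zero]; exact one_dvd _
    | succ M ih =>
      intro l i j hij
      have h1 := congrFun (congrFun (matrixOf_horizontal (X := X) hφ e l) i) j
      rw [Matrix.add_apply, Matrix.map_apply, hF i j hij.ge] at h1
      have h2 : pd l ((p : PSbar p k n) ^ wt i *
          (1 : Matrix (Idx n) (Idx n) (PSbar p k n)) i j) = 0 := by
        have : (p : PSbar p k n) ^ wt i * (1 : Matrix (Idx n) (Idx n) (PSbar p k n)) i j =
            ((p ^ wt i * (1 : Matrix (Idx n) (Idx n) ℕ) i j : ℕ) : PSbar p k n) := by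
          rw [Nat.cast_mul, Nat.cast_pow, Matrix.one_apply, Matrix.one_apply]
          split_ifs <;> simp
        rw [this]
        exact Derivation.map_natCast _ _
      have h3 : (matrixOf e (Dbar X l) * matrixOf e (Fbar X hφ)) i j =
          (p : PSbar p k n) ^ wt i * matrixOf e (Dbar X l) i j := by
        rw [Matrix.mul_apply, Finset.sum_eq_single j, hF j j le_rfl, Matrix.one_apply_eq, hij]
        · ring
        · intro x _ hx
          rcases lt_or_ge (wt x) (wt j) with h | h
          · rw [hN l i x (Or.inl (by omega)), zero_mul]
          · rw [hF x j h, Matrix.one_apply_ne hx, mul_zero, mul_zero]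
        · simp
      have h4 : ∀ m, (matrixOf e (Fbar X hφ) * (matrixOf e (Dbar X m)).map φb.toRingHom) i j =
          (p : PSbar p k n) ^ wt i * φb.toRingHom (matrixOf e (Dbar X m) i j) := by
        intro m
        rw [Matrix.mul_apply, Finset.sum_eq_single i, hF i i le_rfl, Matrix.one_apply_eq,
          Matrix.map_apply]
        · ring
        · intro x _ hx
          rcases lt_or_ge (wt i) (wt x) with h | h
          · rw [Matrix.map_apply, hN m x j (Or.inl (by omega)), map_zero, mul_zero]
          · rw [hF i x h, Matrix.one_apply_ne hx.symm, mul_zero, zero_mul]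
        · simp
      rw [h2, zero_add, h3, Matrix.sum_apply] at h1
      have h5 : ∀ m, ∃ c, algebraMap (PS p k n) (PSbar p k n)
          (pd l (φ.toRingHom (MvPowerSeries.X m))) * φb.toRingHom (matrixOf e (Dbar X m) i j) =
            (p : PSbar p k n) ^ (M + 1) * c := by
        intro m
        obtain ⟨c, hc⟩ := ih m i j hij
        obtain ⟨d, hd⟩ := FrobLift.dvd_pd_X (φ := φ) l m
        refine ⟨algebraMap (PS p k n) (PSbar p k n) d * φb.toRingHom c, ?_⟩
        rw [hc, hd, map_mul, map_mul, map_pow, map_natCast, map_natCast]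
        ring
      choose c hc using h5
      refine ⟨∑ m, c m, mul_left_cancel₀ (pow_ne_zero (wt i) natCast_p_ne_zero_PS) ?_⟩
      rw [h1, Finset.mul_sum, Finset.mul_sum]
      refine Finset.sum_congr rfl fun m _ => ?_
      rw [Matrix.smul_apply, h4, smul_eq_mul, ← hc]
      ring
  intro i j hij
  rcases lt_trichotomy (wt j) (wt i) with h | h | h
  · exact hN l i j (Or.inl h)
  · exact psep_PS _ fun M => hdiv M l i j h.symm
  · exact hN l i j (Or.inr (by omega))

lemma matrixOf_Dbar_closed (hN : ∀ l, HasDeg 1 (matrixOf e (Dbar X l))) (i j : Fin n) :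
    (matrixOf e (Dbar X j)).map (pd i) = (matrixOf e (Dbar X i)).map (pd j) ∧
      matrixOf e (Dbar X i) * matrixOf e (Dbar X j) =
        matrixOf e (Dbar X j) * matrixOf e (Dbar X i) :=
  closed_of_integrable hN (fun i j => matrixOf_Dbar_integrable (X := X) e i j) i j

end Bases

/-! ### Existence of the basis `e`. -/

section HorizontalBasis

variable {p : ℕ} [hp : Fact p.Prime] {k : Type*} [Field k] [CharP k p] [PerfectRing k p] {n : ℕ}
  {H : Type*} [AddCommGroup H] [Module (PS p k n) H]
  [Module.Free (PS p k n) H] [Module.Finite (PS p k n) H]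
  {X : FCrystal p k n H} {φ : FrobLift p k n} {Fil U : ℕ → Submodule (PS p k n) H}
  {B : LinearMap.BilinForm (PS p k n) H}

lemma mem_baseChange_of_sum {M : Type*} [AddCommGroup M] [Module (PS p k n) M]
    (V : Submodule (PS p k n) M) {ι : Type*} [Fintype ι] (ω : Module.Basis ι (PS p k n) M)
    (y : ι → PSbar p k n) (h : ∀ x, y x = 0 ∨ ω x ∈ V) :
    ∑ x, y x • Algebra.TensorProduct.basis (PSbar p k n) ω x ∈
      V.baseChange (PSbar p k n) := by
  refine Submodule.sum_mem _ fun x _ => ?_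
  rcases h x with h | h
  · rw [h, zero_smul]; exact Submodule.zero_mem _
  · rw [Algebra.TensorProduct.basis_apply]
    exact Submodule.smul_mem _ _ (Submodule.tmul_mem_baseChange_of_mem _ h)

lemma form_basis_baseChange (ω : Module.Basis (Idx n) (PS p k n) H)
    (hB : ∀ i j, B (ω i) (ω j) = gramMatrix (PS p k n) n i j) (i j : Idx n) :
    B.baseChange (PSbar p k n) (Algebra.TensorProduct.basis (PSbar p k n) ω i)
      (Algebra.TensorProduct.basis (PSbar p k n) ω j) = gramMatrix (PSbar p k n) n i j := by
  rw [Algebra.TensorProduct.basis_apply, Algebra.TensorProduct.basis_apply,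
    LinearMap.BilinForm.baseChange_tmul, hB, mul_one, ← Algebra.algebraMap_eq_smul_one]
  exact congrFun (congrFun (gramMatrix_map (algebraMap (PS p k n) (PSbar p k n))) i) j

lemma form_eq_toMatrix {R M ι : Type*} [CommRing R] [AddCommGroup M] [Module R M] [Fintype ι]
    (F : LinearMap.BilinForm R M) (b : Module.Basis ι R M) (v : ι → M) (G : Matrix ι ι R)
    (h : ∀ i j, F (b i) (b j) = G i j) (i j : ι) :
    F (v i) (v j) = ((b.toMatrix v).transpose * G * b.toMatrix v) i j := by
  rw [form_eq_sum F b, Finset.sum_comm, Matrix.mul_apply]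
  refine Finset.sum_congr rfl fun y _ => ?_
  rw [Matrix.mul_apply, Finset.sum_mul]
  refine Finset.sum_congr rfl fun x _ => ?_
  rw [h, Matrix.transpose_apply, Module.Basis.toMatrix_apply, Module.Basis.toMatrix_apply]

/-- The symplectic change of basis which trivializes the unit root parts. -/
lemma exists_sympDiag_fixed (hX : IsOrdinaryCY3 X φ Fil B) (hU : IsConjFiltration X φ U)
    (ω : Module.Basis (Idx n) (PS p k n) H) (hω : ∀ j, ω j ∈ U (wt j) ⊓ Fil (wt j)) :
    ∃ Y G : Matrix (Idx n) (Idx n) (PSbar p k n), HasDeg 0 Y ∧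
      Y.transpose * gramMatrix (PSbar p k n) n * Y = gramMatrix (PSbar p k n) n ∧
      (∀ i j, wt i = wt j → algebraMap (PS p k n) (PSbar p k n)
        (matrixOf ω (X.F (stdLift p k n)) i j) = (p : PSbar p k n) ^ wt i * G i j) ∧
      ∀ i j, wt i = wt j → wt i ≤ 1 →
        (G * Y.map (stdLift p (AlgebraicClosure k) n).toRingHom) i j = Y i j := by
  obtain ⟨G, G', hG, hG', hGG', hΦ⟩ := exists_unit_root_matrix hX hU ω hω (stdLift p k n)
  have h1 : G.map (algebraMap (PS p k n) (PSbar p k n)) *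
      G'.map (algebraMap (PS p k n) (PSbar p k n)) = 1 := by
    rw [← Matrix.map_mul, hGG']
    exact Matrix.map_one _ (map_zero _) (map_one _)
  obtain ⟨hu₀, hu₁⟩ := isUnit_toBlocks (hG.map (map_zero _)) h1
  obtain ⟨Y₀, hY₀, hGY₀⟩ := exists_mul_map_stdLift_eq _ hu₀
  obtain ⟨Y₁, hY₁, hGY₁⟩ := exists_mul_map_stdLift_eq _ hu₁
  refine ⟨sympDiag Y₀ Y₁, G.map (algebraMap (PS p k n) (PSbar p k n)), sympDiag_hasDeg _ _,
    sympDiag_gram hY₀ hY₁, fun i j hij => ?_, fun i j hij hi => mul_map_sympDiag _ hGY₀ hGY₁ hij hi⟩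
  rw [hΦ i j hij, map_mul, map_pow, map_natCast, Matrix.map_apply]

lemma matrix_eq_of_mul_eq {R : Type*} [CommRing R] {ι : Type*} [Fintype ι] [DecidableEq ι]
    {Y Y' M M' : Matrix ι ι R} (h : Y' * Y = 1) (hM : Y * M = M') : M = Y' * M' := by
  rw [← hM, ← mul_assoc, h, one_mul]

lemma band_of_change {R : Type*} [CommRing R] {Y Y' N N' N'' : Matrix (Idx n) (Idx n) R}
    (hY : HasDeg 0 Y) (hY' : HasDeg 0 Y') (hN'' : HasDeg 0 N'')
    (hN : ∀ i j, wt j < wt i ∨ wt i + 1 < wt j → N i j = 0) (h : N' = Y' * (N'' + N * Y))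
    (i j : Idx n) (hij : wt j < wt i ∨ wt i + 1 < wt j) : N' i j = 0 := by
  rw [h]
  refine hY'.mul_left_eq_zero (Q := fun a b => b < a ∨ a + 1 < b) (fun i j hij => ?_) hij
  rw [Matrix.add_apply, hN'' i j (by omega), zero_add]
  exact hY.mul_right_eq_zero (Q := fun a b => b < a ∨ a + 1 < b) hN hij

lemma upper_of_change {R : Type*} [CommRing R] {Y Y' Φ Φ' : Matrix (Idx n) (Idx n) R}
    (hY : HasDeg 0 Y) (hY' : HasDeg 0 Y') (hΦ : ∀ i j, wt j < wt i → Φ i j = 0)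
    (h : Φ' = Y' * (Φ * Y)) (i j : Idx n) (hij : wt j < wt i) : Φ' i j = 0 := by
  rw [h]
  refine hY'.mul_left_eq_zero (Q := fun a b => b < a) (fun i j hij => ?_) hij
  exact hY.mul_right_eq_zero (Q := fun a b => b < a) hΦ hij

/-- Lang's theorem is applied to the blocks of weights 0 and 1 of the Frobenius of an adapted basis;
the blocks of weights 3 and 2 are changed contragrediently, so that the basis stays symplectic. A
change of basis that respects weights keeps the basis adapted. -/
theorem exists_horizontal_basis (hX : IsOrdinaryCY3 X φ Fil B) (hU : IsConjFiltration X φ U) :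
    ∃ e : Module.Basis (Idx n) (PSbar p k n) (PSbar p k n ⊗[PS p k n] H),
      (∀ j, e j ∈ (U (wt j)).baseChange (PSbar p k n) ⊓ (Fil (wt j)).baseChange (PSbar p k n)) ∧
      (∀ i j, B.baseChange (PSbar p k n) (e i) (e j) = gramMatrix (PSbar p k n) n i j) ∧
      (∀ l, HasDeg 1 (matrixOf e (Dbar X l))) ∧
      ∀ i j, wt j ≤ wt i → matrixOf e (Fbar X (extends_stdLift (p := p) (k := k) (n := n))) i j =
        (p : PSbar p k n) ^ wt i * (1 : Matrix (Idx n) (Idx n) (PSbar p k n)) i j := by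
  obtain ⟨ω₀, hω₀⟩ := exists_generator hX hU
  obtain ⟨ω, -, hω, hωB, -⟩ := exists_adapted_basis hX hU hω₀
  obtain ⟨Y, G, hY, hYG, hGΦ, hGY⟩ := exists_sympDiag_fixed hX hU ω hω
  obtain ⟨Y', hY'⟩ : ∃ Y', Y' = -(gramMatrix (PSbar p k n) n * Y.transpose *
    gramMatrix (PSbar p k n) n) := ⟨_, rfl⟩
  have hY'0 : HasDeg 0 Y' := fun i j hij => by
    rw [hY', Matrix.neg_apply, hY.gram_transpose_gram i j hij, neg_zero]
  have hYY : Y' * Y = 1 := hY' ▸ isUnit_of_gram hYG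
  obtain ⟨e, he, heY⟩ := exists_basis_of_mul_eq_one
    (Algebra.TensorProduct.basis (PSbar p k n) ω) hYY
  have hgram : ∀ i j, B.baseChange (PSbar p k n) (e i) (e j) = gramMatrix (PSbar p k n) n i j := by
    intro i j
    rw [form_eq_toMatrix _ _ _ _ (form_basis_baseChange ω hωB), heY, hYG]
  have hN := fun l => matrix_eq_of_mul_eq hYY (heY ▸ toMatrix_mul_matrixOf_Dbar (X := X) e
    (Algebra.TensorProduct.basis (PSbar p k n) ω) l)
  have hF := matrix_eq_of_mul_eq hYY (heY ▸ toMatrix_mul_matrixOf_Fbar (X := X)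
    (extends_stdLift (p := p) (k := k) (n := n)) e
    (Algebra.TensorProduct.basis (PSbar p k n) ω))
  rw [matrixOf_Fbar_baseChange] at hF
  simp_rw [matrixOf_Dbar_baseChange] at hN
  have hYσ := hY.map (map_zero (stdLift p (AlgebraicClosure k) n).toRingHom)
  have hFe : ∀ i j, wt j ≤ wt i →
      matrixOf e (Fbar X (extends_stdLift (p := p) (k := k) (n := n))) i j =
        (p : PSbar p k n) ^ wt i * (1 : Matrix (Idx n) (Idx n) (PSbar p k n)) i j := by
    have hup := upper_of_change hYσ hY'0 (fun i j hij => by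
      rw [Matrix.map_apply, matrixOf_F_eq_zero hX hU ω hω _ hij, map_zero]) hF
    intro i j hij
    rcases hij.lt_or_eq with hij | hij
    · rw [hup i j hij, Matrix.one_apply_ne (by rintro rfl; exact hij.false), mul_zero]
    -- Fixed vectors normalize weights 0 and 1; weights 2 and 3 follow from the similitude factor
    -- `p^3`.
    · refine diag_of_similitude (fun m x hx => ?_) hup (fun i j hij hi => ?_)
        (frob_gram _ e hgram (hX.form_frob _)) i j hij.symm
      · exact (mul_eq_zero.1 hx).resolve_left (pow_ne_zero _ natCast_p_ne_zero_PS)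
      · exact diag_of_change hY'0 hYσ hYY hGΦ hGY hF hij hi
  refine ⟨e, fun j => ⟨?_, ?_⟩, hgram, ?_, hFe⟩
  · rw [he]
    refine mem_baseChange_of_sum _ ω _ fun x => ?_
    by_cases hx : wt x = wt j
    · exact Or.inr (hx ▸ (hω x).1)
    · exact Or.inl (hY x j (by omega))
  · rw [he]
    refine mem_baseChange_of_sum _ ω _ fun x => ?_
    by_cases hx : wt x = wt j
    · exact Or.inr (hx ▸ (hω x).2)
    · exact Or.inl (hY x j (by omega))
  · refine matrixOf_Dbar_hasDeg _ e (fun l => ?_) hFe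
    refine band_of_change hY hY'0 (hY.map (pd_zero l)) (fun i j hij => ?_) (hN l)
    rw [Matrix.map_apply, matrixOf_D_eq_zero hX hU ω hω l hij, map_zero]

end HorizontalBasis

/-! ### Unipotence of period matrices. -/

section Tmatrix

variable {R : Type*} [CommRing R] {n : ℕ} (Z : R) (τ₂₃ τ₁₃ : Fin n → R)
  (τ₁₂ : Matrix (Fin n) (Fin n) R)

lemma Tmatrix_eq_one {i j : Idx n} (h : wt j ≤ wt i) :
    Tmatrix Z τ₂₃ τ₁₃ τ₁₂ i j = (1 : Matrix (Idx n) (Idx n) R) i j := by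
  rw [Tmatrix, Matrix.fromBlocks_multiply]
  rcases i with ((i | i) | (i | i)) <;> rcases j with ((j | j) | (j | j)) <;>
    first
    | (exfalso; revert h; simp [wt]; done)
    | simp [Matrix.one_apply]

lemma Tmatrix_apply_last (m : Fin n) :
    Tmatrix Z τ₂₃ τ₁₃ τ₁₂ (Sum.inr (Sum.inl m)) (lastIdx n) = τ₂₃ m := by
  rw [Tmatrix, Matrix.fromBlocks_multiply]
  simp

lemma isUnit_Tmatrix : IsUnit (Tmatrix Z τ₂₃ τ₁₃ τ₁₂) := by
  rw [Matrix.isUnit_iff_isUnit_det, Tmatrix, Matrix.det_mul, Matrix.det_fromBlocks_zero₂₁,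
    Matrix.det_fromBlocks_zero₂₁, Matrix.det_fromBlocks_zero₂₁, Matrix.det_fromBlocks_zero₂₁]
  simp

lemma mul_unipotent {M M' : Matrix (Idx n) (Idx n) R}
    (hM : ∀ i j, wt j ≤ wt i → M i j = (1 : Matrix (Idx n) (Idx n) R) i j)
    (hM' : ∀ i j, wt j ≤ wt i → M' i j = (1 : Matrix (Idx n) (Idx n) R) i j) (i j : Idx n)
    (h : wt j ≤ wt i) : (M * M') i j = (1 : Matrix (Idx n) (Idx n) R) i j := by
  rw [Matrix.mul_apply, Finset.sum_eq_single i, hM i i le_rfl, Matrix.one_apply_eq, one_mul,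
    hM' i j h]
  · intro x _ hx
    rcases le_or_gt (wt x) (wt i) with h1 | h1
    · rw [hM i x h1, Matrix.one_apply_ne hx.symm, zero_mul]
    · rw [hM' x j (by omega), Matrix.one_apply_ne (by rintro rfl; omega), mul_zero]
  · simp

/-- The logarithmic derivative of a unipotent matrix is strictly upper triangular. -/
lemma logDeriv_unipotent {T N : Matrix (Idx n) (Idx n) (MvPowerSeries (Fin n) R)} {l : Fin n}
    (hT : ∀ i j, wt j ≤ wt i → T i j = (1 : Matrix (Idx n) (Idx n) (MvPowerSeries (Fin n) R)) i j)
    (h : T.map (pd l) = T * N) (i j : Idx n) (hij : wt j ≤ wt i) : N i j = 0 := by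
  have key : ∀ d i, 3 - wt i = d → wt j ≤ wt i → N i j = 0 := by
    intro d
    induction d using Nat.strong_induction_on with
    | _ d ih =>
      intro i hd hij
      have h1 := congrFun (congrFun h i) j
      rw [Matrix.map_apply, hT i j hij, Matrix.mul_apply, Finset.sum_eq_single i, hT i i le_rfl,
        Matrix.one_apply_eq, one_mul] at h1
      · rw [← h1, Matrix.one_apply]
        split_ifs
        · exact pd_one l
        · exact pd_zero l
      · intro x _ hx
        rcases le_or_gt (wt x) (wt i) with h1 | h1
        · rw [hT i x h1, Matrix.one_apply_ne hx.symm, zero_mul]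
        · rw [ih (3 - wt x) (by have := wt_le_three x; omega) x rfl (by omega), mul_zero]
      · simp
  exact key _ i rfl hij

end Tmatrix

/-! ### Existence and overconvergence of the period matrix. -/

section Period

variable {p : ℕ} [hp : Fact p.Prime] {k : Type*} [Field k] [CharP k p] {n : ℕ}

/-- Induction on the weight of the column: `N` is strictly upper triangular, so the derivatives of
`T i j` involve only columns of smaller weight, and integration preserves overconvergence. -/
lemma isOverconv_unipotent {T : Matrix (Idx n) (Idx n) (KPS p k n)}
    {N : Fin n → Matrix (Idx n) (Idx n) (KPS p k n)}
    (hT : ∀ i j, wt j ≤ wt i → T i j = (1 : Matrix (Idx n) (Idx n) (KPS p k n)) i j)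
    (h : ∀ l, T.map (pd l) = T * N l) (hN : ∀ l i j, IsOverconv (N l i j)) (i j : Idx n) :
    IsOverconv (T i j) := by
  have hN0 := fun l => logDeriv_unipotent hT (h l)
  induction hd : wt j using Nat.strong_induction_on generalizing j with
  | _ d ih =>
    rcases le_or_gt (wt j) (wt i) with h1 | h1
    · rw [hT i j h1, Matrix.one_apply]
      split_ifs
      · exact (Overconv p k n).one_mem
      · exact (Overconv p k n).zero_mem
    · refine isOverconv_of_pd fun l => ?_
      have h2 := congrFun (congrFun (h l) i) j
      rw [Matrix.map_apply, Matrix.mul_apply] at h2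
      rw [h2]
      refine (Overconv p k n).sum_mem fun x _ => ?_
      rcases le_or_gt (wt j) (wt x) with h3 | h3
      · rw [hN0 l x j h3, mul_zero]
        exact (Overconv p k n).zero_mem
      · exact (Overconv p k n).mul_mem (ih (wt x) (by omega) x rfl) (hN l x j)

/-- The connection is infinitesimally symplectic, so all derivatives of `T G Tᵀ` vanish and the
matrix equals its value at the origin. -/
lemma gram_of_conn {K : Type*} [Field K] [CharZero K]
    {T : Matrix (Idx n) (Idx n) (MvPowerSeries (Fin n) K)}
    {N : Fin n → Matrix (Idx n) (Idx n) (MvPowerSeries (Fin n) K)}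
    (h : ∀ l, T.map (pd l) = T * N l)
    (hN : ∀ l, (N l).transpose * gramMatrix _ n + gramMatrix _ n * N l = 0)
    {c : Matrix (Idx n) (Idx n) K} (hc : T.map (MvPowerSeries.constantCoeff (R := K)) = c)
    (hcG : c * gramMatrix K n * c.transpose = gramMatrix K n) :
    T * gramMatrix _ n * T.transpose = gramMatrix _ n := by
  obtain ⟨G, hG⟩ : ∃ G, G = gramMatrix (MvPowerSeries (Fin n) K) n := ⟨_, rfl⟩
  have hGG : G * G = -1 := hG ▸ gramMatrix_mul_self
  rw [← hG] at hN ⊢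
  have hN' : ∀ l, N l * G + G * (N l).transpose = 0 := by
    intro l
    have h1 := congrArg (fun M => G * M * G) (hN l)
    simp only [mul_add, add_mul, mul_zero, zero_mul] at h1
    rw [mul_assoc, mul_assoc (N l).transpose, hGG, ← mul_assoc G G, hGG] at h1
    rw [← neg_eq_zero, ← h1]
    noncomm_ring
  have hpdG : ∀ l, G.map (pd l) = 0 := fun l => Matrix.ext fun i j => by
    rw [hG]; exact pd_gramMatrix l i j
  have hpd : ∀ l, (T * G * T.transpose).map (pd l) = 0 := by
    intro l
    have h2 : T.transpose.map (pd l) = (N l).transpose * T.transpose := by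
      rw [Matrix.transpose_map, h, Matrix.transpose_mul]
    rw [map_pd_mul, map_pd_mul, hpdG, h2, h, mul_zero, add_zero]
    calc T * N l * G * T.transpose + T * G * ((N l).transpose * T.transpose)
        = T * (N l * G + G * (N l).transpose) * T.transpose := by noncomm_ring
      _ = 0 := by rw [hN', mul_zero, zero_mul]
  have hconst : (T * G * T.transpose).map (MvPowerSeries.constantCoeff (R := K)) =
      gramMatrix K n := by
    rw [Matrix.map_mul, Matrix.map_mul, hG, gramMatrix_map, Matrix.transpose_map, hc, hcG]
  refine Matrix.ext fun i j => ?_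
  rw [eq_C_of_pd_eq_zero _ fun l => congrFun (congrFun (hpd l) i) j]
  have h3 := congrFun (congrFun hconst i) j
  rw [Matrix.map_apply] at h3
  rw [h3, hG]
  exact congrFun (congrFun (gramMatrix_map (MvPowerSeries.C (R := K) (σ := Fin n))) i) j

/-- `T = c M`, with `M` the fundamental matrix that is `1` at the origin and `c` the constant
unipotent matrix which splits the Frobenius there. Left multiplication by a constant does not
disturb `dT = T N`. -/
theorem exists_period_matrix (N : Fin n → Matrix (Idx n) (Idx n) (KPS p k n))
    (hdeg : ∀ l, HasDeg 1 (N l)) (hclosed : ∀ i j, (N j).map (pd i) = (N i).map (pd j))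
    (hcomm : ∀ i j, N i * N j = N j * N i)
    (hN : ∀ l, (N l).transpose * gramMatrix _ n + gramMatrix _ n * N l = 0)
    (Φ : Matrix (Idx n) (Idx n) (Ku p k))
    (hΦ : ∀ i j, wt j ≤ wt i → Φ i j = (p : Ku p k) ^ wt i *
      (1 : Matrix (Idx n) (Idx n) (Ku p k)) i j)
    (hΦG : Φ.transpose * gramMatrix (Ku p k) n * Φ = (p : Ku p k) ^ 3 • gramMatrix (Ku p k) n) :
    ∃ Z τ₂₃ τ₁₃ τ₁₂, (∀ l, (Tmatrix Z τ₂₃ τ₁₃ τ₁₂).map (pd l) = Tmatrix Z τ₂₃ τ₁₃ τ₁₂ * N l) ∧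
      (Tmatrix Z τ₂₃ τ₁₃ τ₁₂).map (MvPowerSeries.constantCoeff (R := Ku p k)) * Φ =
        Pmatrix (Ku p k) n p * ((Tmatrix Z τ₂₃ τ₁₃ τ₁₂).map
          (MvPowerSeries.constantCoeff (R := Ku p k))).map (sigmaKu p k) := by
  have := charZero_Ku (p := p) (k := k)
  obtain ⟨M, hM, hM0, hM1⟩ := exists_fundamental_matrix N hdeg hclosed hcomm
  obtain ⟨c, hc1, hc⟩ := exists_unipotent_frobenius Φ hΦ
  obtain ⟨T, hT⟩ : ∃ T, T = c.map (MvPowerSeries.C (σ := Fin n) (R := Ku p k)) * M := ⟨_, rfl⟩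
  have hT1 : ∀ l, T.map (pd l) = T * N l := by
    intro l
    have h1 : (c.map (MvPowerSeries.C (σ := Fin n) (R := Ku p k))).map (pd l) = 0 :=
      Matrix.ext fun i j => by
        rw [Matrix.map_apply, Matrix.map_apply]
        exact MvPowerSeries.pderiv_C ..
    rw [hT, map_pd_mul, h1, zero_mul, zero_add, hM, mul_assoc]
  have hTc : T.map (MvPowerSeries.constantCoeff (R := Ku p k)) = c := by
    rw [hT, Matrix.map_mul, hM0, mul_one]
    refine Matrix.ext fun i j => ?_
    rw [Matrix.map_apply, Matrix.map_apply]
    exact MvPowerSeries.constantCoeff_C _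
  have hTG := gram_transpose_of_gram (gram_of_conn hT1 hN hTc (unipotent_gram c Φ hc1 hc hΦG))
  have hTu : ∀ i j, wt j ≤ wt i → T i j = (1 : Matrix (Idx n) (Idx n) (KPS p k n)) i j := by
    rw [hT]
    refine mul_unipotent (fun i j hij => ?_) hM1
    rw [Matrix.map_apply, hc1 i j hij, Matrix.one_apply, Matrix.one_apply]
    split_ifs
    · exact map_one _
    · exact map_zero _
  obtain ⟨Z, τ₂₃, τ₁₃, τ₁₂, hZ⟩ := exists_eq_Tmatrix T hTu hTG
  refine ⟨Z, τ₂₃, τ₁₃, τ₁₂, ?_, ?_⟩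
  · rw [← hZ]; exact hT1
  · rw [← hZ, hTc]; exact hc

end Period

/-! ### Iterated derivatives at the origin as Taylor coefficients. -/

section Taylor

variable {R : Type*} [CommRing R] {n : ℕ}

lemma coeff_of_iterate {M : Type*} [AddCommGroup M] (D : AddMonoid.End M)
    (S : M → MvPowerSeries (Fin n) R) {l : Fin n} (hS : ∀ x, S (D x) = pd l (S x)) (a : ℕ) :
    ∀ (x : M) (d : Fin n →₀ ℕ), d l = 0 → MvPowerSeries.coeff d (S ((D ^ a) x)) =
      (a.factorial : R) * MvPowerSeries.coeff (Finsupp.single l a + d) (S x) := by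
  -- Each derivative shifts the exponent in the `l`-th variable, so the induction needs the
  -- statement for all `d`, with factorials on both sides.
  suffices h : ∀ (x : M) (d : Fin n →₀ ℕ), ((d l).factorial : R) *
      MvPowerSeries.coeff d (S ((D ^ a) x)) =
      ((d l + a).factorial : R) * MvPowerSeries.coeff (Finsupp.single l a + d) (S x) by
    intro x d hd
    simpa [hd] using h x d
  induction a with
  | zero => intro x d; simp
  | succ a ih =>
    intro x d
    have h1 : (D ^ (a + 1)) x = D ((D ^ a) x) := by rw [pow_succ']; rfl
    have h2 := ih x (d + Finsupp.single l 1)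
    rw [h1, hS, coeff_pd]
    simp only [Finsupp.add_apply, Finsupp.single_eq_same, Nat.factorial_succ, Nat.cast_mul] at h2
    rw [Nat.cast_add, Nat.cast_one] at h2
    have h3 : Finsupp.single l a + (d + Finsupp.single l 1) = Finsupp.single l (a + 1) + d := by
      rw [Finsupp.single_add]; abel
    rw [h3] at h2
    rw [show d l + (a + 1) = d l + 1 + a by ring, ← h2]
    ring

/-- The variables in the list are distinct, so each operator meets an exponent that is still zero in
its own variable and contributes exactly `(m l)!`. -/
lemma coeff_of_list_prod {M : Type*} [AddCommGroup M] (D : Fin n → AddMonoid.End M)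
    (S : M → MvPowerSeries (Fin n) R) (hS : ∀ l x, S (D l x) = pd l (S x)) (m : Fin n → ℕ)
    (L : List (Fin n)) (hL : L.Nodup) (x : M) : ∀ d : Fin n →₀ ℕ, (∀ l ∈ L, d l = 0) →
      MvPowerSeries.coeff d (S ((L.map fun l => D l ^ m l).prod x)) =
        ((L.map fun l => (m l).factorial).prod : ℕ) *
          MvPowerSeries.coeff ((L.map fun l => Finsupp.single l (m l)).sum + d) (S x) := by
  induction L with
  | nil => intro d _; simp
  | cons l L ih =>
    intro d hd
    rw [List.nodup_cons] at hL
    rw [List.map_cons, List.prod_cons, List.map_cons, List.prod_cons, List.map_cons, List.sum_cons]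
    have h1 := coeff_of_iterate (D l) S (hS l) (m l) ((L.map fun l => D l ^ m l).prod x) d
      (hd l List.mem_cons_self)
    have h2 := ih hL.2 (Finsupp.single l (m l) + d) fun l' hl' => by
      rw [Finsupp.add_apply, hd l' (List.mem_cons_of_mem _ hl'), Finsupp.single_apply,
        if_neg (by rintro rfl; exact hL.1 hl')]
    refine h1.trans ?_
    rw [h2, Nat.cast_mul, mul_assoc, add_left_comm, ← add_assoc]

lemma list_sum_single (m : Fin n → ℕ) :
    ((List.finRange n).map fun l => Finsupp.single l (m l)).sum = Finsupp.equivFunOnFinite.symm m := by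
  rw [← List.ofFn_eq_map, List.sum_ofFn]
  ext i
  simp [Finsupp.finsetSum_apply, Finsupp.single_apply]

/-- A family of power series which satisfies a differential system and vanishes at the origin is
zero. -/
lemma eq_zero_of_system {K V : Type*} [Field K] [CharZero K] (E : V → MvPowerSeries (Fin n) K)
    (D : Fin n → V → V) (a : Fin n → Fin n → MvPowerSeries (Fin n) K)
    (h : ∀ l v, pd l (E v) = ∑ j, a l j * E (D j v))
    (h0 : ∀ v, MvPowerSeries.constantCoeff (E v) = 0) (v : V) : E v = 0 := by
  classical
  refine MvPowerSeries.ext fun d => ?_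
  rw [map_zero]
  induction hN : d.degree using Nat.strong_induction_on generalizing d v with
  | _ N ih =>
    by_cases hd : d = 0
    · rw [hd]; exact h0 v
    · obtain ⟨l, hl⟩ : ∃ l, d l ≠ 0 := by
        by_contra hc
        push Not at hc
        exact hd (Finsupp.ext hc)
      have hle : Finsupp.single l 1 ≤ d := Finsupp.single_le_iff.2 (Nat.one_le_iff_ne_zero.2 hl)
      have h1 := congrArg (MvPowerSeries.coeff (d - Finsupp.single l 1)) (h l v)
      rw [coeff_pd, tsub_add_cancel_of_le hle, map_sum, Finset.sum_eq_zero fun j _ => ?_] at h1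
      · refine (mul_eq_zero.1 h1).resolve_right ?_
        exact Nat.cast_add_one_ne_zero _
      · rw [MvPowerSeries.coeff_mul]
        refine Finset.sum_eq_zero fun x hx => ?_
        rw [Finset.HasAntidiagonal.mem_antidiagonal] at hx
        rw [ih x.2.degree ?_ _ _ rfl, mul_zero]
        have h2 := congrArg Finsupp.degree hx
        have h3 := congrArg Finsupp.degree (tsub_add_cancel_of_le hle)
        rw [map_add] at h2 h3
        rw [Finsupp.degree_single] at h3
        omega

end Taylor

lemma Crystal.coeff_Dpow {p : ℕ} [Fact p.Prime] {k : Type*} [Field k] {n : ℕ}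
    {H : Type*} [AddCommGroup H] [Module (PS p k n) H] {R : Type*} [CommRing R]
    (X : Crystal p k n H) (S : H → MvPowerSeries (Fin n) R) (hS : ∀ l x, S (X.D l x) = pd l (S x))
    (m : Fin n → ℕ) (x : H) : MvPowerSeries.constantCoeff (S (X.Dpow m x)) =
      ((∏ j, (m j).factorial : ℕ) : R) *
        MvPowerSeries.coeff (Finsupp.equivFunOnFinite.symm m) (S x) := by
  have h1 := coeff_of_list_prod X.D S hS m (List.finRange n) (List.nodup_finRange n) x 0
    fun _ _ => rfl
  rw [list_sum_single, add_zero, ← List.ofFn_eq_map, ← List.ofFn_eq_map, List.prod_ofFn] at h1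
  exact h1

/-! ### The value of `φ(f)` at the origin. -/

section FrobAtOrigin

variable {p : ℕ} [hp : Fact p.Prime] {k : Type*} [Field k] [CharP k p] {n : ℕ}

lemma constantCoeff_toKPS (a : PS p k n) : MvPowerSeries.constantCoeff (toKPS p k n a) =
    toKu p k (algebraMap (WittVector p k) _ (MvPowerSeries.constantCoeff a)) := by
  rw [toKPS_eq_map]
  exact MvPowerSeries.constantCoeff_map ..

/-- The value of `φ(f)` at the origin is the value of `σ(f)` at the image of the origin. -/
lemma kuHasSum_frobSer (φ : FrobLift p k n) (f : Overconv p k n) :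
    KuHasSum (fun m : Fin n → ℕ => sigmaKu p k
      (MvPowerSeries.coeff (Finsupp.equivFunOnFinite.symm m) (f : KPS p k n)) *
        ∏ j, MvPowerSeries.constantCoeff (toKPS p k n (φ.toRingHom (MvPowerSeries.X j))) ^ m j)
      (MvPowerSeries.constantCoeff (frobSer φ f)) := by
  classical
  intro N
  obtain ⟨s₀, hs₀⟩ := isFrobImage_frobSer φ f 0 N
  refine ⟨s₀.map Finsupp.equivFunOnFinite.toEmbedding, fun s hs => ?_⟩
  obtain ⟨w, hw⟩ := hs₀ (s.map Finsupp.equivFunOnFinite.symm.toEmbedding) fun x hx => by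
    rw [Finset.mem_map_equiv, Equiv.symm_symm]
    exact hs (Finset.mem_map_of_mem _ hx)
  refine ⟨w, ?_⟩
  rw [← hw, Finset.sum_map]
  congr 1
  refine Finset.sum_congr rfl fun m _ => ?_
  beta_reduce
  congr 1
  have h1 : ∏ j, (toKPS p k n (φ.toRingHom (MvPowerSeries.X j))) ^ m j = toKPS p k n
      (φ.toRingHom (MvPowerSeries.monomial (Finsupp.equivFunOnFinite.symm m) 1)) := by
    rw [MvPowerSeries.monomial_one_eq, Finsupp.prod_fintype _ _ fun _ => pow_zero _, map_prod,
      map_prod]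
    exact Finset.prod_congr rfl fun j _ => by rw [map_pow, map_pow]; rfl
  have h2 := congrArg (MvPowerSeries.constantCoeff (σ := Fin n) (R := Ku p k)) h1
  rw [map_prod] at h2
  simp only [map_pow] at h2
  rw [h2, constantCoeff_toKPS]
  rfl

variable [PerfectRing k p]

lemma constantCoeff_stdLift_X (j : Fin n) :
    MvPowerSeries.constantCoeff ((stdLift p k n).toRingHom (MvPowerSeries.X j)) = 0 := by
  rw [stdLift_apply, MvPowerSeries.constantCoeff_map]
  simp [hp.out.ne_zero]

/-- The standard lift fixes the origin, so only the term `m = 0` survives in the evaluation. -/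
lemma constantCoeff_frobSer_stdLift (f : Overconv p k n) :
    MvPowerSeries.constantCoeff (frobSer (stdLift p k n) f) =
      sigmaKu p k (MvPowerSeries.constantCoeff (f : KPS p k n)) := by
  classical
  refine (kuHasSum_frobSer (stdLift p k n) f).unique fun N => ⟨{0}, fun s hs => ⟨0, ?_⟩⟩
  have h0 : (Finsupp.equivFunOnFinite.symm (0 : Fin n → ℕ) : Fin n →₀ ℕ) = 0 := by ext; rfl
  rw [map_zero, mul_zero, sub_eq_zero, Finset.sum_eq_single 0]
  · simp [h0]
  · intro m _ hm
    obtain ⟨j, hj⟩ : ∃ j, m j ≠ 0 := by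
      by_contra hc
      push Not at hc
      exact hm (funext hc)
    rw [Finset.prod_eq_zero (Finset.mem_univ j), mul_zero]
    rw [constantCoeff_toKPS, constantCoeff_stdLift_X, map_zero, map_zero, zero_pow hj]
  · intro h0
    exact absurd (hs (Finset.mem_singleton_self _)) h0

end FrobAtOrigin

/-! ### Transport of `p`-adic sums to `K^u`. -/

section KuHasSum

variable {p : ℕ} [hp : Fact p.Prime] {k : Type*} [Field k] {n : ℕ}

lemma KuHasSum.p_pow_mul {ι : Type*} {f : ι → Ku p k} {x : Ku p k} (h : KuHasSum f x) (a : ℕ) :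
    KuHasSum (fun i => (p : Ku p k) ^ a * f i) ((p : Ku p k) ^ a * x) := by
  intro N
  obtain ⟨s₀, hs₀⟩ := h N
  refine ⟨s₀, fun s hs => ?_⟩
  obtain ⟨w, hw⟩ := hs₀ s hs
  refine ⟨(p : WittVector p (AlgebraicClosure k)) ^ a * w, ?_⟩
  rw [← Finset.mul_sum, ← mul_sub, hw, map_mul, map_pow, map_natCast]
  ring

/-- A bounded additive map to `K^u` preserves `p`-adic sums. -/
lemma PadicHasSum.kuHasSum {ι M : Type*} [AddCommGroup M] {f : ι → M} {x : M}
    (h : PadicHasSum p f x) (g : M →+ Ku p k) (N₀ : ℕ)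
    (hg : ∀ y, IsSmall 0 ((p : Ku p k) ^ N₀ * g y)) : KuHasSum (fun i => g (f i)) (g x) := by
  intro N
  obtain ⟨s₀, hs₀⟩ := h (N + N₀)
  refine ⟨s₀, fun s hs => ?_⟩
  obtain ⟨y, hy⟩ := hs₀ s hs
  obtain ⟨w, hw⟩ := hg y
  refine ⟨w, ?_⟩
  rw [pow_zero, one_mul] at hw
  rw [← map_sum, ← map_sub, hy, map_nsmul, nsmul_eq_mul, Nat.cast_pow, pow_add, mul_assoc, hw]

end KuHasSum

/-! ### Frobenius in horizontal coordinates, for every lift. -/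

section HorizontalCoords

variable {p : ℕ} [hp : Fact p.Prime] {k : Type*} [Field k] [CharP k p] [PerfectRing k p] {n : ℕ}
  {H : Type*} [AddCommGroup H] [Module (PS p k n) H] {X : FCrystal p k n H}
  (e : Module.Basis (Idx n) (PSbar p k n) (PSbar p k n ⊗[PS p k n] H))
  (T : Matrix (Idx n) (Idx n) (Overconv p k n))

lemma pd_toKPS_base (l : Fin n) (a : PS p k n) :
    pd l (toKPS p k n a) = toKPS p k n (pd l a) :=
  (pd_toKPS l _).trans (congrArg _ (pd_algebraMap l a))

/-- The coordinates with respect to the horizontal basis `e T⁻¹` over `K^u[[t]]`. -/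
def horizontalCoords (i : Idx n) : (PSbar p k n ⊗[PS p k n] H) →+ Overconv p k n :=
  AddMonoidHom.mk' (fun v => ∑ j, T i j * toOverconv p k n (e.repr v j)) fun v w => by
    rw [← Finset.sum_add_distrib]
    refine Finset.sum_congr rfl fun j _ => ?_
    rw [map_add, Finsupp.add_apply, map_add, mul_add]

lemma horizontalCoords_apply (i : Idx n) (v : PSbar p k n ⊗[PS p k n] H) :
    horizontalCoords e T i v = ∑ j, T i j * toOverconv p k n (e.repr v j) := rfl

lemma coe_horizontalCoords (i : Idx n) (v : PSbar p k n ⊗[PS p k n] H) :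
    (horizontalCoords e T i v : KPS p k n) =
      ∑ j, (T i j : KPS p k n) * algebraMap (PSbar p k n) (KPS p k n) (e.repr v j) := by
  rw [horizontalCoords_apply]
  rw [AddSubmonoidClass.coe_finsetSum]
  exact Finset.sum_congr rfl fun j _ => rfl

lemma horizontalCoords_smul (i : Idx n) (a : PSbar p k n) (v : PSbar p k n ⊗[PS p k n] H) :
    horizontalCoords e T i (a • v) = toOverconv p k n a * horizontalCoords e T i v := by
  rw [horizontalCoords_apply, horizontalCoords_apply, Finset.mul_sum]
  refine Finset.sum_congr rfl fun j _ => ?_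
  rw [map_smul, Finsupp.smul_apply, smul_eq_mul, map_mul, mul_left_comm]

lemma horizontalCoords_basis (i j : Idx n) : horizontalCoords e T i (e j) = T i j := by
  classical
  rw [horizontalCoords_apply, Finset.sum_eq_single j]
  · rw [e.repr_self, Finsupp.single_eq_same, map_one, mul_one]
  · intro x _ hx
    rw [e.repr_self, Finsupp.single_apply, if_neg hx.symm, map_zero, mul_zero]
  · simp

variable {T}

/-- This is `dT = T N` in coordinates: in the basis `e T⁻¹` the connection is plain differentiation.
-/
lemma pd_horizontalCoords
    (hT : ∀ l i j, pd l (T i j : KPS p k n) = ∑ x, (T i x : KPS p k n) *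
      algebraMap (PSbar p k n) (KPS p k n) (matrixOf e (Dbar X l) x j)) (l : Fin n) (i : Idx n)
    (v : PSbar p k n ⊗[PS p k n] H) :
    pd l (horizontalCoords e T i v : KPS p k n) = horizontalCoords e T i (Dbar X l v) := by
  rw [coe_horizontalCoords, coe_horizontalCoords, pd_sum]
  simp only [pd_mul, hT, pd_toKPS, repr_Dbar, map_add, map_sum, map_mul, mul_add,
    Finset.sum_add_distrib, Finset.sum_mul, Finset.mul_sum]
  rw [add_comm, Finset.sum_comm]
  simp only [mul_assoc]

lemma constantCoeff_horizontalCoords_stdLift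
    (h0 : ∀ i j, ∑ x, MvPowerSeries.constantCoeff (T i x : KPS p k n) *
        MvPowerSeries.constantCoeff (algebraMap (PSbar p k n) (KPS p k n)
          (matrixOf e (Fbar X (extends_stdLift (p := p) (k := k) (n := n))) x j)) =
      (p : Ku p k) ^ wt i * sigmaKu p k (MvPowerSeries.constantCoeff (T i j : KPS p k n)))
    (i : Idx n) (v : PSbar p k n ⊗[PS p k n] H) :
    MvPowerSeries.constantCoeff (horizontalCoords e T i
        (Fbar X (extends_stdLift (p := p) (k := k) (n := n)) v) : KPS p k n) =
      (p : Ku p k) ^ wt i *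
        sigmaKu p k (MvPowerSeries.constantCoeff (horizontalCoords e T i v : KPS p k n)) := by
  have h1 : ∀ a : PSbar p k n, MvPowerSeries.constantCoeff (algebraMap (PSbar p k n) (KPS p k n)
      ((stdLift p (AlgebraicClosure k) n).toRingHom a)) = sigmaKu p k
        (MvPowerSeries.constantCoeff (algebraMap (PSbar p k n) (KPS p k n) a)) := fun a => by
    rw [← frobSer_of_extends (extends_stdLift (p := p) (k := k) (n := n)),
      constantCoeff_frobSer_stdLift]
    rfl
  rw [coe_horizontalCoords, coe_horizontalCoords]
  simp only [map_sum, map_mul, repr_Fbar, h1, Finset.mul_sum]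
  rw [Finset.sum_comm]
  refine Finset.sum_congr rfl fun j _ => ?_
  rw [← mul_assoc ((p : Ku p k) ^ wt i), ← h0, Finset.sum_mul]
  exact Finset.sum_congr rfl fun x _ => (mul_assoc _ _ _).symm

lemma exists_isSmall_horizontalCoords (T : Matrix (Idx n) (Idx n) (Overconv p k n)) (i : Idx n) :
    ∃ N, ∀ v, IsSmall 0 ((p : Ku p k) ^ N *
      MvPowerSeries.constantCoeff (horizontalCoords e T i v : KPS p k n)) := by
  choose N hN using fun j => exists_isSmall (MvPowerSeries.constantCoeff (T i j : KPS p k n))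
  refine ⟨∑ j, N j, fun v => ?_⟩
  rw [coe_horizontalCoords, map_sum, Finset.mul_sum]
  refine IsSmall.sum _ _ fun j _ => ?_
  rw [map_mul, ← mul_assoc]
  have h1 : MvPowerSeries.constantCoeff (algebraMap (PSbar p k n) (KPS p k n) (e.repr v j)) =
      toKu p k (MvPowerSeries.constantCoeff (e.repr v j)) := MvPowerSeries.constantCoeff_map ..
  rw [h1]
  exact ((hN j).pow_mul_mono (Finset.single_le_sum (f := N) (fun _ _ => Nat.zero_le _)
    (Finset.mem_univ j))).mul (isSmall_toKu _)

variable (hT : ∀ l i j, pd l (T i j : KPS p k n) = ∑ x, (T i x : KPS p k n) *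
      algebraMap (PSbar p k n) (KPS p k n) (matrixOf e (Dbar X l) x j))
  (h0 : ∀ i j, ∑ x, MvPowerSeries.constantCoeff (T i x : KPS p k n) *
        MvPowerSeries.constantCoeff (algebraMap (PSbar p k n) (KPS p k n)
          (matrixOf e (Fbar X (extends_stdLift (p := p) (k := k) (n := n))) x j)) =
      (p : Ku p k) ^ wt i * sigmaKu p k (MvPowerSeries.constantCoeff (T i j : KPS p k n)))

include hT h0

/-- The Taylor formula computes the Frobenius at the origin of every lift of Frobenius. -/
lemma constantCoeff_horizontalCoords_F (φ : FrobLift p k n) (i : Idx n) (x : H) :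
    MvPowerSeries.constantCoeff (horizontalCoords e T i (1 ⊗ₜ X.F φ x) : KPS p k n) =
      (p : Ku p k) ^ wt i *
        MvPowerSeries.constantCoeff (frobSer φ (horizontalCoords e T i (1 ⊗ₜ x))) := by
  obtain ⟨c, hc, hsum⟩ := X.taylor φ (stdLift p k n)
  obtain ⟨N, hN⟩ := exists_isSmall_horizontalCoords e T i
  let ev : H →+ Ku p k := AddMonoidHom.mk' (fun y => MvPowerSeries.constantCoeff
    (horizontalCoords e T i (1 ⊗ₜ y) : KPS p k n)) fun y z => by
      rw [TensorProduct.tmul_add, map_add, Subring.coe_add, map_add]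
  have hev : ∀ y, ev y = MvPowerSeries.constantCoeff
    (horizontalCoords e T i (1 ⊗ₜ y) : KPS p k n) := fun _ => rfl
  clear_value ev
  have h1 := (hsum x).kuHasSum ev N fun y => by rw [hev]; exact hN _
  rw [← hev]
  refine h1.unique ?_
  -- The two series agree term by term. The value of `D^m x` at the origin is `m!` times a Taylor
  -- coefficient, and `m! c_m` is there the product of the `φ(t_j)(0)^{m_j}`, because the standard
  -- lift fixes the origin.
  convert (kuHasSum_frobSer φ (horizontalCoords e T i (1 ⊗ₜ x))).p_pow_mul (wt i) using 2 with m
  have h2 := X.toCrystal.coeff_Dpow (fun y => (horizontalCoords e T i (1 ⊗ₜ y) : KPS p k n))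
    (fun l y => by
      rw [pd_horizontalCoords (X := X) e hT, Dbar_tmul, pd_one, TensorProduct.zero_tmul, zero_add])
      m x
  have h3 : ev (X.F (stdLift p k n) (X.Dpow m x)) =
      (p : Ku p k) ^ wt i * sigmaKu p k (ev (X.Dpow m x)) := by
    rw [hev, hev, ← constantCoeff_horizontalCoords_stdLift e h0, Fbar_tmul, map_one]
  have h4 : ∀ (a : PS p k n) (y : H),
      ev (a • y) = MvPowerSeries.constantCoeff (toKPS p k n a) * ev y := by
    intro a y
    rw [hev, hev, ← TensorProduct.smul_tmul, ← mul_one (a • (1 : PSbar p k n)), ← smul_eq_mul,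
      ← TensorProduct.smul_tmul', horizontalCoords_smul, Subring.coe_mul, map_mul, coe_toOverconv,
      Algebra.smul_def, mul_one]
    rfl
  have h5 := congrArg (fun a => MvPowerSeries.constantCoeff (toKPS p k n a)) (hc m)
  simp only [map_mul, map_natCast, map_prod, map_pow, map_sub] at h5
  have h6 : ∀ j, MvPowerSeries.constantCoeff (toKPS p k n
      ((stdLift p k n).toRingHom (MvPowerSeries.X j))) = 0 := fun j => by
    rw [constantCoeff_toKPS, constantCoeff_stdLift_X, map_zero, map_zero]
  rw [← hev] at h2
  rw [h4, h3, h2, map_mul, map_natCast]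
  simp only [h6, sub_zero] at h5
  rw [← h5]
  ring

/-- Both sides obey the same chain rule, so their difference `E` satisfies `∂_l E(v) = ∑ ∂_l φ(t_j)
E(D_j v)`. Such a family is zero once its constant terms are, and these vanish by the Taylor formula
at the origin. -/
theorem horizontalCoords_Fbar {φ : FrobLift p k n} {φb : FrobLift p (AlgebraicClosure k) n}
    (hφ : Extends φb φ) (i : Idx n) (v : PSbar p k n ⊗[PS p k n] H) :
    (horizontalCoords e T i (Fbar X hφ v) : KPS p k n) =
      (p : KPS p k n) ^ wt i * frobSer φ (horizontalCoords e T i v) := by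
  have := charZero_Ku (p := p) (k := k)
  have hpd : ∀ l, pd l ((p : KPS p k n) ^ wt i) = 0 := fun l => by
    rw [← Nat.cast_pow]; exact Derivation.map_natCast _ _
  rw [← sub_eq_zero]
  refine eq_zero_of_system (fun v => (horizontalCoords e T i (Fbar X hφ v) : KPS p k n) -
    (p : KPS p k n) ^ wt i * frobSer φ (horizontalCoords e T i v)) (fun l => Dbar X l)
    (fun l j => pd l (toKPS p k n (φ.toRingHom (MvPowerSeries.X j)))) (fun l v => ?_)
    (fun v => ?_) v
  · have h1 : ∀ j, (⟨pd j (horizontalCoords e T i v : KPS p k n),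
        (horizontalCoords e T i v).2.pd j⟩ : Overconv p k n) =
          horizontalCoords e T i (Dbar X j v) := fun j =>
      Subtype.ext (pd_horizontalCoords e hT j i v)
    have h2 : pd l (horizontalCoords e T i (Fbar X hφ v) : KPS p k n) =
        ∑ j, pd l (toKPS p k n (φ.toRingHom (MvPowerSeries.X j))) *
          (horizontalCoords e T i (Fbar X hφ (Dbar X j v)) : KPS p k n) := by
      rw [pd_horizontalCoords e hT, Dbar_Fbar, map_sum]
      refine (map_sum (Overconv p k n).subtype _ _).trans (Finset.sum_congr rfl fun j _ => ?_)
      rw [horizontalCoords_smul, map_mul]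
      congr 1
      exact (pd_toKPS_base l (φ.toRingHom (MvPowerSeries.X j))).symm
    have h3 : pd l ((p : KPS p k n) ^ wt i * frobSer φ (horizontalCoords e T i v)) =
        ∑ j, pd l (toKPS p k n (φ.toRingHom (MvPowerSeries.X j))) *
          ((p : KPS p k n) ^ wt i * frobSer φ (horizontalCoords e T i (Dbar X j v))) := by
      rw [pd_mul, hpd, zero_mul, zero_add, pd_frobSer, Finset.mul_sum]
      exact Finset.sum_congr rfl fun j _ => by rw [h1, mul_left_comm]
    have h4 : ∀ a b : KPS p k n, pd l (a - b) = pd l a - pd l b := fun a b => map_sub _ _ _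
    rw [h4, h2, h3, ← Finset.sum_sub_distrib]
    exact Finset.sum_congr rfl fun j _ => (mul_sub _ _ _).symm
  · rw [map_sub, sub_eq_zero]
    induction v using TensorProduct.induction_on with
    | zero => simp
    | add v w hv hw =>
      rw [map_add, map_add, map_add, map_add, Subring.coe_add, map_add, hv, hw, mul_add, map_add]
    | tmul a x =>
      rw [show (a ⊗ₜ x : PSbar p k n ⊗[PS p k n] H) = a • (1 ⊗ₜ x) by
        rw [TensorProduct.smul_tmul', smul_eq_mul, mul_one], Fbar_smul, horizontalCoords_smul,
        horizontalCoords_smul, map_mul (frobSer φ), frobSer_of_extends hφ, Subring.coe_mul, map_mul,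
        coe_toOverconv, Fbar_tmul, map_one, constantCoeff_horizontalCoords_F e hT h0]
      rw [map_mul, map_mul, map_pow, map_natCast]
      ring

end HorizontalCoords

section Maps

variable {R S : Type*} [CommRing R] [CommRing S] {n : ℕ} (f : R →+* S)
  {M : Matrix (Idx n) (Idx n) R}

lemma map_gram_add (h : M.transpose * gramMatrix R n + gramMatrix R n * M = 0) :
    (M.map f).transpose * gramMatrix S n + gramMatrix S n * M.map f = 0 := by
  have h1 := congrArg (fun A => A.map f) h
  simp only [Matrix.map_add f (map_add f), Matrix.map_mul, Matrix.transpose_map, gramMatrix_map,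
    Matrix.map_zero f (map_zero f)] at h1
  exact h1

lemma map_gram_similitude {q : R}
    (h : M.transpose * gramMatrix R n * M = q • gramMatrix R n) :
    (M.map f).transpose * gramMatrix S n * M.map f = f q • gramMatrix S n := by
  have h1 := congrArg (fun A => A.map f) h
  simp only [Matrix.map_mul, Matrix.transpose_map, gramMatrix_map] at h1
  rw [h1, ← gramMatrix_map f]
  exact Matrix.ext fun i j => map_mul f _ _

end Maps

/-! ### Existence of a frame. -/

section FrameExistence

variable {p : ℕ} [hp : Fact p.Prime] {k : Type*} [Field k] [CharP k p] [PerfectRing k p] {n : ℕ}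
  {H : Type*} [AddCommGroup H] [Module (PS p k n) H] {X : FCrystal p k n H}

lemma map_pd_toKPS (l : Fin n) (M : Matrix (Idx n) (Idx n) (PSbar p k n)) :
    (M.map (algebraMap (PSbar p k n) (KPS p k n))).map (pd l) =
      (M.map (pd l)).map (algebraMap (PSbar p k n) (KPS p k n)) :=
  Matrix.ext fun _ _ => pd_toKPS l _

/-- A basis with a horizontal Frobenius structure of the standard form has a period matrix. -/
lemma exists_period_matrix_of_basis {B : LinearMap.BilinForm (PS p k n) H}
    (e : Module.Basis (Idx n) (PSbar p k n) (PSbar p k n ⊗[PS p k n] H))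
    (he : ∀ i j, B.baseChange (PSbar p k n) (e i) (e j) = gramMatrix (PSbar p k n) n i j)
    (hB : ∀ (i : Fin n) (x y : H), B (X.D i x) y + B x (X.D i y) = pd i (B x y))
    (hBF : ∀ (x y : H), B (X.F (stdLift p k n) x) (X.F (stdLift p k n) y) =
      (p : PS p k n) ^ 3 * (stdLift p k n).toRingHom (B x y))
    (hN : ∀ l, HasDeg 1 (matrixOf e (Dbar X l)))
    (hΦ : ∀ i j, wt j ≤ wt i →
      matrixOf e (Fbar X (extends_stdLift (p := p) (k := k) (n := n))) i j =
        (p : PSbar p k n) ^ wt i * (1 : Matrix (Idx n) (Idx n) (PSbar p k n)) i j) :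
    ∃ Z τ₂₃ τ₁₃ τ₁₂, (∀ l, (Tmatrix Z τ₂₃ τ₁₃ τ₁₂).map (pd l) = Tmatrix Z τ₂₃ τ₁₃ τ₁₂ *
        (matrixOf e (Dbar X l)).map (algebraMap (PSbar p k n) (KPS p k n))) ∧
      ∀ i j, ∑ x, MvPowerSeries.constantCoeff (Tmatrix Z τ₂₃ τ₁₃ τ₁₂ i x) *
        MvPowerSeries.constantCoeff (algebraMap (PSbar p k n) (KPS p k n)
          (matrixOf e (Fbar X (extends_stdLift (p := p) (k := k) (n := n))) x j)) =
      (p : Ku p k) ^ wt i *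
        sigmaKu p k (MvPowerSeries.constantCoeff (Tmatrix Z τ₂₃ τ₁₃ τ₁₂ i j)) := by
  obtain ⟨g, hg⟩ : ∃ g : PSbar p k n →+* Ku p k, ∀ a, g a =
      MvPowerSeries.constantCoeff (algebraMap (PSbar p k n) (KPS p k n) a) :=
    ⟨(MvPowerSeries.constantCoeff).comp (algebraMap (PSbar p k n) (KPS p k n)), fun _ => rfl⟩
  obtain ⟨Z, τ₂₃, τ₁₃, τ₁₂, h1, h2⟩ := exists_period_matrix
    (fun l => (matrixOf e (Dbar X l)).map (algebraMap (PSbar p k n) (KPS p k n)))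
    (fun l => (hN l).map (map_zero _))
    (fun i j => by rw [map_pd_toKPS, map_pd_toKPS, (matrixOf_Dbar_closed e hN i j).1])
    (fun i j => by rw [← Matrix.map_mul, (matrixOf_Dbar_closed e hN i j).2, Matrix.map_mul])
    (fun l => map_gram_add _ (conn_gram e he hB l))
    ((matrixOf e (Fbar X (extends_stdLift (p := p) (k := k) (n := n)))).map g)
    (fun i j hij => by
      rw [Matrix.map_apply, hΦ i j hij, map_mul, map_pow, map_natCast, Matrix.one_apply,
        Matrix.one_apply]
      split_ifs <;> simp)
    (by
      have h3 := map_gram_similitude g (frob_gram (extends_stdLift (p := p) (k := k) (n := n)) e he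
        hBF)
      rwa [map_pow, map_natCast] at h3)
  refine ⟨Z, τ₂₃, τ₁₃, τ₁₂, h1, fun i j => ?_⟩
  have h3 := congrFun (congrFun h2 i) j
  rw [Pmatrix, Matrix.diagonal_mul, Matrix.mul_apply] at h3
  rw [← Matrix.map_apply (f := MvPowerSeries.constantCoeff (R := Ku p k)), ← Matrix.map_apply
    (f := sigmaKu p k), ← h3]
  exact Finset.sum_congr rfl fun x _ => by rw [Matrix.map_apply, Matrix.map_apply, hg]

theorem nonempty_frame [Module.Free (PS p k n) H] [Module.Finite (PS p k n) H]
    {φ : FrobLift p k n} {Fil U : ℕ → Submodule (PS p k n) H}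
    {B : LinearMap.BilinForm (PS p k n) H} (hX : IsOrdinaryCY3 X φ Fil B)
    (hU : IsConjFiltration X φ U) : Nonempty (Frame X Fil U B) := by
  obtain ⟨e, hmem, he, hN, hΦ⟩ := exists_horizontal_basis hX hU
  obtain ⟨Z, τ₂₃, τ₁₃, τ₁₂, h1, h2⟩ := exists_period_matrix_of_basis e he hX.form_conn
    (hX.form_frob _) hN hΦ
  have hu := (Matrix.isUnit_iff_isUnit_det _).1 (isUnit_Tmatrix Z τ₂₃ τ₁₃ τ₁₂)
  refine ⟨⟨e, Z, τ₂₃, τ₁₃, τ₁₂, hmem, he, fun l => ?_, fun ψ => ?_⟩⟩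
  · rw [h1, Matrix.nonsing_inv_mul_cancel_left _ _ hu]
  · obtain ⟨φb, hφ⟩ := exists_extends ψ
    have hov := isOverconv_unipotent (fun i j h => Tmatrix_eq_one Z τ₂₃ τ₁₃ τ₁₂ h) h1
      fun l i j => isOverconv_algebraMap _
    obtain ⟨T, hT⟩ : ∃ T : Matrix (Idx n) (Idx n) (Overconv p k n),
        ∀ i j, (T i j : KPS p k n) = Tmatrix Z τ₂₃ τ₁₃ τ₁₂ i j :=
      ⟨fun i j => ⟨_, hov i j⟩, fun _ _ => rfl⟩
    obtain ⟨φT, hφT⟩ : ∃ φT : Matrix (Idx n) (Idx n) (KPS p k n),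
        ∀ i j, φT i j = frobSer ψ (T i j) := ⟨fun i j => _, fun _ _ => rfl⟩
    refine ⟨φb, hφ, φT, fun i j => ?_, ?_⟩
    · rw [hφT, ← hT]
      exact isFrobImage_frobSer ψ (T i j)
    -- Column `j` of the matrix identity is the Frobenius formula in horizontal coordinates, applied
    -- to `e j`.
    · have key : Tmatrix Z τ₂₃ τ₁₃ τ₁₂ *
          (matrixOf e (Fbar X hφ)).map (algebraMap (PSbar p k n) (KPS p k n)) =
            Pmatrix (KPS p k n) n p * φT := by
        refine Matrix.ext fun i j => ?_
        have h3 := horizontalCoords_Fbar e (T := T) (fun l i j => by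
          have := congrFun (congrFun (h1 l) i) j
          rw [Matrix.map_apply, Matrix.mul_apply] at this
          simpa only [hT, Matrix.map_apply] using this) (fun i j => by simpa only [hT] using h2 i j) hφ i (e j)
        rw [coe_horizontalCoords, horizontalCoords_basis] at h3
        rw [Pmatrix, Matrix.diagonal_mul, hφT, ← h3, Matrix.mul_apply]
        exact Finset.sum_congr rfl fun x _ => by rw [hT, Matrix.map_apply, matrixOf_apply]
      rw [Matrix.mul_assoc, ← key, Matrix.nonsing_inv_mul_cancel_left _ _ hu]

end FrameExistence

/-! ### Recognizing the matrix `S`. -/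

section Smatrix

variable {R : Type*} [CommRing R] {n : ℕ}

/-- For a block diagonal symplectic matrix the blocks of weights 0 and 1 are contragredient to those
of weights 3 and 2. The latter are prescribed here as `f` and `f J`. -/
lemma Smatrix_map {S : Type*} [CommRing S] (g : R →+* S) {M : Matrix (Idx n) (Idx n) R}
    {f : Rˣ} {J : Matrix (Fin n) (Fin n) S} (hM : HasDeg 0 M)
    (hG : M.transpose * gramMatrix R n * M = gramMatrix R n)
    (hf : M (lastIdx n) (lastIdx n) = f) (hJ : IsUnit J)
    (h : ∀ a b, g (M (Sum.inr (Sum.inl a)) (Sum.inr (Sum.inl b))) = g f * J a b) :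
    M.map g = Smatrix (Units.map g.toMonoidHom f) J := by
  have hf' : ((Units.map g.toMonoidHom f : Sˣ) : S) = g f := rfl
  have hfi : (((Units.map g.toMonoidHom f)⁻¹ : Sˣ) : S) = g ((f⁻¹ : Rˣ) : R) := rfl
  have hff : g ((f⁻¹ : Rˣ) : R) * g f = 1 := by rw [← map_mul, Units.inv_mul, map_one]
  have h0 : M (Sum.inl (Sum.inl ())) (Sum.inl (Sum.inl ())) = ((f⁻¹ : Rˣ) : R) := by
    have h1 := congrFun (congrFun hG (Sum.inl (Sum.inl ()))) (lastIdx n)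
    rw [mul_assoc, Matrix.mul_apply, Finset.sum_eq_single (Sum.inl (Sum.inl ())),
      Matrix.transpose_apply, gramMatrix_mul_apply_zero, hf] at h1
    · rw [show gramMatrix R n (Sum.inl (Sum.inl ())) (lastIdx n) = -1 by simp [gramMatrix],
        mul_neg, neg_inj] at h1
      exact Units.eq_inv_of_mul_eq_one_left ((mul_comm _ _).trans h1)
    · intro x _ hx
      rw [Matrix.transpose_apply, hM, zero_mul]
      rcases x with ((x | x) | (x | x)) <;> simp_all [wt]
    · simp
  have h1 : M.toBlocks₁₁.toBlocks₂₂.map g = g ((f⁻¹ : Rˣ) : R) • (J⁻¹).transpose := by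
    have h2 : (M.toBlocks₁₁.toBlocks₂₂.map g).transpose * (g f • J) = 1 := by
      refine Matrix.ext fun a b => ?_
      have h3 := congrFun (congrFun hG (Sum.inl (Sum.inr a))) (Sum.inr (Sum.inl b))
      rw [mul_assoc, Matrix.mul_apply, Fintype.sum_sum_type, Fintype.sum_sum_type] at h3
      rw [Finset.sum_eq_zero (s := (Finset.univ : Finset Unit)) (fun x _ => by
        rw [Matrix.transpose_apply, hM _ _ (by simp [wt]), zero_mul]),
        Finset.sum_eq_zero (s := (Finset.univ : Finset (Fin n ⊕ Unit))) (fun x _ => by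
          rw [Matrix.transpose_apply, hM _ _ (by rcases x with x | x <;> simp [wt]), zero_mul]),
        zero_add, add_zero] at h3
      have h4 := congrArg g h3
      rw [map_sum] at h4
      rw [Matrix.mul_apply]
      refine (Finset.sum_congr rfl fun x _ => ?_).trans (h4.trans ?_)
      · rw [map_mul, gramMatrix_mul_apply_one, h]
        rfl
      · simp only [gramMatrix, Matrix.fromBlocks_apply₁₂, Matrix.fromBlocks_apply₂₁,
          Matrix.one_apply]
        split_ifs <;> simp
    have h5 : (M.toBlocks₁₁.toBlocks₂₂.map g).transpose = g ((f⁻¹ : Rˣ) : R) • J⁻¹ := by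
      have h6 : (g f • J) * (g ((f⁻¹ : Rˣ) : R) • J⁻¹) = 1 := by
        rw [Matrix.smul_mul, Matrix.mul_smul, smul_smul, mul_comm, hff, one_smul,
          Matrix.mul_nonsing_inv _ ((Matrix.isUnit_iff_isUnit_det _).1 hJ)]
      exact left_inv_eq_right_inv h2 h6
    rw [← Matrix.transpose_transpose (M.toBlocks₁₁.toBlocks₂₂.map g), h5, Matrix.transpose_smul]
  refine Matrix.ext fun i j => ?_
  rcases i with ((i | i) | (i | i)) <;> rcases j with ((j | j) | (j | j)) <;>
    first
    | (rw [Matrix.map_apply, hM _ _ (by simp [wt]), map_zero]; simp [Smatrix]; done)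
    | skip
  · rw [Matrix.map_apply, show i = () from rfl, show j = () from rfl, h0, Smatrix, hfi]
    simp
  · refine (congrFun (congrFun h1 i) j).trans ?_
    rw [Smatrix, hfi]
    simp
  · rw [Matrix.map_apply, h, Smatrix, hf']
    simp
  · rw [Matrix.map_apply, show i = () from rfl, show j = () from rfl, hf, Smatrix, hf']
    simp

lemma eq_inv_mul_of_mul_eq {ι : Type*} [Fintype ι] [DecidableEq ι] {A M M' : Matrix ι ι R}
    (hA : IsUnit A) (h : A * M = M') : M = A⁻¹ * M' := by
  rw [← h, Matrix.nonsing_inv_mul_cancel_left _ _ ((Matrix.isUnit_iff_isUnit_det _).1 hA)]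

lemma mul_eq_of_eq_inv_mul {ι : Type*} [Fintype ι] [DecidableEq ι] {A M M' : Matrix ι ι R}
    (hA : IsUnit A) (h : M = A⁻¹ * M') : A * M = M' := by
  rw [h, Matrix.mul_nonsing_inv_cancel_left _ _ ((Matrix.isUnit_iff_isUnit_det _).1 hA)]

end Smatrix

/-! ### Comparison of adapted bases of `H` with the basis of a frame. -/

section AdaptedBasis

variable {p : ℕ} [hp : Fact p.Prime] {k : Type*} [Field k] [CharP k p] [PerfectRing k p] {n : ℕ}
  {H : Type*} [AddCommGroup H] [Module (PS p k n) H]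
  [Module.Free (PS p k n) H] [Module.Finite (PS p k n) H]
  {X : FCrystal p k n H} {φ : FrobLift p k n} {Fil U : ℕ → Submodule (PS p k n) H}
  {B : LinearMap.BilinForm (PS p k n) H}

lemma repr_eq_zero_of_mem_baseChange {ι : Type*} (ω : Module.Basis ι (PS p k n) H)
    {V : Submodule (PS p k n) H} {i : ι} (h : ∀ x ∈ V, ω.repr x i = 0)
    {v : PSbar p k n ⊗[PS p k n] H} (hv : v ∈ V.baseChange (PSbar p k n)) :
    (Algebra.TensorProduct.basis (PSbar p k n) ω).repr v i = 0 := by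
  rw [Submodule.baseChange_eq_span] at hv
  induction hv using Submodule.span_induction with
  | mem v hv =>
    obtain ⟨x, hx, rfl⟩ := hv
    rw [TensorProduct.mk_apply, Algebra.TensorProduct.basis_repr_tmul, one_smul,
      Finsupp.mapRange_apply, h x hx, map_zero]
  | zero => rw [map_zero]; rfl
  | add v w _ _ hv hw => rw [map_add, Finsupp.add_apply, hv, hw, add_zero]
  | smul a v _ hv => rw [map_smul, Finsupp.smul_apply, hv, smul_zero]

/-- Both bases are adapted to the same pair of opposite filtrations: membership in `U` bounds the
weights of the coordinates from above, membership in `Fil` from below. -/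
lemma toMatrix_hasDeg (hX : IsOrdinaryCY3 X φ Fil B) (hU : IsConjFiltration X φ U)
    (ω : Module.Basis (Idx n) (PS p k n) H) (hω : ∀ j, ω j ∈ U (wt j) ⊓ Fil (wt j))
    (e : Module.Basis (Idx n) (PSbar p k n) (PSbar p k n ⊗[PS p k n] H))
    (he : ∀ j, e j ∈ (U (wt j)).baseChange (PSbar p k n) ⊓ (Fil (wt j)).baseChange (PSbar p k n)) :
    HasDeg 0 ((Algebra.TensorProduct.basis (PSbar p k n) ω).toMatrix e) := by
  intro i j hij
  rw [Module.Basis.toMatrix_apply]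
  rcases lt_or_ge (wt j) (wt i) with h | h
  · exact repr_eq_zero_of_mem_baseChange ω
      (fun x hx => repr_eq_zero_of_mem_U hX hU ω hω hx h) (he j).1
  · obtain ⟨s, hs⟩ := Nat.exists_eq_succ_of_ne_zero (show wt j ≠ 0 by omega)
    refine repr_eq_zero_of_mem_baseChange ω (fun x hx => ?_) (he j).2
    rw [hs] at hx
    exact repr_eq_zero_of_mem_Fil hX hU ω hω hx (by omega)

/-- The change of basis from an adapted basis of `H` to an adapted basis of `H̄`. -/
lemma toMatrix_symplectic (hX : IsOrdinaryCY3 X φ Fil B) (hU : IsConjFiltration X φ U)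
    (ω : Module.Basis (Idx n) (PS p k n) H) (hω : ∀ j, ω j ∈ U (wt j) ⊓ Fil (wt j))
    (hωB : ∀ i j, B (ω i) (ω j) = gramMatrix (PS p k n) n i j)
    (e : Module.Basis (Idx n) (PSbar p k n) (PSbar p k n ⊗[PS p k n] H))
    (he : ∀ j, e j ∈ (U (wt j)).baseChange (PSbar p k n) ⊓ (Fil (wt j)).baseChange (PSbar p k n))
    (heB : ∀ i j, B.baseChange (PSbar p k n) (e i) (e j) = gramMatrix (PSbar p k n) n i j) :
    ∃ S Q : Matrix (Idx n) (Idx n) (PSbar p k n),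
      e.toMatrix (Algebra.TensorProduct.basis (PSbar p k n) ω) = S ∧ HasDeg 0 S ∧ HasDeg 0 Q ∧
      S * Q = 1 ∧ S.transpose * gramMatrix (PSbar p k n) n * S = gramMatrix (PSbar p k n) n := by
  obtain ⟨Q, hQ⟩ : ∃ Q, (Algebra.TensorProduct.basis (PSbar p k n) ω).toMatrix e = Q := ⟨_, rfl⟩
  obtain ⟨S, hS⟩ : ∃ S, e.toMatrix (Algebra.TensorProduct.basis (PSbar p k n) ω) = S := ⟨_, rfl⟩
  have hQ0 : HasDeg 0 Q := hQ ▸ toMatrix_hasDeg hX hU ω hω e he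
  have hSQ : S * Q = 1 := by rw [← hS, ← hQ, Module.Basis.toMatrix_mul_toMatrix_flip]
  have hQG : Q.transpose * gramMatrix (PSbar p k n) n * Q = gramMatrix (PSbar p k n) n := by
    refine Matrix.ext fun i j => ?_
    rw [← heB, ← hQ]
    exact (form_eq_toMatrix _ _ _ _ (form_basis_baseChange ω hωB) i j).symm
  have hSG : S.transpose * gramMatrix (PSbar p k n) n * S = gramMatrix (PSbar p k n) n := by
    refine Matrix.ext fun i j => ?_
    rw [← form_basis_baseChange ω hωB, ← hS]
    exact (form_eq_toMatrix _ _ _ _ heB i j).symm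
  refine ⟨S, Q, hS, fun i j hij => ?_, hQ0, hSQ, hSG⟩
  have h1 : S = -(gramMatrix (PSbar p k n) n * Q.transpose * gramMatrix (PSbar p k n) n) :=
    left_inv_eq_right_inv hSQ (mul_eq_one_comm.1 (isUnit_of_gram hQG))
  rw [h1, Matrix.neg_apply, hQ0.gram_transpose_gram i j hij, neg_zero]

end AdaptedBasis

section Blocks

variable {R : Type*} [CommRing R] {n : ℕ} {G G' : Matrix (Idx n) (Idx n) R}

lemma isUnit_toBlocks₂₂ (hG : HasDeg 0 G) (h : G * G' = 1) : IsUnit G.toBlocks₂₂.toBlocks₁₁ := by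
  refine IsUnit.of_mul_eq_one G'.toBlocks₂₂.toBlocks₁₁ (Matrix.ext fun i j => ?_)
  have h1 := congrFun (congrFun h (Sum.inr (Sum.inl i))) (Sum.inr (Sum.inl j))
  rw [Matrix.mul_apply, Fintype.sum_sum_type,
    Finset.sum_eq_zero (s := (Finset.univ : Finset (Unit ⊕ Fin n))) (fun x _ => by
      rw [hG _ _ (by rcases x with x | x <;> simp [wt]), zero_mul]), zero_add,
    Fintype.sum_sum_type, Finset.sum_eq_zero (s := (Finset.univ : Finset Unit)) (fun x _ => by
      rw [hG _ _ (by simp [wt]), zero_mul]), add_zero] at h1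
  rw [Matrix.mul_apply]
  refine h1.trans ?_
  simp [Matrix.one_apply]

lemma mul_apply_last (hG : HasDeg 0 G) (h : G * G' = 1) :
    G (lastIdx n) (lastIdx n) * G' (lastIdx n) (lastIdx n) = 1 := by
  have h1 := congrFun (congrFun h (lastIdx n)) (lastIdx n)
  rw [Matrix.mul_apply, Finset.sum_eq_single (lastIdx n), Matrix.one_apply_eq] at h1
  · exact h1
  · intro x _ hx
    rw [hG, zero_mul]
    rcases x with ((x | x) | (x | x)) <;> simp_all [wt]
  · simp

end Blocks

/-! ### Consequences of the axioms of a frame. -/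

section FrameFacts

variable {p : ℕ} [hp : Fact p.Prime] {k : Type*} [Field k] [CharP k p] [PerfectRing k p] {n : ℕ}
  {H : Type*} [AddCommGroup H] [Module (PS p k n) H]
  {X : FCrystal p k n H} {Fil U : ℕ → Submodule (PS p k n) H}
  {B : LinearMap.BilinForm (PS p k n) H} (E : Frame X Fil U B)

lemma Frame.isUnit_T : IsUnit E.T := isUnit_Tmatrix _ _ _ _

lemma Frame.T_eq_one {i j : Idx n} (h : wt j ≤ wt i) :
    E.T i j = (1 : Matrix (Idx n) (Idx n) (KPS p k n)) i j := Tmatrix_eq_one _ _ _ _ h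

lemma Frame.map_pd_T (l : Fin n) : E.T.map (pd l) =
    E.T * (matrixOf E.e (Dbar X l)).map (algebraMap (PSbar p k n) (KPS p k n)) :=
  (mul_eq_of_eq_inv_mul E.isUnit_T (E.conn l)).symm

lemma Frame.isOverconv_T (i j : Idx n) : IsOverconv (E.T i j) :=
  isOverconv_unipotent (fun _ _ => E.T_eq_one) E.map_pd_T (fun _ _ _ => isOverconv_algebraMap _) i j

lemma Frame.conn_eq_zero (l : Fin n) {i j : Idx n} (h : wt j ≤ wt i) :
    matrixOf E.e (Dbar X l) i j = 0 := by
  refine toKPS_injective ?_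
  rw [map_zero]
  exact logDeriv_unipotent (fun _ _ => E.T_eq_one) (E.map_pd_T l) i j h

/-- The connection matrix contains the Jacobian matrix of `τ₂₃`. -/
lemma Frame.conn_last (l m : Fin n) : algebraMap (PSbar p k n) (KPS p k n)
    (matrixOf E.e (Dbar X l) (Sum.inr (Sum.inl m)) (lastIdx n)) = jacobian E.τ₂₃ m l := by
  have h1 := congrFun (congrFun (E.map_pd_T l) (Sum.inr (Sum.inl m))) (lastIdx n)
  rw [Matrix.map_apply, Matrix.mul_apply, Finset.sum_eq_single (Sum.inr (Sum.inl m)),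
    E.T_eq_one le_rfl, Matrix.one_apply_eq, one_mul, Matrix.map_apply] at h1
  · rw [← h1, Frame.T, Tmatrix_apply_last]
    rfl
  · intro x _ hx
    rcases le_or_gt (wt x) 2 with h | h
    · rw [E.T_eq_one (show wt x ≤ wt (Sum.inr (Sum.inl m) : Idx n) from h),
        Matrix.one_apply_ne hx.symm, zero_mul]
    · rw [Matrix.map_apply, E.conn_eq_zero l (show wt (lastIdx n) ≤ wt x from h), map_zero,
        mul_zero]
  · simp

lemma IsFrobImage.unique {ψ : FrobLift p k n} {f g g' : KPS p k n} (h : IsFrobImage ψ f g)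
    (h' : IsFrobImage ψ f g') : g = g' :=
  MvPowerSeries.ext fun d => (h d).unique (h' d)

variable {ω : Module.Basis (Idx n) (PS p k n) H} {S : Matrix (Idx n) (Idx n) (PSbar p k n)}
  (hS : E.e.toMatrix (Algebra.TensorProduct.basis (PSbar p k n) ω) = S)

include hS

lemma Frame.conn_change (l : Fin n) :
    E.T * S.map (algebraMap (PSbar p k n) (KPS p k n)) * (matrixOf ω (X.D l)).map
      (fun a => algebraMap (PSbar p k n) (KPS p k n) (algebraMap (PS p k n) (PSbar p k n) a)) =
    (E.T * S.map (algebraMap (PSbar p k n) (KPS p k n))).map (pd l) := by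
  have h1 := toMatrix_mul_matrixOf_Dbar (X := X) (Algebra.TensorProduct.basis (PSbar p k n) ω) E.e l
  rw [hS, matrixOf_Dbar_baseChange] at h1
  have h2 := congrArg (fun M => M.map (algebraMap (PSbar p k n) (KPS p k n))) h1
  rw [Matrix.map_mul, Matrix.map_add _ (map_add _), Matrix.map_mul, Matrix.map_map] at h2
  rw [map_pd_mul, E.map_pd_T, map_pd_toKPS, mul_assoc, mul_assoc, ← mul_add]
  refine congrArg (fun M => E.T * M) (h2.trans ?_)
  rw [add_comm]

/-- The matrix `T` of any frame is overconvergent, as the solution of an integral unipotent system.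
Sums of convergent series being unique, its Frobenius image is `frobSer φ` of its entries. Since
`frobSer φ` is a ring homomorphism, the image of `T S` is the product of the images, and the usual
change of basis applies. -/
lemma Frame.frob_change (φ : FrobLift p k n) : ∃ φTS : Matrix (Idx n) (Idx n) (KPS p k n),
    (∀ i j, IsFrobImage φ ((E.T * S.map (algebraMap (PSbar p k n) (KPS p k n))) i j) (φTS i j)) ∧
    E.T * S.map (algebraMap (PSbar p k n) (KPS p k n)) * (matrixOf ω (X.F φ)).map
      (fun a => algebraMap (PSbar p k n) (KPS p k n) (algebraMap (PS p k n) (PSbar p k n) a)) =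
    Pmatrix (KPS p k n) n p * φTS := by
  obtain ⟨φb, hφ, φT, hφT, hF⟩ := E.frob φ
  have hTF := mul_eq_of_eq_inv_mul E.isUnit_T (hF.trans (mul_assoc _ _ _))
  obtain ⟨T, hT⟩ : ∃ T : Matrix (Idx n) (Idx n) (Overconv p k n),
      ∀ i j, (T i j : KPS p k n) = E.T i j :=
    ⟨fun i j => ⟨_, E.isOverconv_T i j⟩, fun _ _ => rfl⟩
  have hφT' : ∀ i j, φT i j = frobSer φ (T i j) := fun i j =>
    (hφT i j).unique (by
      have := isFrobImage_frobSer φ (T i j)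
      rwa [hT] at this)
  refine ⟨φT * (S.map φb.toRingHom).map (algebraMap (PSbar p k n) (KPS p k n)), fun i j => ?_, ?_⟩
  · have h1 := isFrobImage_frobSer φ (∑ x, T i x * toOverconv p k n (S x j))
    have h2 : ((∑ x, T i x * toOverconv p k n (S x j) : Overconv p k n) : KPS p k n) =
        (E.T * S.map (algebraMap (PSbar p k n) (KPS p k n))) i j := by
      rw [AddSubmonoidClass.coe_finsetSum, Matrix.mul_apply]
      exact Finset.sum_congr rfl fun x _ => by rw [Subring.coe_mul, hT]; rfl
    have h3 : frobSer φ (∑ x, T i x * toOverconv p k n (S x j)) =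
        (φT * (S.map φb.toRingHom).map (algebraMap (PSbar p k n) (KPS p k n))) i j := by
      rw [map_sum, Matrix.mul_apply]
      exact Finset.sum_congr rfl fun x _ => by
        rw [map_mul, frobSer_of_extends hφ, hφT', Matrix.map_apply, Matrix.map_apply]
    rwa [h2, h3] at h1
  · have h1 := toMatrix_mul_matrixOf_Fbar (X := X) hφ
      (Algebra.TensorProduct.basis (PSbar p k n) ω) E.e
    rw [hS, matrixOf_Fbar_baseChange] at h1
    have h2 := congrArg (fun M => M.map (algebraMap (PSbar p k n) (KPS p k n))) h1
    rw [Matrix.map_mul, Matrix.map_mul, Matrix.map_map] at h2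
    rw [← mul_assoc, ← hTF, mul_assoc, mul_assoc]
    exact congrArg (fun M => E.T * M) h2

end FrameFacts

/-! ### Identification of the transition matrix with `S`. -/

section NormalForm

variable {p : ℕ} [hp : Fact p.Prime] {k : Type*} [Field k] [CharP k p] [PerfectRing k p] {n : ℕ}
  {H : Type*} [AddCommGroup H] [Module (PS p k n) H]
  {X : FCrystal p k n H} {Fil U : ℕ → Submodule (PS p k n) H}
  {B : LinearMap.BilinForm (PS p k n) H} (E : Frame X Fil U B)
  {ω : Module.Basis (Idx n) (PS p k n) H} {S : Matrix (Idx n) (Idx n) (PSbar p k n)}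
  (hS : E.e.toMatrix (Algebra.TensorProduct.basis (PSbar p k n) ω) = S)

include hS

lemma Frame.repr_tmul (i j : Idx n) : E.e.repr (1 ⊗ₜ ω j) i = S i j := by
  rw [← hS, Module.Basis.toMatrix_apply, Algebra.TensorProduct.basis_apply]

lemma Frame.tmul_last (hS0 : HasDeg 0 S) :
    (1 ⊗ₜ ω (lastIdx n) : PSbar p k n ⊗[PS p k n] H) =
      S (lastIdx n) (lastIdx n) • E.e (lastIdx n) := by
  rw [← E.e.sum_repr (1 ⊗ₜ ω (lastIdx n)), Finset.sum_eq_single (lastIdx n)]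
  · rw [E.repr_tmul hS]
  · intro x _ hx
    rw [E.repr_tmul hS, hS0, zero_smul]
    rcases x with ((x | x) | (x | x)) <;> simp_all [wt]
  · simp

/-- `ω_{n+j}` is the covariant derivative of the normalized generator. -/
lemma Frame.tmul_two (hS0 : HasDeg 0 S) {f : (PSbar p k n)ˣ}
    (hf : (1 ⊗ₜ ω (lastIdx n) : PSbar p k n ⊗[PS p k n] H) = (f : PSbar p k n) • E.e (lastIdx n))
    (j : Fin n) {c : PS p k n}
    (hc : ω (Sum.inr (Sum.inl j)) = X.D j (ω (lastIdx n)) + c • ω (lastIdx n)) :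
    (1 ⊗ₜ ω (Sum.inr (Sum.inl j)) : PSbar p k n ⊗[PS p k n] H) =
      (f : PSbar p k n) • Dbar X j (E.e (lastIdx n)) := by
  have h1 : (1 ⊗ₜ ω (Sum.inr (Sum.inl j)) : PSbar p k n ⊗[PS p k n] H) =
      (pd j (f : PSbar p k n) + algebraMap (PS p k n) (PSbar p k n) c * f) • E.e (lastIdx n) +
        (f : PSbar p k n) • Dbar X j (E.e (lastIdx n)) := by
    have h2 : (1 ⊗ₜ X.D j (ω (lastIdx n)) : PSbar p k n ⊗[PS p k n] H) =
        Dbar X j (1 ⊗ₜ ω (lastIdx n)) := by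
      rw [Dbar_tmul, pd_one, TensorProduct.zero_tmul, zero_add]
    have h3 : (1 ⊗ₜ (c • ω (lastIdx n)) : PSbar p k n ⊗[PS p k n] H) =
        algebraMap (PS p k n) (PSbar p k n) c • (1 ⊗ₜ ω (lastIdx n)) := by
      rw [TensorProduct.tmul_smul, algebraMap_smul]
    rw [hc, TensorProduct.tmul_add, h2, h3, hf, Dbar_smul, smul_smul, add_smul]
    abel
  -- Compare coordinates along the last vector: the left side has weight 2, and the derivative of
  -- the last basis vector has no component along it. Hence the coefficient of `E.e (lastIdx n)` is
  -- zero.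
  have h2 := congrArg (fun v => E.e.repr v (lastIdx n)) h1
  beta_reduce at h2
  rw [E.repr_tmul hS, hS0 _ _ (by simp [wt]), map_add, Finsupp.add_apply, map_smul, map_smul,
    Finsupp.smul_apply, Finsupp.smul_apply, E.e.repr_self, Finsupp.single_eq_same,
    ← matrixOf_apply E.e (Dbar X j), E.conn_eq_zero j le_rfl, smul_zero, add_zero, smul_eq_mul,
    mul_one] at h2
  rw [h1, ← h2, zero_smul, zero_add]

/-- The last column of the connection matrix carries the Jacobian of `τ₂₃` in weight 2, so the
weight 2 block of `S` is `f` times that Jacobian. This block is invertible with `S`, hence so is the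
Jacobian, and the symplectic condition determines the rest. -/
lemma Frame.toMatrix_map_eq_S (hS0 : HasDeg 0 S) {Q : Matrix (Idx n) (Idx n) (PSbar p k n)}
    (hSQ : S * Q = 1)
    (hSG : S.transpose * gramMatrix (PSbar p k n) n * S = gramMatrix (PSbar p k n) n)
    {f : (PSbar p k n)ˣ} (hf : S (lastIdx n) (lastIdx n) = f)
    (h2 : ∀ j, (1 ⊗ₜ ω (Sum.inr (Sum.inl j)) : PSbar p k n ⊗[PS p k n] H) =
      (f : PSbar p k n) • Dbar X j (E.e (lastIdx n))) :
    IsUnit (jacobian E.τ₂₃) ∧ S.map (algebraMap (PSbar p k n) (KPS p k n)) = E.S f := by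
  obtain ⟨g, hg⟩ : ∃ g, g = algebraMap (PSbar p k n) (KPS p k n) := ⟨_, rfl⟩
  have h3 : ∀ a b, g (S (Sum.inr (Sum.inl a)) (Sum.inr (Sum.inl b))) =
      g f * jacobian E.τ₂₃ a b := by
    intro a b
    rw [← E.repr_tmul hS, h2, map_smul, Finsupp.smul_apply, smul_eq_mul, map_mul,
      ← matrixOf_apply E.e (Dbar X b), hg, E.conn_last]
  have h4 : IsUnit (jacobian E.τ₂₃) := by
    have h5 : IsUnit (S.toBlocks₂₂.toBlocks₁₁.map g) :=
      (isUnit_toBlocks₂₂ hS0 hSQ).map (RingHom.mapMatrix g)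
    have h6 : S.toBlocks₂₂.toBlocks₁₁.map g = (Units.map g.toMonoidHom f) • jacobian E.τ₂₃ :=
      Matrix.ext fun a b => h3 a b
    rw [h6] at h5
    exact (isUnit_smul_iff _ _).1 h5
  refine ⟨h4, ?_⟩
  rw [← hg, Smatrix_map g hS0 hSG hf h4 h3, hg]
  rfl

end NormalForm

/-! ### The basis attached to a frame and a generator. -/

section Main

variable {p : ℕ} [hp : Fact p.Prime] {k : Type*} [Field k] [CharP k p] [PerfectRing k p] {n : ℕ}
  {H : Type*} [AddCommGroup H] [Module (PS p k n) H]
  [Module.Free (PS p k n) H] [Module.Finite (PS p k n) H]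
  {X : FCrystal p k n H} {φ₀ : FrobLift p k n} {Fil U : ℕ → Submodule (PS p k n) H}
  {B : LinearMap.BilinForm (PS p k n) H}

/-- The basis of `H` attached to a frame and a generator of the last step of the Hodge
filtration. -/
theorem Frame.exists_basis (hX : IsOrdinaryCY3 X φ₀ Fil B) (hU : IsConjFiltration X φ₀ U)
    (E : Frame X Fil U B) {ω₀ : H} (hω₀ : Fil 3 = Submodule.span (PS p k n) {ω₀}) :
    ∃ f : (PSbar p k n)ˣ,
      (1 : PSbar p k n) ⊗ₜ[PS p k n] ω₀ = (f : PSbar p k n) • E.e (lastIdx n) ∧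
      IsUnit (jacobian E.τ₂₃) ∧ ∃ S : Matrix (Idx n) (Idx n) (PSbar p k n),
        IsUnit S ∧ S.map (algebraMap (PSbar p k n) (KPS p k n)) = E.S f ∧
        ∃ ω : Module.Basis (Idx n) (PS p k n) H, ω (lastIdx n) = ω₀ ∧
          (∀ j : Fin n, (1 : PSbar p k n) ⊗ₜ[PS p k n] ω (Sum.inr (Sum.inl j)) =
            (f : PSbar p k n) • Dbar X j (((f⁻¹ : (PSbar p k n)ˣ) : PSbar p k n) •
              ((1 : PSbar p k n) ⊗ₜ[PS p k n] ω₀))) ∧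
          (∀ j, ω j ∈ U (wt j) ⊓ Fil (wt j)) ∧
          E.e.toMatrix (Algebra.TensorProduct.basis (PSbar p k n) ω) = S := by
  obtain ⟨ω, hωl, hω, hωB, hω2⟩ := exists_adapted_basis hX hU hω₀
  obtain ⟨S, Q, hS, hS0, hQ0, hSQ, hSG⟩ := toMatrix_symplectic hX hU ω hω hωB E.e E.mem E.gram
  obtain ⟨f, hf⟩ := IsUnit.of_mul_eq_one _ (mul_apply_last hS0 hSQ)
  have hfe := E.tmul_last hS hS0
  rw [← hf] at hfe
  have h2 : ∀ j, (1 ⊗ₜ ω (Sum.inr (Sum.inl j)) : PSbar p k n ⊗[PS p k n] H) =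
      (f : PSbar p k n) • Dbar X j (E.e (lastIdx n)) := by
    intro j
    have h3 := hω2 j
    rw [hω₀] at h3
    obtain ⟨c, hc⟩ := Submodule.mem_span_singleton.1 h3
    exact E.tmul_two hS hS0 hfe j (c := c) (by rw [hωl, hc]; abel)
  obtain ⟨hJ, hSE⟩ := E.toMatrix_map_eq_S hS hS0 hSQ hSG hf.symm h2
  refine ⟨f, by rw [← hωl, hfe], hJ, S, IsUnit.of_mul_eq_one _ hSQ, hSE, ω, hωl, fun j => ?_, hω, hS⟩
  rw [h2, ← hωl, hfe, smul_smul, Units.inv_mul, one_smul]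

end Main

end CY3Crystal

end

open CY3Crystal in
theorem mainTheorem7 (p : ℕ) [Fact p.Prime] (hp : 3 < p)
    (k : Type*) [Field k] [CharP k p] [PerfectRing k p] (h : ℕ)
    (H : Type*) [AddCommGroup H] [Module (PS p k h) H]
    [Module.Free (PS p k h) H] [Module.Finite (PS p k h) H]
    (X : FCrystal p k h H) (φ₀ : FrobLift p k h) (Fil : ℕ → Submodule (PS p k h) H)
    (B : LinearMap.BilinForm (PS p k h) H) (hX : IsOrdinaryCY3 X φ₀ Fil B) :
    (∃ U, IsConjFiltration X φ₀ U) ∧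
    ∀ U, IsConjFiltration X φ₀ U →
      Nonempty (Frame X Fil U B) ∧
      ∀ (E : Frame X Fil U B) (ω₀ : H), Fil 3 = Submodule.span (PS p k h) {ω₀} →
        ∃ f : (PSbar p k h)ˣ,
          (1 : PSbar p k h) ⊗ₜ[PS p k h] ω₀ = (f : PSbar p k h) • E.e (lastIdx h) ∧
          IsUnit (jacobian E.τ₂₃) ∧ IsUnit (E.T * E.S f) ∧
          ∃ ω : Module.Basis (Idx h) (PS p k h) H,
            ω (lastIdx h) = ω₀ ∧
            (∀ j : Fin h, (1 : PSbar p k h) ⊗ₜ[PS p k h] ω (Sum.inr (Sum.inl j)) =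
              (f : PSbar p k h) • Dbar X j (((f⁻¹ : (PSbar p k h)ˣ) : PSbar p k h) •
                ((1 : PSbar p k h) ⊗ₜ[PS p k h] ω₀))) ∧
            (∀ j, ω j ∈ U (wt j) ⊓ Fil (wt j)) ∧
            (∀ i j, algebraMap (PSbar p k h) (KPS p k h)
              (E.e.repr ((1 : PSbar p k h) ⊗ₜ[PS p k h] ω j) i) = E.S f i j) ∧
            (∀ l : Fin h,
              (matrixOf ω (X.D l)).map (fun a => algebraMap (PSbar p k h) (KPS p k h)
                  (algebraMap (PS p k h) (PSbar p k h) a)) =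
                (E.T * E.S f)⁻¹ * (E.T * E.S f).map (pd l)) ∧
            ∀ φ : FrobLift p k h, ∃ φTS : Matrix (Idx h) (Idx h) (KPS p k h),
              (∀ i j, IsFrobImage φ ((E.T * E.S f) i j) (φTS i j)) ∧
              (matrixOf ω (X.F φ)).map (fun a => algebraMap (PSbar p k h) (KPS p k h)
                  (algebraMap (PS p k h) (PSbar p k h) a)) =
                (E.T * E.S f)⁻¹ * Pmatrix (KPS p k h) h p * φTS := by
  refine ⟨exists_isConjFiltration X φ₀ hX.ordinary.opposite, fun U hU =>
    ⟨nonempty_frame hX hU, fun E ω₀ hω₀ => ?_⟩⟩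
  obtain ⟨f, hf, hJ, S, hSu, hSE, ω, hωl, hω2, hω, hS⟩ := E.exists_basis hX hU hω₀
  have hTS : IsUnit (E.T * E.S f) := by
    rw [← hSE]
    exact E.isUnit_T.mul (hSu.map (RingHom.mapMatrix (algebraMap (PSbar p k h) (KPS p k h))))
  refine ⟨f, hf, hJ, hTS, ω, hωl, hω2, hω, fun i j => ?_, fun l => ?_, fun φ => ?_⟩
  · rw [E.repr_tmul hS, ← hSE, Matrix.map_apply]
  · refine eq_inv_mul_of_mul_eq hTS ?_
    rw [← hSE]
    exact E.conn_change hS l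
  · obtain ⟨φTS, h1, h2⟩ := E.frob_change hS φ
    rw [hSE] at h1 h2
    exact ⟨φTS, h1, (eq_inv_mul_of_mul_eq hTS h2).trans (mul_assoc _ _ _).symm⟩
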